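/- **Setting.** Let $\varepsilon_\infty>0$ and $f\in C^2(\mathbb R)$ be such that $\mathbb R$ splits into finitely many intervals on each of which $f''$ is monotone, and $e^{-|t|/\varepsilon_\infty}$ is summable with respect to $|df''|$. A *root* is an arc $c$ (a point, segment, ray or the line, closed) on which $f''$ is constant and at which $f'''$ changes sign from $+$ to $-$: to the left of $c$ (if anything is there) $f''$ is near $c$ monotone increasing and strictly smaller than on $c$; to the right of $c$ (if anything is there) $f''$ is near $c$ monotone decreasing and strictly smaller than on $c$. **Chords.** $\langle f''\rangle_{[a,b]}=\frac{f'(b)-f'(a)}{b-a}$ (and $f''(a)$ if $a=b$); $D_L(a,b)=f''(a)-\langle f''\rangle_{[a,b]}$, $D_R(a,b)=f''(b)-\langle f''\rangle_{[a,b]}$. The pair $(a,b)$ satisfies the cup equation if $f(b)-f(a)=(b-a)\frac{f'(a)+f'(b)}2$. A *chordal domain* with upper chord $[a_0,b_0]$ and lower chord $[a_1,b_1]$, $0\le b_1-a_1<b_0-a_0$, is a family of chords $[a(l),b(l)]$, $b(l)-a(l)=l\in[b_1-a_1,b_0-a_0]$, with these end chords, with $a,b$ continuous, differentiable inside with $a'<0<b'$,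 satisfying the cup equation and $D_L\le0$, $D_R\le0$, both strict inside. Forces: $$F_R(u;a,b;\varepsilon)=D_R(a,b)e^{(b-u)/\varepsilon}+e^{-u/\varepsilon}\!\int_b^u\! e^{t/\varepsilon}df''(t),\qquad F_L(u;a,b;\varepsilon)=-D_L(a,b)e^{(u-a)/\varepsilon}+e^{u/\varepsilon}\!\int_u^a\! e^{-t/\varepsilon}df''(t),$$ $$F_R(u;-\infty;\varepsilon)=e^{-u/\varepsilon}\int_{-\infty}^ue^{t/\varepsilon}df''(t),\qquad F_L(u;+\infty;\varepsilon)=e^{u/\varepsilon}\int_u^{\infty}e^{-t/\varepsilon}df''(t).$$ The tail of a right force starting at $b$ is $(b,t^R)$, $t^R=\sup\{t>b: F_R<0\text{ on }(b,t)\}$; the tail of a left force starting at $a$ is $(t^L,a)$, $t^L=\inf\{t<a: F_L>0\text{ on }(t,a)\}$. **Graphs.** A graph is a finite planar tree. Its *free vertices* form a path, ordered from left to right; consecutive ones are joined by an edge representing a domain of right tangents (oriented to the right) or of left tangents (oriented to the left). Each free vertex sits on finitely many disjoint closed arcs $\mathfrak a_1<\dots<\mathfrak a_k$ of $\mathbb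 R$ (points allowed), or at $\pm\infty$. The type of a free vertex is determined by its arcs and by the tangents $(\text{left neighbour},\text{right neighbour})$: - one point: *angle* if $(R,L)$, right or left vertex of the *fifth type* if $(R,R)$ or $(L,L)$; - two points $a<b$: *birdie* $(R,L)$, right or left *trolleybus* $(R,R)$ or $(L,L)$; if $(L,R)$, a *long chord*: of the *first type* if $D_L(a,b)\ne0\ne D_R(a,b)$, of the *third type* otherwise; - any other collection of arcs: *multibirdie* $(R,L)$, right or left *multitrolleybus* $(R,R)$ or $(L,L)$, *multicup* $(L,R)$; - $\pm\infty$: *fourth type*, with tangents of either family on its only side. From every free vertex, and from every vertex below it, there goes down, for each pair of consecutive arcs, an edge representing a chordal domain with upper chord $[\mathfrak a_i^r,\mathfrak a_{i+1}^l]$. The vertex at its lower end sits on finitely many disjoint bounded arcs whose extreme points are the ends of the lower chord; it is of the *second type* if this is one point, of the *third type* (a short chord) if these are two points, and a *closed multicup* otherwise. **Admissibility** for $f$ and $\varepsilon>0$: - The figures cover the free boundary without intersections: the leftmost free vertex is $-\infty$ or has a left-infinite arc, similarly on the right; the right end $u_1$ of each free vertex is strictly less than the left end $u_2$ of the next, and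 both prescribe the same family of tangents between them. Only multicups, left multitrolleybuses (to the left) and right multitrolleybuses (to the right) may have infinite arcs. - Gaps between consecutive arcs are at most $2\varepsilon$; long chords have length $2\varepsilon$; $\mathfrak a_k^r-\mathfrak a_1^l\ge2\varepsilon$ for multicups and $<2\varepsilon$ for the lower vertices. - For each vertex there is a number $\beta$ such that $f'(y)-f'(x)=2\beta(y-x)$ and the cup equation holds for all $x,y$ in its arcs; $2\beta=f''(c)$ for a vertex of the fifth type at $c$. - For some choice of such $\beta$, each domain of right tangents between consecutive free vertices with ends $u_1<u_2$ has a function $m$ with $\varepsilon m'+m=f'$, $m''<0$ on $(u_1,u_2)$, and $m(u_i)=f'(u_i)-2\varepsilon\beta_i$ at its finite ends, $\beta_i$ being the number of the adjacent vertex; if $u_1=-\infty$, then $m(u)=\varepsilon^{-1}e^{-u/\varepsilon}\int_{-\infty}^uf'(t)e^{t/\varepsilon}dt$. Symmetrically for left tangents: $-\varepsilon m'+m=f'$, $m''>0$, $m(u_i)=f'(u_i)+2\varepsilon\beta_i$, and $m(u)=\varepsilon^{-1}e^{u/\varepsilon}\int_u^{\infty}f'(t)e^{-t/\varepsilon}dt$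 if $u_2=+\infty$. **Non-degeneracy force condition.** For each tangent edge, $(u_1,u_2)$ lies in the tail of the force assigned to it: for right tangents starting from a vertex with arcs $\mathfrak a_1,\dots,\mathfrak a_k$ this is $F_R(\cdot;\mathfrak a_1^l,\mathfrak a_k^r;\varepsilon)$ (if $\mathfrak a_1$ is left-infinite, any point of $\mathfrak a_1$ may replace $\mathfrak a_1^l$), for right tangents from $-\infty$ it is $F_R(\cdot;-\infty;\varepsilon)$; symmetrically for left tangents. **Leaf–root condition.** Each arc of a multicup, multitrolleybus, multibirdie or closed multicup that is not a point is a root; vertices of the second and fifth types sit at single-point roots; for a (long or short) chord $[a,b]$ of the third type, $D_R(a,b)=0$ implies that $b$ is a single-point root, and $D_L(a,b)=0$ implies that $a$ is. **Smooth flows.** A graph is *smooth* (for $\varepsilon$) if it has no full multicups ($\mathfrak a_k^r-\mathfrak a_1^l=2\varepsilon$), multitrolleybuses, multibirdies, long chords of the third type or vertices of the fifth type. A *smooth flow* on $(\eta_1,\eta_2)$ is a family $\Gamma(\varepsilon)$, $\varepsilon\in(\eta_1,\eta_2)$, of smooth graphs, admissible for $f$ and $\varepsilon$ and satisfying both conditions,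 such that the free vertices other than angles, listed from left to right, are equal in number for all $\varepsilon$, and each of them is, as $\varepsilon$ varies, one of the following: a multicup, which is constant together with everything below it; one and the same infinity; a long chord of the first type over chordal domains that increase by inclusion in $\varepsilon$ (a full flow); a trolleybus (of varying orientation) or birdie over chordal domains that decrease by inclusion, the length of the base being continuous and non-increasing in $\varepsilon$. In the last two cases everything below the chordal domain is constant. Angles are not restricted further. **Modified limit.** Graphs of one and the same combinatorial structure *converge* if the ends of the arcs of their free vertices converge in $[-\infty,\infty]$ and their uppermost chordal domains converge (the chords of the limit are the limits of chords of the domains), everything below being constant. The limit may have edges of zero length. It is *reconstructed* as follows. (1) Long chords of the first type with a vanishing differential are renamed into the third type. (2) If the chordal domain below a trolleybus or birdie has shrunk to a single chord or point, this figure is replaced by the one that sits on the arcs of the lower vertex, with the same tangents on both sides and with the edges leaving the lower vertex. (3) Any two consecutive free vertices with coinciding right and left ends are glued step by step into one: the last arc of the first is united with the first arc of the second, the branches are joined, the tangents on the outer sides are kept. In (2) and (3) the type of the new vertex is determined by its arcs and tangents as above (an angle or $\pm\infty$ glued together give $\pm\infty$). A graph $\mathcal G$ is the *modified limit* of the flow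 at $\eta_2$ if every sequence in $(\eta_1,\eta_2)$ tending to $\eta_2$ has a subsequence along which $\Gamma(\varepsilon)$ converges to a graph whose reconstruction is $\mathcal G$. **Theorem.** Let $0\le\eta_1<\eta_2<\varepsilon_\infty$ and let $\Gamma(\varepsilon)$, $\varepsilon\in(\eta_1,\eta_2)$, be a smooth flow of graphs. Then its modified limit $\mathcal G$ at $\eta_2$ exists and is unique, and it is a graph admissible for $f$ and $\eta_2$ that satisfies the non-degeneracy force condition and the leaf–root condition. -/

import Mathlib

open Set Filter Topology MeasureTheory

namespace BMOFoliation

noncomputable section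

open scoped Classical

/-! ### The boundary function and its third derivative -/

/-- The function `f` is twice continuously differentiable, and the line splits into finitely many
intervals on each of which the second derivative is monotone. -/
def RegularityCondition (f : ℝ → ℝ) : Prop :=
  ContDiff ℝ 2 f ∧ ∃ s : Finset ℝ, ∀ a b : ℝ, a ≤ b → (∀ x ∈ s, x ∉ Ioo a b) →
    MonotoneOn (deriv (deriv f)) (Icc a b) ∨ AntitoneOn (deriv (deriv f)) (Icc a b)

/-- The signed variation of `g` from `0` to `x`. -/
def variationFun (g : ℝ → ℝ) (x : ℝ) : ℝ := variationOnFromTo g univ 0 x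

/-- The Lebesgue-Stieltjes measure of a monotone function (and `0` for other functions). -/
def stieltjesMeasure (g : ℝ → ℝ) : Measure ℝ :=
  if h : Monotone g then h.stieltjesFunction.measure else 0

/-- The measure `|dg|`, for `g` of locally bounded variation. -/
def totalVariationMeasure (g : ℝ → ℝ) : Measure ℝ := stieltjesMeasure (variationFun g)

theorem monotone_variationFun {g : ℝ → ℝ} (hg : LocallyBoundedVariationOn g univ) :
    Monotone (variationFun g) :=
  fun _ _ h => variationOnFromTo.monotoneOn hg (mem_univ 0) (mem_univ _) (mem_univ _) h

theorem monotone_variationFun_sub {g : ℝ → ℝ} (hg : LocallyBoundedVariationOn g univ) :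
    Monotone (fun x => variationFun g x - g x) :=
  fun _ _ h => variationOnFromTo.sub_self_monotoneOn hg (mem_univ 0) (mem_univ _) (mem_univ _) h

/-- The integral of `φ` over `s` against the signed measure `dg`, written through
`dg = dV - d(V - g)`, where `V` is the variation of `g`; here `dV = |dg|`. -/
def integralAgainst (g : ℝ → ℝ) (s : Set ℝ) (φ : ℝ → ℝ) : ℝ :=
  (∫ t in s, φ t ∂(stieltjesMeasure (variationFun g))) -
    ∫ t in s, φ t ∂(stieltjesMeasure (fun x => variationFun g x - g x))

/-- The weight `exp (-|t| / ε)` is summable with respect to `|df''|`. -/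
def SummabilityCondition (f : ℝ → ℝ) (ε : ℝ) : Prop :=
  Integrable (fun t => Real.exp (-|t| / ε)) (totalVariationMeasure (deriv (deriv f)))

/-- A closed interval of the extended line (a point, a segment, a ray, the line), or one of the two
points at infinity. -/
structure Arc where
  l : EReal
  r : EReal

/-- The point `p` as an arc. -/
def Arc.point (p : ℝ) : Arc := ⟨p, p⟩

/-- The real points of an arc. -/
def Arc.carrier (x : Arc) : Set ℝ := {t | x.l ≤ t ∧ (t : EReal) ≤ x.r}

/-- The arc `c` is an essential root of `f'''` at which `f'''` changes its sign from plus to minus: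
`f''` is constant on `c`, increases up to this value on the left of `c` and decreases from this
value on the right of `c` (whenever there is something on the left, respectively on the right). -/
def IsPlusMinusRoot (f : ℝ → ℝ) (c : Arc) : Prop :=
  c.l ≤ c.r ∧ c.l ≠ ⊤ ∧ c.r ≠ ⊥ ∧
  (∀ x ∈ c.carrier, ∀ y ∈ c.carrier, deriv (deriv f) x = deriv (deriv f) y) ∧
  (c.l = ⊥ ∨ ∃ x₀ < c.l.toReal, MonotoneOn (deriv (deriv f)) (Icc x₀ c.l.toReal) ∧
    ∀ x ∈ Ico x₀ c.l.toReal, deriv (deriv f) x < deriv (deriv f) c.l.toReal) ∧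
  (c.r = ⊤ ∨ ∃ x₁ > c.r.toReal, AntitoneOn (deriv (deriv f)) (Icc c.r.toReal x₁) ∧
    ∀ x ∈ Ioc c.r.toReal x₁, deriv (deriv f) x < deriv (deriv f) c.r.toReal)

/-! ### Chords, differentials and forces -/

/-- The cup equation for the pair `(a, b)`. -/
def CupEquation (f : ℝ → ℝ) (a b : ℝ) : Prop :=
  f b - f a = (b - a) * ((deriv f a + deriv f b) / 2)

/-- The left differential: `f'' a` minus the average of `f''` over `[a, b]` (over the point `a` if
`a = b`). -/
def DL (f : ℝ → ℝ) (a b : ℝ) : ℝ := deriv (deriv f) a - dslope (deriv f) a b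

/-- The right differential: `f'' b` minus the average of `f''` over `[a, b]`. -/
def DR (f : ℝ → ℝ) (a b : ℝ) : ℝ := deriv (deriv f) b - dslope (deriv f) a b

/-- `C` is a chordal domain with the upper chord `top` and the lower chord `bot`: a family of chords
`[a l, b l]` indexed by their lengths `l`. A chord is recorded as the pair of its endpoints. The
lower chord may degenerate to a point. -/
def IsChordalDomain (f : ℝ → ℝ) (C : Set (ℝ × ℝ)) (top bot : ℝ × ℝ) : Prop :=
  0 ≤ bot.2 - bot.1 ∧ bot.2 - bot.1 < top.2 - top.1 ∧
  ∃ a b : ℝ → ℝ,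
    a (top.2 - top.1) = top.1 ∧ b (top.2 - top.1) = top.2 ∧
    a (bot.2 - bot.1) = bot.1 ∧ b (bot.2 - bot.1) = bot.2 ∧
    ContinuousOn a (Icc (bot.2 - bot.1) (top.2 - top.1)) ∧
    ContinuousOn b (Icc (bot.2 - bot.1) (top.2 - top.1)) ∧
    (∀ l ∈ Icc (bot.2 - bot.1) (top.2 - top.1), b l - a l = l ∧ CupEquation f (a l) (b l) ∧
      DL f (a l) (b l) ≤ 0 ∧ DR f (a l) (b l) ≤ 0) ∧
    (∀ l ∈ Ioo (bot.2 - bot.1) (top.2 - top.1),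
      (∃ p < 0, HasDerivAt a p l) ∧ (∃ q > 0, HasDerivAt b q l) ∧
      DL f (a l) (b l) < 0 ∧ DR f (a l) (b l) < 0) ∧
    C = (fun l => (a l, b l)) '' Icc (bot.2 - bot.1) (top.2 - top.1)

/-- The right force of the chord `[a, b]`. -/
def forceR (f : ℝ → ℝ) (ε a b u : ℝ) : ℝ :=
  DR f a b * Real.exp ((b - u) / ε) +
    Real.exp (-u / ε) * integralAgainst (deriv (deriv f)) (Ioc b u) (fun t => Real.exp (t / ε))

/-- The left force of the chord `[a, b]`. -/
def forceL (f : ℝ → ℝ) (ε a b u : ℝ) : ℝ :=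
  -DL f a b * Real.exp ((u - a) / ε) +
    Real.exp (u / ε) * integralAgainst (deriv (deriv f)) (Ioc u a) (fun t => Real.exp (-t / ε))

/-- The force coming from minus infinity. -/
def forceRInfinity (f : ℝ → ℝ) (ε u : ℝ) : ℝ :=
  Real.exp (-u / ε) * integralAgainst (deriv (deriv f)) (Iic u) (fun t => Real.exp (t / ε))

/-- The force coming from plus infinity. -/
def forceLInfinity (f : ℝ → ℝ) (ε u : ℝ) : ℝ :=
  Real.exp (u / ε) * integralAgainst (deriv (deriv f)) (Ioi u) (fun t => Real.exp (-t / ε))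

/-- The right tail of a right force `F` that starts at `b`. -/
def rightTail (F : ℝ → ℝ) (b : EReal) : Set ℝ :=
  {u | b < u ∧ (u : EReal) < sSup {t : EReal | b < t ∧ ∀ s : ℝ, b < s → (s : EReal) < t → F s < 0}}

/-- The left tail of a left force `F` that starts at `a`. -/
def leftTail (F : ℝ → ℝ) (a : EReal) : Set ℝ :=
  {u | sInf {t : EReal | t < a ∧ ∀ s : ℝ, t < s → (s : EReal) < a → 0 < F s} < u ∧ (u : EReal) < a}

/-! ### Figures and graphs -/

/-- The two families of tangents. -/
inductive Side
  | right
  | left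

/-- The types of the vertices that are not subordinated to other vertices: angles, right and left
trolleybuses, birdies, multicups, right and left multitrolleybuses, multibirdies, long chords with
nonzero differentials (`firstType`), long chords with a vanishing differential (`thirdType`), the
points at infinity (`negInfinity`, `posInfinity`; the argument is the family of the tangents that
are adjacent to the vertex), single tangents (`fifthType`). -/
inductive Kind
  | angle
  | trolleybus (s : Side)
  | birdie
  | multicup
  | multitrolleybus (s : Side)
  | multibirdie
  | firstType
  | thirdType
  | negInfinity (s : Side)
  | posInfinity (s : Side)
  | fifthType (s : Side)

/-- The family of the tangents that are adjacent to the figure on the left. -/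
def Kind.leftSide : Kind → Side
  | .angle => .right
  | .trolleybus s => s
  | .birdie => .right
  | .multicup => .left
  | .multitrolleybus s => s
  | .multibirdie => .right
  | .firstType => .left
  | .thirdType => .left
  | .negInfinity s => s
  | .posInfinity s => s
  | .fifthType s => s

/-- The family of the tangents that are adjacent to the figure on the right. -/
def Kind.rightSide : Kind → Side
  | .angle => .left
  | .trolleybus s => s
  | .birdie => .left
  | .multicup => .right
  | .multitrolleybus s => s
  | .multibirdie => .left
  | .firstType => .right
  | .thirdType => .right
  | .negInfinity s => s
  | .posInfinity s => s
  | .fifthType s => s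

/-- The types of the vertices that are subordinated to other vertices: origins of cups, short
chords, closed multicups. -/
inductive FixedKind
  | secondType
  | thirdType
  | closedMulticup

/-- An edge that represents a chordal domain (the set of its chords), with the vertex at its lower
end (the type of this vertex and its arcs on the fixed boundary, from left to right), and with the
branches that leave this vertex, from left to right. -/
inductive Branch
  | mk (chords : Set (ℝ × ℝ)) (kind : FixedKind) (arcs : List Arc) (below : List Branch)

/-- A vertex that is not subordinated to other vertices: its type, its arcs on the fixed boundary
from left to right, and the branches that leave it, from left to right. Single points are
degenerate arcs; in particular a trolleybus, a birdie or a long chord has two arcs, the endpoints of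
its base. -/
structure FreeVertex where
  kind : Kind
  arcs : List Arc
  below : List Branch

/-- The graph of a foliation: a planar tree, recorded as the list, from left to right, of the
vertices that are not subordinated to other vertices. Any two neighbours in this list are joined by
an edge that represents the tangent domain between them; the edge goes from left to right if the
tangents are right, and from right to left if they are left. -/
abbrev FoliationGraph := List FreeVertex

/-- The left endpoint of the first arc. -/
def leftEnd : List Arc → EReal
  | [] => ⊤
  | x :: _ => x.l

/-- The right endpoint of the last arc. -/
def rightEnd : List Arc → EReal
  | [] => ⊥
  | [x] => x.r
  | _ :: y :: ys => rightEnd (y :: ys)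

/-- The chords that join consecutive arcs. -/
def gaps : List Arc → List (ℝ × ℝ)
  | x :: y :: ys => (x.r.toReal, y.l.toReal) :: gaps (y :: ys)
  | _ => []

/-- The real points of a list of arcs. -/
def arcPoints (arcs : List Arc) : Set ℝ := {t | ∃ x ∈ arcs, t ∈ x.carrier}

/-- The chord that joins the extreme points of a list of arcs. -/
def hull (arcs : List Arc) : ℝ × ℝ := ((leftEnd arcs).toReal, (rightEnd arcs).toReal)

/-- The left endpoint of the first arc, or its right endpoint if this arc is infinite to the left
(all the points of an arc of a linearity domain define one and the same right force). -/
def leftPoint (arcs : List Arc) : ℝ :=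
  match arcs with
  | [] => 0
  | x :: _ => if x.l = ⊥ then x.r.toReal else x.l.toReal

/-- The right endpoint of the last arc, or its left endpoint if this arc is infinite to the
right. -/
def rightPoint : List Arc → ℝ
  | [] => 0
  | [x] => if x.r = ⊤ then x.l.toReal else x.r.toReal
  | _ :: y :: ys => rightPoint (y :: ys)

def Branch.chords : Branch → Set (ℝ × ℝ)
  | .mk C _ _ _ => C

def Branch.kind : Branch → FixedKind
  | .mk _ k _ _ => k

def Branch.arcs : Branch → List Arc
  | .mk _ _ as _ => as

def Branch.children : Branch → List Branch
  | .mk _ _ _ bs => bs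

mutual

/-- The branch and all the branches below it. -/
def Branch.nodes : Branch → List Branch
  | .mk C k as bs => .mk C k as bs :: branchNodes bs

/-- The branches of a list and all the branches below them. -/
def branchNodes : List Branch → List Branch
  | [] => []
  | b :: bs => b.nodes ++ branchNodes bs

end

/-- All the chordal domains of a graph, with the vertices at their lower ends. -/
def allBranches (Γ : FoliationGraph) : List Branch := Γ.flatMap fun v => branchNodes v.below

def FreeVertex.leftEnd (v : FreeVertex) : EReal := BMOFoliation.leftEnd v.arcs

def FreeVertex.rightEnd (v : FreeVertex) : EReal := BMOFoliation.rightEnd v.arcs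

/-- The type of the figure that sits on the given arcs and is surrounded by tangents of the family
`s₁` on the left and of the family `s₂` on the right. -/
def kindOfShape (f : ℝ → ℝ) (s₁ s₂ : Side) (arcs : List Arc) : Kind :=
  match arcs with
  | [x] =>
    if x.l = x.r then
      if x.l = ⊥ then .negInfinity s₂
      else if x.l = ⊤ then .posInfinity s₁
      else match s₁, s₂ with
        | .right, .left => .angle
        | .right, .right => .fifthType .right
        | .left, .left => .fifthType .left
        | .left, .right => .multicup
    else match s₁, s₂ with
      | .right, .left => .multibirdie
      | .right, .right => .multitrolleybus .right
      | .left, .left => .multitrolleybus .left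
      | .left, .right => .multicup
  | [x, y] =>
    if x.l = x.r ∧ y.l = y.r then match s₁, s₂ with
      | .right, .left => .birdie
      | .right, .right => .trolleybus .right
      | .left, .left => .trolleybus .left
      | .left, .right =>
        if DL f x.l.toReal y.r.toReal = 0 ∨ DR f x.l.toReal y.r.toReal = 0 then .thirdType
        else .firstType
    else match s₁, s₂ with
      | .right, .left => .multibirdie
      | .right, .right => .multitrolleybus .right
      | .left, .left => .multitrolleybus .left
      | .left, .right => .multicup
  | _ => match s₁, s₂ with
    | .right, .left => .multibirdie
    | .right, .right => .multitrolleybus .right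
    | .left, .left => .multitrolleybus .left
    | .left, .right => .multicup

/-- The type of a figure that sits on the given arcs and is separated from the free boundary. -/
def fixedKindOfShape (arcs : List Arc) : FixedKind :=
  match arcs with
  | [x] => if x.l = x.r then .secondType else .closedMulticup
  | [x, y] => if x.l = x.r ∧ y.l = y.r then .thirdType else .closedMulticup
  | _ => .closedMulticup

/-! ### Admissible graphs -/

/-- The points `(t, f' t)`, with `t` in the arcs, lie on one line of slope `σ`, and every pair of
points of the arcs satisfies the cup equation. -/
def IsLinearity (f : ℝ → ℝ) (arcs : List Arc) (σ : ℝ) : Prop :=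
  ∀ x ∈ arcPoints arcs, ∀ y ∈ arcPoints arcs,
    deriv f y - deriv f x = σ * (y - x) ∧ CupEquation f x y

/-- The arcs are closed intervals of the line, disjoint and ordered from left to right. -/
def ArcsOrdered (arcs : List Arc) : Prop :=
  arcs ≠ [] ∧ (∀ x ∈ arcs, x.l ≤ x.r ∧ x.l ≠ ⊤ ∧ x.r ≠ ⊥) ∧
    arcs.IsChain (fun x y => x.r < y.l)

/-- The branches that leave a vertex represent chordal domains that fill the segments cut off by the
chords between the arcs of the vertex. -/
def Wired (f : ℝ → ℝ) (arcs : List Arc) (below : List Branch) : Prop :=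
  List.Forall₂ (fun g (b : Branch) => IsChordalDomain f b.chords g (hull b.arcs)) (gaps arcs) below

/-- The vertex at the lower end of a chordal domain satisfies the requirements on a closed multicup,
a short chord or the origin of a cup. -/
def Branch.IsAdmissible (f : ℝ → ℝ) (ε : ℝ) (b : Branch) : Prop :=
  b.kind = fixedKindOfShape b.arcs ∧ ArcsOrdered b.arcs ∧
  leftEnd b.arcs ≠ ⊥ ∧ rightEnd b.arcs ≠ ⊤ ∧
  (hull b.arcs).2 - (hull b.arcs).1 < 2 * ε ∧
  (∃ σ, IsLinearity f b.arcs σ) ∧ Wired f b.arcs b.children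

/-- The arcs of a vertex are as the type of the vertex requires. -/
def FreeVertex.IsAdmissible (f : ℝ → ℝ) (ε : ℝ) (v : FreeVertex) : Prop :=
  v.kind = kindOfShape f v.kind.leftSide v.kind.rightSide v.arcs ∧
  Wired f v.arcs v.below ∧
  (∀ g ∈ gaps v.arcs, g.2 - g.1 ≤ 2 * ε) ∧
  match v.kind with
  | .negInfinity _ => True
  | .posInfinity _ => True
  | .multicup => ArcsOrdered v.arcs ∧ v.leftEnd + ((2 * ε : ℝ) : EReal) ≤ v.rightEnd
  | .multitrolleybus .right => ArcsOrdered v.arcs ∧ v.leftEnd ≠ ⊥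
  | .multitrolleybus .left => ArcsOrdered v.arcs ∧ v.rightEnd ≠ ⊤
  | .firstType =>
    ArcsOrdered v.arcs ∧ v.leftEnd ≠ ⊥ ∧ v.rightEnd ≠ ⊤ ∧
      (hull v.arcs).2 - (hull v.arcs).1 = 2 * ε
  | .thirdType =>
    ArcsOrdered v.arcs ∧ v.leftEnd ≠ ⊥ ∧ v.rightEnd ≠ ⊤ ∧
      (hull v.arcs).2 - (hull v.arcs).1 = 2 * ε
  | _ => ArcsOrdered v.arcs ∧ v.leftEnd ≠ ⊥ ∧ v.rightEnd ≠ ⊤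

/-- The vertices `v` and `w` are neighbours, `v` being on the left. -/
def Neighbours (Γ : FoliationGraph) (i : ℕ) (v w : FreeVertex) : Prop :=
  Γ[i]? = some v ∧ Γ[i + 1]? = some w

/-- The figures cover the free boundary without intersections. -/
def IsPath (Γ : FoliationGraph) : Prop :=
  (∃ v, Γ.head? = some v ∧ v.leftEnd = ⊥) ∧ (∃ v, Γ.getLast? = some v ∧ v.rightEnd = ⊤) ∧
  ∀ i v w, Neighbours Γ i v w → v.kind.rightSide = w.kind.leftSide ∧ v.rightEnd < w.leftEnd

/-- The slope coefficient `m` of the domain of right tangents between the figures `v` and `w`, whose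
standard candidates have the derivatives `β₁` and `β₂` in the second variable: the differential
equation, the strict concavity, and the agreement with the neighbouring figures (with the
corresponding formula for tangents that come from minus infinity). -/
def IsRightSlope (f : ℝ → ℝ) (ε : ℝ) (v w : FreeVertex) (β₁ β₂ : ℝ) (m : ℝ → ℝ) : Prop :=
  (∀ u, HasDerivAt m ((deriv f u - m u) / ε) u) ∧
  (∀ u : ℝ, v.rightEnd < u → (u : EReal) < w.leftEnd → iteratedDeriv 2 m u < 0) ∧
  (match v.kind with
    | .negInfinity _ => ∀ u, m u =
        ε⁻¹ * Real.exp (-u / ε) * ∫ t in Iic u, deriv f t * Real.exp (t / ε)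
    | _ => m v.rightEnd.toReal = deriv f v.rightEnd.toReal - 2 * ε * β₁) ∧
  (match w.kind with
    | .posInfinity _ => True
    | _ => m w.leftEnd.toReal = deriv f w.leftEnd.toReal - 2 * ε * β₂)

/-- The slope coefficient `m` of the domain of left tangents between the figures `v` and `w`. -/
def IsLeftSlope (f : ℝ → ℝ) (ε : ℝ) (v w : FreeVertex) (β₁ β₂ : ℝ) (m : ℝ → ℝ) : Prop :=
  (∀ u, HasDerivAt m ((m u - deriv f u) / ε) u) ∧
  (∀ u : ℝ, v.rightEnd < u → (u : EReal) < w.leftEnd → 0 < iteratedDeriv 2 m u) ∧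
  (match w.kind with
    | .posInfinity _ => ∀ u, m u =
        ε⁻¹ * Real.exp (u / ε) * ∫ t in Ioi u, deriv f t * Real.exp (-t / ε)
    | _ => m w.leftEnd.toReal = deriv f w.leftEnd.toReal + 2 * ε * β₂) ∧
  (match v.kind with
    | .negInfinity _ => True
    | _ => m v.rightEnd.toReal = deriv f v.rightEnd.toReal + 2 * ε * β₁)

/-- The standard candidates in the figures of `Γ` can be chosen so that they agree along the tangent
domains; `β i` is the derivative of the standard candidate of the vertex number `i` in the second
variable, and `m i` is the slope coefficient in the tangent domain that follows this vertex. -/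
def HasCandidates (f : ℝ → ℝ) (ε : ℝ) (Γ : FoliationGraph) : Prop :=
  ∃ (β : ℕ → ℝ) (m : ℕ → ℝ → ℝ),
    (∀ i v, Γ[i]? = some v → IsLinearity f v.arcs (2 * β i) ∧
      ∀ s, v.kind = .fifthType s → 2 * β i = deriv (deriv f) v.leftEnd.toReal) ∧
    ∀ i v w, Neighbours Γ i v w →
      match v.kind.rightSide with
      | .right => IsRightSlope f ε v w (β i) (β (i + 1)) (m i)
      | .left => IsLeftSlope f ε v w (β i) (β (i + 1)) (m i)

/-- The graph `Γ` is admissible for `f` and `ε`. -/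
def IsAdmissible (f : ℝ → ℝ) (ε : ℝ) (Γ : FoliationGraph) : Prop :=
  0 < ε ∧ IsPath Γ ∧ (∀ v ∈ Γ, v.IsAdmissible f ε) ∧ (∀ b ∈ allBranches Γ, b.IsAdmissible f ε) ∧
    HasCandidates f ε Γ

/-! ### The two conditions, smooth graphs -/

/-- The right force assigned to the right tangents that leave the vertex `v`. -/
def FreeVertex.forceR (f : ℝ → ℝ) (ε : ℝ) (v : FreeVertex) : ℝ → ℝ :=
  match v.kind with
  | .negInfinity _ => forceRInfinity f ε
  | _ => BMOFoliation.forceR f ε (leftPoint v.arcs) v.rightEnd.toReal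

/-- The left force assigned to the left tangents that leave the vertex `v`. -/
def FreeVertex.forceL (f : ℝ → ℝ) (ε : ℝ) (v : FreeVertex) : ℝ → ℝ :=
  match v.kind with
  | .posInfinity _ => forceLInfinity f ε
  | _ => BMOFoliation.forceL f ε v.leftEnd.toReal (rightPoint v.arcs)

/-- The non-degeneracy force condition: every tangent domain lies in the tail of the force that is
assigned to it. -/
def NonDegeneracyForce (f : ℝ → ℝ) (ε : ℝ) (Γ : FoliationGraph) : Prop :=
  ∀ i v w, Neighbours Γ i v w →
    match v.kind.rightSide with
    | .right => {u : ℝ | v.rightEnd < u ∧ (u : EReal) < w.leftEnd} ⊆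
        rightTail (v.forceR f ε) v.rightEnd
    | .left => {u : ℝ | v.rightEnd < u ∧ (u : EReal) < w.leftEnd} ⊆
        leftTail (w.forceL f ε) w.leftEnd

/-- Every arc that is not a single point is a root of `f'''`. -/
def SolidArcsAreRoots (f : ℝ → ℝ) (arcs : List Arc) : Prop :=
  ∀ x ∈ arcs, x.l ≠ x.r → IsPlusMinusRoot f x

/-- An endpoint of the chord at which the differential vanishes is a single-point root of `f'''`. -/
def DegenerateEndsAreRoots (f : ℝ → ℝ) (p : ℝ × ℝ) : Prop :=
  (DR f p.1 p.2 = 0 → IsPlusMinusRoot f (Arc.point p.2)) ∧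
  (DL f p.1 p.2 = 0 → IsPlusMinusRoot f (Arc.point p.1))

/-- The leaf-root condition. -/
def LeafRoot (f : ℝ → ℝ) (Γ : FoliationGraph) : Prop :=
  (∀ v ∈ Γ, match v.kind with
    | .multicup => SolidArcsAreRoots f v.arcs
    | .multitrolleybus _ => SolidArcsAreRoots f v.arcs
    | .multibirdie => SolidArcsAreRoots f v.arcs
    | .thirdType => DegenerateEndsAreRoots f (hull v.arcs)
    | .fifthType _ => IsPlusMinusRoot f (Arc.point v.leftEnd.toReal)
    | _ => True) ∧
  ∀ b ∈ allBranches Γ, match b.kind with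
    | .closedMulticup => SolidArcsAreRoots f b.arcs
    | .secondType => IsPlusMinusRoot f (Arc.point (hull b.arcs).1)
    | .thirdType => DegenerateEndsAreRoots f (hull b.arcs)

/-- A smooth graph: no full multicups, multitrolleybuses, multibirdies, long chords with a vanishing
differential, or single tangents among its vertices. -/
def IsSmooth (ε : ℝ) (Γ : FoliationGraph) : Prop :=
  ∀ v ∈ Γ, match v.kind with
    | .multicup => v.rightEnd ≠ v.leftEnd + ((2 * ε : ℝ) : EReal)
    | .multitrolleybus _ => False
    | .multibirdie => False
    | .thirdType => False
    | .fifthType _ => False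
    | _ => True

/-! ### Smooth flows -/

def Kind.notAngle : Kind → Bool
  | .angle => false
  | _ => true

/-- The vertex `v` is a multicup that does not depend on the parameter. -/
def IsConstantMulticup (I : Set ℝ) (v : ℝ → FreeVertex) : Prop :=
  ∃ w : FreeVertex, w.kind = .multicup ∧ ∀ ε ∈ I, v ε = w

/-- The vertex `v` is one and the same point at infinity. -/
def IsConstantInfinity (I : Set ℝ) (v : ℝ → FreeVertex) : Prop :=
  (∀ ε ∈ I, ∃ s, (v ε).kind = .negInfinity s) ∨ (∀ ε ∈ I, ∃ s, (v ε).kind = .posInfinity s)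

/-- The chordal domain `C ε` lies below the vertex `v ε`; everything below this chordal domain does
not depend on `ε`. -/
def SitsOn (I : Set ℝ) (v : ℝ → FreeVertex) (C : ℝ → Set (ℝ × ℝ)) : Prop :=
  ∃ k arcs below, ∀ ε ∈ I, (v ε).below = [Branch.mk (C ε) k arcs below]

/-- The vertex `v` is a long chord over a full flow of chordal domains: the chordal domains are
parts of one and the same growing chordal domain. -/
def IsFullFlow (I : Set ℝ) (v : ℝ → FreeVertex) : Prop :=
  (∀ ε ∈ I, (v ε).kind = .firstType) ∧ ∃ C, SitsOn I v C ∧ MonotoneOn C I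

/-- The vertex `v` is a trolleybus (whose orientation may depend on the parameter) or a birdie over
a decreasing flow of chordal domains. -/
def IsDecreasingFlow (I : Set ℝ) (v : ℝ → FreeVertex) : Prop :=
  (∀ ε ∈ I, (∃ s, (v ε).kind = .trolleybus s) ∨ (v ε).kind = .birdie) ∧
  (∃ C, SitsOn I v C ∧ AntitoneOn C I) ∧
  ContinuousOn (fun ε => (hull (v ε).arcs).2 - (hull (v ε).arcs).1) I ∧
  AntitoneOn (fun ε => (hull (v ε).arcs).2 - (hull (v ε).arcs).1) I

/-- A smooth flow of graphs, with the parameter in `(η₁, η₂)`: smooth admissible graphs that satisfy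
the two conditions and differ only in the positions of angles, in the orientation of trolleybuses
(a trolleybus may also become a birdie and conversely), in the full chordal domains, which form full
flows, and in the chordal domains adjacent to trolleybuses and birdies, which form decreasing
flows. -/
def IsSmoothFlow (f : ℝ → ℝ) (η₁ η₂ : ℝ) (Γ : ℝ → FoliationGraph) : Prop :=
  (∀ ε ∈ Ioo η₁ η₂, IsAdmissible f ε (Γ ε) ∧ IsSmooth ε (Γ ε) ∧ NonDegeneracyForce f ε (Γ ε) ∧
    LeafRoot f (Γ ε)) ∧
  ∃ (n : ℕ) (S : Fin n → ℝ → FreeVertex),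
    (∀ ε ∈ Ioo η₁ η₂,
      (Γ ε).filter (fun v => v.kind.notAngle) = List.ofFn (fun i => S i ε)) ∧
    ∀ i, IsConstantMulticup (Ioo η₁ η₂) (S i) ∨ IsConstantInfinity (Ioo η₁ η₂) (S i) ∨
      IsFullFlow (Ioo η₁ η₂) (S i) ∨ IsDecreasingFlow (Ioo η₁ η₂) (S i)

/-! ### Limits of graphs and the modified limit -/

/-- Lists of constant length converge if their entries do. -/
def ListConverges {α : Type} (R : (ℕ → α) → α → Prop) (x : ℕ → List α) (y : List α) : Prop :=
  ∃ (m : ℕ) (p : Fin m → ℕ → α) (q : Fin m → α),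
    (∀ n, x n = List.ofFn (fun i => p i n)) ∧ y = List.ofFn q ∧ ∀ i, R (p i) (q i)

/-- Convergence of the endpoints in the extended line. -/
def ArcConverges (x : ℕ → Arc) (y : Arc) : Prop :=
  Tendsto (fun n => (x n).l) atTop (𝓝 y.l) ∧ Tendsto (fun n => (x n).r) atTop (𝓝 y.r)

/-- The chords of the limit are the limits of chords; nothing changes below the chordal domain. -/
def BranchConverges (x : ℕ → Branch) (y : Branch) : Prop :=
  ∃ (C : ℕ → Set (ℝ × ℝ)) (k : FixedKind) (arcs : List Arc) (below : List Branch),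
    (∀ n, x n = .mk (C n) k arcs below) ∧
    y = .mk {p | ∃ q : ℕ → ℝ × ℝ, (∀ n, q n ∈ C n) ∧ Tendsto q atTop (𝓝 p)} k arcs below

def VertexConverges (x : ℕ → FreeVertex) (y : FreeVertex) : Prop :=
  (∀ n, (x n).kind = y.kind) ∧ ListConverges ArcConverges (fun n => (x n).arcs) y.arcs ∧
    ListConverges BranchConverges (fun n => (x n).below) y.below

/-- Convergence of graphs of one and the same combinatorial structure to a graph that may have edges
of zero length. -/
def GraphConverges (x : ℕ → FoliationGraph) (y : FoliationGraph) : Prop :=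
  ListConverges VertexConverges x y

/-- Long chords with a vanishing differential become vertices of the third type. -/
def renameLongChord (f : ℝ → ℝ) (v : FreeVertex) : FreeVertex :=
  match v.kind with
  | .firstType =>
    if DL f (hull v.arcs).1 (hull v.arcs).2 = 0 ∨ DR f (hull v.arcs).1 (hull v.arcs).2 = 0 then
      { v with kind := .thirdType }
    else v
  | _ => v

/-- If the chordal domain below a trolleybus or a birdie has zero length, then the trolleybus or the
birdie is glued with the figure below this chordal domain. -/
def collapseChord (f : ℝ → ℝ) (v : FreeVertex) : FreeVertex :=
  match v.below with
  | [.mk _ _ arcs below] =>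
    if leftEnd arcs = v.leftEnd ∧ rightEnd arcs = v.rightEnd ∧
        ((∃ s, v.kind = .trolleybus s) ∨ v.kind = .birdie) then
      ⟨kindOfShape f v.kind.leftSide v.kind.rightSide arcs, arcs, below⟩
    else v
  | _ => v

/-- Concatenation of two lists of arcs, the last arc of the first list being united with the first
arc of the second list. -/
def joinArcs : List Arc → List Arc → List Arc
  | [], ys => ys
  | [x], [] => [x]
  | [x], y :: ys => ⟨x.l, y.r⟩ :: ys
  | x :: x₂ :: xs, ys => x :: joinArcs (x₂ :: xs) ys

/-- Two figures that are adjacent to one and the same tangent domain of zero length form one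
figure. -/
def glue (f : ℝ → ℝ) (v w : FreeVertex) : FreeVertex :=
  ⟨kindOfShape f v.kind.leftSide w.kind.rightSide (joinArcs v.arcs w.arcs),
    joinArcs v.arcs w.arcs, v.below ++ w.below⟩

/-- Gluing along all the tangent domains of zero length. -/
def collapseTangents (f : ℝ → ℝ) : FoliationGraph → FoliationGraph
  | [] => []
  | v :: vs =>
    match collapseTangents f vs with
    | [] => [v]
    | w :: ws => if v.rightEnd = w.leftEnd then glue f v w :: ws else v :: w :: ws

/-- The reconstruction of a graph that may have edges of zero length. -/
def reconstruct (f : ℝ → ℝ) (Γ : FoliationGraph) : FoliationGraph :=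
  collapseTangents f ((Γ.map (renameLongChord f)).map (collapseChord f))

/-- The graph `G` is the modified limit of the flow `Γ` at `η₂`. The limit is taken along sequences,
because the combinatorial structure of `Γ ε` (orientation of trolleybuses, trolleybuses becoming
birdies) need not stabilize: from every sequence of parameters that tends to `η₂` one can extract a
subsequence along which the graphs converge, and the reconstruction of the limit is `G`. -/
def IsModifiedLimit (f : ℝ → ℝ) (η₁ η₂ : ℝ) (Γ : ℝ → FoliationGraph) (G : FoliationGraph) : Prop :=
  ∀ e : ℕ → ℝ, (∀ n, e n ∈ Ioo η₁ η₂) → Tendsto e atTop (𝓝 η₂) →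
    ∃ φ : ℕ → ℕ, StrictMono φ ∧ ∃ L : FoliationGraph,
      GraphConverges (fun n => Γ (e (φ n))) L ∧ reconstruct f L = G

end

end BMOFoliation

open BMOFoliation

-- Write `g = f''` and `κ = 1/ε`. The natural unknown of a domain of right tangents is not `m` but
-- its derivative `N = m' = (f' - m)/ε`. It solves `N' = κ (g - N)`; the boundary condition `m = f'
-- - 2εβ` becomes `N = 2β`, the slope of the adjacent figure; `m'' < 0` becomes `g < N`; and
-- integration by parts shows that the right force is exactly `g - N`. So the concavity of the
-- candidate and the force condition are one and the same inequality, and only `N` has to be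
-- followed as `ε` tends to `η₂`. Left tangents are the mirror image under `t ↦ -t`.
--
-- The danger in a limit is that the strict inequality `g < N` degenerates. Monotonicity in `ε`
-- excludes this. If `g ≤ N`, then lowering `κ` can only raise the solution (`slope_comparison`), so
-- for figures that stand still the slope for `ε < η₂` is at most the limit slope, and `g < N_ε ≤
-- N_η` survives. For a moving chord of length `l` with right end `b` and average slope `A`,
-- differentiation of the cup equation gives `dA/db = (2/l)(g - A)`, an equation of the same kind.
-- On a full flow `2/l = 1/ε`, and on a decreasing flow `2/l ≥ 1/ε`; in both cases the comparison
-- has the right direction (`IsChordCurve.le_of_increasing`, `IsChordCurve.le_of_decreasing`).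
-- `PortTendsto` records this monotonicity, and `Gap.limit` passes to the limit.
--
-- Angles are free to move, so their convergence must be proved. An angle at `c` between two fixed
-- figures is a point where the slope from the left figure equals the slope from the right one.
-- Where both inequalities hold, the first slope strictly falls and the second strictly rises, so
-- there is only one such point (`Gap.unique`). The extended line is compact and every limit point
-- of the angles is again an angle of the limit figures; hence the angles converge. A domain without
-- an angle is treated as an angle pushed to the end of the domain.
--
-- The types of the vertices need not stabilize, since trolleybuses may turn and become birdies.
-- However, there are finitely many types, and the reconstruction depends only on the limit figures
-- and the limit positions of the angles (`collapse_weave`, with the explicit result `assemble`).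
-- This gives both existence along subsequences and uniqueness.
--
-- Finally, the requirements on a figure are arranged so that gluing preserves them
-- (`IsFigure.join`). Touching figures have equal slopes; two solid roots cannot touch; a figure
-- with left tangents on the left and right tangents on the right can only arise from one that is
-- already long. If a differential of a limit long chord vanishes, the chordal domain below forces
-- `g` to increase strictly up to this end and the tangent domain beside it forces `g` to decrease
-- strictly after it, so the end is a root. Conversely, a chain of good blocks joined by such
-- tangents is an admissible graph with both conditions (`blocks_good`).

namespace BMOFoliation

/-! ### The derivative of the slope coefficient of a tangent domain -/

/-- The solution of `N' = κ (g - N)` with `N p = σ`. -/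
noncomputable def slopeFrom (g : ℝ → ℝ) (κ p σ u : ℝ) : ℝ :=
  Real.exp (-κ * u) * (σ * Real.exp (κ * p) + κ * ∫ t in p..u, g t * Real.exp (κ * t))

/-- The solution of `N' = κ (g - N)` that comes from minus infinity. -/
noncomputable def slopeFromBot (g : ℝ → ℝ) (κ u : ℝ) : ℝ :=
  Real.exp (-κ * u) * (κ * ∫ t in Iic u, g t * Real.exp (κ * t))

/-- The solution of `N' = κ (g - N)` that starts at a point of the line or at minus infinity. -/
noncomputable def rightSlope (g : ℝ → ℝ) (κ : ℝ) (p : EReal) (σ u : ℝ) : ℝ :=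
  open scoped Classical in if p = ⊥ then slopeFromBot g κ u else slopeFrom g κ p.toReal σ u

/-- The solution of `N' = κ (N - g)` that starts at a point of the line or at plus infinity. -/
noncomputable def leftSlope (g : ℝ → ℝ) (κ : ℝ) (q : EReal) (σ u : ℝ) : ℝ :=
  rightSlope (fun t => g (-t)) κ (-q) σ (-u)

/-- The growth of `g` is at most exponential with the exponent `κ₀`. -/
def ExpBounded (g : ℝ → ℝ) (κ₀ : ℝ) : Prop := ∃ C, ∀ t, |g t| ≤ C * Real.exp (κ₀ * |t|)

theorem ExpBounded.neg {g : ℝ → ℝ} {κ₀ : ℝ} (h : ExpBounded g κ₀) :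
    ExpBounded (fun t => g (-t)) κ₀ := by
  obtain ⟨C, hC⟩ := h
  exact ⟨C, fun t => by simpa using hC (-t)⟩

/-- For `t ≤ 0` a larger `κ` only makes the exponential smaller. The separate exponent `κ'` yields
one majorant for all `κ ≥ κ'`, as dominated convergence in `κ` requires. -/
theorem ExpBounded.norm_mul_exp_le {g : ℝ → ℝ} {κ₀ : ℝ} (h : ExpBounded g κ₀) :
    ∃ C, 0 ≤ C ∧ ∀ t ≤ 0, ∀ κ' κ, κ' ≤ κ →
      ‖g t * Real.exp (κ * t)‖ ≤ C * Real.exp ((κ' - κ₀) * t) := by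
  obtain ⟨C, hC⟩ := h
  have hC0 : 0 ≤ C := by
    have := (abs_nonneg _).trans (hC 0)
    simpa using this
  refine ⟨C, hC0, fun t ht κ' κ hκ => ?_⟩
  rw [norm_mul, Real.norm_eq_abs, Real.norm_eq_abs, Real.abs_exp]
  calc |g t| * Real.exp (κ * t) ≤ C * Real.exp (κ₀ * |t|) * Real.exp (κ' * t) := by
        gcongr ?_ * Real.exp ?_
        · exact hC t
        · exact mul_le_mul_of_nonpos_right hκ ht
    _ = C * Real.exp ((κ' - κ₀) * t) := by
        rw [mul_assoc, ← Real.exp_add, abs_of_nonpos ht]; ring_nf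

theorem ExpBounded.integrableOn_Iic {g : ℝ → ℝ} {κ₀ κ : ℝ} (h : ExpBounded g κ₀)
    (hg : Continuous g) (hκ : κ₀ < κ) (u : ℝ) :
    IntegrableOn (fun t => g t * Real.exp (κ * t)) (Iic u) := by
  have h0 : IntegrableOn (fun t => g t * Real.exp (κ * t)) (Iic 0) := by
    obtain ⟨C, -, hC⟩ := h.norm_mul_exp_le
    refine Integrable.mono' (((integrableOn_exp_mul_Iic (sub_pos.2 hκ) 0)).const_mul C)
      (by fun_prop) ?_
    filter_upwards [ae_restrict_mem measurableSet_Iic] with t ht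
    exact hC t ht κ κ le_rfl
  have h1 : IntegrableOn (fun t => g t * Real.exp (κ * t)) (Icc 0 u) :=
    (by fun_prop : Continuous fun t => g t * Real.exp (κ * t)).continuousOn.integrableOn_Icc
  refine (h0.union h1).mono_set fun x hx => ?_
  rcases le_total x 0 with h | h
  · exact Or.inl h
  · exact Or.inr ⟨h, hx⟩

theorem slopeFrom_self (g : ℝ → ℝ) (κ p σ : ℝ) : slopeFrom g κ p σ p = σ := by
  simp only [slopeFrom, intervalIntegral.integral_same, mul_zero, add_zero]
  rw [mul_left_comm, ← Real.exp_add]; simp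

theorem hasDerivAt_slopeFrom {g : ℝ → ℝ} (hg : Continuous g) (κ p σ u : ℝ) :
    HasDerivAt (slopeFrom g κ p σ) (κ * (g u - slopeFrom g κ p σ u)) u := by
  have h1 : HasDerivAt (fun u => Real.exp (-κ * u)) (Real.exp (-κ * u) * (-κ * 1)) u :=
    ((hasDerivAt_id u).const_mul (-κ)).exp
  have h2 : HasDerivAt (fun u => ∫ t in p..u, g t * Real.exp (κ * t)) (g u * Real.exp (κ * u)) u :=
    intervalIntegral.integral_hasDerivAt_right
      ((by fun_prop : Continuous fun t => g t * Real.exp (κ * t)).intervalIntegrable _ _)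
      (Continuous.stronglyMeasurableAtFilter (by fun_prop) _ _) (by fun_prop)
  refine (h1.mul ((h2.const_mul κ).const_add (σ * Real.exp (κ * p)))).congr_deriv ?_
  have : Real.exp (-κ * u) * Real.exp (κ * u) = 1 := by rw [← Real.exp_add]; simp
  simp only [slopeFrom]
  linear_combination κ * g u * this

/-- Past any point `a`, the solution from minus infinity is an ordinary solution of the initial
value problem, so local properties are inherited from `slopeFrom`. -/
theorem slopeFromBot_eq {g : ℝ → ℝ} {κ₀ κ : ℝ} (h : ExpBounded g κ₀)
    (hg : Continuous g) (hκ : κ₀ < κ) (a u : ℝ) :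
    slopeFromBot g κ u = slopeFrom g κ a (slopeFromBot g κ a) u := by
  simp only [slopeFrom, slopeFromBot]
  rw [← intervalIntegral.integral_Iic_sub_Iic (h.integrableOn_Iic hg hκ a)
    (h.integrableOn_Iic hg hκ u)]
  have : Real.exp (-κ * a) * Real.exp (κ * a) = 1 := by rw [← Real.exp_add]; simp
  linear_combination -(Real.exp (-κ * u) * κ * ∫ t in Iic a, g t * Real.exp (κ * t)) * this

theorem hasDerivAt_slopeFromBot {g : ℝ → ℝ} {κ₀ κ : ℝ} (h : ExpBounded g κ₀)
    (hg : Continuous g) (hκ : κ₀ < κ) (u : ℝ) :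
    HasDerivAt (slopeFromBot g κ) (κ * (g u - slopeFromBot g κ u)) u := by
  have h1 : slopeFromBot g κ = slopeFrom g κ 0 (slopeFromBot g κ 0) :=
    funext fun u => slopeFromBot_eq h hg hκ 0 u
  rw [h1]
  exact hasDerivAt_slopeFrom hg _ _ _ _

theorem hasDerivAt_rightSlope {g : ℝ → ℝ} {κ₀ κ : ℝ} (h : ExpBounded g κ₀)
    (hg : Continuous g) (hκ : κ₀ < κ) (p : EReal) (σ u : ℝ) :
    HasDerivAt (rightSlope g κ p σ) (κ * (g u - rightSlope g κ p σ u)) u := by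
  unfold rightSlope
  split_ifs
  · exact hasDerivAt_slopeFromBot h hg hκ u
  · exact hasDerivAt_slopeFrom hg _ _ _ _

theorem hasDerivAt_leftSlope {g : ℝ → ℝ} {κ₀ κ : ℝ} (h : ExpBounded g κ₀)
    (hg : Continuous g) (hκ : κ₀ < κ) (q : EReal) (σ u : ℝ) :
    HasDerivAt (leftSlope g κ q σ) (κ * (leftSlope g κ q σ u - g u)) u := by
  have := (hasDerivAt_rightSlope h.neg (hg.comp continuous_neg) hκ (-q) σ (-u)).comp u
    (hasDerivAt_neg u)
  refine this.congr_deriv ?_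
  simp only [leftSlope, neg_neg]; ring

theorem rightSlope_self (g : ℝ → ℝ) (κ σ p : ℝ) : rightSlope g κ p σ p = σ := by
  simp [rightSlope, slopeFrom_self]

theorem leftSlope_self (g : ℝ → ℝ) (κ σ q : ℝ) : leftSlope g κ q σ q = σ := by
  have := rightSlope_self (fun t => g (-t)) κ σ (-q)
  rwa [EReal.coe_neg] at this

/-- A supersolution of a linear equation that is nonpositive stays nonpositive. -/
theorem nonpos_of_deriv_le {z z' w w' : ℝ → ℝ} {κ a b : ℝ} (hab : a ≤ b)
    (hzc : ContinuousOn z (Icc a b)) (hwc : ContinuousOn w (Icc a b))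
    (hz : ∀ t ∈ Ioo a b, HasDerivAt z (z' t) t) (hw : ∀ t ∈ Ioo a b, HasDerivAt w (w' t) t)
    (hle : ∀ t ∈ Ioo a b, z' t ≤ -κ * w' t * z t) :
    z b * Real.exp (κ * w b) ≤ z a * Real.exp (κ * w a) := by
  -- `exp (κ * w)` is the integrating factor of `z' = -κ w' z`. The clock `w` is kept general: later
  -- the equation runs along a curve of chords with `w` the right end of the chord and the chord
  -- length as parameter.
  have hanti : AntitoneOn (fun t => z t * Real.exp (κ * w t)) (Icc a b) := by
    refine antitoneOn_of_deriv_nonpos (convex_Icc a b) (by fun_prop) ?_ ?_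
    · rw [interior_Icc]
      intro t ht
      exact ((hz t ht).mul ((hw t ht).const_mul κ).exp).differentiableAt.differentiableWithinAt
    · rw [interior_Icc]
      intro t ht
      refine (HasDerivAt.deriv ((hz t ht).mul ((hw t ht).const_mul κ).exp)).trans_le ?_
      have := mul_le_mul_of_nonneg_right (hle t ht) (Real.exp_pos (κ * w t)).le
      nlinarith
  exact hanti (left_mem_Icc.2 hab) (right_mem_Icc.2 hab) hab

/-- Uniqueness for the linear equation. -/
theorem eq_slopeFrom {g N : ℝ → ℝ} (hg : Continuous g) {κ p : ℝ}
    (hN : ∀ u, HasDerivAt N (κ * (g u - N u)) u) (u : ℝ) : N u = slopeFrom g κ p (N p) u := by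
  have hd : ∀ t, HasDerivAt (fun t => (N t - slopeFrom g κ p (N p) t) * Real.exp (κ * t)) 0 t := by
    intro t
    have h3 : HasDerivAt (fun u => Real.exp (κ * u)) (Real.exp (κ * t) * (κ * 1)) t :=
      ((hasDerivAt_id t).const_mul κ).exp
    refine (((hN t).sub (hasDerivAt_slopeFrom hg κ p (N p) t)).mul h3).congr_deriv ?_
    simp only [Pi.sub_apply]
    ring
  have hc := is_const_of_deriv_eq_zero (fun t => (hd t).differentiableAt)
    (fun t => (hd t).deriv) u p
  simp only [slopeFrom_self, sub_self, zero_mul] at hc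
  have := (mul_eq_zero.1 hc).resolve_right (Real.exp_pos _).ne'
  linarith

theorem continuous_slopeFrom {g : ℝ → ℝ} (hg : Continuous g) :
    Continuous fun x : ℝ × ℝ × ℝ × ℝ => slopeFrom g x.1 x.2.1 x.2.2.1 x.2.2.2 := by
  have h0 : Continuous fun y : ℝ × ℝ => ∫ t in (0 : ℝ)..y.2, g t * Real.exp (y.1 * t) := by
    refine intervalIntegral.continuous_parametric_intervalIntegral_of_continuous
      (f := fun (y : ℝ × ℝ) t => g t * Real.exp (y.1 * t)) ?_ continuous_snd
    fun_prop
  -- Splitting at `0` removes the moving lower limit, so that only integrals with a fixed lower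
  -- limit and a parameter remain.
  have h1 : ∀ κ p u : ℝ, ∫ t in p..u, g t * Real.exp (κ * t) =
      (∫ t in (0 : ℝ)..u, g t * Real.exp (κ * t)) - ∫ t in (0 : ℝ)..p, g t * Real.exp (κ * t) := by
    intro κ p u
    have hi : ∀ a b, IntervalIntegrable (fun t => g t * Real.exp (κ * t)) volume a b := fun a b =>
      (by fun_prop : Continuous fun t => g t * Real.exp (κ * t)).intervalIntegrable _ _
    rw [intervalIntegral.integral_interval_sub_left (hi _ _) (hi _ _)]
  have h2 : Continuous fun x : ℝ × ℝ × ℝ × ℝ =>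
      ∫ t in (0 : ℝ)..x.2.2.2, g t * Real.exp (x.1 * t) :=
    h0.comp (by fun_prop : Continuous fun x : ℝ × ℝ × ℝ × ℝ => (x.1, x.2.2.2))
  have h3 : Continuous fun x : ℝ × ℝ × ℝ × ℝ =>
      ∫ t in (0 : ℝ)..x.2.1, g t * Real.exp (x.1 * t) :=
    h0.comp (by fun_prop : Continuous fun x : ℝ × ℝ × ℝ × ℝ => (x.1, x.2.1))
  unfold slopeFrom
  refine Continuous.mul (by fun_prop) (Continuous.add (by fun_prop) (continuous_fst.mul ?_))
  exact (h2.sub h3).congr fun x => (h1 _ _ _).symm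

theorem tendsto_slopeFromBot {g : ℝ → ℝ} {κ₀ κ u : ℝ} (h : ExpBounded g κ₀)
    (hg : Continuous g) (hκ : κ₀ < κ) {k v : ℕ → ℝ} (hk : Tendsto k atTop (𝓝 κ))
    (hv : Tendsto v atTop (𝓝 u)) :
    Tendsto (fun n => slopeFromBot g (k n) (v n)) atTop (𝓝 (slopeFromBot g κ u)) := by
  have h0 : Tendsto (fun n => slopeFromBot g (k n) 0) atTop (𝓝 (slopeFromBot g κ 0)) := by
    have : Tendsto (fun n => ∫ t in Iic (0 : ℝ), g t * Real.exp (k n * t)) atTop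
        (𝓝 (∫ t in Iic (0 : ℝ), g t * Real.exp (κ * t))) := by
      -- An intermediate exponent gives an integrable majorant common to all `k n ≥ κ'`, hence to
      -- almost all `n`.
      obtain ⟨κ', h1, h2⟩ := exists_between hκ
      obtain ⟨C, -, hC⟩ := h.norm_mul_exp_le
      refine tendsto_integral_filter_of_dominated_convergence
        (fun t => C * Real.exp ((κ' - κ₀) * t)) (Eventually.of_forall fun n => by fun_prop) ?_
        ((integrableOn_exp_mul_Iic (sub_pos.2 h1) 0).const_mul C) ?_
      · filter_upwards [hk.eventually (lt_mem_nhds h2)] with n hn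
        filter_upwards [ae_restrict_mem measurableSet_Iic] with t ht
        exact hC t ht κ' (k n) hn.le
      · refine Eventually.of_forall fun t => ?_
        exact tendsto_const_nhds.mul ((Real.continuous_exp.tendsto _).comp (hk.mul_const t))
    simp only [slopeFromBot, mul_zero, Real.exp_zero, one_mul]
    exact hk.mul this
  have h1 : Tendsto (fun n => slopeFrom g (k n) 0 (slopeFromBot g (k n) 0) (v n)) atTop
      (𝓝 (slopeFrom g κ 0 (slopeFromBot g κ 0) u)) :=
    ((continuous_slopeFrom hg).tendsto (κ, 0, slopeFromBot g κ 0, u)).comp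
      (hk.prodMk_nhds (tendsto_const_nhds.prodMk_nhds (h0.prodMk_nhds hv)))
  rw [slopeFromBot_eq h hg hκ 0 u]
  refine h1.congr' ?_
  filter_upwards [hk.eventually (lt_mem_nhds hκ)] with n hn
  exact (slopeFromBot_eq h hg hn 0 _).symm

/-- The solution that comes from minus infinity is an average of `g`. -/
theorem slopeFromBot_le {g : ℝ → ℝ} {κ₀ κ u B : ℝ} (h : ExpBounded g κ₀) (hκ₀ : 0 ≤ κ₀)
    (hg : Continuous g) (hκ : κ₀ < κ) (hB : ∀ t < u, g t ≤ B) : slopeFromBot g κ u ≤ B := by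
  have hκp : 0 < κ := hκ₀.trans_lt hκ
  have hB' : ∀ t ≤ u, g t ≤ B := fun t ht => by
    rcases ht.lt_or_eq with h | rfl
    · exact hB t h
    · exact le_of_tendsto (hg.tendsto t |>.mono_left (nhdsWithin_le_nhds (s := Iio t)))
        (by filter_upwards [self_mem_nhdsWithin] with s hs using hB s hs)
  have h1 : ∫ t in Iic u, g t * Real.exp (κ * t) ≤ ∫ t in Iic u, B * Real.exp (κ * t) := by
    refine setIntegral_mono_on (h.integrableOn_Iic hg hκ u)
      ((integrableOn_exp_mul_Iic hκp u).const_mul B) measurableSet_Iic fun t ht => ?_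
    exact mul_le_mul_of_nonneg_right (hB' t ht) (Real.exp_pos _).le
  rw [integral_const_mul, integral_exp_mul_Iic hκp] at h1
  have h2 : Real.exp (-κ * u) * Real.exp (κ * u) = 1 := by rw [← Real.exp_add]; simp
  calc slopeFromBot g κ u ≤ Real.exp (-κ * u) * (κ * (B * (Real.exp (κ * u) / κ))) := by
        unfold slopeFromBot; gcongr
    _ = B * (Real.exp (-κ * u) * Real.exp (κ * u)) := by field_simp
    _ = B := by rw [h2, mul_one]

/-- This is the boundary term at minus infinity in comparison arguments. The exponent `κ'` may
differ from `κ`, because two solutions with different parameters are compared with one integrating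
factor. -/
theorem tendsto_slopeFromBot_mul_exp {g : ℝ → ℝ} {κ₀ κ κ' : ℝ} (h : ExpBounded g κ₀)
    (hκ : κ₀ < κ) (hκ' : κ₀ < κ') :
    Tendsto (fun t => slopeFromBot g κ t * Real.exp (κ' * t)) atBot (𝓝 0) := by
  obtain ⟨C, hC0, hC⟩ := h.norm_mul_exp_le
  have hb : ∀ t ≤ 0, ‖slopeFromBot g κ t * Real.exp (κ' * t)‖ ≤
      (|κ| * C / (κ - κ₀)) * Real.exp ((κ' - κ₀) * t) := by
    intro t ht
    have h1 : ‖∫ s in Iic t, g s * Real.exp (κ * s)‖ ≤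
        C * (Real.exp ((κ - κ₀) * t) / (κ - κ₀)) := by
      rw [← integral_exp_mul_Iic (sub_pos.2 hκ), ← integral_const_mul]
      refine norm_integral_le_of_norm_le
        ((integrableOn_exp_mul_Iic (sub_pos.2 hκ) t).const_mul C) ?_
      filter_upwards [ae_restrict_mem measurableSet_Iic] with s hs
      exact hC s (le_trans hs ht) κ κ le_rfl
    simp only [slopeFromBot, norm_mul, Real.norm_eq_abs, Real.abs_exp] at h1 ⊢
    calc _ ≤ Real.exp (-κ * t) * (|κ| * (C * (Real.exp ((κ - κ₀) * t) / (κ - κ₀)))) *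
          Real.exp (κ' * t) := by gcongr
      _ = (|κ| * C / (κ - κ₀)) * (Real.exp (-κ * t) * Real.exp ((κ - κ₀) * t) *
          Real.exp (κ' * t)) := by ring
      _ = _ := by rw [← Real.exp_add, ← Real.exp_add]; ring_nf
  have hlim : Tendsto (fun t => (|κ| * C / (κ - κ₀)) * Real.exp ((κ' - κ₀) * t)) atBot (𝓝 0) := by
    rw [← mul_zero (|κ| * C / (κ - κ₀))]
    exact (Real.tendsto_exp_atBot.comp
      (tendsto_id.const_mul_atBot (sub_pos.2 hκ'))).const_mul _
  exact squeeze_zero_norm' ((eventually_le_atBot 0).mono hb) hlim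

/-! ### Comparison of the slopes for different parameters -/

/-- The difference `z = P - Q` satisfies `z' = -κ₂ z + (κ₁ - κ₂)(g - P)`, and the last term is
nonpositive where `g ≤ P`. Thus a larger `ε` can only raise the slope as long as the tangents are
correct. The form with exponentials allows `a` to tend to minus infinity. -/
theorem slope_comparison_aux {g P Q : ℝ → ℝ} {κ₁ κ₂ a u : ℝ} (hκ : κ₂ ≤ κ₁) (hau : a ≤ u)
    (hP : ∀ t, HasDerivAt P (κ₁ * (g t - P t)) t) (hQ : ∀ t, HasDerivAt Q (κ₂ * (g t - Q t)) t)
    (hg : ∀ t ∈ Ioo a u, g t ≤ P t) :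
    (P u - Q u) * Real.exp (κ₂ * u) ≤ (P a - Q a) * Real.exp (κ₂ * a) := by
  refine nonpos_of_deriv_le (z := fun t => P t - Q t) (w := id)
    (z' := fun t => κ₁ * (g t - P t) - κ₂ * (g t - Q t)) (w' := fun _ => 1) hau ?_
    continuousOn_id (fun t _ => (hP t).sub (hQ t)) (fun t _ => hasDerivAt_id t) fun t ht => ?_
  · exact fun t _ => ((hP t).sub (hQ t)).continuousAt.continuousWithinAt
  · have := mul_nonneg (sub_nonneg.2 hκ) (sub_nonneg.2 (hg t ht))
    nlinarith

theorem slope_comparison {g P Q : ℝ → ℝ} {κ₁ κ₂ a u : ℝ} (hκ : κ₂ ≤ κ₁) (hau : a ≤ u)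
    (hP : ∀ t, HasDerivAt P (κ₁ * (g t - P t)) t) (hQ : ∀ t, HasDerivAt Q (κ₂ * (g t - Q t)) t)
    (hg : ∀ t ∈ Ioo a u, g t ≤ P t) (ha : P a ≤ Q a) : P u ≤ Q u := by
  have h1 := slope_comparison_aux hκ hau hP hQ hg
  have h2 : (P a - Q a) * Real.exp (κ₂ * a) ≤ 0 :=
    mul_nonpos_of_nonpos_of_nonneg (sub_nonpos.2 ha) (Real.exp_pos _).le
  have h3 := Real.exp_pos (κ₂ * u)
  by_contra! h
  have := mul_pos (sub_pos.2 h) h3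
  linarith

/-- The same comparison started at `a`, with `a → -∞`: growth below both exponents kills the initial
term. -/
theorem slopeFromBot_comparison {g : ℝ → ℝ} {κ₀ κ₁ κ₂ u : ℝ} (h : ExpBounded g κ₀)
    (hg : Continuous g) (hκ₂ : κ₀ < κ₂) (hκ : κ₂ ≤ κ₁) (hu : ∀ t < u, g t ≤ slopeFromBot g κ₁ t) :
    slopeFromBot g κ₁ u ≤ slopeFromBot g κ₂ u := by
  have hκ₁ := hκ₂.trans_le hκ
  have hlim : Tendsto (fun a => (slopeFromBot g κ₁ a - slopeFromBot g κ₂ a) * Real.exp (κ₂ * a))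
      atBot (𝓝 0) := by
    simp_rw [sub_mul]
    simpa using (tendsto_slopeFromBot_mul_exp h hκ₁ hκ₂).sub
      (tendsto_slopeFromBot_mul_exp h hκ₂ hκ₂)
  have h1 : (slopeFromBot g κ₁ u - slopeFromBot g κ₂ u) * Real.exp (κ₂ * u) ≤ 0 := by
    refine ge_of_tendsto hlim ?_
    filter_upwards [eventually_le_atBot u] with a ha
    exact slope_comparison_aux hκ ha (hasDerivAt_slopeFromBot h hg hκ₁)
      (hasDerivAt_slopeFromBot h hg hκ₂) fun t ht => hu t ht.2
  by_contra! h2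
  have := mul_pos (sub_pos.2 h2) (Real.exp_pos (κ₂ * u))
  linarith

/-- The curve `l ↦ (b l, A l)` of the right ends and the slopes of the chords of a chordal domain:
on the right end of a chord the second derivative `g` is smaller than the slope of the chord. -/
structure IsChordCurve (g b A : ℝ → ℝ) (l₁ l₂ : ℝ) : Prop where
  continuousOn_end : ContinuousOn b (Icc l₁ l₂)
  continuousOn_slope : ContinuousOn A (Icc l₁ l₂)
  deriv : ∀ l ∈ Ioo l₁ l₂, g (b l) < A l ∧
    ∃ q > 0, HasDerivAt b q l ∧ HasDerivAt A (2 / l * (g (b l) - A l) * q) l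

theorem IsChordCurve.mono {g b A : ℝ → ℝ} {l₁ l₂ l₁' l₂' : ℝ} (h : IsChordCurve g b A l₁ l₂)
    (h₁ : l₁ ≤ l₁') (h₂ : l₂' ≤ l₂) : IsChordCurve g b A l₁' l₂' :=
  ⟨h.1.mono (Icc_subset_Icc h₁ h₂), h.2.mono (Icc_subset_Icc h₁ h₂),
    fun l hl => h.3 l (Ioo_subset_Ioo h₁ h₂ hl)⟩

theorem IsChordCurve.strictMonoOn {g b A : ℝ → ℝ} {l₁ l₂ : ℝ} (h : IsChordCurve g b A l₁ l₂) :
    StrictMonoOn b (Icc l₁ l₂) := by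
  refine strictMonoOn_of_deriv_pos (convex_Icc _ _) h.1 fun l hl => ?_
  rw [interior_Icc] at hl
  obtain ⟨-, q, hq, hb, -⟩ := h.3 l hl
  rwa [hb.deriv]

/-- For `z = P ∘ b - A` one finds `z' = -(2/l₁) b' z + (2/l₁ - 2/l)(g - A) b'`, where the last term
is nonpositive since `l ≥ l₁` and `g < A`. With `l₁ = 2ε` the equation of `P` is that of right
tangents, so tangents leaving a long chord lie below the slopes of the longer chords that come
later. -/
theorem IsChordCurve.le_of_increasing {g b A P : ℝ → ℝ} {l₁ l₂ : ℝ} (h : IsChordCurve g b A l₁ l₂)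
    (hl₁ : 0 < l₁) (hl : l₁ ≤ l₂) (hP : ∀ t, HasDerivAt P (2 / l₁ * (g t - P t)) t)
    (h₁ : P (b l₁) ≤ A l₁) : P (b l₂) ≤ A l₂ := by
  choose! hlt q hq hb hA using h.3
  have h1 := nonpos_of_deriv_le (κ := 2 / l₁) (z := fun l => P (b l) - A l) (w := b)
    (z' := fun l => 2 / l₁ * (g (b l) - P (b l)) * q l - 2 / l * (g (b l) - A l) * q l) (w' := q) hl
    ((fun l hl => ((hP _).continuousAt.comp_continuousWithinAt (h.1 l hl)).sub (h.2 l hl))) h.1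
    (fun l hl => ((hP (b l)).comp l (hb l hl)).sub (hA l hl)) hb fun l hl => ?_
  · have h2 : (P (b l₁) - A l₁) * Real.exp (2 / l₁ * b l₁) ≤ 0 :=
      mul_nonpos_of_nonpos_of_nonneg (sub_nonpos.2 h₁) (Real.exp_pos _).le
    by_contra! h3
    have := mul_pos (sub_pos.2 h3) (Real.exp_pos (2 / l₁ * b l₂))
    linarith
  · have h2 : 2 / l ≤ 2 / l₁ := div_le_div_of_nonneg_left zero_le_two hl₁ hl.1.le
    have := mul_nonneg (mul_nonneg (sub_nonneg.2 h2) (sub_nonneg.2 (hlt l hl).le)) (hq l hl).le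
    nlinarith

/-- Now `z = A - Q ∘ b` satisfies `z' = -κ b' z + (2/l - κ)(g - A) b'`, and `κ ≤ 2/l₂ ≤ 2/l` since
the chords are not longer than `2/κ`. When a base shrinks, the tangents that leave the shorter chord
lie above the slopes of the longer ones. -/
theorem IsChordCurve.le_of_decreasing {g b A Q : ℝ → ℝ} {l₁ l₂ κ : ℝ}
    (h : IsChordCurve g b A l₁ l₂) (hl₁ : 0 ≤ l₁) (hl : l₁ ≤ l₂)
    (hQ : ∀ t, HasDerivAt Q (κ * (g t - Q t)) t) (hκ : κ ≤ 2 / l₂)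
    (h₁ : A l₁ ≤ Q (b l₁)) : A l₂ ≤ Q (b l₂) := by
  choose! hlt q hq hb hA using h.3
  have h1 := nonpos_of_deriv_le (κ := κ) (z := fun l => A l - Q (b l)) (w := b)
    (z' := fun l => 2 / l * (g (b l) - A l) * q l - κ * (g (b l) - Q (b l)) * q l) (w' := q) hl
    ((fun l hl => (h.2 l hl).sub ((hQ _).continuousAt.comp_continuousWithinAt (h.1 l hl)))) h.1
    (fun l hl => (hA l hl).sub ((hQ (b l)).comp l (hb l hl))) hb fun l hl => ?_
  · have h2 : (A l₁ - Q (b l₁)) * Real.exp (κ * b l₁) ≤ 0 :=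
      mul_nonpos_of_nonpos_of_nonneg (sub_nonpos.2 h₁) (Real.exp_pos _).le
    by_contra! h3
    have := mul_pos (sub_pos.2 h3) (Real.exp_pos (κ * b l₂))
    linarith
  · have h2 : κ ≤ 2 / l := hκ.trans
      (div_le_div_of_nonneg_left zero_le_two (hl₁.trans_lt hl.1) hl.2.le)
    have := mul_nonneg (mul_nonneg (sub_nonneg.2 h2) (sub_nonneg.2 (hlt l hl).le)) (hq l hl).le
    nlinarith

/-- If the right differential vanishes on the upper chord, then `g` does not decrease on the left of
its right end. -/
theorem IsChordCurve.not_antitoneOn {g b A : ℝ → ℝ} {l₁ l₂ x : ℝ} (h : IsChordCurve g b A l₁ l₂)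
    (hl₁ : 0 ≤ l₁) (hl : l₁ < l₂) (hA : A l₂ = g (b l₂)) (hx : x < b l₂) :
    ¬ AntitoneOn g (Icc x (b l₂)) := by
  intro hanti
  -- The argument starts at an interior length: there the differential is strictly negative, the
  -- coefficient `2/l` is bounded, and the right end already lies in the interval where `g` is
  -- supposed to be nonincreasing.
  obtain ⟨l₃, hl₃, hbl₃⟩ : ∃ l ∈ Ioo l₁ l₂, x < b l := by
    have h1 : Tendsto b (𝓝[<] l₂) (𝓝 (b l₂)) := by
      rw [← nhdsWithin_Ioo_eq_nhdsLT hl]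
      exact (h.1 l₂ (right_mem_Icc.2 hl.le)).mono_left (nhdsWithin_mono _ Ioo_subset_Icc_self)
    have h2 : ∀ᶠ l in 𝓝[<] l₂, l ∈ Ioo l₁ l₂ := Ioo_mem_nhdsLT hl
    exact (h2.and (h1.eventually (lt_mem_nhds hx))).exists
  have h' := h.mono hl₃.1.le le_rfl
  choose! hlt q hq hb hA' using h'.3
  have hγ : ∀ l ∈ Icc l₃ l₂, g (b l₂) ≤ g (b l) := fun l hl => by
    have hm := h'.strictMonoOn.monotoneOn
    have h3 := hm hl (right_mem_Icc.2 hl₃.2.le) hl.2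
    have h4 := hm (left_mem_Icc.2 hl₃.2.le) hl hl.1
    exact hanti ⟨hbl₃.le.trans h4, h3⟩ (right_mem_Icc.2 hx.le) h3
  have h0 : 0 < l₃ := hl₁.trans_lt hl₃.1
  -- The quantity `g (b l₂) - A` is negative at `l₃`, because `A > g ∘ b ≥ g (b l₂)`. The
  -- differential inequality then keeps it negative up to `l₂`, where it should vanish.
  have h1 := nonpos_of_deriv_le (κ := 2 / l₃) (z := fun l => g (b l₂) - A l) (w := b)
    (z' := fun l => -(2 / l * (g (b l) - A l) * q l)) (w' := q) hl₃.2.le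
    (continuousOn_const.sub h'.2) h'.1
    (fun l hl => (hA' l hl).const_sub _) hb fun l hl => ?_
  · have h2 : (g (b l₂) - A l₃) * Real.exp (2 / l₃ * b l₃) < 0 := by
      refine mul_neg_of_neg_of_pos (sub_neg.2 ?_) (Real.exp_pos _)
      exact (hγ l₃ (left_mem_Icc.2 hl₃.2.le)).trans_lt (h.3 l₃ hl₃).1
    simp only [hA, sub_self, zero_mul] at h1
    linarith
  · have h2 : 2 / l ≤ 2 / l₃ := div_le_div_of_nonneg_left zero_le_two h0 hl.1.le
    have h3 := hγ l (Ioo_subset_Icc_self hl)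
    have h4 := hlt l hl
    have h5 : 0 ≤ 2 / l := div_nonneg zero_le_two (h0.trans hl.1).le
    have h6 := hq l hl
    have h7 := mul_nonneg (mul_nonneg (sub_nonneg.2 h2) (sub_nonneg.2 (h3.trans h4.le))) h6.le
    have h8 := mul_nonneg (mul_nonneg h5 (sub_nonneg.2 h3)) h6.le
    nlinarith

/-! ### Tangents between consecutive figures -/

/-- Right tangents from `p` to `c` and left tangents from `q` to `c` that agree at the point `c`;
`σ` and `σ'` are the slopes of the figures at `p` and `q`. -/
structure Gap (g : ℝ → ℝ) (κ : ℝ) (p : EReal) (σ : ℝ) (q : EReal) (σ' : ℝ) (c : EReal) :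
    Prop where
  left_le : p ≤ c
  le_right : c ≤ q
  left_ne : p ≠ ⊤
  right_ne : q ≠ ⊥
  lt_rightSlope : ∀ u : ℝ, p < u → (u : EReal) < c → g u < rightSlope g κ p σ u
  lt_leftSlope : ∀ u : ℝ, c < u → (u : EReal) < q → g u < leftSlope g κ q σ' u
  balance : ∀ t : ℝ, c = t → rightSlope g κ p σ t = leftSlope g κ q σ' t

theorem leftSlope_neg (g : ℝ → ℝ) (κ : ℝ) (p : EReal) (σ u : ℝ) :
    leftSlope (fun t => g (-t)) κ (-p) σ (-u) = rightSlope g κ p σ u := by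
  simp [leftSlope]

/-- The reflection `t ↦ -t` exchanges the two families of tangents, so each statement about gaps
needs only its right half. -/
theorem Gap.reflect {g : ℝ → ℝ} {κ : ℝ} {p : EReal} {σ : ℝ} {q : EReal} {σ' : ℝ} {c : EReal}
    (h : Gap g κ p σ q σ' c) : Gap (fun t => g (-t)) κ (-q) σ' (-p) σ (-c) where
  left_le := EReal.neg_le_neg_iff.2 h.le_right
  le_right := EReal.neg_le_neg_iff.2 h.left_le
  left_ne := by simpa [EReal.neg_eq_top_iff] using h.right_ne
  right_ne := by simpa [EReal.neg_eq_bot_iff] using h.left_ne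
  lt_rightSlope u h1 h2 := by
    have := h.lt_leftSlope (-u) (by rw [EReal.coe_neg]; exact EReal.lt_neg_comm.1 h2)
      (by rw [EReal.coe_neg]; exact EReal.neg_lt_comm.1 h1)
    simpa [leftSlope] using this
  lt_leftSlope u h1 h2 := by
    have := h.lt_rightSlope (-u) (by rw [EReal.coe_neg]; exact EReal.lt_neg_comm.1 h2)
      (by rw [EReal.coe_neg]; exact EReal.neg_lt_comm.1 h1)
    rw [← leftSlope_neg] at this
    simpa using this
  balance t ht := by
    have h1 : c = ((-t : ℝ) : EReal) := by rw [EReal.coe_neg, ← ht, neg_neg]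
    have := h.balance _ h1
    rw [← leftSlope_neg] at this
    simpa [leftSlope] using this.symm

/-- Between `c` and `c'` both strict inequalities are available: the one for right tangents because
of `c'`, the one for left tangents because of `c`. By the differential equations the right slope
falls there and the left slope rises. Since they agree at `c`, the order after `c` is determined. -/
theorem Gap.rightSlope_lt {g : ℝ → ℝ} {κ₀ κ : ℝ} {p : EReal} {σ : ℝ} {q : EReal} {σ' : ℝ}
    {c c' : EReal} (hg : Continuous g) (hb : ExpBounded g κ₀) (hκ₀ : 0 ≤ κ₀) (hκ : κ₀ < κ)
    (h : Gap g κ p σ q σ' c) (h' : Gap g κ p σ q σ' c') :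
    (∀ u v : ℝ, c < u → u < v → (v : EReal) < c' →
      rightSlope g κ p σ v < rightSlope g κ p σ u ∧ leftSlope g κ q σ' u < leftSlope g κ q σ' v) ∧
    ∀ u : ℝ, c < u → (u : EReal) < c' → rightSlope g κ p σ u ≤ leftSlope g κ q σ' u := by
  have hκp : 0 < κ := hκ₀.trans_lt hκ
  have hR := hasDerivAt_rightSlope hb hg hκ p σ
  have hL := hasDerivAt_leftSlope hb hg hκ q σ'
  have hRm : ∀ u v : ℝ, c ≤ u → u < v → (v : EReal) < c' →
      rightSlope g κ p σ v < rightSlope g κ p σ u := by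
    intro u v h1 h2 h3
    refine strictAntiOn_of_deriv_neg (convex_Icc u v)
      (fun t _ => (hR t).continuousAt.continuousWithinAt) (fun t ht => ?_)
      (left_mem_Icc.2 h2.le) (right_mem_Icc.2 h2.le) h2
    rw [interior_Icc] at ht
    rw [(hR t).deriv]
    have h4 : p < (t : EReal) :=
      (h.left_le.trans h1).trans_lt (EReal.coe_lt_coe_iff.2 ht.1)
    have := h'.lt_rightSlope t h4 ((EReal.coe_lt_coe_iff.2 ht.2).trans h3)
    exact mul_neg_of_pos_of_neg hκp (sub_neg.2 this)
  have hLm : ∀ u v : ℝ, c ≤ u → u < v → (v : EReal) < c' →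
      leftSlope g κ q σ' u < leftSlope g κ q σ' v := by
    intro u v h1 h2 h3
    refine strictMonoOn_of_deriv_pos (convex_Icc u v)
      (fun t _ => (hL t).continuousAt.continuousWithinAt) (fun t ht => ?_)
      (left_mem_Icc.2 h2.le) (right_mem_Icc.2 h2.le) h2
    rw [interior_Icc] at ht
    rw [(hL t).deriv]
    have h4 : (t : EReal) < q := ((EReal.coe_lt_coe_iff.2 ht.2).trans h3).trans_le h'.le_right
    have := h.lt_leftSlope t (h1.trans_lt (EReal.coe_lt_coe_iff.2 ht.1)) h4
    exact mul_pos hκp (sub_pos.2 this)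
  refine ⟨fun u v h1 h2 h3 => ⟨hRm u v h1.le h2 h3, hLm u v h1.le h2 h3⟩, fun u h1 h2 => ?_⟩
  induction c using EReal.rec with
  | bot =>
    -- No balance is required at minus infinity. Instead, the right slope at `u` is an average of
    -- `g` over `(-∞, u)`, and there `g` lies below the increasing left slope.
    have hp : p = ⊥ := le_bot_iff.1 h.left_le
    subst hp
    have : rightSlope g κ ⊥ σ u = slopeFromBot g κ u := if_pos rfl
    rw [this]
    refine slopeFromBot_le hb hκ₀ hg hκ fun t ht => ?_
    exact (h.lt_leftSlope t (EReal.bot_lt_coe t)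
      ((EReal.coe_lt_coe_iff.2 ht).trans (h2.trans_le h'.le_right))).le.trans
        (hLm t u bot_le ht h2).le
  | top => exact absurd h1 not_top_lt
  | coe t =>
    have h3 := EReal.coe_lt_coe_iff.1 h1
    have h4 := hRm t u le_rfl h3 h2
    have h5 := hLm t u le_rfl h3 h2
    have h6 := h.balance t rfl
    linarith

/-- For `c < u < v < c'` the order seen from `c` gives `N_R v < N_R u ≤ N_L u < N_L v`, while the
order seen from `c'` after reflection gives `N_L v ≤ N_R v`. -/
theorem Gap.unique {g : ℝ → ℝ} {κ₀ κ : ℝ} {p : EReal} {σ : ℝ} {q : EReal} {σ' : ℝ}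
    {c c' : EReal} (hg : Continuous g) (hb : ExpBounded g κ₀) (hκ₀ : 0 ≤ κ₀) (hκ : κ₀ < κ)
    (h : Gap g κ p σ q σ' c) (h' : Gap g κ p σ q σ' c') : c = c' := by
  have key : ∀ {c c' : EReal}, Gap g κ p σ q σ' c → Gap g κ p σ q σ' c' → ¬ c < c' := by
    intro c c' h h' hlt
    obtain ⟨v, h1, h2⟩ := EReal.lt_iff_exists_real_btwn.1 hlt
    obtain ⟨u, h3, h4⟩ := EReal.lt_iff_exists_real_btwn.1 h1
    have h5 := EReal.coe_lt_coe_iff.1 h4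
    obtain ⟨h6, h7⟩ := Gap.rightSlope_lt hg hb hκ₀ hκ h h'
    have h8 := (Gap.rightSlope_lt (hg.comp continuous_neg) hb.neg hκ₀ hκ h'.reflect h.reflect).2
      (-v) (by rw [EReal.coe_neg]; exact EReal.neg_lt_neg_iff.2 h2)
      (by rw [EReal.coe_neg]; exact EReal.neg_lt_neg_iff.2 h1)
    have h9 : leftSlope g κ q σ' v ≤ leftSlope (fun t => g (-t)) κ (-p) σ (-v) := h8
    rw [leftSlope_neg] at h9
    have h10 := h7 u h3 (h4.trans h2)
    have h11 := h6 u v h3 h5 h2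
    linarith
  exact le_antisymm (not_lt.1 (key h' h)) (not_lt.1 (key h h'))

/-- The right ends `pₙ` and the slopes `σₙ` of a figure that moves as the parameter changes converge
to `p` and `σ`, and the tangents that leave it become longer. -/
structure PortTendsto (g : ℝ → ℝ) (k : ℕ → ℝ) (κ : ℝ) (p : ℕ → EReal) (p' : EReal) (σ : ℕ → ℝ)
    (σ' : ℝ) : Prop where
  tendsto : ((∀ n, p n = ⊥) ∧ p' = ⊥) ∨
    (p' ≠ ⊥ ∧ p' ≠ ⊤ ∧ Tendsto p atTop (𝓝 p') ∧ Tendsto σ atTop (𝓝 σ'))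
  mono : ∀ᶠ n in atTop, ∀ u : ℝ, p n < u → p' < u →
    (∀ t : ℝ, p n < t → t < u → g t < rightSlope g (k n) (p n) (σ n) t) →
      rightSlope g (k n) (p n) (σ n) u ≤ rightSlope g κ p' σ' u

theorem PortTendsto.tendsto_end {g : ℝ → ℝ} {k : ℕ → ℝ} {κ : ℝ} {p : ℕ → EReal} {p' : EReal}
    {σ : ℕ → ℝ} {σ' : ℝ} (h : PortTendsto g k κ p p' σ σ') : Tendsto p atTop (𝓝 p') := by
  rcases h.tendsto with ⟨h1, rfl⟩ | h1
  · simp [funext h1]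
  · exact h1.2.2.1

theorem PortTendsto.tendsto_rightSlope {g : ℝ → ℝ} {κ₀ : ℝ} {k : ℕ → ℝ} {κ : ℝ} {p : ℕ → EReal}
    {p' : EReal} {σ : ℕ → ℝ} {σ' : ℝ} (hg : Continuous g) (hb : ExpBounded g κ₀) (hκ : κ₀ < κ)
    (hk : Tendsto k atTop (𝓝 κ)) (h : PortTendsto g k κ p p' σ σ') {u : ℕ → ℝ} {v : ℝ}
    (hu : Tendsto u atTop (𝓝 v)) :
    Tendsto (fun n => rightSlope g (k n) (p n) (σ n) (u n)) atTop (𝓝 (rightSlope g κ p' σ' v)) := by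
  rcases h.tendsto with ⟨h1, rfl⟩ | ⟨h1, h2, h3, h4⟩
  · simp only [rightSlope, h1, if_true]
    exact tendsto_slopeFromBot hb hg hκ hk hu
  · have h5 : Tendsto (fun n => (p n).toReal) atTop (𝓝 p'.toReal) :=
      (EReal.tendsto_toReal h2 h1).comp h3
    have h6 : Tendsto (fun n => slopeFrom g (k n) (p n).toReal (σ n) (u n)) atTop
        (𝓝 (slopeFrom g κ p'.toReal σ' v)) :=
      ((continuous_slopeFrom hg).tendsto (κ, p'.toReal, σ', v)).comp
        (hk.prodMk_nhds (h5.prodMk_nhds (h4.prodMk_nhds hu)))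
    simp only [rightSlope, h1, if_false]
    refine h6.congr' ?_
    filter_upwards [h3.eventually_ne h1] with n hn
    rw [if_neg hn]

/-- Balance and weak inequalities pass to the limit by continuity. Strictness does not come from
continuity: at a given `u` a single large `n` is taken, and `g u < N_n u ≤ N u` by the monotonicity
stored in `PortTendsto.mono`. -/
theorem Gap.limit {g : ℝ → ℝ} {κ₀ : ℝ} {k : ℕ → ℝ} {κ : ℝ} {p : ℕ → EReal}
    {p' : EReal} {σ : ℕ → ℝ} {σ' : ℝ} {q : ℕ → EReal} {q' : EReal} {ρ : ℕ → ℝ} {ρ' : ℝ}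
    {c : ℕ → EReal} {c' : EReal} (hg : Continuous g) (hb : ExpBounded g κ₀) (hκ : κ₀ < κ)
    (hk : Tendsto k atTop (𝓝 κ)) (hp : PortTendsto g k κ p p' σ σ')
    (hq : PortTendsto (fun t => g (-t)) k κ (fun n => -q n) (-q') ρ ρ')
    (hc : Tendsto c atTop (𝓝 c')) (h : ∀ n, Gap g (k n) (p n) (σ n) (q n) (ρ n) (c n)) :
    Gap g κ p' σ' q' ρ' c' := by
  have hright : ∀ {g : ℝ → ℝ} {p : ℕ → EReal} {p' : EReal} {σ : ℕ → ℝ} {σ' : ℝ} {q : ℕ → EReal}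
      {ρ : ℕ → ℝ} {c : ℕ → EReal} {c' : EReal}, PortTendsto g k κ p p' σ σ' →
      Tendsto c atTop (𝓝 c') → (∀ n, Gap g (k n) (p n) (σ n) (q n) (ρ n) (c n)) →
      p' ≤ c' ∧ p' ≠ ⊤ ∧ ∀ u : ℝ, p' < u → (u : EReal) < c' → g u < rightSlope g κ p' σ' u := by
    intro g p p' σ σ' q ρ c c' hp hc h
    refine ⟨le_of_tendsto_of_tendsto' hp.tendsto_end hc fun n => (h n).left_le, ?_, ?_⟩
    · rcases hp.tendsto with ⟨h1, rfl⟩ | h1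
      · exact bot_ne_top
      · exact h1.2.1
    · intro u h1 h2
      obtain ⟨n, h3, h4, h5⟩ := ((hp.mono.and ((hp.tendsto_end.eventually (gt_mem_nhds h1)).and
        (hc.eventually (lt_mem_nhds h2))))).exists
      refine ((h n).lt_rightSlope u h4 h5).trans_le (h3 u h4 h1 fun t h6 h7 => ?_)
      exact (h n).lt_rightSlope t h6 ((EReal.coe_lt_coe_iff.2 h7).trans h5)
  obtain ⟨a1, a2, a3⟩ := hright hp hc h
  obtain ⟨b1, b2, b3⟩ := hright hq ((continuous_neg.tendsto c').comp hc) fun n => (h n).reflect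
  have := hasDerivAt_rightSlope hb hg hκ p' σ'
  refine ⟨a1, EReal.neg_le_neg_iff.1 b1, a2, fun h1 => b2 (by simp [h1]), a3, ?_, ?_⟩
  · intro u h1 h2
    have := b3 (-u) (by rw [EReal.coe_neg]; exact EReal.neg_lt_neg_iff.2 h2)
      (by rw [EReal.coe_neg]; exact EReal.neg_lt_neg_iff.2 h1)
    simpa [leftSlope] using this
  · rintro t rfl
    have h1 : Tendsto (fun n => (c n).toReal) atTop (𝓝 t) :=
      (EReal.tendsto_toReal (EReal.coe_ne_top t) (EReal.coe_ne_bot t)).comp hc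
    have h2 := hp.tendsto_rightSlope hg hb hκ hk h1
    have h3 := hq.tendsto_rightSlope (hg.comp continuous_neg) hb.neg hκ hk h1.neg
    refine tendsto_nhds_unique h2 (h3.congr' ?_)
    filter_upwards [hc.eventually_ne (EReal.coe_ne_bot t), hc.eventually_ne (EReal.coe_ne_top t)]
      with n h4 h5
    exact ((h n).balance _ (EReal.coe_toReal h5 h4).symm).symm

/-! ### Integration against the third derivative -/

/-- Integration by parts, obtained from Fubini for `(t, s) ↦ φ' s` on the triangle `t ≤ s`: one
order of integration gives `φ b - φ t`, the other `(H s - H a) φ' s`. -/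
theorem StieltjesFunction_integral_mul_eq (H : StieltjesFunction ℝ) {φ φ' : ℝ → ℝ}
    (hφ : ∀ t, HasDerivAt φ (φ' t) t) (hφ' : Continuous φ') {a b : ℝ} (hab : a ≤ b) :
    ∫ t in Ioc a b, φ t ∂H.measure = H b * φ b - H a * φ a - ∫ t in a..b, H t * φ' t := by
  have hφc : Continuous φ := continuous_iff_continuousAt.2 fun t => (hφ t).continuousAt
  have hfin : H.measure (Ioc a b) ≠ ⊤ := by rw [H.measure_Ioc]; exact ENNReal.ofReal_ne_top
  have : IsFiniteMeasure (H.measure.restrict (Ioc a b)) :=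
    ⟨by rw [Measure.restrict_apply_univ]; exact hfin.lt_top⟩
  obtain ⟨K, hK⟩ := (isCompact_Icc (a := a) (b := b)).exists_bound_of_continuousOn hφ'.continuousOn
  let F : ℝ → ℝ → ℝ := fun t s => indicator (Ici t) φ' s
  have hFm : Measurable (Function.uncurry F) := by
    have : Function.uncurry F =
        indicator {x : ℝ × ℝ | x.1 ≤ x.2} (fun x => φ' x.2) := by
      ext ⟨t, s⟩
      simp [F, indicator]
    rw [this]
    exact (hφ'.measurable.comp measurable_snd).indicator
      (measurableSet_le measurable_fst measurable_snd)
  have hFi : Integrable (Function.uncurry F)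
      ((H.measure.restrict (Ioc a b)).prod (volume.restrict (Ioc a b))) := by
    refine Integrable.of_bound hFm.aestronglyMeasurable K ?_
    rw [Measure.prod_restrict]
    filter_upwards [ae_restrict_mem (measurableSet_Ioc.prod measurableSet_Ioc)] with x hx
    refine le_trans ?_ (hK x.2 (Ioc_subset_Icc_self hx.2))
    exact norm_indicator_le_norm_self _ _
  have hint : ∀ x y, IntervalIntegrable φ' volume x y := fun x y => hφ'.intervalIntegrable x y
  have h1 : ∀ t ∈ Ioc a b, ∫ s in Ioc a b, F t s = φ b - φ t := by
    intro t ht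
    have : Ioc a b ∩ Ici t = Icc t b := by
      ext s; simp only [mem_inter_iff, mem_Ioc, mem_Ici, mem_Icc]
      exact ⟨fun h => ⟨h.2, h.1.2⟩, fun h => ⟨⟨ht.1.trans_le h.1, h.2⟩, h.1⟩⟩
    simp only [F]
    rw [setIntegral_indicator measurableSet_Ici, this, integral_Icc_eq_integral_Ioc,
      ← intervalIntegral.integral_of_le ht.2,
      intervalIntegral.integral_eq_sub_of_hasDerivAt (fun s _ => hφ s) (hint t b)]
  have h2 : ∀ s ∈ Ioc a b, ∫ t in Ioc a b, F t s ∂H.measure = H s * φ' s - H a * φ' s := by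
    intro s hs
    have h3 : ∀ t, F t s = indicator (Iic s) (fun _ => φ' s) t := fun t => by
      simp [F, indicator]
    have h4 : Ioc a b ∩ Iic s = Ioc a s := by
      ext t; simp only [mem_inter_iff, mem_Ioc, mem_Iic]
      exact ⟨fun h => ⟨h.1.1, h.2⟩, fun h => ⟨⟨h.1, h.2.trans hs.2⟩, h.2⟩⟩
    simp only [h3]
    rw [setIntegral_indicator measurableSet_Iic, h4, setIntegral_const, measureReal_def,
      H.measure_Ioc, ENNReal.toReal_ofReal (sub_nonneg.2 (H.mono hs.1.le)), smul_eq_mul]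
    ring
  have hswap := integral_integral_swap hFi
  have hHi : IntervalIntegrable (fun t => H t * φ' t) volume a b :=
    (H.mono.intervalIntegrable).mul_continuousOn hφ'.continuousOn
  have hφi : Integrable φ (H.measure.restrict (Ioc a b)) := by
    obtain ⟨K', hK'⟩ := (isCompact_Icc (a := a) (b := b)).exists_bound_of_continuousOn
      hφc.continuousOn
    refine Integrable.of_bound hφc.aestronglyMeasurable K' ?_
    filter_upwards [ae_restrict_mem measurableSet_Ioc] with t ht
    exact hK' t (Ioc_subset_Icc_self ht)
  rw [setIntegral_congr_fun measurableSet_Ioc h1, setIntegral_congr_fun measurableSet_Ioc h2,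
    integral_sub (integrable_const _) hφi,
    ← intervalIntegral.integral_of_le (μ := volume) hab,
    intervalIntegral.integral_sub hHi ((hint a b).const_mul _), intervalIntegral.integral_const_mul,
    intervalIntegral.integral_eq_sub_of_hasDerivAt (fun s _ => hφ s) (hint a b),
    setIntegral_const, measureReal_def, H.measure_Ioc,
    ENNReal.toReal_ofReal (sub_nonneg.2 (H.mono hab)), smul_eq_mul] at hswap
  linarith

/-- A monotone function that is continuous on the right, as a Stieltjes function. -/
theorem stieltjesMeasure_eq {H : ℝ → ℝ} (hm : Monotone H)
    (hc : ∀ x, ContinuousWithinAt H (Ici x) x) :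
    ∃ S : StieltjesFunction ℝ, (∀ x, S x = H x) ∧ stieltjesMeasure H = S.measure := by
  let S : StieltjesFunction ℝ := { toFun := H, mono' := hm, right_continuous' := hc }
  have hS : hm.stieltjesFunction = S := StieltjesFunction.ext fun x =>
    (hm.stieltjesFunction_eq x).trans (S.rightLim_eq x)
  refine ⟨S, fun x => rfl, ?_⟩
  rw [← hS]
  exact dif_pos hm

/-- What is used of the second derivative of the boundary function. -/
structure IsBoundarySecondDeriv (g : ℝ → ℝ) : Prop where
  continuous : Continuous g
  locallyBounded : LocallyBoundedVariationOn g univ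

variable {g : ℝ → ℝ}

/-- Right continuity ensures that the Stieltjes function made from the variation has the values of
the variation itself and not of its right limits. -/
theorem IsBoundarySecondDeriv.continuousWithinAt_variationFun (h : IsBoundarySecondDeriv g) (x : ℝ) :
    ContinuousWithinAt (variationFun g) (Ici x) x := by
  have h1 := variationOnFromTo.tendsto_right (mem_univ 0) (mem_univ x) h.locallyBounded
    (l := g x) ((h.continuous.tendsto x).mono_left nhdsWithin_le_nhds)
  rw [dist_self, add_zero, univ_inter] at h1
  exact (continuousWithinAt_Ioi_iff_Ici (f := variationFun g)).1 h1

theorem IsBoundarySecondDeriv.stieltjes (h : IsBoundarySecondDeriv g) :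
    ∃ S T : StieltjesFunction ℝ, (∀ x, S x = variationFun g x) ∧
      (∀ x, T x = variationFun g x - g x) ∧ stieltjesMeasure (variationFun g) = S.measure ∧
      stieltjesMeasure (fun x => variationFun g x - g x) = T.measure := by
  obtain ⟨S, hS, hS'⟩ := stieltjesMeasure_eq (monotone_variationFun h.locallyBounded)
    h.continuousWithinAt_variationFun
  obtain ⟨T, hT, hT'⟩ := stieltjesMeasure_eq (monotone_variationFun_sub h.locallyBounded)
    fun x => (h.continuousWithinAt_variationFun x).sub h.continuous.continuousWithinAt
  exact ⟨S, T, hS, hT, hS', hT'⟩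

theorem IsBoundarySecondDeriv.integralAgainst_Ioc (h : IsBoundarySecondDeriv g) {φ φ' : ℝ → ℝ}
    (hφ : ∀ t, HasDerivAt φ (φ' t) t) (hφ' : Continuous φ') {a b : ℝ} (hab : a ≤ b) :
    integralAgainst g (Ioc a b) φ = g b * φ b - g a * φ a - ∫ t in a..b, g t * φ' t := by
  obtain ⟨S, T, hS, hT, hS', hT'⟩ := h.stieltjes
  unfold integralAgainst
  rw [hS', hT', StieltjesFunction_integral_mul_eq S hφ hφ' hab,
    StieltjesFunction_integral_mul_eq T hφ hφ' hab]
  have h1 : IntervalIntegrable (fun t => S t * φ' t) volume a b :=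
    (S.mono.intervalIntegrable).mul_continuousOn hφ'.continuousOn
  have h2 : IntervalIntegrable (fun t => T t * φ' t) volume a b :=
    (T.mono.intervalIntegrable).mul_continuousOn hφ'.continuousOn
  have h3 : ∫ t in a..b, g t * φ' t =
      (∫ t in a..b, S t * φ' t) - ∫ t in a..b, T t * φ' t := by
    rw [← intervalIntegral.integral_sub h1 h2]
    refine intervalIntegral.integral_congr fun t _ => ?_
    simp only [hS, hT]; ring
  rw [h3, hS, hS, hT, hT]
  ring

-- Exponential growth of the second derivative and of its variation

theorem IsBoundarySecondDeriv.variationFun_growth (h : IsBoundarySecondDeriv g) {κ₀ : ℝ}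
    (hκ₀ : 0 < κ₀)
    (hs : Integrable (fun t => Real.exp (-κ₀ * |t|)) (totalVariationMeasure g)) :
    ExpBounded (variationFun g) κ₀ := by
  obtain ⟨S, T, hS, hT, hS', hT'⟩ := h.stieltjes
  unfold totalVariationMeasure at hs
  rw [hS'] at hs
  -- On an interval inside `[-M, M]` the weight is at least `exp (-κ₀ M)`, so the mass of the
  -- interval is at most the total weighted mass times `exp (κ₀ M)`.
  have key : ∀ {a b M : ℝ}, a ≤ b → (∀ t ∈ Ioc a b, |t| ≤ M) →
      S b - S a ≤ (∫ t, Real.exp (-κ₀ * |t|) ∂S.measure) * Real.exp (κ₀ * M) := by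
    intro a b M hab hM
    have hfin : S.measure (Ioc a b) ≠ ⊤ := by rw [S.measure_Ioc]; exact ENNReal.ofReal_ne_top
    have h1 : (S b - S a) * Real.exp (-κ₀ * M) ≤ ∫ t, Real.exp (-κ₀ * |t|) ∂S.measure := by
      calc (S b - S a) * Real.exp (-κ₀ * M) = ∫ t in Ioc a b, Real.exp (-κ₀ * M) ∂S.measure := by
            rw [setIntegral_const, measureReal_def, S.measure_Ioc,
              ENNReal.toReal_ofReal (sub_nonneg.2 (S.mono hab)), smul_eq_mul]
        _ ≤ ∫ t in Ioc a b, Real.exp (-κ₀ * |t|) ∂S.measure := by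
            refine setIntegral_mono_on (integrableOn_const hfin)
              hs.integrableOn measurableSet_Ioc fun t ht => ?_
            have := mul_le_mul_of_nonneg_left (hM t ht) hκ₀.le
            exact Real.exp_le_exp.2 (by linarith)
        _ ≤ _ := setIntegral_le_integral hs (Eventually.of_forall fun t => (Real.exp_pos _).le)
    have h2 : Real.exp (-κ₀ * M) * Real.exp (κ₀ * M) = 1 := by rw [← Real.exp_add]; simp
    have h3 := mul_le_mul_of_nonneg_right h1 (Real.exp_pos (κ₀ * M)).le
    rwa [mul_assoc, h2, mul_one] at h3
  refine ⟨∫ t, Real.exp (-κ₀ * |t|) ∂S.measure, fun t => ?_⟩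
  have h0 : S 0 = 0 := by rw [hS]; exact variationOnFromTo.self _ _ _
  rw [← hS]
  rcases le_total 0 t with ht | ht
  · have h1 := key ht (M := |t|) fun s hs => by
      rw [abs_of_pos hs.1, abs_of_nonneg ht]; exact hs.2
    have h2 := S.mono ht
    rw [abs_of_nonneg (by linarith)]
    linarith
  · have h1 := key ht (M := |t|) fun s hs => by
      rw [abs_of_nonpos hs.2, abs_of_nonpos ht]; linarith [hs.1]
    have h2 := S.mono ht
    rw [abs_of_nonpos (by linarith)]
    linarith

theorem ExpBounded.sub {g h : ℝ → ℝ} {κ₀ : ℝ} (hg : ExpBounded g κ₀) (hh : ExpBounded h κ₀) :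
    ExpBounded (fun t => g t - h t) κ₀ := by
  obtain ⟨C, hC⟩ := hg
  obtain ⟨D, hD⟩ := hh
  refine ⟨C + D, fun t => (abs_sub _ _).trans ?_⟩
  rw [add_mul]
  exact add_le_add (hC t) (hD t)

theorem ExpBounded.of_sub_le {g h : ℝ → ℝ} {κ₀ : ℝ} (hκ₀ : 0 ≤ κ₀) (hh : ExpBounded h κ₀)
    (hgh : ∀ t, |g t - g 0| ≤ |h t|) : ExpBounded g κ₀ := by
  obtain ⟨D, hD⟩ := hh
  refine ⟨|g 0| + D, fun t => ?_⟩
  have h1 : |g t| ≤ |g t - g 0| + |g 0| := by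
    simpa using abs_add_le (g t - g 0) (g 0)
  have h2 : 1 ≤ Real.exp (κ₀ * |t|) := Real.one_le_exp (by positivity)
  have h3 := mul_le_mul_of_nonneg_left h2 (abs_nonneg (g 0))
  linarith [hD t, hgh t]

theorem IsBoundarySecondDeriv.expBounded (h : IsBoundarySecondDeriv g) {κ₀ : ℝ}
    (hκ₀ : 0 < κ₀)
    (hs : Integrable (fun t => Real.exp (-κ₀ * |t|)) (totalVariationMeasure g)) :
    ExpBounded g κ₀ := by
  refine ExpBounded.of_sub_le hκ₀.le (h.variationFun_growth hκ₀ hs) fun t => ?_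
  have h0 : variationFun g 0 = 0 := variationOnFromTo.self _ _ _
  rcases le_total 0 t with ht | ht
  · have h1 : |g t - g 0| ≤ variationFun g t - variationFun g 0 :=
      variationOnFromTo.abs_sub_le_sub_of_le h.locallyBounded (mem_univ 0) (mem_univ 0)
        (mem_univ t) ht
    rw [h0, sub_zero] at h1
    exact h1.trans (le_abs_self _)
  · have h1 : |g 0 - g t| ≤ variationFun g 0 - variationFun g t :=
      variationOnFromTo.abs_sub_le_sub_of_le h.locallyBounded (mem_univ 0) (mem_univ t)
        (mem_univ 0) ht
    rw [h0, zero_sub] at h1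
    rw [abs_sub_comm]
    exact h1.trans (neg_le_abs _)

/-- The antiderivative of a function of exponential growth. -/
theorem ExpBounded.of_hasDerivAt {g h : ℝ → ℝ} {κ₀ : ℝ} (hκ₀ : 0 < κ₀) (hg : ExpBounded g κ₀)
    (hh : ∀ t, HasDerivAt h (g t) t) : ExpBounded h κ₀ := by
  obtain ⟨C, hC⟩ := hg
  have hC0 : 0 ≤ C := by simpa using (abs_nonneg _).trans (hC 0)
  have key : ∀ {h g : ℝ → ℝ}, (∀ t, |g t| ≤ C * Real.exp (κ₀ * |t|)) →
      (∀ t, HasDerivAt h (g t) t) → ∀ t ≥ 0, |h t - h 0| ≤ C / κ₀ * Real.exp (κ₀ * |t|) := by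
    intro h g hC hh t ht
    have := image_norm_le_of_norm_deriv_right_le_deriv_boundary (f := fun t => h t - h 0)
      (f' := g) (a := 0) (b := t) (B := fun t => C / κ₀ * Real.exp (κ₀ * t))
      (B' := fun t => C * Real.exp (κ₀ * t))
      (fun s _ => ((hh s).sub_const _).continuousAt.continuousWithinAt)
      (fun s _ => ((hh s).sub_const _).hasDerivWithinAt) (by simp; positivity)
      (fun s => by
        have h1 : HasDerivAt (fun u => Real.exp (κ₀ * u)) (Real.exp (κ₀ * s) * (κ₀ * 1)) s :=
          ((hasDerivAt_id s).const_mul κ₀).exp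
        refine (h1.const_mul (C / κ₀)).congr_deriv ?_
        field_simp)
      (fun s hs => by
        have := hC s
        rwa [abs_of_nonneg hs.1] at this) (right_mem_Icc.2 ht)
    rwa [abs_of_nonneg ht]
  refine ExpBounded.of_sub_le (h := fun t => C / κ₀ * Real.exp (κ₀ * |t|)) hκ₀.le
    ⟨C / κ₀, fun t => (abs_of_nonneg (by positivity)).le⟩ fun t => ?_
  rw [abs_of_nonneg (by positivity : 0 ≤ C / κ₀ * Real.exp (κ₀ * |t|))]
  rcases le_total 0 t with ht | ht
  · exact key hC hh t ht
  · have := key (h := fun t => h (-t)) (g := fun t => -g (-t)) (fun t => by simpa using hC (-t))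
      (fun t => by
        refine ((hh (-t)).comp t (hasDerivAt_neg t)).congr_deriv ?_
        ring) (-t) (by linarith)
    simpa using this

-- Improper integrals against the third derivative

variable {g : ℝ → ℝ}

theorem IsBoundarySecondDeriv.continuous_variationFun (h : IsBoundarySecondDeriv g) :
    Continuous (variationFun g) := by
  refine continuous_iff_continuousAt.2 fun x => ?_
  refine continuousAt_iff_continuous_left_right.2 ⟨?_, h.continuousWithinAt_variationFun x⟩
  have h1 := variationOnFromTo.tendsto_left (mem_univ 0) (mem_univ x) h.locallyBounded
    (l := g x) ((h.continuous.tendsto x).mono_left nhdsWithin_le_nhds)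
  rw [dist_self, sub_zero, univ_inter] at h1
  exact (continuousWithinAt_Iio_iff_Iic (f := variationFun g)).1 h1

theorem ExpBounded.tendsto_mul_exp {h : ℝ → ℝ} {κ₀ κ : ℝ} (hb : ExpBounded h κ₀) (hκ : κ₀ < κ) :
    Tendsto (fun t => h t * Real.exp (κ * t)) atBot (𝓝 0) := by
  obtain ⟨C, -, hC⟩ := hb.norm_mul_exp_le
  have hlim : Tendsto (fun t => C * Real.exp ((κ - κ₀) * t)) atBot (𝓝 0) := by
    rw [← mul_zero C]
    exact (Real.tendsto_exp_atBot.comp (tendsto_id.const_mul_atBot (sub_pos.2 hκ))).const_mul _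
  exact squeeze_zero_norm' ((eventually_le_atBot 0).mono fun t ht => hC t ht κ κ le_rfl) hlim

theorem ExpBounded.tendsto_mul_exp_neg {h : ℝ → ℝ} {κ₀ κ : ℝ} (hb : ExpBounded h κ₀)
    (hκ : κ₀ < κ) : Tendsto (fun t => h t * Real.exp (-κ * t)) atTop (𝓝 0) := by
  have := (hb.neg.tendsto_mul_exp hκ).comp tendsto_neg_atTop_atBot
  simpa [Function.comp_def] using this

theorem ExpBounded.integrableOn_Ioi {κ₀ κ : ℝ} (h : ExpBounded g κ₀)
    (hg : Continuous g) (hκ : κ₀ < κ) (u : ℝ) :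
    IntegrableOn (fun t => g t * Real.exp (-κ * t)) (Ioi u) := by
  have h1 := h.neg.integrableOn_Iic (hg.comp continuous_neg) hκ (-u)
  rw [← integrableOn_Ici_iff_integrableOn_Ioi, ← integrable_indicator_iff measurableSet_Ici]
  rw [← integrable_indicator_iff measurableSet_Iic] at h1
  refine h1.comp_neg.congr (Eventually.of_forall fun t => ?_)
  simp [indicator]

theorem hasDerivAt_exp_mul (κ t : ℝ) :
    HasDerivAt (fun t => Real.exp (κ * t)) (κ * Real.exp (κ * t)) t :=
  ((hasDerivAt_id t).const_mul κ).exp.congr_deriv (by simp [mul_comm])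

/-- Integrability near minus infinity is itself derived from integration by parts: the right-hand
side converges because the growth exponent is smaller than `κ`, and the integrand is positive. -/
theorem StieltjesFunction_tendsto_integral_Iic {S : StieltjesFunction ℝ} (hS : Continuous S)
    {κ₀ κ : ℝ} (hb : ExpBounded S κ₀) (hκ : κ₀ < κ) (u : ℝ) :
    Tendsto (fun a => ∫ t in Ioc a u, Real.exp (κ * t) ∂S.measure) atBot
      (𝓝 (∫ t in Iic u, Real.exp (κ * t) ∂S.measure)) := by
  have hc : Continuous fun t => Real.exp (κ * t) := by fun_prop
  have hloc : ∀ a, IntegrableOn (fun t => Real.exp (κ * t)) (Ioc a u) S.measure := fun a =>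
    (hc.continuousOn.integrableOn_Icc).mono_set Ioc_subset_Icc_self
  have hi : IntegrableOn (fun t => S t * (κ * Real.exp (κ * t))) (Iic u) := by
    simp_rw [mul_left_comm _ κ]
    exact (hb.integrableOn_Iic hS hκ u).const_mul κ
  have hint : IntegrableOn (fun t => Real.exp (κ * t)) (Iic u) S.measure := by
    refine integrableOn_Iic_of_intervalIntegral_norm_tendsto
      (S u * Real.exp (κ * u) - 0 - ∫ t in Iic u, S t * (κ * Real.exp (κ * t))) u hloc
      tendsto_id ?_
    have h1 : Tendsto (fun a => S u * Real.exp (κ * u) - S a * Real.exp (κ * a) -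
        ∫ t in a..u, S t * (κ * Real.exp (κ * t))) atBot
        (𝓝 (S u * Real.exp (κ * u) - 0 - ∫ t in Iic u, S t * (κ * Real.exp (κ * t)))) :=
      (tendsto_const_nhds.sub (hb.tendsto_mul_exp hκ)).sub
        (intervalIntegral_tendsto_integral_Iic u hi tendsto_id)
    refine h1.congr' ?_
    filter_upwards [eventually_le_atBot u] with a ha
    rw [← StieltjesFunction_integral_mul_eq S (hasDerivAt_exp_mul κ) (by fun_prop) ha,
      intervalIntegral.integral_of_le ha]
    simp [Real.norm_eq_abs]
  refine (intervalIntegral_tendsto_integral_Iic u hint tendsto_id).congr' ?_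
  filter_upwards [eventually_le_atBot u] with a ha
  rw [id, intervalIntegral.integral_of_le ha]

theorem StieltjesFunction_tendsto_integral_Ioi {S : StieltjesFunction ℝ} (hS : Continuous S)
    {κ₀ κ : ℝ} (hb : ExpBounded S κ₀) (hκ : κ₀ < κ) (u : ℝ) :
    Tendsto (fun b => ∫ t in Ioc u b, Real.exp (-κ * t) ∂S.measure) atTop
      (𝓝 (∫ t in Ioi u, Real.exp (-κ * t) ∂S.measure)) := by
  have hc : Continuous fun t => Real.exp (-κ * t) := by fun_prop
  have hloc : ∀ b, IntegrableOn (fun t => Real.exp (-κ * t)) (Ioc u b) S.measure := fun b =>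
    (hc.continuousOn.integrableOn_Icc).mono_set Ioc_subset_Icc_self
  have hi : IntegrableOn (fun t => S t * (-κ * Real.exp (-κ * t))) (Ioi u) := by
    simp_rw [mul_left_comm _ (-κ)]
    exact (hb.integrableOn_Ioi hS hκ u).const_mul (-κ)
  have hint : IntegrableOn (fun t => Real.exp (-κ * t)) (Ioi u) S.measure := by
    refine integrableOn_Ioi_of_intervalIntegral_norm_tendsto
      (0 - S u * Real.exp (-κ * u) - ∫ t in Ioi u, S t * (-κ * Real.exp (-κ * t))) u hloc
      tendsto_id ?_
    have h1 : Tendsto (fun b => S b * Real.exp (-κ * b) - S u * Real.exp (-κ * u) -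
        ∫ t in u..b, S t * (-κ * Real.exp (-κ * t))) atTop
        (𝓝 (0 - S u * Real.exp (-κ * u) - ∫ t in Ioi u, S t * (-κ * Real.exp (-κ * t)))) :=
      ((hb.tendsto_mul_exp_neg hκ).sub_const _).sub
        (intervalIntegral_tendsto_integral_Ioi u hi tendsto_id)
    refine h1.congr' ?_
    filter_upwards [eventually_ge_atTop u] with b hb
    rw [← StieltjesFunction_integral_mul_eq S (hasDerivAt_exp_mul (-κ)) (by fun_prop) hb,
      intervalIntegral.integral_of_le hb]
    simp [Real.norm_eq_abs]
  refine (intervalIntegral_tendsto_integral_Ioi u hint tendsto_id).congr' ?_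
  filter_upwards [eventually_ge_atTop u] with b hb
  rw [id, intervalIntegral.integral_of_le hb]

/-- The formula on `(a, u]` with `a → -∞`; the boundary term `g a * exp (κ a)` vanishes in the
limit. -/
theorem IsBoundarySecondDeriv.integralAgainst_Iic (h : IsBoundarySecondDeriv g) {κ₀ κ : ℝ}
    (hV : ExpBounded (variationFun g) κ₀) (hg : ExpBounded g κ₀) (hκ : κ₀ < κ) (u : ℝ) :
    integralAgainst g (Iic u) (fun t => Real.exp (κ * t)) =
      g u * Real.exp (κ * u) - κ * ∫ t in Iic u, g t * Real.exp (κ * t) := by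
  obtain ⟨S, T, hS, hT, hS', hT'⟩ := h.stieltjes
  have hSe : (S : ℝ → ℝ) = variationFun g := funext hS
  have hTe : (T : ℝ → ℝ) = fun x => variationFun g x - g x := funext hT
  have h1 : Tendsto (fun a => integralAgainst g (Ioc a u) (fun t => Real.exp (κ * t))) atBot
      (𝓝 (integralAgainst g (Iic u) (fun t => Real.exp (κ * t)))) := by
    unfold integralAgainst
    rw [hS', hT']
    refine (StieltjesFunction_tendsto_integral_Iic ?_ (κ₀ := κ₀) ?_ hκ u).sub
      (StieltjesFunction_tendsto_integral_Iic ?_ (κ₀ := κ₀) ?_ hκ u)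
    · rw [hSe]; exact h.continuous_variationFun
    · rw [hSe]; exact hV
    · rw [hTe]; exact h.continuous_variationFun.sub h.continuous
    · rw [hTe]; exact hV.sub hg
  have hi := hg.integrableOn_Iic h.continuous hκ u
  have h2 : Tendsto (fun a => g u * Real.exp (κ * u) - g a * Real.exp (κ * a) -
      κ * ∫ t in a..u, g t * Real.exp (κ * t)) atBot
      (𝓝 (g u * Real.exp (κ * u) - 0 - κ * ∫ t in Iic u, g t * Real.exp (κ * t))) :=
    (tendsto_const_nhds.sub (hg.tendsto_mul_exp hκ)).sub
      ((intervalIntegral_tendsto_integral_Iic u hi tendsto_id).const_mul κ)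
  rw [sub_zero] at h2
  refine tendsto_nhds_unique h1 (h2.congr' ?_)
  filter_upwards [eventually_le_atBot u] with a ha
  rw [h.integralAgainst_Ioc (hasDerivAt_exp_mul κ) (by fun_prop) ha,
    ← intervalIntegral.integral_const_mul]
  simp_rw [mul_left_comm κ]

theorem IsBoundarySecondDeriv.integralAgainst_Ioi (h : IsBoundarySecondDeriv g) {κ₀ κ : ℝ}
    (hV : ExpBounded (variationFun g) κ₀) (hg : ExpBounded g κ₀) (hκ : κ₀ < κ) (u : ℝ) :
    integralAgainst g (Ioi u) (fun t => Real.exp (-κ * t)) =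
      κ * (∫ t in Ioi u, g t * Real.exp (-κ * t)) - g u * Real.exp (-κ * u) := by
  obtain ⟨S, T, hS, hT, hS', hT'⟩ := h.stieltjes
  have hSe : (S : ℝ → ℝ) = variationFun g := funext hS
  have hTe : (T : ℝ → ℝ) = fun x => variationFun g x - g x := funext hT
  have h1 : Tendsto (fun b => integralAgainst g (Ioc u b) (fun t => Real.exp (-κ * t))) atTop
      (𝓝 (integralAgainst g (Ioi u) (fun t => Real.exp (-κ * t)))) := by
    unfold integralAgainst
    rw [hS', hT']
    refine (StieltjesFunction_tendsto_integral_Ioi ?_ (κ₀ := κ₀) ?_ hκ u).sub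
      (StieltjesFunction_tendsto_integral_Ioi ?_ (κ₀ := κ₀) ?_ hκ u)
    · rw [hSe]; exact h.continuous_variationFun
    · rw [hSe]; exact hV
    · rw [hTe]; exact h.continuous_variationFun.sub h.continuous
    · rw [hTe]; exact hV.sub hg
  have hi := hg.integrableOn_Ioi h.continuous hκ u
  have h2 : Tendsto (fun b => g b * Real.exp (-κ * b) - g u * Real.exp (-κ * u) +
      κ * ∫ t in u..b, g t * Real.exp (-κ * t)) atTop
      (𝓝 (0 - g u * Real.exp (-κ * u) + κ * ∫ t in Ioi u, g t * Real.exp (-κ * t))) :=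
    ((hg.tendsto_mul_exp_neg hκ).sub_const _).add
      ((intervalIntegral_tendsto_integral_Ioi u hi tendsto_id).const_mul κ)
  rw [zero_sub, neg_add_eq_sub] at h2
  refine tendsto_nhds_unique h1 (h2.congr' ?_)
  filter_upwards [eventually_ge_atTop u] with b hb
  rw [h.integralAgainst_Ioc (hasDerivAt_exp_mul (-κ)) (by fun_prop) hb]
  simp_rw [mul_left_comm _ (-κ)]
  rw [intervalIntegral.integral_const_mul]
  ring

/-! ### The boundary function -/

/-- The boundary function `f` together with the exponent that bounds the growth of its
derivatives. -/
structure IsBoundary (f : ℝ → ℝ) (κ₀ : ℝ) : Prop where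
  pos : 0 < κ₀
  hasDerivAt : ∀ t, HasDerivAt f (deriv f t) t
  hasDerivAt_deriv : ∀ t, HasDerivAt (deriv f) (deriv (deriv f) t) t
  secondDeriv : IsBoundarySecondDeriv (deriv (deriv f))
  variation_growth : ExpBounded (variationFun (deriv (deriv f))) κ₀
  growth : ExpBounded (deriv (deriv f)) κ₀
  monotone_left : ∀ b, ∃ x < b, MonotoneOn (deriv (deriv f)) (Icc x b) ∨
    AntitoneOn (deriv (deriv f)) (Icc x b)
  monotone_right : ∀ b, ∃ x > b, MonotoneOn (deriv (deriv f)) (Icc b x) ∨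
    AntitoneOn (deriv (deriv f)) (Icc b x)

/-- Induction on the number of break points inside the interval: cutting at one of them leaves
strictly fewer on each side, and without break points the function is monotone or antitone. -/
theorem locallyBoundedVariationOn_of_piecewise {g : ℝ → ℝ} {s : Finset ℝ}
    (hs : ∀ a b : ℝ, a ≤ b → (∀ x ∈ s, x ∉ Ioo a b) →
      MonotoneOn g (Icc a b) ∨ AntitoneOn g (Icc a b)) : LocallyBoundedVariationOn g univ := by
  classical
  have key : ∀ (n : ℕ) (a b : ℝ), a ≤ b → (s.filter (· ∈ Ioo a b)).card ≤ n →
      eVariationOn g (Icc a b) ≠ ⊤ := by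
    intro n
    induction n with
    | zero =>
      intro a b hab hn
      have hno : ∀ x ∈ s, x ∉ Ioo a b := fun x hx hx' => by
        have : x ∈ s.filter (· ∈ Ioo a b) := Finset.mem_filter.2 ⟨hx, hx'⟩
        rw [Finset.card_eq_zero.1 (Nat.le_zero.1 hn)] at this
        simp at this
      have hm : ∀ {h : ℝ → ℝ}, MonotoneOn h (Icc a b) → eVariationOn h (Icc a b) ≠ ⊤ := fun hh => by
        have := hh.eVariationOn_eq (left_mem_Icc.2 hab) (right_mem_Icc.2 hab)
        rw [inter_self] at this
        rw [this]
        exact ENNReal.ofReal_ne_top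
      rcases hs a b hab hno with h | h
      · exact hm h
      · have h1 := (LipschitzWith.id (α := ℝ)).neg.comp_boundedVariationOn (hm h.neg)
        have h2 : (-id) ∘ (-g) = g := by ext; simp
        rwa [← h2]
    | succ n ih =>
      intro a b hab hn
      by_cases hno : ∀ x ∈ s, x ∉ Ioo a b
      · refine ih a b hab ?_
        rw [Finset.filter_eq_empty_iff.2 (fun x hx => hno x hx)]
        simp
      · push Not at hno
        obtain ⟨x, hx, hxab⟩ := hno
        have hlt : ∀ a' b', Ioo a' b' ⊆ Ioo a b → x ∉ Ioo a' b' →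
            (s.filter (· ∈ Ioo a' b')).card ≤ n := by
          intro a' b' hsub hx'
          refine Nat.le_of_lt_succ (lt_of_lt_of_le (Finset.card_lt_card ?_) hn)
          refine ⟨Finset.monotone_filter_right s fun y _ hy => hsub hy, fun h => hx' ?_⟩
          exact (Finset.mem_filter.1 (h (Finset.mem_filter.2 ⟨hx, hxab⟩))).2
        have h1 := ih a x hxab.1.le (hlt a x (Ioo_subset_Ioo le_rfl hxab.2.le) (by simp))
        have h2 := ih x b hxab.2.le (hlt x b (Ioo_subset_Ioo hxab.1.le le_rfl) (by simp))
        have h3 := eVariationOn.Icc_add_Icc g (s := univ) hxab.1.le hxab.2.le (mem_univ x)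
        simp only [univ_inter] at h3
        rw [← h3]
        exact ENNReal.add_ne_top.2 ⟨h1, h2⟩
  intro a b _ _
  rw [univ_inter]
  rcases le_total a b with hab | hab
  · exact key _ a b hab le_rfl
  · rw [BoundedVariationOn, eVariationOn.subsingleton]
    · simp
    · exact subsingleton_Icc_of_ge hab

theorem RegularityCondition.isBoundary {f : ℝ → ℝ} {ε : ℝ} (hreg : RegularityCondition f)
    (hε : 0 < ε) (hsum : SummabilityCondition f ε) : IsBoundary f ε⁻¹ := by
  obtain ⟨hf, s, hs⟩ := hreg
  have hf1 : Differentiable ℝ f := hf.differentiable two_ne_zero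
  have hd : ContDiff ℝ 1 (deriv f) := hf.deriv'
  have hd1 : Differentiable ℝ (deriv f) := hd.differentiable one_ne_zero
  have hg : IsBoundarySecondDeriv (deriv (deriv f)) :=
    ⟨hd.continuous_deriv le_rfl, locallyBoundedVariationOn_of_piecewise hs⟩
  have hpos : 0 < ε⁻¹ := inv_pos.2 hε
  have hsum' : Integrable (fun t => Real.exp (-ε⁻¹ * |t|))
      (totalVariationMeasure (deriv (deriv f))) := by
    refine Integrable.congr hsum (Eventually.of_forall fun t => ?_)
    simp only
    congr 1
    field_simp
  have hgrow := hg.expBounded hpos hsum'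
  have hder : ∀ t, HasDerivAt (deriv f) (deriv (deriv f) t) t := fun t => (hd1 t).hasDerivAt
  refine ⟨hpos, fun t => (hf1 t).hasDerivAt, hder, hg, hg.variationFun_growth hpos hsum',
    hgrow, fun b => ?_, fun b => ?_⟩
  · have h1 : ∀ᶠ x in 𝓝[<] b, ∀ y ∈ s, y ∉ Ioo x b := by
      rw [Filter.eventually_all_finset]
      intro y _
      rcases lt_or_ge y b with h | h
      · filter_upwards [Ioo_mem_nhdsLT h] with x hx hy
        exact absurd hx.1 hy.1.le.not_gt
      · exact Eventually.of_forall fun x hx => absurd hx.2 h.not_gt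
    obtain ⟨x, hx, hxb⟩ := (h1.and self_mem_nhdsWithin).exists
    exact ⟨x, hxb, hs x b (le_of_lt hxb) hx⟩
  · have h1 : ∀ᶠ x in 𝓝[>] b, ∀ y ∈ s, y ∉ Ioo b x := by
      rw [Filter.eventually_all_finset]
      intro y _
      rcases lt_or_ge b y with h | h
      · filter_upwards [Ioo_mem_nhdsGT h] with x hx hy
        exact absurd hx.2 hy.2.le.not_gt
      · exact Eventually.of_forall fun x hx => absurd hx.1 h.not_gt
    obtain ⟨x, hx, hxb⟩ := (h1.and self_mem_nhdsWithin).exists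
    exact ⟨x, hxb, hs b x (le_of_lt hxb) hx⟩

/-! ### The forces -/

section forces

variable {f : ℝ → ℝ} {κ₀ ε : ℝ}

/-- Integration by parts replaces `df''` by `f''`; the boundary term at `b` combines with the
differential so that only the average slope of the chord remains as the initial value. Hence the
force is `g - N`, and its sign is the sign of `m''`. -/
theorem IsBoundary.forceR_eq (hf : IsBoundary f κ₀) {a b u : ℝ} (hbu : b ≤ u) :
    forceR f ε a b u =
      deriv (deriv f) u - rightSlope (deriv (deriv f)) ε⁻¹ b (dslope (deriv f) a b) u := by
  have h1 : ∀ t, t / ε = ε⁻¹ * t := fun t => div_eq_inv_mul t ε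
  have h2 := hf.secondDeriv.integralAgainst_Ioc (hasDerivAt_exp_mul ε⁻¹) (by fun_prop) hbu
  simp only [forceR, DR, rightSlope, slopeFrom, EReal.coe_ne_bot, if_false, EReal.toReal_coe, h1, h2]
  simp_rw [mul_left_comm _ ε⁻¹ (Real.exp _)]
  rw [intervalIntegral.integral_const_mul]
  have h3 : Real.exp (-(ε⁻¹ * u)) * Real.exp (ε⁻¹ * u) = 1 := by rw [← Real.exp_add]; simp
  have h4 : Real.exp (ε⁻¹ * (b - u)) = Real.exp (-(ε⁻¹ * u)) * Real.exp (ε⁻¹ * b) := by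
    rw [← Real.exp_add]; ring_nf
  rw [h4]
  simp only [neg_mul, mul_neg]
  linear_combination deriv (deriv f) u * h3

theorem IsBoundary.forceL_eq (hf : IsBoundary f κ₀) {a b u : ℝ} (hua : u ≤ a) :
    forceL f ε a b u =
      leftSlope (deriv (deriv f)) ε⁻¹ a (dslope (deriv f) a b) u - deriv (deriv f) u := by
  have h1 : ∀ t, t / ε = ε⁻¹ * t := fun t => div_eq_inv_mul t ε
  have h1' : ∀ t, -t / ε = -ε⁻¹ * t := fun t => by rw [h1]; ring
  have h2 := hf.secondDeriv.integralAgainst_Ioc (hasDerivAt_exp_mul (-ε⁻¹)) (by fun_prop) hua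
  have h5 : ∫ t in (-a)..(-u), deriv (deriv f) (-t) * Real.exp (ε⁻¹ * t) =
      ∫ t in u..a, deriv (deriv f) t * Real.exp (-ε⁻¹ * t) := by
    rw [← intervalIntegral.integral_comp_neg]
    simp
  simp only [forceL, DL, leftSlope, rightSlope, slopeFrom, ← EReal.coe_neg, EReal.coe_ne_bot,
    if_false, EReal.toReal_coe, h1', h2, h5]
  simp only [h1]
  simp_rw [mul_left_comm _ (-ε⁻¹) (Real.exp _)]
  rw [intervalIntegral.integral_const_mul]
  have h3 : Real.exp (ε⁻¹ * u) * Real.exp (-(ε⁻¹ * u)) = 1 := by rw [← Real.exp_add]; simp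
  have h4 : Real.exp (ε⁻¹ * (u - a)) = Real.exp (ε⁻¹ * u) * Real.exp (-(ε⁻¹ * a)) := by
    rw [← Real.exp_add]; ring_nf
  rw [h4]
  simp only [neg_mul, neg_neg, mul_neg]
  linear_combination -deriv (deriv f) u * h3

/-- The initial slope `σ` is arbitrary: a solution that starts at minus infinity ignores it. -/
theorem IsBoundary.forceRInfinity_eq (hf : IsBoundary f κ₀) (hε : κ₀ < ε⁻¹) (σ u : ℝ) :
    forceRInfinity f ε u =
      deriv (deriv f) u - rightSlope (deriv (deriv f)) ε⁻¹ ⊥ σ u := by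
  have h1 : ∀ t, t / ε = ε⁻¹ * t := fun t => div_eq_inv_mul t ε
  have h2 := hf.secondDeriv.integralAgainst_Iic hf.variation_growth hf.growth hε u
  simp only [forceRInfinity, rightSlope, slopeFromBot, if_true, h1, h2]
  have h3 : Real.exp (ε⁻¹ * -u) * Real.exp (ε⁻¹ * u) = 1 := by rw [← Real.exp_add]; simp
  simp only [neg_mul, mul_neg] at h3 ⊢
  linear_combination deriv (deriv f) u * h3

theorem integral_Iic_neg_comp (g : ℝ → ℝ) (κ u : ℝ) :
    ∫ t in Iic (-u), g (-t) * Real.exp (κ * t) = ∫ t in Ioi u, g t * Real.exp (-κ * t) := by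
  have := integral_comp_neg_Iic (-u) fun t => g t * Real.exp (-κ * t)
  simpa using this

theorem IsBoundary.forceLInfinity_eq (hf : IsBoundary f κ₀) (hε : κ₀ < ε⁻¹) (σ u : ℝ) :
    forceLInfinity f ε u =
      leftSlope (deriv (deriv f)) ε⁻¹ ⊤ σ u - deriv (deriv f) u := by
  have h1 : ∀ t, t / ε = ε⁻¹ * t := fun t => div_eq_inv_mul t ε
  have h1' : ∀ t, -t / ε = -ε⁻¹ * t := fun t => by rw [h1]; ring
  have h2 := hf.secondDeriv.integralAgainst_Ioi hf.variation_growth hf.growth hε u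
  simp only [forceLInfinity, leftSlope, rightSlope, slopeFromBot, EReal.neg_top, if_true, h1',
    h2, integral_Iic_neg_comp]
  simp only [h1]
  have h3 : Real.exp (ε⁻¹ * u) * Real.exp (-ε⁻¹ * u) = 1 := by rw [← Real.exp_add]; simp
  rw [neg_mul_neg]
  linear_combination -deriv (deriv f) u * h3

/-- The slope coefficient of the tangents that come from minus infinity. -/
theorem slopeFromBot_of_hasDerivAt {g h : ℝ → ℝ} {κ : ℝ} (hκ₀ : 0 < κ₀) (hg : Continuous g)
    (hgb : ExpBounded g κ₀) (hh : ∀ t, HasDerivAt h (g t) t) (hκ : κ₀ < κ) (u : ℝ) :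
    slopeFromBot h κ u = h u - κ⁻¹ * slopeFromBot g κ u := by
  have hhb := hgb.of_hasDerivAt hκ₀ hh
  have hhc : Continuous h := continuous_iff_continuousAt.2 fun t => (hh t).continuousAt
  have hκp : κ ≠ 0 := (hκ₀.trans hκ).ne'
  -- Both sides solve the same linear equation, so their difference times `exp (κ t)` is constant;
  -- growth bounds make this constant `0` at minus infinity.
  have hd : ∀ t, HasDerivAt (fun t => (slopeFromBot h κ t - (h t - κ⁻¹ * slopeFromBot g κ t)) *
      Real.exp (κ * t)) 0 t := by
    intro t
    refine (((hasDerivAt_slopeFromBot hhb hhc hκ t).sub ((hh t).sub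
      ((hasDerivAt_slopeFromBot hgb hg hκ t).const_mul κ⁻¹))).mul
        (hasDerivAt_exp_mul κ t)).congr_deriv ?_
    simp only [Pi.sub_apply]
    field_simp
    ring
  have hlim : Tendsto (fun t => (slopeFromBot h κ t - (h t - κ⁻¹ * slopeFromBot g κ t)) *
      Real.exp (κ * t)) atBot (𝓝 0) := by
    have := (tendsto_slopeFromBot_mul_exp hhb hκ hκ).sub ((hhb.tendsto_mul_exp hκ).sub
      ((tendsto_slopeFromBot_mul_exp hgb hκ hκ).const_mul κ⁻¹))
    simp only [mul_zero, sub_zero] at this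
    refine this.congr fun t => ?_
    ring
  have hz : (slopeFromBot h κ u - (h u - κ⁻¹ * slopeFromBot g κ u)) * Real.exp (κ * u) = 0 := by
    refine tendsto_nhds_unique ?_ hlim
    refine tendsto_const_nhds.congr fun t => ?_
    exact is_const_of_deriv_eq_zero (fun t => (hd t).differentiableAt) (fun t => (hd t).deriv) u t
  have := (mul_eq_zero.1 hz).resolve_right (Real.exp_pos _).ne'
  linarith

end forces

/-! ### Slope coefficients of tangent domains -/

/-- Right tangents from `p` to `q` between figures with the slopes `σ` and `σ'`. -/
def RightEdge (g : ℝ → ℝ) (κ : ℝ) (p : EReal) (σ : ℝ) (q : EReal) (σ' : ℝ) : Prop :=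
  (∀ u : ℝ, p < u → (u : EReal) < q → g u < rightSlope g κ p σ u) ∧
    ∀ t : ℝ, q = t → rightSlope g κ p σ t = σ'

/-- Left tangents from `q` to `p` between figures with the slopes `σ` and `σ'`. -/
def LeftEdge (g : ℝ → ℝ) (κ : ℝ) (p : EReal) (σ : ℝ) (q : EReal) (σ' : ℝ) : Prop :=
  (∀ u : ℝ, p < u → (u : EReal) < q → g u < leftSlope g κ q σ' u) ∧
    ∀ t : ℝ, p = t → leftSlope g κ q σ' t = σ

section slopes

variable {f : ℝ → ℝ} {κ₀ ε : ℝ}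

theorem eq_rightSlope {g N : ℝ → ℝ} (hg : Continuous g) {κ p σ : ℝ}
    (hN : ∀ u, HasDerivAt N (κ * (g u - N u)) u) (hp : N p = σ) (u : ℝ) :
    N u = rightSlope g κ p σ u := by
  simp only [rightSlope, EReal.coe_ne_bot, if_false, EReal.toReal_coe, ← hp]
  exact eq_slopeFrom hg hN u

theorem eq_leftSlope {g N : ℝ → ℝ} (hg : Continuous g) {κ q σ : ℝ}
    (hN : ∀ u, HasDerivAt N (κ * (N u - g u)) u) (hq : N q = σ) (u : ℝ) :
    N u = leftSlope g κ q σ u := by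
  have := eq_rightSlope (g := fun t => g (-t)) (N := fun t => N (-t)) (hg.comp continuous_neg)
    (κ := κ) (p := -q) (σ := σ) (fun u => ?_) (by simpa using hq) (-u)
  · simpa [leftSlope] using this
  · refine ((hN (-u)).comp u (hasDerivAt_neg u)).congr_deriv ?_
    ring

theorem integral_Iic_eq_slopeFromBot (h : ℝ → ℝ) (ε u : ℝ) :
    ε⁻¹ * Real.exp (-u / ε) * ∫ t in Iic u, h t * Real.exp (t / ε) = slopeFromBot h ε⁻¹ u := by
  have h1 : ∀ t, t / ε = ε⁻¹ * t := fun t => div_eq_inv_mul t ε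
  simp only [slopeFromBot, h1, mul_neg, neg_mul]
  ring

theorem integral_Ioi_eq_slopeFromBot (h : ℝ → ℝ) (ε u : ℝ) :
    ε⁻¹ * Real.exp (u / ε) * ∫ t in Ioi u, h t * Real.exp (-t / ε) =
      slopeFromBot (fun t => h (-t)) ε⁻¹ (-u) := by
  have h1 : ∀ t, t / ε = ε⁻¹ * t := fun t => div_eq_inv_mul t ε
  have h1' : ∀ t, -t / ε = -ε⁻¹ * t := fun t => by rw [h1]; ring
  simp only [slopeFromBot, integral_Iic_neg_comp, h1', neg_mul_neg]
  simp only [h1]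
  ring

theorem IsBoundary.continuous_secondDeriv (hf : IsBoundary f κ₀) :
    Continuous (deriv (deriv f)) := hf.secondDeriv.continuous

/-- With `N = (f' - m)/ε = m'` the equation for `m` becomes `N' = (g - N)/ε`. Therefore `m'' < 0`
says `g < N`, and the value `f' - 2εβ` of `m` says that `N = 2β`. -/
theorem IsRightSlope.rightEdge (hf : IsBoundary f κ₀) (hε : 0 < ε) (hκ : κ₀ < ε⁻¹)
    {v w : FreeVertex} {β₁ β₂ : ℝ} {m : ℝ → ℝ} (h : IsRightSlope f ε v w β₁ β₂ m)
    (hv : v.rightEnd = ⊥ ↔ ∃ s, v.kind = .negInfinity s) (hv' : v.rightEnd ≠ ⊤)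
    (hw : w.leftEnd ≠ ⊤ → ∀ s, w.kind ≠ .posInfinity s) :
    RightEdge (deriv (deriv f)) ε⁻¹ v.rightEnd (2 * β₁) w.leftEnd (2 * β₂) := by
  obtain ⟨h1, h2, h3, h4⟩ := h
  have hg := hf.continuous_secondDeriv
  set g := deriv (deriv f)
  set N : ℝ → ℝ := fun u => (deriv f u - m u) / ε with hN
  have hNd : ∀ u, HasDerivAt N (ε⁻¹ * (g u - N u)) u := fun u =>
    (((hf.hasDerivAt_deriv u).sub (h1 u)).div_const ε).congr_deriv (div_eq_inv_mul _ _)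
  have hm2 : ∀ u, iteratedDeriv 2 m u = ε⁻¹ * (g u - N u) := by
    intro u
    have : deriv m = N := funext fun u => (h1 u).deriv
    rw [iteratedDeriv_succ, iteratedDeriv_one, this, (hNd u).deriv]
  have hNR : ∀ u, N u = rightSlope g ε⁻¹ v.rightEnd (2 * β₁) u := by
    intro u
    by_cases hb : v.rightEnd = ⊥
    · obtain ⟨s, hs⟩ := hv.1 hb
      rw [hs] at h3
      simp only at h3
      rw [hb]
      simp only [rightSlope, if_true, hN]
      rw [h3, integral_Iic_eq_slopeFromBot,
        slopeFromBot_of_hasDerivAt hf.pos hg hf.growth hf.hasDerivAt_deriv hκ]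
      field_simp
      ring
    · have h5 : m v.rightEnd.toReal = deriv f v.rightEnd.toReal - 2 * ε * β₁ := by
        revert h3
        rcases hk : v.kind <;> intro h3 <;> simp only at h3 <;> try exact h3
        exact absurd (hv.2 ⟨_, hk⟩) hb
      rw [← EReal.coe_toReal hv' hb]
      refine eq_rightSlope hg hNd ?_ u
      simp only [hN, h5]
      field_simp
      ring
  refine ⟨fun u hu1 hu2 => ?_, fun t ht => ?_⟩
  · have := h2 u hu1 hu2
    rw [hm2] at this
    have h5 := neg_of_mul_neg_right this (inv_pos.2 hε).le
    rw [← hNR]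
    linarith
  · have hw' := hw (by rw [ht]; exact EReal.coe_ne_top t)
    have h5 : m w.leftEnd.toReal = deriv f w.leftEnd.toReal - 2 * ε * β₂ := by
      revert h4
      rcases hk : w.kind <;> intro h4 <;> simp only at h4 <;> try exact h4
      exact absurd hk (hw' _)
    rw [ht, EReal.toReal_coe] at h5
    rw [← hNR]
    simp only [hN, h5]
    field_simp
    ring

theorem IsLeftSlope.leftEdge (hf : IsBoundary f κ₀) (hε : 0 < ε) (hκ : κ₀ < ε⁻¹)
    {v w : FreeVertex} {β₁ β₂ : ℝ} {m : ℝ → ℝ} (h : IsLeftSlope f ε v w β₁ β₂ m)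
    (hw : w.leftEnd = ⊤ ↔ ∃ s, w.kind = .posInfinity s) (hw' : w.leftEnd ≠ ⊥)
    (hv : v.rightEnd ≠ ⊥ → ∀ s, v.kind ≠ .negInfinity s) :
    LeftEdge (deriv (deriv f)) ε⁻¹ v.rightEnd (2 * β₁) w.leftEnd (2 * β₂) := by
  obtain ⟨h1, h2, h3, h4⟩ := h
  have hg := hf.continuous_secondDeriv
  set g := deriv (deriv f)
  set N : ℝ → ℝ := fun u => (m u - deriv f u) / ε with hN
  have hNd : ∀ u, HasDerivAt N (ε⁻¹ * (N u - g u)) u := fun u =>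
    (((h1 u).sub (hf.hasDerivAt_deriv u)).div_const ε).congr_deriv (div_eq_inv_mul _ _)
  have hm2 : ∀ u, iteratedDeriv 2 m u = ε⁻¹ * (N u - g u) := by
    intro u
    have : deriv m = N := funext fun u => (h1 u).deriv
    rw [iteratedDeriv_succ, iteratedDeriv_one, this, (hNd u).deriv]
  have hNR : ∀ u, N u = leftSlope g ε⁻¹ w.leftEnd (2 * β₂) u := by
    intro u
    by_cases hb : w.leftEnd = ⊤
    · obtain ⟨s, hs⟩ := hw.1 hb
      rw [hs] at h3
      simp only at h3
      rw [hb]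
      simp only [leftSlope, EReal.neg_top, rightSlope, if_true, hN]
      rw [h3, integral_Ioi_eq_slopeFromBot,
        slopeFromBot_of_hasDerivAt (h := fun t => deriv f (-t)) (g := fun t => -g (-t)) hf.pos
          (by fun_prop) (by obtain ⟨C, hC⟩ := hf.growth.neg; exact ⟨C, fun t => by simpa using hC t⟩)
          (fun t => by
            refine ((hf.hasDerivAt_deriv (-t)).comp t (hasDerivAt_neg t)).congr_deriv ?_
            ring) hκ]
      have h6 : slopeFromBot (fun t => -g (-t)) ε⁻¹ (-u) =
          -slopeFromBot (fun t => g (-t)) ε⁻¹ (-u) := by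
        simp only [slopeFromBot, neg_mul, integral_neg, mul_neg]
      rw [h6]
      simp only [neg_neg]
      field_simp
      ring
    · have h5 : m w.leftEnd.toReal = deriv f w.leftEnd.toReal + 2 * ε * β₂ := by
        revert h3
        rcases hk : w.kind <;> intro h3 <;> simp only at h3 <;> try exact h3
        exact absurd (hw.2 ⟨_, hk⟩) hb
      rw [← EReal.coe_toReal hb hw']
      refine eq_leftSlope hg hNd ?_ u
      simp only [hN, h5]
      field_simp
      ring
  refine ⟨fun u hu1 hu2 => ?_, fun t ht => ?_⟩
  · have := h2 u hu1 hu2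
    rw [hm2] at this
    have h5 := (mul_pos_iff_of_pos_left (inv_pos.2 hε)).1 this
    rw [← hNR]
    linarith
  · have hv' := hv (by rw [ht]; exact EReal.coe_ne_bot t)
    have h5 : m v.rightEnd.toReal = deriv f v.rightEnd.toReal + 2 * ε * β₁ := by
      revert h4
      rcases hk : v.kind <;> intro h4 <;> simp only at h4 <;> try exact h4
      exact absurd hk (hv' _)
    rw [ht, EReal.toReal_coe] at h5
    rw [← hNR]
    simp only [hN, h5]
    field_simp
    ring

/-- The converse passage recovers the slope coefficient as `m = f' - ε N`. -/
theorem RightEdge.isRightSlope (hf : IsBoundary f κ₀) (hε : 0 < ε) (hκ : κ₀ < ε⁻¹)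
    {v w : FreeVertex} {β₁ β₂ : ℝ}
    (h : RightEdge (deriv (deriv f)) ε⁻¹ v.rightEnd (2 * β₁) w.leftEnd (2 * β₂))
    (hv : v.rightEnd = ⊥ ↔ ∃ s, v.kind = .negInfinity s) (hv' : v.rightEnd ≠ ⊤)
    (hw : w.leftEnd = ⊤ → ∃ s, w.kind = .posInfinity s) (hw' : w.leftEnd ≠ ⊥) :
    IsRightSlope f ε v w β₁ β₂ (fun u =>
      deriv f u - ε * rightSlope (deriv (deriv f)) ε⁻¹ v.rightEnd (2 * β₁) u) := by
  have hg := hf.continuous_secondDeriv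
  obtain ⟨h1, h2⟩ := h
  set g := deriv (deriv f)
  set N : ℝ → ℝ := rightSlope g ε⁻¹ v.rightEnd (2 * β₁) with hN
  have hNd : ∀ u, HasDerivAt N (ε⁻¹ * (g u - N u)) u :=
    hasDerivAt_rightSlope hf.growth hg hκ _ _
  have hm : ∀ u, HasDerivAt (fun u => deriv f u - ε * N u) (N u) u := fun u => by
    refine ((hf.hasDerivAt_deriv u).sub ((hNd u).const_mul ε)).congr_deriv ?_
    field_simp
    ring
  refine ⟨fun u => (hm u).congr_deriv ?_, fun u hu1 hu2 => ?_, ?_, ?_⟩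
  · field_simp
    ring
  · have : deriv (fun u => deriv f u - ε * N u) = N := funext fun u => (hm u).deriv
    rw [iteratedDeriv_succ, iteratedDeriv_one, this, (hNd u).deriv]
    exact mul_neg_of_pos_of_neg (inv_pos.2 hε) (sub_neg.2 (h1 u hu1 hu2))
  · have hfin : v.rightEnd ≠ ⊥ → deriv f v.rightEnd.toReal - ε * N v.rightEnd.toReal =
        deriv f v.rightEnd.toReal - 2 * ε * β₁ := by
      intro hb
      have h3 := rightSlope_self g ε⁻¹ (2 * β₁) v.rightEnd.toReal
      rw [EReal.coe_toReal hv' hb] at h3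
      rw [hN, h3]
      ring
    rcases hk : v.kind <;> simp only <;> try exact hfin fun hb => by simpa [hk] using hv.1 hb
    intro u
    have hb := hv.2 ⟨_, hk⟩
    rw [integral_Iic_eq_slopeFromBot,
      slopeFromBot_of_hasDerivAt hf.pos hg hf.growth hf.hasDerivAt_deriv hκ, inv_inv]
    simp only [hN, hb, rightSlope, if_true, g]
  · have hfin : w.leftEnd ≠ ⊤ → deriv f w.leftEnd.toReal - ε * N w.leftEnd.toReal =
        deriv f w.leftEnd.toReal - 2 * ε * β₂ := by
      intro ht
      rw [h2 w.leftEnd.toReal (EReal.coe_toReal ht hw').symm]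
      ring
    rcases hk : w.kind <;> simp only <;> exact hfin fun hb => by simpa [hk] using hw hb

theorem LeftEdge.isLeftSlope (hf : IsBoundary f κ₀) (hε : 0 < ε) (hκ : κ₀ < ε⁻¹)
    {v w : FreeVertex} {β₁ β₂ : ℝ}
    (h : LeftEdge (deriv (deriv f)) ε⁻¹ v.rightEnd (2 * β₁) w.leftEnd (2 * β₂))
    (hw : w.leftEnd = ⊤ ↔ ∃ s, w.kind = .posInfinity s) (hw' : w.leftEnd ≠ ⊥)
    (hv : v.rightEnd = ⊥ → ∃ s, v.kind = .negInfinity s) (hv' : v.rightEnd ≠ ⊤) :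
    IsLeftSlope f ε v w β₁ β₂ (fun u =>
      deriv f u + ε * leftSlope (deriv (deriv f)) ε⁻¹ w.leftEnd (2 * β₂) u) := by
  have hg := hf.continuous_secondDeriv
  obtain ⟨h1, h2⟩ := h
  set g := deriv (deriv f)
  set N : ℝ → ℝ := leftSlope g ε⁻¹ w.leftEnd (2 * β₂) with hN
  have hNd : ∀ u, HasDerivAt N (ε⁻¹ * (N u - g u)) u :=
    hasDerivAt_leftSlope hf.growth hg hκ _ _
  have hm : ∀ u, HasDerivAt (fun u => deriv f u + ε * N u) (N u) u := fun u => by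
    refine ((hf.hasDerivAt_deriv u).add ((hNd u).const_mul ε)).congr_deriv ?_
    field_simp
    ring
  refine ⟨fun u => (hm u).congr_deriv ?_, fun u hu1 hu2 => ?_, ?_, ?_⟩
  · field_simp
    ring
  · have : deriv (fun u => deriv f u + ε * N u) = N := funext fun u => (hm u).deriv
    rw [iteratedDeriv_succ, iteratedDeriv_one, this, (hNd u).deriv]
    exact mul_pos (inv_pos.2 hε) (sub_pos.2 (h1 u hu1 hu2))
  · have hfin : w.leftEnd ≠ ⊤ → deriv f w.leftEnd.toReal + ε * N w.leftEnd.toReal =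
        deriv f w.leftEnd.toReal + 2 * ε * β₂ := by
      intro hb
      have h3 := leftSlope_self g ε⁻¹ (2 * β₂) w.leftEnd.toReal
      rw [EReal.coe_toReal hb hw'] at h3
      rw [hN, h3]
      ring
    rcases hk : w.kind <;> simp only <;> try exact hfin fun hb => by simpa [hk] using hw.1 hb
    intro u
    have hb := hw.2 ⟨_, hk⟩
    rw [integral_Ioi_eq_slopeFromBot,
      slopeFromBot_of_hasDerivAt (h := fun t => deriv f (-t)) (g := fun t => -g (-t)) hf.pos
        (by fun_prop) (by obtain ⟨C, hC⟩ := hf.growth.neg; exact ⟨C, fun t => by simpa using hC t⟩)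
        (fun t => by
          refine ((hf.hasDerivAt_deriv (-t)).comp t (hasDerivAt_neg t)).congr_deriv ?_
          ring) hκ]
    have h6 : slopeFromBot (fun t => -g (-t)) ε⁻¹ (-u) =
        -slopeFromBot (fun t => g (-t)) ε⁻¹ (-u) := by
      simp only [slopeFromBot, neg_mul, integral_neg, mul_neg]
    rw [h6]
    simp only [hN, hb, leftSlope, EReal.neg_top, rightSlope, if_true, inv_inv, neg_neg]
    ring
  · have hfin : v.rightEnd ≠ ⊥ → deriv f v.rightEnd.toReal + ε * N v.rightEnd.toReal =
        deriv f v.rightEnd.toReal + 2 * ε * β₁ := by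
      intro ht
      rw [h2 v.rightEnd.toReal (EReal.coe_toReal hv' ht).symm]
      ring
    rcases hk : v.kind <;> simp only <;> exact hfin fun hb => by simpa [hk] using hv hb

end slopes

/-! ### Chordal domains -/

/-- A family of chords indexed by their lengths. -/
structure IsChordFamily (f a b : ℝ → ℝ) (l₀ l₁ : ℝ) : Prop where
  nonneg : 0 ≤ l₀
  continuousOn_left : ContinuousOn a (Icc l₀ l₁)
  continuousOn_right : ContinuousOn b (Icc l₀ l₁)
  closed : ∀ l ∈ Icc l₀ l₁, b l - a l = l ∧ CupEquation f (a l) (b l) ∧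
    DL f (a l) (b l) ≤ 0 ∧ DR f (a l) (b l) ≤ 0
  interior : ∀ l ∈ Ioo l₀ l₁, (∃ p < 0, HasDerivAt a p l) ∧ (∃ q > 0, HasDerivAt b q l) ∧
    DL f (a l) (b l) < 0 ∧ DR f (a l) (b l) < 0

theorem isChordalDomain_iff {f : ℝ → ℝ} {C : Set (ℝ × ℝ)} {top bot : ℝ × ℝ} :
    IsChordalDomain f C top bot ↔ ∃ a b : ℝ → ℝ, ∃ l₀ l₁ : ℝ, IsChordFamily f a b l₀ l₁ ∧ l₀ < l₁ ∧
      top = (a l₁, b l₁) ∧ bot = (a l₀, b l₀) ∧ C = (fun l => (a l, b l)) '' Icc l₀ l₁ := by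
  constructor
  · rintro ⟨h1, h2, a, b, h3, h4, h5, h6, h7, h8, h9, h10, h11⟩
    exact ⟨a, b, _, _, ⟨h1, h7, h8, h9, h10⟩, h2, by rw [h3, h4], by rw [h5, h6], h11⟩
  · rintro ⟨a, b, l₀, l₁, h, hl, rfl, rfl, rfl⟩
    have e0 := (h.closed l₀ (left_mem_Icc.2 hl.le)).1
    have e1 := (h.closed l₁ (right_mem_Icc.2 hl.le)).1
    simp only [IsChordalDomain, e0, e1]
    exact ⟨h.nonneg, hl, a, b, rfl, rfl, rfl, rfl, h.2, h.3, h.4, h.5, rfl⟩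

variable {f : ℝ → ℝ} {κ₀ : ℝ}

/-- As an average over the fixed interval `[0, 1]`, the divided difference is visibly continuous in
both endpoints, also where a chord degenerates to a point. -/
theorem IsBoundary.dslope_eq (hf : IsBoundary f κ₀) (x y : ℝ) :
    dslope (deriv f) x y = ∫ t in (0 : ℝ)..1, deriv (deriv f) (x + t * (y - x)) := by
  rcases eq_or_ne y x with rfl | hne
  · simp
  · rw [dslope_of_ne _ hne, slope_def_field]
    have h1 : ∀ t ∈ uIcc (0 : ℝ) 1, HasDerivAt (fun t => deriv f (x + t * (y - x)) / (y - x))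
        (deriv (deriv f) (x + t * (y - x))) t := by
      intro t _
      have h2 : HasDerivAt (fun t => x + t * (y - x)) (1 * (y - x)) t :=
        ((hasDerivAt_id t).mul_const _).const_add x
      refine (((hf.hasDerivAt_deriv _).comp t h2).div_const (y - x)).congr_deriv ?_
      have := sub_ne_zero.2 hne
      field_simp
    have hg := hf.continuous_secondDeriv
    rw [intervalIntegral.integral_eq_sub_of_hasDerivAt h1
      ((by fun_prop : Continuous fun t => deriv (deriv f) (x + t * (y - x))).intervalIntegrable _ _)]
    simp [sub_div]

theorem IsBoundary.continuous_dslope (hf : IsBoundary f κ₀) :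
    Continuous fun p : ℝ × ℝ => dslope (deriv f) p.1 p.2 := by
  simp_rw [hf.dslope_eq]
  refine intervalIntegral.continuous_parametric_intervalIntegral_of_continuous'
    (f := fun (p : ℝ × ℝ) t => deriv (deriv f) (p.1 + t * (p.2 - p.1))) ?_ 0 1
  have hg := hf.continuous_secondDeriv
  fun_prop

/-- Let `A` be the slope of the chord and `p = a'`, `q = b'`. Differentiating `b - a = l` and the
cup equation gives `q - p = 1` and `A (p + q) = g(a) p + g(b) q`. Substitution into `l A' = g(b) q -
g(a) p - A` eliminates one end and leaves a linear equation for `A` along the other end. -/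
theorem IsChordFamily.hasDerivAt_slope (hf : IsBoundary f κ₀) {a b : ℝ → ℝ} {l₀ l₁ : ℝ}
    (h : IsChordFamily f a b l₀ l₁) {l : ℝ} (hl : l ∈ Ioo l₀ l₁) {p q : ℝ} (ha : HasDerivAt a p l)
    (hb : HasDerivAt b q l) :
    HasDerivAt (fun l => dslope (deriv f) (a l) (b l))
        (2 / l * (deriv (deriv f) (b l) - dslope (deriv f) (a l) (b l)) * q) l ∧
      HasDerivAt (fun l => dslope (deriv f) (a l) (b l))
        (2 / l * (deriv (deriv f) (a l) - dslope (deriv f) (a l) (b l)) * (-p)) l := by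
  have hl0 : 0 < l := h.nonneg.trans_lt hl.1
  have hnear : ∀ᶠ x in 𝓝 l, x ∈ Ioo l₀ l₁ := Ioo_mem_nhds hl.1 hl.2
  have hA : ∀ x ∈ Ioo l₀ l₁, dslope (deriv f) (a x) (b x) =
      (deriv f (b x) - deriv f (a x)) / x := by
    intro x hx
    have h1 := (h.closed x (Ioo_subset_Icc_self hx)).1
    have h2 : 0 < x := h.nonneg.trans_lt hx.1
    have hne : b x ≠ a x := by intro h3; rw [h3, sub_self] at h1; exact h2.ne h1
    rw [dslope_of_ne _ hne, slope_def_field, h1]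
  have hpq : q - p = 1 := by
    have h1 : HasDerivAt (fun x => b x - a x) (q - p) l := hb.sub ha
    have h2 : HasDerivAt (fun x => b x - a x) 1 l := by
      refine (hasDerivAt_id l).congr_of_eventuallyEq ?_
      filter_upwards [hnear] with x hx
      exact (h.closed x (Ioo_subset_Icc_self hx)).1
    exact h1.unique h2
  have hfb := (hf.hasDerivAt (b l)).comp l hb
  have hfa := (hf.hasDerivAt (a l)).comp l ha
  have hgb := (hf.hasDerivAt_deriv (b l)).comp l hb
  have hga := (hf.hasDerivAt_deriv (a l)).comp l ha
  have hcup : deriv f (b l) * q - deriv f (a l) * p =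
      1 * ((deriv f (a l) + deriv f (b l)) / 2) +
        l * ((deriv (deriv f) (a l) * p + deriv (deriv f) (b l) * q) / 2) := by
    have h1 : HasDerivAt (fun x => f (b x) - f (a x)) _ l := hfb.sub hfa
    have h2 : HasDerivAt (fun x => f (b x) - f (a x))
        (1 * ((deriv f (a l) + deriv f (b l)) / 2) +
          l * ((deriv (deriv f) (a l) * p + deriv (deriv f) (b l) * q) / 2)) l := by
      refine ((hasDerivAt_id l).mul ((hga.add hgb).div_const 2)).congr_of_eventuallyEq ?_
      filter_upwards [hnear] with x hx
      obtain ⟨h3, h4, -⟩ := h.closed x (Ioo_subset_Icc_self hx)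
      rw [CupEquation, h3] at h4
      exact h4
    exact h1.unique h2
  have hAl := hA l hl
  set A := dslope (deriv f) (a l) (b l) with hAdef
  have hAl' : deriv f (b l) - deriv f (a l) = l * A := by rw [hAl]; field_simp
  have hder : HasDerivAt (fun l => dslope (deriv f) (a l) (b l))
      (((deriv (deriv f) (b l) * q - deriv (deriv f) (a l) * p) * l -
        (deriv f (b l) - deriv f (a l)) * 1) / l ^ 2) l := by
    refine ((hgb.sub hga).div (hasDerivAt_id l) hl0.ne').congr_of_eventuallyEq ?_
    filter_upwards [hnear] with x hx
    exact hA x hx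
  have hrel : A * (p + q) = deriv (deriv f) (a l) * p + deriv (deriv f) (b l) * q := by
    have : l * (A * (p + q)) = l * (deriv (deriv f) (a l) * p + deriv (deriv f) (b l) * q) := by
      have hq : q = 1 + p := by linarith
      subst hq
      linear_combination 2 * hcup - (1 + 2 * p) * hAl'
    exact mul_left_cancel₀ hl0.ne' this
  constructor
  · refine hder.congr_deriv ?_
    rw [hAl']
    field_simp
    linear_combination hrel + A * hpq
  · refine hder.congr_deriv ?_
    rw [hAl']
    field_simp
    linear_combination (-1) * hrel + A * hpq

theorem IsChordFamily.chordCurve_right (hf : IsBoundary f κ₀) {a b : ℝ → ℝ} {l₀ l₁ : ℝ}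
    (h : IsChordFamily f a b l₀ l₁) :
    IsChordCurve (deriv (deriv f)) b (fun l => dslope (deriv f) (a l) (b l)) l₀ l₁ := by
  refine ⟨h.3, ?_, fun l hl => ?_⟩
  · exact hf.continuous_dslope.comp_continuousOn (h.2.prodMk h.3)
  · obtain ⟨⟨p, hp, ha⟩, ⟨q, hq, hb⟩, -, hD⟩ := h.interior l hl
    exact ⟨sub_neg.1 hD, q, hq, hb, (h.hasDerivAt_slope hf hl ha hb).1⟩

theorem IsChordFamily.chordCurve_left (hf : IsBoundary f κ₀) {a b : ℝ → ℝ} {l₀ l₁ : ℝ}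
    (h : IsChordFamily f a b l₀ l₁) :
    IsChordCurve (fun t => deriv (deriv f) (-t)) (fun l => -a l)
      (fun l => dslope (deriv f) (a l) (b l)) l₀ l₁ := by
  refine ⟨h.2.neg, (h.chordCurve_right hf).2, fun l hl => ?_⟩
  obtain ⟨⟨p, hp, ha⟩, ⟨q, hq, hb⟩, hD, -⟩ := h.interior l hl
  refine ⟨by simpa using sub_neg.1 hD, -p, neg_pos.2 hp, ha.neg, ?_⟩
  simpa using (h.hasDerivAt_slope hf hl ha hb).2

theorem IsChordFamily.mono {a b : ℝ → ℝ} {l₀ l₁ l₂ : ℝ}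
    (h : IsChordFamily f a b l₀ l₁) (hl : l₂ ≤ l₁) : IsChordFamily f a b l₀ l₂ :=
  ⟨h.1, h.2.mono (Icc_subset_Icc le_rfl hl), h.3.mono (Icc_subset_Icc le_rfl hl),
    fun l hl' => h.4 l (Icc_subset_Icc le_rfl hl hl'), fun l hl' =>
      h.5 l (Ioo_subset_Ioo le_rfl hl hl')⟩

/-! ### Lists of arcs -/

theorem rightEnd_append (xs : List Arc) (x : Arc) : rightEnd (xs ++ [x]) = x.r := by
  induction xs with
  | nil => rfl
  | cons a xs ih =>
    cases xs with
    | nil => rfl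
    | cons b xs => exact ih

theorem rightPoint_append (xs : List Arc) (x : Arc) :
    rightPoint (xs ++ [x]) = if x.r = ⊤ then x.l.toReal else x.r.toReal := by
  induction xs with
  | nil => rfl
  | cons a xs ih =>
    cases xs with
    | nil => rfl
    | cons b xs => exact ih

theorem joinArcs_append (xs : List Arc) (x y : Arc) (ys : List Arc) :
    joinArcs (xs ++ [x]) (y :: ys) = xs ++ ⟨x.l, y.r⟩ :: ys := by
  induction xs with
  | nil => rfl
  | cons a xs ih =>
    cases xs with
    | nil => rfl
    | cons b xs => simpa [joinArcs] using ih

theorem gaps_append (xs : List Arc) (z : Arc) (ys : List Arc) :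
    gaps (xs ++ z :: ys) = gaps (xs ++ [z]) ++ gaps (z :: ys) := by
  induction xs with
  | nil => simp [gaps]
  | cons a xs ih =>
    cases xs with
    | nil => simp [gaps]
    | cons b xs => simpa [gaps] using ih

theorem gaps_append_congr (xs : List Arc) {x z : Arc} (h : x.l = z.l) :
    gaps (xs ++ [x]) = gaps (xs ++ [z]) := by
  induction xs with
  | nil => rfl
  | cons a xs ih =>
    cases xs with
    | nil => simp [gaps, h]
    | cons b xs => simpa [gaps] using ih

theorem gaps_cons_congr {x z : Arc} (ys : List Arc) (h : x.r = z.r) :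
    gaps (x :: ys) = gaps (z :: ys) := by
  cases ys with
  | nil => rfl
  | cons y ys => simp [gaps, h]

theorem leftEnd_append (xs : List Arc) {x z : Arc} (ys : List Arc) (h : x.l = z.l) :
    leftEnd (xs ++ z :: ys) = leftEnd (xs ++ [x]) := by
  cases xs with
  | nil => exact h.symm
  | cons a xs => rfl

theorem rightEnd_append_cons (xs : List Arc) {y z : Arc} (ys : List Arc) (h : y.r = z.r) :
    rightEnd (xs ++ z :: ys) = rightEnd (y :: ys) := by
  rcases List.eq_nil_or_concat ys with rfl | ⟨zs, w, rfl⟩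
  · rw [rightEnd_append]; exact h.symm
  · have h1 : xs ++ z :: zs.concat w = (xs ++ z :: zs) ++ [w] := by simp
    have h2 : y :: zs.concat w = (y :: zs) ++ [w] := by simp
    rw [h1, h2, rightEnd_append, rightEnd_append]

theorem ArcsOrdered.left_ne_top {A : List Arc} (h : ArcsOrdered A) : leftEnd A ≠ ⊤ := by
  obtain ⟨h1, h2, -⟩ := h
  cases A with
  | nil => exact absurd rfl h1
  | cons x xs => exact (h2 x (by simp)).2.1

theorem ArcsOrdered.right_ne_bot {A : List Arc} (h : ArcsOrdered A) : rightEnd A ≠ ⊥ := by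
  obtain ⟨h1, h2, -⟩ := h
  rcases List.eq_nil_or_concat A with rfl | ⟨xs, x, rfl⟩
  · exact absurd rfl h1
  · rw [List.concat_eq_append, rightEnd_append]
    exact (h2 x (by simp)).2.2

theorem isChain_arcs_le {A : List Arc} (h1 : ∀ x ∈ A, x.l ≤ x.r)
    (h2 : A.IsChain (fun x y => x.r < y.l)) :
    ∀ x ∈ A, leftEnd A ≤ x.l ∧ x.r ≤ rightEnd A := by
  induction A with
  | nil => simp
  | cons a A ih =>
    cases A with
    | nil =>
      intro x hx
      rw [List.mem_singleton] at hx
      subst hx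
      exact ⟨le_rfl, le_rfl⟩
    | cons b A =>
      have h3 := (List.isChain_cons_cons.1 h2)
      have ih' := ih (fun x hx => h1 x (List.mem_cons_of_mem _ hx)) h3.2
      have hab : a.r < b.l := h3.1
      have ha := h1 a (by simp)
      intro x hx
      rcases List.mem_cons.1 hx with rfl | hx
      · refine ⟨le_rfl, hab.le.trans ?_⟩
        have hb := ih' b (by simp)
        exact (h1 b (by simp)).trans hb.2
      · obtain ⟨h4, h5⟩ := ih' x hx
        exact ⟨(ha.trans hab.le).trans h4, h5⟩

theorem ArcsOrdered.le {A : List Arc} (h : ArcsOrdered A) : leftEnd A ≤ rightEnd A := by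
  obtain ⟨h1, h2, h3⟩ := h
  obtain ⟨x, hx⟩ := List.exists_mem_of_ne_nil A h1
  obtain ⟨h4, h5⟩ := isChain_arcs_le (fun x hx => (h2 x hx).1) h3 x hx
  exact (h4.trans (h2 x hx).1).trans h5

/-! ### Gluing of figures -/

theorem ArcsOrdered.join {xs ys : List Arc} {x y : Arc} (h : ArcsOrdered (xs ++ [x]))
    (h' : ArcsOrdered (y :: ys)) (hxy : x.r = y.l) : ArcsOrdered (xs ++ ⟨x.l, y.r⟩ :: ys) := by
  obtain ⟨-, h2, h3⟩ := h
  obtain ⟨-, h2', h3'⟩ := h'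
  have hx := h2 x (by simp)
  have hy := h2' y (by simp)
  refine ⟨by simp, fun z hz => ?_, ?_⟩
  · rw [List.mem_append, List.mem_cons] at hz
    rcases hz with hz | rfl | hz
    · exact h2 z (by simp [hz])
    · exact ⟨(hx.1.trans hxy.le).trans hy.1, hx.2.1, hy.2.2⟩
    · exact h2' z (by simp [hz])
  · rw [List.isChain_append] at h3 ⊢
    refine ⟨h3.1, ?_, ?_⟩
    · cases ys with
      | nil => simp
      | cons z ys =>
        rw [List.isChain_cons_cons] at h3' ⊢
        exact h3'
    · intro a ha b hb
      have := h3.2.2 a ha x (by simp)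
      simp only [List.head?_cons, Option.mem_def, Option.some.injEq] at hb
      subst hb
      exact this

theorem mem_arcPoints_join {xs ys : List Arc} {x y : Arc} {t : ℝ} (hx : x.r = t) (hy : y.l = t)
    {s : ℝ} (hs : s ∈ arcPoints (xs ++ ⟨x.l, y.r⟩ :: ys)) :
    s ∈ arcPoints (xs ++ [x]) ∨ s ∈ arcPoints (y :: ys) := by
  obtain ⟨z, hz, hzs⟩ := hs
  rw [List.mem_append, List.mem_cons] at hz
  rcases hz with hz | rfl | hz
  · exact Or.inl ⟨z, by simp [hz], hzs⟩
  · rcases le_total s t with h | h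
    · refine Or.inl ⟨x, by simp, hzs.1, ?_⟩
      rw [hx]; exact EReal.coe_le_coe_iff.2 h
    · refine Or.inr ⟨y, by simp, ?_, hzs.2⟩
      rw [hy]; exact EReal.coe_le_coe_iff.2 h
  · exact Or.inr ⟨z, by simp [hz], hzs⟩

/-- The cup equation is not transitive by itself; it becomes additive when the increments of `f'`
over both pairs have the same slope. -/
theorem CupEquation.trans {f : ℝ → ℝ} {σ s t u : ℝ} (h₁ : CupEquation f s t)
    (h₂ : CupEquation f t u) (h₃ : deriv f t - deriv f s = σ * (t - s))
    (h₄ : deriv f u - deriv f t = σ * (u - t)) : CupEquation f s u := by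
  unfold CupEquation at *
  linear_combination h₁ + h₂ + (u - t) / 2 * h₃ - (t - s) / 2 * h₄

theorem CupEquation.symm {f : ℝ → ℝ} {s t : ℝ} (h : CupEquation f s t) : CupEquation f t s := by
  unfold CupEquation at *
  linear_combination -h

theorem IsLinearity.join {f : ℝ → ℝ} {σ : ℝ} {xs ys : List Arc} {x y : Arc} {t : ℝ}
    (h : IsLinearity f (xs ++ [x]) σ) (h' : IsLinearity f (y :: ys) σ) (hx : x.r = t)
    (hy : y.l = t) (hxle : x.l ≤ x.r) (hyle : y.l ≤ y.r) :
    IsLinearity f (xs ++ ⟨x.l, y.r⟩ :: ys) σ := by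
  have ht : t ∈ arcPoints (xs ++ [x]) := ⟨x, by simp, hx ▸ hxle, hx.ge⟩
  have ht' : t ∈ arcPoints (y :: ys) := ⟨y, by simp, hy.le, hy ▸ hyle⟩
  intro s hs u hu
  have key : ∀ s ∈ arcPoints (xs ++ [x]), ∀ u ∈ arcPoints (y :: ys),
      deriv f u - deriv f s = σ * (u - s) ∧ CupEquation f s u := by
    intro s hs u hu
    obtain ⟨h1, h2⟩ := h s hs t ht
    obtain ⟨h3, h4⟩ := h' t ht' u hu
    exact ⟨by linear_combination h1 + h3, h2.trans h4 h1 h3⟩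
  rcases mem_arcPoints_join hx hy hs with hs | hs <;> rcases mem_arcPoints_join hx hy hu with hu | hu
  · exact h s hs u hu
  · exact key s hs u hu
  · obtain ⟨h1, h2⟩ := key u hu s hs
    exact ⟨by linear_combination -h1, h2.symm⟩
  · exact h' s hs u hu

/-- Two roots that are not points have no common ends. -/
theorem IsPlusMinusRoot.eq_of_touch {f : ℝ → ℝ} {x y : Arc} {t : ℝ} (hx : IsPlusMinusRoot f x)
    (hxt : x.r = t) (hyt : y.l = t) (hy : IsPlusMinusRoot f y) : y.l = y.r := by
  by_contra hne
  have hlt : y.l < y.r := lt_of_le_of_ne hy.1 hne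
  obtain ⟨-, -, -, -, -, h⟩ := hx
  rcases h with h | ⟨x₁, h1, -, h2⟩
  · rw [hxt] at h; exact EReal.coe_ne_top t h
  · rw [hxt, EReal.toReal_coe] at h1 h2
    obtain ⟨s, hs1, hs2⟩ := EReal.lt_iff_exists_real_btwn.1 hlt
    rw [hyt, EReal.coe_lt_coe_iff] at hs1
    set s' := min s x₁
    have hs' : t < s' := lt_min hs1 h1
    have h3 := h2 s' ⟨hs', min_le_right _ _⟩
    have h4 := hy.2.2.2.1 s' ⟨hyt.le.trans (EReal.coe_le_coe_iff.2 hs'.le),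
      (EReal.coe_le_coe_iff.2 (min_le_left _ _)).trans hs2.le⟩ t ⟨hyt.le, hyt ▸ hlt.le⟩
    exact h3.ne h4

/-- Two solid roots cannot touch, so one of the united arcs is a point, and the union is the other
arc. -/
theorem SolidArcsAreRoots.join {f : ℝ → ℝ} {xs ys : List Arc} {x y : Arc} {t : ℝ}
    (h : SolidArcsAreRoots f (xs ++ [x])) (h' : SolidArcsAreRoots f (y :: ys)) (hx : x.r = t)
    (hy : y.l = t) : SolidArcsAreRoots f (xs ++ ⟨x.l, y.r⟩ :: ys) := by
  intro z hz hne
  rw [List.mem_append, List.mem_cons] at hz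
  rcases hz with hz | rfl | hz
  · exact h z (by simp [hz]) hne
  · by_cases h1 : x.l = x.r
    · have h2 : (⟨x.l, y.r⟩ : Arc) = y := by rw [h1, hx, ← hy]
      rw [h2] at hne ⊢
      exact h' y (by simp) hne
    · by_cases h2 : y.l = y.r
      · have h3 : (⟨x.l, y.r⟩ : Arc) = x := by rw [← h2, hy, ← hx]
        rw [h3]
        exact h x (by simp) h1
      · exact absurd ((h x (by simp) h1).eq_of_touch hx hy (h' y (by simp) h2)) h2
  · exact h' z (by simp [hz]) hne

/-- The requirements on the arcs of a figure that is not at infinity; `l` and `r` are the families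
of tangents on its left and right, `σ` is its slope. The conditions are such that they are inherited
when figures are glued. -/
structure IsFigure (f : ℝ → ℝ) (ε : ℝ) (l r : Side) (A : List Arc) (σ : ℝ) : Prop where
  ordered : ArcsOrdered A
  linear : IsLinearity f A σ
  solid : SolidArcsAreRoots f A
  left_infinite : leftEnd A = ⊥ → l = .left
  right_infinite : rightEnd A = ⊤ → r = .right
  long : l = .left → r = .right → leftEnd A + ((2 * ε : ℝ) : EReal) ≤ rightEnd A
  long_chord : l = .left → r = .right → ∀ x y : Arc, A = [x, y] → x.l = x.r → y.l = y.r →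
    y.r.toReal - x.l.toReal = 2 * ε
  single : l = r → ∀ x : Arc, A = [x] → x.l = x.r →
    IsPlusMinusRoot f (Arc.point x.l.toReal) ∧ σ = deriv (deriv f) x.l.toReal

theorem IsFigure.not_long_single {f : ℝ → ℝ} {ε : ℝ} (hε : 0 < ε) {l r : Side} {A : List Arc}
    {σ : ℝ} (h : IsFigure f ε l r A σ) (hl : l = .left) (hr : r = .right) {x : Arc}
    (hA : A = [x]) (hx : x.l = x.r) : False := by
  subst hA
  have h1 := h.long hl hr
  have h2 := h.ordered.left_ne_top
  have h3 := h.ordered.right_ne_bot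
  simp only [leftEnd, rightEnd] at h1 h2 h3
  rw [hx] at h1 h2
  rw [← EReal.coe_toReal h2 h3, ← EReal.coe_add, EReal.coe_le_coe_iff] at h1
  linarith

theorem Side.eq_or (s : Side) : s = .left ∨ s = .right := by cases s <;> simp

/-- The common family `s` decides everything. If the result has left tangents on the left and right
tangents on the right, then one of the two parts has them too and is already long. If the result is
a chord of this kind, one part is a single point, which cannot be long, so the other part is the
long chord. If the result is a single point with equal families, then `s` is the same family, since
otherwise one part would be a long single point. -/
theorem IsFigure.join {f : ℝ → ℝ} {ε : ℝ} (hε : 0 < ε) {l s r : Side} {A B : List Arc} {σ t : ℝ}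
    (hA : IsFigure f ε l s A σ) (hB : IsFigure f ε s r B σ) (hAt : rightEnd A = t)
    (hBt : leftEnd B = t) : IsFigure f ε l r (joinArcs A B) σ := by
  rcases List.eq_nil_or_concat A with rfl | ⟨xs, x, rfl⟩
  · exact absurd rfl hA.ordered.1
  rcases B with _ | ⟨y, ys⟩
  · exact absurd rfl hB.ordered.1
  rw [List.concat_eq_append] at *
  have hL := leftEnd_append xs (x := x) (z := ⟨x.l, y.r⟩) ys rfl
  have hR := rightEnd_append_cons xs (y := y) (z := ⟨x.l, y.r⟩) ys rfl
  have hx : x.r = t := by rw [← hAt, rightEnd_append]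
  have hy : y.l = t := hBt
  have hxle := (hA.ordered.2.1 x (by simp)).1
  have hyle := (hB.ordered.2.1 y (by simp)).1
  have hlong : l = .left → r = .right → (l = .left ∧ s = .right) ∨ (s = .left ∧ r = .right) := by
    intro h1 h2
    rcases s.eq_or with h | h
    · exact Or.inr ⟨h, h2⟩
    · exact Or.inl ⟨h1, h⟩
  rw [joinArcs_append]
  refine ⟨hA.ordered.join hB.ordered (hx.trans hy.symm), hA.linear.join hB.linear hx hy hxle hyle,
    hA.solid.join hB.solid hx hy, ?_, ?_, ?_, ?_, ?_⟩
  · rw [hL]; exact hA.left_infinite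
  · rw [hR]; exact hB.right_infinite
  · intro h1 h2
    rw [hL, hR]
    have h3 := hA.ordered.le
    have h4 := hB.ordered.le
    rw [hAt] at h3
    rw [hBt] at h4
    rcases hlong h1 h2 with ⟨h5, h6⟩ | ⟨h5, h6⟩
    · exact ((hA.long h5 h6).trans_eq hAt).trans h4
    · refine le_trans ?_ (hB.long h5 h6)
      rw [hBt]
      gcongr
  · intro h1 h2 a b hab ha hb
    rcases xs with _ | ⟨x', xs⟩
    · simp only [List.nil_append, List.cons.injEq] at hab
      obtain ⟨rfl, rfl⟩ := hab
      simp only at ha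
      have hxx : x.l = x.r := le_antisymm hxle (by rw [ha, hx, ← hy]; exact hyle)
      rcases hlong h1 h2 with ⟨h5, h6⟩ | ⟨h5, h6⟩
      · exact (hA.not_long_single hε h5 h6 rfl hxx).elim
      · have h7 := hB.long_chord h5 h6 y b rfl (by rw [hy, ← ha, hxx, hx]) hb
        simpa [hxx, hx, hy] using h7
    · have h7 : xs = [] ∧ ys = [] ∧ x' = a ∧ (⟨x.l, y.r⟩ : Arc) = b := by
        have := congrArg List.length hab
        simp only [List.length_append, List.length_cons, List.length_nil] at this
        have h8 : xs = [] := List.length_eq_zero_iff.1 (by omega)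
        have h9 : ys = [] := List.length_eq_zero_iff.1 (by omega)
        subst h8; subst h9
        simpa using hab
      obtain ⟨rfl, rfl, rfl, rfl⟩ := h7
      simp only at hb ⊢
      have hyy : y.l = y.r := le_antisymm hyle (by rw [← hb, hy, ← hx]; exact hxle)
      rcases hlong h1 h2 with ⟨h5, h6⟩ | ⟨h5, h6⟩
      · have h7 := hA.long_chord h5 h6 x' x rfl ha (by rw [hb, ← hyy, hy, hx])
        rw [← hyy, hy, ← hx]; exact h7
      · exact (hB.not_long_single hε h5 h6 rfl hyy).elim
  · intro h1 a ha hal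
    have h7 : xs = [] ∧ ys = [] ∧ (⟨x.l, y.r⟩ : Arc) = a := by
      have := congrArg List.length ha
      simp only [List.length_append, List.length_cons, List.length_nil] at this
      have h8 : xs = [] := List.length_eq_zero_iff.1 (by omega)
      have h9 : ys = [] := List.length_eq_zero_iff.1 (by omega)
      subst h8; subst h9
      simpa using ha
    obtain ⟨rfl, rfl, rfl⟩ := h7
    simp only at hal ⊢
    have hxx : x.l = x.r := le_antisymm hxle (by rw [hal, hx, ← hy]; exact hyle)
    have hyy : y.l = y.r := le_antisymm hyle (by rw [← hal, hy, ← hx]; exact hxle)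
    by_cases hs : l = s
    · exact hA.single hs x rfl hxx
    · exfalso
      subst h1
      rcases l.eq_or with h | h <;> rcases s.eq_or with h' | h'
      · exact hs (h.trans h'.symm)
      · exact hA.not_long_single hε h h' rfl hxx
      · exact hB.not_long_single hε h' h rfl hyy
      · exact hs (h.trans h'.symm)

/-! ### Types of figures -/

theorem kindOfShape_bot (f : ℝ → ℝ) (l r : Side) :
    kindOfShape f l r [⟨⊥, ⊥⟩] = .negInfinity r := by simp [kindOfShape]

theorem kindOfShape_top (f : ℝ → ℝ) (l r : Side) :
    kindOfShape f l r [⟨⊤, ⊤⟩] = .posInfinity l := by simp [kindOfShape]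

/-- The possible types of a figure that is not at infinity. -/
theorem kindOfShape_cases (f : ℝ → ℝ) (l r : Side) {A : List Arc} (h₁ : A ≠ [⟨⊥, ⊥⟩])
    (h₂ : A ≠ [⟨⊤, ⊤⟩]) :
    (kindOfShape f l r A = .angle ∧ l = .right ∧ r = .left ∧ ∃ x, A = [x] ∧ x.l = x.r) ∨
    (∃ s, kindOfShape f l r A = .fifthType s ∧ l = s ∧ r = s ∧ ∃ x, A = [x] ∧ x.l = x.r) ∨
    (kindOfShape f l r A = .birdie ∧ l = .right ∧ r = .left ∧
      ∃ x y, A = [x, y] ∧ x.l = x.r ∧ y.l = y.r) ∨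
    (∃ s, kindOfShape f l r A = .trolleybus s ∧ l = s ∧ r = s ∧
      ∃ x y, A = [x, y] ∧ x.l = x.r ∧ y.l = y.r) ∨
    ((kindOfShape f l r A = .thirdType ∨ kindOfShape f l r A = .firstType) ∧ l = .left ∧
      r = .right ∧ ∃ x y, A = [x, y] ∧ x.l = x.r ∧ y.l = y.r) ∨
    (kindOfShape f l r A = .multibirdie ∧ l = .right ∧ r = .left) ∨
    (∃ s, kindOfShape f l r A = .multitrolleybus s ∧ l = s ∧ r = s) ∨
    (kindOfShape f l r A = .multicup ∧ l = .left ∧ r = .right ∧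
      ∀ x y, A = [x, y] → x.l = x.r → y.l ≠ y.r) := by
  rcases A with _ | ⟨x, _ | ⟨y, _ | ⟨z, A⟩⟩⟩
  · cases l <;> cases r <;> simp [kindOfShape]
  · by_cases hx : x.l = x.r
    · by_cases hb : x.l = ⊥
      · exact absurd (by rw [show x = ⟨⊥, ⊥⟩ from congrArg₂ Arc.mk hb (hx ▸ hb)]) h₁
      · by_cases ht : x.l = ⊤
        · exact absurd (by rw [show x = ⟨⊤, ⊤⟩ from congrArg₂ Arc.mk ht (hx ▸ ht)]) h₂
        · have hb' : x.r ≠ ⊥ := hx ▸ hb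
          have ht' : x.r ≠ ⊤ := hx ▸ ht
          cases l <;> cases r <;> simp [kindOfShape, hx, hb', ht']
    · cases l <;> cases r <;> simp [kindOfShape, hx]
  · by_cases hxy : x.l = x.r ∧ y.l = y.r
    · by_cases hD : DL f x.l.toReal y.r.toReal = 0 ∨ DR f x.l.toReal y.r.toReal = 0
      · rw [hxy.1] at hD
        cases l <;> cases r <;> simp [kindOfShape, hxy, hD]
      · rw [hxy.1] at hD
        cases l <;> cases r <;> simp [kindOfShape, hxy, hD]
    · cases l <;> cases r <;> simp [kindOfShape, hxy]
      tauto
  · cases l <;> cases r <;> simp [kindOfShape]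

theorem kindOfShape_leftSide (f : ℝ → ℝ) (l r : Side) {A : List Arc} (h₁ : A ≠ [⟨⊥, ⊥⟩])
    (h₂ : A ≠ [⟨⊤, ⊤⟩]) : (kindOfShape f l r A).leftSide = l := by
  rcases kindOfShape_cases f l r h₁ h₂ with ⟨h, h', -⟩ | ⟨s, h, h', -⟩ | ⟨h, h', -⟩ | ⟨s, h, h', -⟩ |
    ⟨h | h, h', -⟩ | ⟨h, h', -⟩ | ⟨s, h, h', -⟩ | ⟨h, h', -⟩ <;> rw [h, h'] <;> rfl

theorem kindOfShape_rightSide (f : ℝ → ℝ) (l r : Side) {A : List Arc} (h₁ : A ≠ [⟨⊥, ⊥⟩])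
    (h₂ : A ≠ [⟨⊤, ⊤⟩]) : (kindOfShape f l r A).rightSide = r := by
  rcases kindOfShape_cases f l r h₁ h₂ with ⟨h, -, h', -⟩ | ⟨s, h, -, h', -⟩ | ⟨h, -, h', -⟩ |
    ⟨s, h, -, h', -⟩ | ⟨h | h, -, h', -⟩ | ⟨h, -, h'⟩ | ⟨s, h, -, h'⟩ | ⟨h, -, h', -⟩ <;>
    rw [h, h'] <;> rfl

theorem kindOfShape_leftSide' (f : ℝ → ℝ) (l r : Side) {A : List Arc} (h₁ : A ≠ [⟨⊥, ⊥⟩]) :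
    (kindOfShape f l r A).leftSide = l := by
  by_cases h₂ : A = [⟨⊤, ⊤⟩]
  · rw [h₂, kindOfShape_top]; rfl
  · exact kindOfShape_leftSide f l r h₁ h₂

theorem kindOfShape_rightSide' (f : ℝ → ℝ) (l r : Side) {A : List Arc} (h₂ : A ≠ [⟨⊤, ⊤⟩]) :
    (kindOfShape f l r A).rightSide = r := by
  by_cases h₁ : A = [⟨⊥, ⊥⟩]
  · rw [h₁, kindOfShape_bot]; rfl
  · exact kindOfShape_rightSide f l r h₁ h₂

/-- At infinity a type remembers only one of the two families, so `l` and `r` cannot always be read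
off; nevertheless, the families that are read off reproduce the type. -/
theorem kindOfShape_eq (f : ℝ → ℝ) (l r : Side) (A : List Arc) :
    kindOfShape f l r A =
      kindOfShape f (kindOfShape f l r A).leftSide (kindOfShape f l r A).rightSide A := by
  by_cases h₁ : A = [⟨⊥, ⊥⟩]
  · rw [h₁, kindOfShape_bot, kindOfShape_bot]; rfl
  · by_cases h₂ : A = [⟨⊤, ⊤⟩]
    · rw [h₂, kindOfShape_top, kindOfShape_top]; rfl
    · rw [kindOfShape_leftSide f l r h₁ h₂, kindOfShape_rightSide f l r h₁ h₂]

/-! ### Blocks -/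

/-- A vertex of a graph together with the families of tangents on its sides and its slope. -/
structure Block where
  l : Side
  r : Side
  arcs : List Arc
  below : List Branch
  slope : ℝ

noncomputable def Block.vertex (f : ℝ → ℝ) (b : Block) : FreeVertex :=
  ⟨kindOfShape f b.l b.r b.arcs, b.arcs, b.below⟩

/-- The leaf-root condition for a vertex subordinated to other vertices. -/
def Branch.LeafRoot (f : ℝ → ℝ) (b : Branch) : Prop :=
  match b.kind with
  | .closedMulticup => SolidArcsAreRoots f b.arcs
  | .secondType => IsPlusMinusRoot f (Arc.point (hull b.arcs).1)
  | .thirdType => DegenerateEndsAreRoots f (hull b.arcs)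

/-- These are the requirements that concern one vertex only; those on the tangents between
neighbours form `Block.Linked`. Both are stable under gluing. -/
structure Block.IsGood (f : ℝ → ℝ) (ε : ℝ) (b : Block) : Prop where
  figure : b.arcs = [⟨⊥, ⊥⟩] ∨ b.arcs = [⟨⊤, ⊤⟩] ∨ IsFigure f ε b.l b.r b.arcs b.slope
  wired : Wired f b.arcs b.below
  gaps : ∀ g ∈ gaps b.arcs, g.2 - g.1 ≤ 2 * ε
  branches : ∀ c ∈ branchNodes b.below, c.IsAdmissible f ε ∧ c.LeafRoot f

/-- The tangents between the neighbours `b` and `b'` (maybe, a tangent domain of zero length). -/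
structure Block.Linked (g : ℝ → ℝ) (κ : ℝ) (b b' : Block) : Prop where
  side : b.r = b'.l
  ne_top : rightEnd b.arcs ≠ ⊤
  ne_bot : leftEnd b'.arcs ≠ ⊥
  right : b.r = .right →
    RightEdge g κ (rightEnd b.arcs) b.slope (leftEnd b'.arcs) b'.slope
  left : b.r = .left →
    LeftEdge g κ (rightEnd b.arcs) b.slope (leftEnd b'.arcs) b'.slope

theorem Block.Linked.congr {g : ℝ → ℝ} {κ : ℝ} {b b' c c' : Block} (h : b.Linked g κ b')
    (h₁ : c.r = b.r) (h₂ : rightEnd c.arcs = rightEnd b.arcs) (h₃ : c.slope = b.slope)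
    (h₄ : c'.l = b'.l) (h₅ : leftEnd c'.arcs = leftEnd b'.arcs) (h₆ : c'.slope = b'.slope) :
    c.Linked g κ c' := by
  obtain ⟨k1, k2, k3, k4, k5⟩ := h
  constructor <;> simp only [h₁, h₂, h₃, h₄, h₅, h₆] <;> assumption

/-- On a tangent domain of zero length the agreement of slopes at the far end is the initial
condition, so the two figures have equal slopes. -/
theorem Block.Linked.slope_eq {g : ℝ → ℝ} {κ : ℝ} {b b' : Block} (h : b.Linked g κ b')
    (he : rightEnd b.arcs = leftEnd b'.arcs) :
    ∃ t : ℝ, rightEnd b.arcs = t ∧ leftEnd b'.arcs = t ∧ b.slope = b'.slope := by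
  have h1 : rightEnd b.arcs ≠ ⊥ := by rw [he]; exact h.ne_bot
  obtain ⟨t, ht⟩ : ∃ t : ℝ, rightEnd b.arcs = t := ⟨_, (EReal.coe_toReal h.ne_top h1).symm⟩
  have ht' : leftEnd b'.arcs = t := he ▸ ht
  refine ⟨t, ht, ht', ?_⟩
  rcases b.r.eq_or with hs | hs
  · have := (h.left hs).2 t ht
    rw [ht', leftSlope_self] at this
    exact this.symm
  · have := (h.right hs).2 t ht'
    rwa [ht, rightSlope_self] at this

def Block.glue (b w : Block) : Block :=
  ⟨b.l, w.r, joinArcs b.arcs w.arcs, b.below ++ w.below, b.slope⟩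

theorem branchNodes_append (bs cs : List Branch) :
    branchNodes (bs ++ cs) = branchNodes bs ++ branchNodes cs := by
  induction bs with
  | nil => simp [branchNodes]
  | cons b bs ih => simp [branchNodes, ih]

theorem Block.IsGood.figure_of_right {f : ℝ → ℝ} {ε : ℝ} {b : Block} (h : b.IsGood f ε) {t : ℝ}
    (ht : rightEnd b.arcs = t) : IsFigure f ε b.l b.r b.arcs b.slope := by
  rcases h.figure with h | h | h
  · rw [h] at ht; exact absurd ht.symm (EReal.coe_ne_bot t)
  · rw [h] at ht; exact absurd ht.symm (EReal.coe_ne_top t)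
  · exact h

theorem Block.IsGood.figure_of_left {f : ℝ → ℝ} {ε : ℝ} {b : Block} (h : b.IsGood f ε) {t : ℝ}
    (ht : leftEnd b.arcs = t) : IsFigure f ε b.l b.r b.arcs b.slope := by
  rcases h.figure with h | h | h
  · rw [h] at ht; exact absurd ht.symm (EReal.coe_ne_bot t)
  · rw [h] at ht; exact absurd ht.symm (EReal.coe_ne_top t)
  · exact h

theorem IsFigure.ne_infinity {f : ℝ → ℝ} {ε : ℝ} {l r : Side} {A : List Arc} {σ : ℝ}
    (h : IsFigure f ε l r A σ) : A ≠ [⟨⊥, ⊥⟩] ∧ A ≠ [⟨⊤, ⊤⟩] := by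
  constructor
  · rintro rfl; exact h.ordered.right_ne_bot rfl
  · rintro rfl; exact h.ordered.left_ne_top rfl

theorem ends_join {A B : List Arc} (hA : A ≠ []) (hB : B ≠ []) :
    leftEnd (joinArcs A B) = leftEnd A ∧ rightEnd (joinArcs A B) = rightEnd B := by
  rcases List.eq_nil_or_concat A with rfl | ⟨xs, x, rfl⟩
  · exact absurd rfl hA
  rcases B with _ | ⟨y, ys⟩
  · exact absurd rfl hB
  rw [List.concat_eq_append, joinArcs_append]
  exact ⟨leftEnd_append xs ys rfl, rightEnd_append_cons xs ys rfl⟩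

theorem gaps_join {A B : List Arc} (hA : A ≠ []) (hB : B ≠ []) :
    gaps (joinArcs A B) = gaps A ++ gaps B := by
  rcases List.eq_nil_or_concat A with rfl | ⟨xs, x, rfl⟩
  · exact absurd rfl hA
  rcases B with _ | ⟨y, ys⟩
  · exact absurd rfl hB
  rw [List.concat_eq_append, joinArcs_append, gaps_append,
    gaps_append_congr xs (x := ⟨x.l, y.r⟩) (z := x) rfl,
    gaps_cons_congr (x := ⟨x.l, y.r⟩) (z := y) ys rfl]

theorem Block.IsGood.glue {f g : ℝ → ℝ} {ε κ : ℝ} (hε : 0 < ε) {b w : Block} (hb : b.IsGood f ε)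
    (hw : w.IsGood f ε) (h : b.Linked g κ w) (he : rightEnd b.arcs = leftEnd w.arcs) :
    (b.glue w).IsGood f ε ∧ leftEnd (b.glue w).arcs = leftEnd b.arcs ∧
      rightEnd (b.glue w).arcs = rightEnd w.arcs ∧
      BMOFoliation.glue f (b.vertex f) (w.vertex f) = (b.glue w).vertex f := by
  obtain ⟨t, ht, ht', hσ⟩ := h.slope_eq he
  have hbf := hb.figure_of_right ht
  have hwf := hw.figure_of_left ht'
  obtain ⟨e1, e2⟩ := ends_join hbf.ordered.1 hwf.ordered.1
  have e3 := gaps_join hbf.ordered.1 hwf.ordered.1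
  have hwf' := hwf
  rw [← hσ, ← h.side] at hwf'
  refine ⟨⟨Or.inr (Or.inr (hbf.join hε hwf' ht ht')), ?_, ?_, ?_⟩, e1, e2, ?_⟩
  · have := hb.wired
    have := hw.wired
    unfold Wired at *
    simp only [Block.glue, e3]
    exact List.rel_append hb.wired hw.wired
  · intro g hg
    simp only [Block.glue, e3, List.mem_append] at hg
    exact hg.elim (hb.gaps g) (hw.gaps g)
  · intro c hc
    simp only [Block.glue, branchNodes_append, List.mem_append] at hc
    exact hc.elim (hb.branches c) (hw.branches c)
  · obtain ⟨h1, h2⟩ := hbf.ne_infinity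
    obtain ⟨h3, h4⟩ := hwf.ne_infinity
    simp only [BMOFoliation.glue, Block.vertex, Block.glue,
      kindOfShape_leftSide f b.l b.r h1 h2, kindOfShape_rightSide f w.l w.r h3 h4]

/-! ### Slopes of figures as averages -/

theorem IsLinearity.dslope_eq {f : ℝ → ℝ} {A : List Arc} {σ x y : ℝ} (h : IsLinearity f A σ)
    (hx : x ∈ arcPoints A) (hy : y ∈ arcPoints A)
    (hxy : x = y → deriv (deriv f) y = σ) : dslope (deriv f) x y = σ := by
  by_cases he : x = y
  · rw [he, dslope_same, hxy he]
  · rw [dslope_of_ne _ (Ne.symm he), slope_def_field, (h x hx y hy).1]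
    exact mul_div_cancel_right₀ _ (sub_ne_zero.2 (Ne.symm he))

theorem IsLinearity.secondDeriv_eq {f : ℝ → ℝ} {A : List Arc} {σ x y : ℝ}
    (h : IsLinearity f A σ) (hf : HasDerivAt (deriv f) (deriv (deriv f) x) x) (hxy : x ≠ y)
    (hA : uIcc x y ⊆ arcPoints A) : deriv (deriv f) x = σ := by
  have h1 : HasDerivWithinAt (deriv f) σ (uIcc x y) x := by
    have h2 : HasDerivAt (fun t => deriv f x + σ * (t - x)) σ x := by
      simpa using (((hasDerivAt_id x).sub_const x).const_mul σ).const_add (deriv f x)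
    refine h2.hasDerivWithinAt.congr (fun t ht => ?_) (by simp)
    have := (h x (hA left_mem_uIcc) t (hA ht)).1
    linarith
  have h3 : UniqueDiffWithinAt ℝ (uIcc x y) x :=
    uniqueDiffOn_Icc (min_lt_max.2 hxy) x left_mem_uIcc
  exact h3.eq_deriv _ hf.hasDerivWithinAt h1

theorem mem_arcPoints_head {x : Arc} {xs : List Arc} {t : ℝ} (h₁ : x.l ≤ t) (h₂ : t ≤ x.r) :
    t ∈ arcPoints (x :: xs) := ⟨x, by simp, h₁, h₂⟩

theorem mem_arcPoints_last {x : Arc} {xs : List Arc} {t : ℝ} (h₁ : x.l ≤ t) (h₂ : t ≤ x.r) :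
    t ∈ arcPoints (xs ++ [x]) := ⟨x, by simp, h₁, h₂⟩

theorem ArcsOrdered.exists_of_eq {A : List Arc} (h : ArcsOrdered A) {t : ℝ} (h₁ : t ≤ leftEnd A)
    (h₂ : rightEnd A ≤ t) : A = [⟨t, t⟩] := by
  obtain ⟨hne, hle, hc⟩ := h
  rcases A with _ | ⟨x, _ | ⟨y, ys⟩⟩
  · exact absurd rfl hne
  · have h3 := (hle x (by simp)).1
    have h1' : (t : EReal) ≤ x.l := h₁
    have h2' : x.r ≤ t := h₂
    have e1 : x.l = t := le_antisymm (h3.trans h2') h1'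
    have e2 : x.r = t := le_antisymm h2' (h1'.trans h3)
    rw [← congrArg₂ Arc.mk e1 e2]
  · exfalso
    have h3 := isChain_arcs_le (fun z hz => (hle z hz).1) hc
    have h4 := (h3 x (by simp)).1
    have h5 := (h3 y (by simp)).2
    have h6 := (List.isChain_cons_cons.1 hc).1
    have h7 := (hle x (by simp)).1
    have h8 := (hle y (by simp)).1
    exact absurd (h₁.trans (h4.trans h7)) (not_le.2 (h6.trans_le (h8.trans (h5.trans h₂))))

section average

variable {f : ℝ → ℝ} {κ₀ ε : ℝ} {l r : Side} {A : List Arc} {σ : ℝ}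

theorem IsFigure.eq_of_point (hε : 0 < ε) (h : IsFigure f ε l r A σ) {t : ℝ} (hA : A = [⟨t, t⟩])
    (h' : ¬ (l = .right ∧ r = .left)) : deriv (deriv f) t = σ := by
  by_cases hlr : l = r
  · exact ((h.single hlr _ hA rfl).2).symm
  · rcases l.eq_or with hl | hl <;> rcases r.eq_or with hr | hr
    · exact absurd (hl.trans hr.symm) hlr
    · exact (h.not_long_single hε hl hr hA rfl).elim
    · exact absurd ⟨hl, hr⟩ h'
    · exact absurd (hl.trans hr.symm) hlr

/-- This identifies the initial value of the force with the slope of the figure. The only problem is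
a degenerate chord, where the average is `f''`: it occurs for a single point, whose slope is `f''`
by assumption on figures that emit right tangents to the right, and for a ray. -/
theorem IsFigure.dslope_right (hf : IsBoundary f κ₀) (hε : 0 < ε) (h : IsFigure f ε l r A σ)
    (hr : r = .right) {b : ℝ} (hb : rightEnd A = b) : dslope (deriv f) (leftPoint A) b = σ := by
  obtain ⟨hne, hle, hc⟩ := h.ordered
  have hbA : b ∈ arcPoints A := by
    rcases List.eq_nil_or_concat A with rfl | ⟨xs, x, rfl⟩
    · exact absurd rfl hne
    rw [List.concat_eq_append] at hb hle ⊢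
    rw [rightEnd_append] at hb
    exact mem_arcPoints_last (hb ▸ (hle x (by simp)).1) hb.ge
  rcases A with _ | ⟨x, xs⟩
  · exact absurd rfl hne
  have hx := hle x (by simp)
  have hxb : x.r ≤ b := hb ▸ (isChain_arcs_le (fun z hz => (hle z hz).1) hc x (by simp)).2
  have hxr : x.r = (x.r.toReal : ℝ) :=
    (EReal.coe_toReal (ne_top_of_le_ne_top (EReal.coe_ne_top b) hxb) hx.2.2).symm
  by_cases hxl : x.l = ⊥
  · have hp : leftPoint (x :: xs) = x.r.toReal := if_pos hxl
    rw [hp]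
    -- If the chord degenerates here, the first arc is the ray that ends at `b`, and `f'` is affine
    -- with slope `σ` on it; any point to the left of `b`, such as `b - 1`, lets the one-sided
    -- derivative be computed.
    refine h.linear.dslope_eq (mem_arcPoints_head (by simp [hxl]) hxr.ge) hbA fun he => ?_
    refine h.linear.secondDeriv_eq (hf.hasDerivAt_deriv b) (y := b - 1) (sub_one_lt b).ne' fun t ht => ?_
    refine mem_arcPoints_head (by simp [hxl]) ?_
    rw [uIcc_of_ge (by linarith)] at ht
    rw [hxr, he]; exact_mod_cast ht.2
  · have hp : leftPoint (x :: xs) = x.l.toReal := if_neg hxl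
    have hxl' : x.l = (x.l.toReal : ℝ) := (EReal.coe_toReal hx.2.1 hxl).symm
    rw [hp]
    refine h.linear.dslope_eq (mem_arcPoints_head hxl'.le (hxl' ▸ hx.1)) hbA fun he => ?_
    refine h.eq_of_point hε (h.ordered.exists_of_eq (t := b) ?_ hb.le) (by simp [hr])
    exact (hxl'.trans (congrArg _ he)).ge

theorem IsFigure.dslope_left (hf : IsBoundary f κ₀) (hε : 0 < ε) (h : IsFigure f ε l r A σ)
    (hl : l = .left) {a : ℝ} (ha : leftEnd A = a) : dslope (deriv f) a (rightPoint A) = σ := by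
  obtain ⟨hne, hle, hc⟩ := h.ordered
  have haA : a ∈ arcPoints A := by
    rcases A with _ | ⟨x, xs⟩
    · exact absurd rfl hne
    have ha' : x.l = a := ha
    exact mem_arcPoints_head ha'.le (ha' ▸ (hle x (by simp)).1)
  rcases List.eq_nil_or_concat A with rfl | ⟨xs, x, rfl⟩
  · exact absurd rfl hne
  rw [List.concat_eq_append] at *
  have hx := hle x (by simp)
  have hxa : a ≤ x.l := ha ▸ (isChain_arcs_le (fun z hz => (hle z hz).1) hc x (by simp)).1
  have hxl : x.l = (x.l.toReal : ℝ) :=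
    (EReal.coe_toReal hx.2.1 (ne_bot_of_le_ne_bot (EReal.coe_ne_bot a) hxa)).symm
  rw [rightPoint_append]
  by_cases hxr : x.r = ⊤
  · rw [if_pos hxr]
    refine h.linear.dslope_eq haA (mem_arcPoints_last hxl.le (by simp [hxr])) fun he => ?_
    rw [← he]
    refine h.linear.secondDeriv_eq (hf.hasDerivAt_deriv a) (y := a + 1) (by simp) fun t ht => ?_
    refine mem_arcPoints_last ?_ (by simp [hxr])
    rw [uIcc_of_le (by linarith)] at ht
    rw [hxl, ← he]; exact_mod_cast ht.1
  · have hxr' : x.r = (x.r.toReal : ℝ) := (EReal.coe_toReal hxr hx.2.2).symm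
    rw [if_neg hxr]
    refine h.linear.dslope_eq haA (mem_arcPoints_last (hxr' ▸ hx.1) hxr'.ge) fun he => ?_
    rw [← he]
    refine h.eq_of_point hε (h.ordered.exists_of_eq (t := a) ha.ge ?_) (by simp [hl])
    rw [rightEnd_append, hxr', ← he]

end average

theorem hasDerivAt_rightSlope_coe {g : ℝ → ℝ} (hg : Continuous g) (κ p σ u : ℝ) :
    HasDerivAt (rightSlope g κ p σ) (κ * (g u - rightSlope g κ p σ u)) u := by
  have : rightSlope g κ p σ = slopeFrom g κ p σ := by ext; simp [rightSlope]
  rw [this]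
  exact hasDerivAt_slopeFrom hg κ p σ u

/-! ### Roots at the ends of chords -/

/-- Piecewise monotonicity leaves two cases. A decrease up to the end is impossible by
`IsChordCurve.not_antitoneOn`; if `g` increases but takes its final value earlier, it is constant
from there on, which is the excluded case again. -/
theorem IsChordCurve.strict_left {g b A : ℝ → ℝ} {l₁ l₂ : ℝ} (h : IsChordCurve g b A l₁ l₂)
    (hl₁ : 0 ≤ l₁) (hl : l₁ < l₂) (hA : A l₂ = g (b l₂))
    (hm : ∃ x < b l₂, MonotoneOn g (Icc x (b l₂)) ∨ AntitoneOn g (Icc x (b l₂))) :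
    ∃ x < b l₂, MonotoneOn g (Icc x (b l₂)) ∧ ∀ t ∈ Ico x (b l₂), g t < g (b l₂) := by
  obtain ⟨x, hx, hm | hm⟩ := hm
  · refine ⟨x, hx, hm, fun t ht => lt_of_not_ge fun hge => ?_⟩
    refine h.not_antitoneOn hl₁ hl hA ht.2 fun y hy z hz hyz => ?_
    have h1 := hm ⟨ht.1.trans hz.1, hz.2⟩ (right_mem_Icc.2 hx.le) hz.2
    have h2 := hm (Ico_subset_Icc_self ht) ⟨ht.1.trans hy.1, hy.2⟩ hy.1
    exact h1.trans (hge.trans h2)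
  · exact absurd hm (h.not_antitoneOn hl₁ hl hA hx)

/-- The solution `N` starts at the value `g y` and strictly falls while `g < N`, so it drags `g`
below `g y`. This excludes the increasing alternative. -/
theorem strict_right_of_slope {g N : ℝ → ℝ} {κ y : ℝ} {q : EReal} (hκ : 0 < κ)
    (hN : ∀ u, HasDerivAt N (κ * (g u - N u)) u) (hy : N y = g y) (hq : y < q)
    (hlt : ∀ u : ℝ, y < u → u < q → g u < N u)
    (hm : ∃ x > y, MonotoneOn g (Icc y x) ∨ AntitoneOn g (Icc y x)) :
    ∃ x > y, AntitoneOn g (Icc y x) ∧ ∀ t ∈ Ioc y x, g t < g y := by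
  obtain ⟨x, hx, hm⟩ := hm
  obtain ⟨z, hz1, hz2⟩ := EReal.lt_iff_exists_real_btwn.1
    (lt_min hq (EReal.coe_lt_coe_iff.2 hx))
  have hyz : y < z := EReal.coe_lt_coe_iff.1 hz1
  have hzq := hz2.trans_le (min_le_left _ _)
  have hzx : z < x := EReal.coe_lt_coe_iff.1 (hz2.trans_le (min_le_right _ _))
  have hlt' : ∀ u ∈ Ioc y z, g u < N u := fun u hu =>
    hlt u hu.1 ((EReal.coe_le_coe_iff.2 hu.2).trans_lt hzq)
  have hanti : StrictAntiOn N (Icc y z) :=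
    strictAntiOn_of_hasDerivWithinAt_neg (convex_Icc y z)
      (fun u _ => (hN u).continuousAt.continuousWithinAt)
      (fun u _ => (hN u).hasDerivWithinAt) fun u hu => by
        rw [interior_Icc] at hu
        exact mul_neg_of_pos_of_neg hκ (sub_neg.2 (hlt' u (Ioo_subset_Ioc_self hu)))
  have hlt2 : ∀ u ∈ Ioc y z, g u < g y := fun u hu => (hlt' u hu).trans
    (hy ▸ hanti (left_mem_Icc.2 hyz.le) (Ioc_subset_Icc_self hu) hu.1)
  refine ⟨z, hyz, ?_, hlt2⟩
  rcases hm with hm | hm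
  · exact absurd (hm (left_mem_Icc.2 hx.le) ⟨hyz.le, hzx.le⟩ hyz.le)
      (not_le.2 (hlt2 z (right_mem_Ioc.2 hyz)))
  · exact hm.mono (Icc_subset_Icc_right hzx.le)

theorem antitoneOn_comp_neg {g : ℝ → ℝ} {a b : ℝ} (h : AntitoneOn (fun t => g (-t)) (Icc a b)) :
    MonotoneOn g (Icc (-b) (-a)) := fun x hx y hy hxy => by
  have := h (a := -y) (b := -x) ⟨by linarith [hy.2], by linarith [hy.1]⟩
    ⟨by linarith [hx.2], by linarith [hx.1]⟩ (by linarith)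
  simpa using this

theorem monotoneOn_comp_neg {g : ℝ → ℝ} {a b : ℝ} (h : MonotoneOn (fun t => g (-t)) (Icc a b)) :
    AntitoneOn g (Icc (-b) (-a)) := fun x hx y hy hxy => by
  have := h (a := -y) (b := -x) ⟨by linarith [hy.2], by linarith [hy.1]⟩
    ⟨by linarith [hx.2], by linarith [hx.1]⟩ (by linarith)
  simpa using this

theorem antitoneOn_comp_neg' {g : ℝ → ℝ} {a b : ℝ} (h : AntitoneOn g (Icc a b)) :
    MonotoneOn (fun t => g (-t)) (Icc (-b) (-a)) :=
  antitoneOn_comp_neg (g := fun t => g (-t)) (by simpa using h)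

theorem monotoneOn_comp_neg' {g : ℝ → ℝ} {a b : ℝ} (h : MonotoneOn g (Icc a b)) :
    AntitoneOn (fun t => g (-t)) (Icc (-b) (-a)) :=
  monotoneOn_comp_neg (g := fun t => g (-t)) (by simpa using h)

theorem isPlusMinusRoot_point {f : ℝ → ℝ} {t : ℝ}
    (h₁ : ∃ x < t, MonotoneOn (deriv (deriv f)) (Icc x t) ∧
      ∀ s ∈ Ico x t, deriv (deriv f) s < deriv (deriv f) t)
    (h₂ : ∃ x > t, AntitoneOn (deriv (deriv f)) (Icc t x) ∧
      ∀ s ∈ Ioc t x, deriv (deriv f) s < deriv (deriv f) t) :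
    IsPlusMinusRoot f (Arc.point t) := by
  refine ⟨le_rfl, EReal.coe_ne_top t, EReal.coe_ne_bot t, fun x hx y hy => ?_, Or.inr h₁,
    Or.inr h₂⟩
  have h3 : ∀ z ∈ (Arc.point t).carrier, z = t := fun z hz =>
    le_antisymm (EReal.coe_le_coe_iff.1 hz.2) (EReal.coe_le_coe_iff.1 hz.1)
  rw [h3 x hx, h3 y hy]

/-- The chordal domain under the chord supplies the behaviour of `f''` on the left of the end, and
the tangents that leave the chord supply it on the right. -/
theorem rightRoot_of_chord {f : ℝ → ℝ} {κ₀ ε : ℝ} (hf : IsBoundary f κ₀) (hε : 0 < ε)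
    {a b l₀ l₁ : _} (h : IsChordFamily f a b l₀ l₁) (hl : l₀ < l₁) {q : EReal} {σ : ℝ}
    (hq : b l₁ < q) (he : RightEdge (deriv (deriv f)) ε⁻¹ (b l₁) (dslope (deriv f) (a l₁) (b l₁)) q σ)
    (hD : DR f (a l₁) (b l₁) = 0) : IsPlusMinusRoot f (Arc.point (b l₁)) := by
  have hD' : dslope (deriv f) (a l₁) (b l₁) = deriv (deriv f) (b l₁) := (sub_eq_zero.1 hD).symm
  refine isPlusMinusRoot_point ((h.chordCurve_right hf).strict_left h.nonneg hl hD'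
    (hf.monotone_left _)) ?_
  refine strict_right_of_slope (inv_pos.2 hε) (fun u => ?_) ((rightSlope_self _ _ _ _).trans hD')
    hq (fun u hu => he.1 u (EReal.coe_lt_coe_iff.2 hu)) (hf.monotone_right _)
  exact hasDerivAt_rightSlope_coe hf.continuous_secondDeriv _ _ _ u

theorem leftRoot_of_chord {f : ℝ → ℝ} {κ₀ ε : ℝ} (hf : IsBoundary f κ₀) (hε : 0 < ε)
    {a b l₀ l₁ : _} (h : IsChordFamily f a b l₀ l₁) (hl : l₀ < l₁) {p : EReal} {σ : ℝ}
    (hp : p < a l₁) (he : LeftEdge (deriv (deriv f)) ε⁻¹ p σ (a l₁) (dslope (deriv f) (a l₁) (b l₁)))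
    (hD : DL f (a l₁) (b l₁) = 0) : IsPlusMinusRoot f (Arc.point (a l₁)) := by
  have hD' : dslope (deriv f) (a l₁) (b l₁) = deriv (deriv f) (a l₁) := (sub_eq_zero.1 hD).symm
  have hmr : ∃ x > -a l₁, MonotoneOn (fun t => deriv (deriv f) (-t)) (Icc (-a l₁) x) ∨
      AntitoneOn (fun t => deriv (deriv f) (-t)) (Icc (-a l₁) x) := by
    obtain ⟨x, hx, hm⟩ := hf.monotone_left (a l₁)
    refine ⟨-x, neg_lt_neg hx, hm.symm.imp antitoneOn_comp_neg' monotoneOn_comp_neg'⟩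
  have hml : ∃ x < -a l₁, MonotoneOn (fun t => deriv (deriv f) (-t)) (Icc x (-a l₁)) ∨
      AntitoneOn (fun t => deriv (deriv f) (-t)) (Icc x (-a l₁)) := by
    obtain ⟨x, hx, hm⟩ := hf.monotone_right (a l₁)
    refine ⟨-x, neg_lt_neg hx, hm.symm.imp antitoneOn_comp_neg' monotoneOn_comp_neg'⟩
  refine isPlusMinusRoot_point ?_ ?_
  · have hc : Continuous fun t => deriv (deriv f) (-t) :=
      hf.continuous_secondDeriv.comp continuous_neg
    have hlt : ∀ u : ℝ, -a l₁ < u → (u : EReal) < -p → deriv (deriv f) (-u) <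
        rightSlope (fun t => deriv (deriv f) (-t)) ε⁻¹ ((-a l₁ : ℝ) : EReal)
          (dslope (deriv f) (a l₁) (b l₁)) u := by
      intro u hu1 hu2
      have h3 := he.1 (-u) (by rw [EReal.coe_neg]; exact EReal.lt_neg_comm.1 hu2)
        (by exact_mod_cast (neg_lt.1 hu1))
      rw [leftSlope, neg_neg, ← EReal.coe_neg] at h3
      exact h3
    obtain ⟨x, hx, h1, h2⟩ := strict_right_of_slope (inv_pos.2 hε)
      (hasDerivAt_rightSlope_coe hc _ _ _) (by rw [rightSlope_self, hD', neg_neg])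
      (by rw [EReal.coe_neg]; exact EReal.neg_lt_neg_iff.2 hp) hlt hmr
    refine ⟨-x, by linarith, by simpa using antitoneOn_comp_neg h1, fun s hs => ?_⟩
    have := h2 (-s) ⟨by linarith [hs.2], by linarith [hs.1]⟩
    simpa using this
  · have hc := h.chordCurve_left hf
    obtain ⟨x, hx, h1, h2⟩ := hc.strict_left h.nonneg hl (by simpa using hD') hml
    refine ⟨-x, by linarith, by simpa using monotoneOn_comp_neg h1, fun s hs => ?_⟩
    have := h2 (-s) ⟨by linarith [hs.2], by linarith [hs.1]⟩
    simpa using this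

/-! ### Admissibility of a chain of blocks -/

section vertex

variable {f : ℝ → ℝ} {κ₀ ε : ℝ} {b b' : Block}

theorem kindOfShape_not_infinity (f : ℝ → ℝ) (l r : Side) {A : List Arc} (h₁ : A ≠ [⟨⊥, ⊥⟩])
    (h₂ : A ≠ [⟨⊤, ⊤⟩]) :
    (∀ s, kindOfShape f l r A ≠ .negInfinity s) ∧ ∀ s, kindOfShape f l r A ≠ .posInfinity s := by
  rcases kindOfShape_cases f l r h₁ h₂ with ⟨h, -⟩ | ⟨s, h, -⟩ | ⟨h, -⟩ | ⟨s, h, -⟩ |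
    ⟨h | h, -⟩ | ⟨h, -⟩ | ⟨s, h, -⟩ | ⟨h, -⟩ <;> simp [h]

theorem Block.IsGood.rightEnd_eq_bot (h : b.IsGood f ε) :
    (b.vertex f).rightEnd = ⊥ ↔ ∃ s, (b.vertex f).kind = .negInfinity s := by
  simp only [FreeVertex.rightEnd, Block.vertex]
  rcases h.figure with hb | hb | hb
  · rw [hb, kindOfShape_bot]; simp [rightEnd]
  · rw [hb, kindOfShape_top]; simp [rightEnd]
  · obtain ⟨h1, h2⟩ := hb.ne_infinity
    simp [hb.ordered.right_ne_bot, (kindOfShape_not_infinity f b.l b.r h1 h2).1]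

theorem Block.IsGood.leftEnd_eq_top (h : b.IsGood f ε) :
    (b.vertex f).leftEnd = ⊤ ↔ ∃ s, (b.vertex f).kind = .posInfinity s := by
  simp only [FreeVertex.leftEnd, Block.vertex]
  rcases h.figure with hb | hb | hb
  · rw [hb, kindOfShape_bot]; simp [leftEnd]
  · rw [hb, kindOfShape_top]; simp [leftEnd]
  · obtain ⟨h1, h2⟩ := hb.ne_infinity
    simp [hb.ordered.left_ne_top, (kindOfShape_not_infinity f b.l b.r h1 h2).2]

theorem Block.IsGood.isLinearity (h : b.IsGood f ε) : IsLinearity f b.arcs b.slope := by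
  rcases h.figure with hb | hb | hb
  · rintro x ⟨y, hy, h1, h2⟩
    rw [hb] at hy
    simp only [List.mem_singleton] at hy
    subst hy
    simp at h2
  · rintro x ⟨y, hy, h1, h2⟩
    rw [hb] at hy
    simp only [List.mem_singleton] at hy
    subst hy
    simp at h1
  · exact hb.linear

theorem Block.IsGood.isAdmissible (h : b.IsGood f ε) : (b.vertex f).IsAdmissible f ε := by
  refine ⟨kindOfShape_eq f b.l b.r b.arcs, h.wired, h.gaps, ?_⟩
  simp only [Block.vertex, FreeVertex.leftEnd, FreeVertex.rightEnd]
  rcases h.figure with hb | hb | hb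
  · rw [hb, kindOfShape_bot]; trivial
  · rw [hb, kindOfShape_top]; trivial
  obtain ⟨h1, h2⟩ := hb.ne_infinity
  have hl : b.l = .right → leftEnd b.arcs ≠ ⊥ := fun h e => by
    rw [hb.left_infinite e] at h; exact Side.noConfusion h
  have hr : b.r = .left → rightEnd b.arcs ≠ ⊤ := fun h e => by
    rw [hb.right_infinite e] at h; exact Side.noConfusion h
  have hpt : ∀ x ∈ b.arcs, x.l = x.r → x.l ≠ ⊥ ∧ x.r ≠ ⊤ := fun x hx e =>
    ⟨e ▸ (hb.ordered.2.1 x hx).2.2, e ▸ (hb.ordered.2.1 x hx).2.1⟩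
  rcases kindOfShape_cases f b.l b.r h1 h2 with ⟨h, hl', hr', -⟩ | ⟨s, h, -, -, x, hA, hx⟩ |
    ⟨h, hl', hr', -⟩ | ⟨s, h, -, -, x, y, hA, hx, hy⟩ | ⟨h, hl', hr', x, y, hA, hx, hy⟩ |
    ⟨h, hl', hr'⟩ | ⟨s, h, hl', hr'⟩ | ⟨h, hl', hr', -⟩
  · rw [h]; exact ⟨hb.ordered, hl hl', hr hr'⟩
  · rw [h]
    have := hpt x (by simp [hA]) hx
    exact ⟨hb.ordered, by rw [hA]; exact this.1, by rw [hA]; exact this.2⟩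
  · rw [h]; exact ⟨hb.ordered, hl hl', hr hr'⟩
  · rw [h]
    exact ⟨hb.ordered, by rw [hA]; exact (hpt x (by simp [hA]) hx).1,
      by rw [hA]; exact (hpt y (by simp [hA]) hy).2⟩
  · have h3 : leftEnd b.arcs ≠ ⊥ := by rw [hA]; exact (hpt x (by simp [hA]) hx).1
    have h4 : rightEnd b.arcs ≠ ⊤ := by rw [hA]; exact (hpt y (by simp [hA]) hy).2
    have h5 : (hull b.arcs).2 - (hull b.arcs).1 = 2 * ε := by
      rw [hA]; exact hb.long_chord hl' hr' x y hA hx hy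
    rcases h with h | h <;> rw [h] <;> exact ⟨hb.ordered, h3, h4, h5⟩
  · rw [h]; exact ⟨hb.ordered, hl hl', hr hr'⟩
  · rw [h]
    cases s
    · exact ⟨hb.ordered, hl hl'⟩
    · exact ⟨hb.ordered, hr hr'⟩
  · rw [h]; exact ⟨hb.ordered, hb.long hl' hr'⟩

theorem Block.Linked.rightSide (h : b.Linked (deriv (deriv f)) ε⁻¹ b') :
    (b.vertex f).kind.rightSide = b.r :=
  kindOfShape_rightSide' f b.l b.r fun e => h.ne_top (by rw [e]; rfl)

theorem Block.Linked.leftSide (h : b.Linked (deriv (deriv f)) ε⁻¹ b') :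
    (b'.vertex f).kind.leftSide = b'.l :=
  kindOfShape_leftSide' f b'.l b'.r fun e => h.ne_bot (by rw [e]; rfl)

theorem Block.Linked.exists_slope (hf : IsBoundary f κ₀) (hε : 0 < ε) (hκ : κ₀ < ε⁻¹)
    (hb : b.IsGood f ε) (hb' : b'.IsGood f ε) (h : b.Linked (deriv (deriv f)) ε⁻¹ b') :
    ∃ m : ℝ → ℝ, match (b.vertex f).kind.rightSide with
      | .right => IsRightSlope f ε (b.vertex f) (b'.vertex f) (b.slope / 2) (b'.slope / 2) m
      | .left => IsLeftSlope f ε (b.vertex f) (b'.vertex f) (b.slope / 2) (b'.slope / 2) m := by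
  have e1 : 2 * (b.slope / 2) = b.slope := by ring
  have e2 : 2 * (b'.slope / 2) = b'.slope := by ring
  rw [h.rightSide]
  rcases b.r.eq_or with hs | hs
  · rw [hs]
    refine ⟨_, LeftEdge.isLeftSlope hf hε hκ ?_ hb'.leftEnd_eq_top h.ne_bot
      hb.rightEnd_eq_bot.1 h.ne_top⟩
    rw [e1, e2]; exact h.left hs
  · rw [hs]
    refine ⟨_, RightEdge.isRightSlope hf hε hκ ?_ hb.rightEnd_eq_bot h.ne_top
      hb'.leftEnd_eq_top.1 h.ne_bot⟩
    rw [e1, e2]; exact h.right hs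

/-- The force is the difference of `g` and the slope, so the edge inequality fixes its sign on the
whole domain; the far end of the domain then competes in the extremum that defines the tail. -/
theorem Block.Linked.force (hf : IsBoundary f κ₀) (hε : 0 < ε) (hκ : κ₀ < ε⁻¹)
    (hb : b.IsGood f ε) (hb' : b'.IsGood f ε) (h : b.Linked (deriv (deriv f)) ε⁻¹ b')
    (hlt : rightEnd b.arcs < leftEnd b'.arcs) :
    match (b.vertex f).kind.rightSide with
    | .right => {u : ℝ | (b.vertex f).rightEnd < u ∧ (u : EReal) < (b'.vertex f).leftEnd} ⊆
        rightTail ((b.vertex f).forceR f ε) (b.vertex f).rightEnd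
    | .left => {u : ℝ | (b.vertex f).rightEnd < u ∧ (u : EReal) < (b'.vertex f).leftEnd} ⊆
        leftTail ((b'.vertex f).forceL f ε) (b'.vertex f).leftEnd := by
  rw [h.rightSide]
  rcases b.r.eq_or with hs | hs
  · rw [hs]
    have hF : ∀ u : ℝ, rightEnd b.arcs < u → (u : EReal) < leftEnd b'.arcs →
        0 < (b'.vertex f).forceL f ε u := by
      intro u hu1 hu2
      have h1 := (h.left hs).1 u hu1 hu2
      by_cases hbot : leftEnd b'.arcs = ⊤
      · obtain ⟨s, hs⟩ := hb'.leftEnd_eq_top.1 hbot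
        rw [FreeVertex.forceL, hs]
        rw [hbot] at h1
        simp only
        rw [hf.forceLInfinity_eq hκ b'.slope]
        linarith
      · obtain ⟨t, ht⟩ : ∃ t : ℝ, leftEnd b'.arcs = t := ⟨_, (EReal.coe_toReal hbot h.ne_bot).symm⟩
        have h2 := hb'.figure_of_left ht
        have h3 : (b'.vertex f).forceL f ε = BMOFoliation.forceL f ε t (rightPoint b'.arcs) := by
          have h4 : ∀ s, (b'.vertex f).kind ≠ .posInfinity s := by
            obtain ⟨h5, h6⟩ := h2.ne_infinity
            exact (kindOfShape_not_infinity f b'.l b'.r h5 h6).2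
          rw [FreeVertex.forceL]
          have h7 : (b'.vertex f).leftEnd = t := ht
          split
          · rename_i s h8; exact absurd h8 (h4 s)
          · rw [h7]; rfl
        rw [ht] at h1 hu2
        rw [h3, hf.forceL_eq (EReal.coe_lt_coe_iff.1 hu2).le,
          h2.dslope_left hf hε (h.side ▸ hs) ht]
        linarith
    rintro u ⟨hu1, hu2⟩
    have h1 : sInf {t : EReal | t < leftEnd b'.arcs ∧ ∀ s : ℝ, t < s →
        (s : EReal) < leftEnd b'.arcs → 0 < (b'.vertex f).forceL f ε s} ≤ rightEnd b.arcs :=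
      sInf_le ⟨hlt, hF⟩
    exact ⟨h1.trans_lt hu1, hu2⟩
  · rw [hs]
    have hF : ∀ u : ℝ, rightEnd b.arcs < u → (u : EReal) < leftEnd b'.arcs →
        (b.vertex f).forceR f ε u < 0 := by
      intro u hu1 hu2
      have h1 := (h.right hs).1 u hu1 hu2
      by_cases hbot : rightEnd b.arcs = ⊥
      · obtain ⟨s, hs⟩ := hb.rightEnd_eq_bot.1 hbot
        rw [FreeVertex.forceR, hs]
        rw [hbot] at h1
        simp only
        rw [hf.forceRInfinity_eq hκ b.slope]
        linarith
      · obtain ⟨t, ht⟩ : ∃ t : ℝ, rightEnd b.arcs = t := ⟨_, (EReal.coe_toReal h.ne_top hbot).symm⟩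
        have h2 := hb.figure_of_right ht
        have h3 : (b.vertex f).forceR f ε = BMOFoliation.forceR f ε (leftPoint b.arcs) t := by
          have h4 : ∀ s, (b.vertex f).kind ≠ .negInfinity s := by
            obtain ⟨h5, h6⟩ := h2.ne_infinity
            exact (kindOfShape_not_infinity f b.l b.r h5 h6).1
          rw [FreeVertex.forceR]
          have h7 : (b.vertex f).rightEnd = t := ht
          split
          · rename_i s h8; exact absurd h8 (h4 s)
          · rw [h7]; rfl
        rw [ht] at h1 hu1
        rw [h3, hf.forceR_eq (EReal.coe_lt_coe_iff.1 hu1).le, h2.dslope_right hf hε hs ht]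
        linarith
    rintro u ⟨hu1, hu2⟩
    exact ⟨hu1, hu2.trans_le (le_sSup ⟨hlt, hF⟩)⟩

end vertex

section chain

variable {f : ℝ → ℝ} {κ₀ ε : ℝ}

/-- The leaf-root condition for a free vertex. -/
def FreeVertex.LeafRoot (f : ℝ → ℝ) (v : FreeVertex) : Prop :=
  match v.kind with
  | .multicup => SolidArcsAreRoots f v.arcs
  | .multitrolleybus _ => SolidArcsAreRoots f v.arcs
  | .multibirdie => SolidArcsAreRoots f v.arcs
  | .thirdType => DegenerateEndsAreRoots f (hull v.arcs)
  | .fifthType _ => IsPlusMinusRoot f (Arc.point v.leftEnd.toReal)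
  | _ => True

/-- A long chord between two tangent domains with vanishing differentials only at roots. -/
theorem Block.IsGood.degenerateEndsAreRoots (hf : IsBoundary f κ₀) (hε : 0 < ε) {b b₁ b₂ : Block}
    (h : b.IsGood f ε) (h₁ : b₁.Linked (deriv (deriv f)) ε⁻¹ b)
    (h₁' : rightEnd b₁.arcs < leftEnd b.arcs) (h₂ : b.Linked (deriv (deriv f)) ε⁻¹ b₂)
    (h₂' : rightEnd b.arcs < leftEnd b₂.arcs) (hl : b.l = .left) (hr : b.r = .right) {x y : Arc}
    (hA : b.arcs = [x, y]) (hx : x.l = x.r) (hy : y.l = y.r) :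
    DegenerateEndsAreRoots f (hull b.arcs) := by
  have hw := h.wired
  rw [hA] at hw
  obtain ⟨C, hC⟩ : ∃ C : Branch, IsChordalDomain f C.chords (x.r.toReal, y.l.toReal)
      (hull C.arcs) := by
    obtain ⟨C, -, hC, -⟩ := List.forall₂_cons_left_iff.1 hw
    exact ⟨C, hC⟩
  obtain ⟨a, c, l₀, l₁, hfam, hlt, htop, -, -⟩ := isChordalDomain_iff.1 hC
  obtain ⟨e1, e2⟩ := Prod.mk.inj htop
  have hfig : IsFigure f ε b.l b.r b.arcs b.slope := by
    rcases h.figure with h | h | h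
    · simp [hA] at h
    · simp [hA] at h
    · exact h
  have hox := hfig.ordered.2.1 x (by simp [hA])
  have hoy := hfig.ordered.2.1 y (by simp [hA])
  have hxa : leftEnd b.arcs = (a l₁ : ℝ) := by
    rw [← e1, hA]
    exact hx.trans (EReal.coe_toReal (hx ▸ hox.2.1) hox.2.2).symm
  have hyc : rightEnd b.arcs = (c l₁ : ℝ) := by
    rw [← e2, hA]
    exact hy.symm.trans (EReal.coe_toReal hoy.2.1 (hy ▸ hoy.2.2)).symm
  have hhull : hull b.arcs = (a l₁, c l₁) := by simp [hull, hxa, hyc]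
  have hσ : dslope (deriv f) (a l₁) (c l₁) = b.slope := by
    have := hfig.dslope_right hf hε hr hyc
    rwa [hA, leftPoint, if_neg (by rw [hx]; exact hox.2.2), hx, e1] at this
  have hR := h₂.right hr
  have hL := h₁.left (h₁.side.trans hl)
  rw [hyc, ← hσ] at hR
  rw [hxa, ← hσ] at hL
  rw [hyc] at h₂'
  rw [hxa] at h₁'
  rw [hhull]
  exact ⟨rightRoot_of_chord hf hε hfam hlt h₂' hR, leftRoot_of_chord hf hε hfam hlt h₁' hL⟩

/-- This reduces the theorem to a chain of good linked blocks without zero distances. The numbers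
`β` are half of the block slopes, and the forces and slope coefficients both come from the edge
inequalities. -/
theorem blocks_good (hf : IsBoundary f κ₀) (hε : 0 < ε) (hκ : κ₀ < ε⁻¹) {bs : List Block}
    (hgood : ∀ b ∈ bs, b.IsGood f ε)
    (hchain : bs.IsChain fun b w =>
      b.Linked (deriv (deriv f)) ε⁻¹ w ∧ rightEnd b.arcs < leftEnd w.arcs)
    (hhead : ∃ b, bs.head? = some b ∧ leftEnd b.arcs = ⊥)
    (hlast : ∃ b, bs.getLast? = some b ∧ rightEnd b.arcs = ⊤) :
    IsAdmissible f ε (bs.map (Block.vertex f)) ∧ NonDegeneracyForce f ε (bs.map (Block.vertex f)) ∧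
      LeafRoot f (bs.map (Block.vertex f)) := by
  have hN : ∀ i v w, Neighbours (bs.map (Block.vertex f)) i v w → ∃ b b', bs[i]? = some b ∧
      bs[i + 1]? = some b' ∧ v = b.vertex f ∧ w = b'.vertex f ∧ b.IsGood f ε ∧ b'.IsGood f ε ∧
      b.Linked (deriv (deriv f)) ε⁻¹ b' ∧ rightEnd b.arcs < leftEnd b'.arcs := by
    rintro i v w ⟨hv, hw⟩
    rw [List.getElem?_map, Option.map_eq_some_iff] at hv hw
    obtain ⟨b, hb, rfl⟩ := hv
    obtain ⟨b', hb', rfl⟩ := hw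
    obtain ⟨h1, h2⟩ := List.getElem?_eq_some_iff.1 hb
    obtain ⟨h3, h4⟩ := List.getElem?_eq_some_iff.1 hb'
    have h5 := List.isChain_iff_getElem.1 hchain i h3
    rw [h2, h4] at h5
    exact ⟨b, b', hb, hb', rfl, rfl, hgood b (List.mem_of_getElem? hb),
      hgood b' (List.mem_of_getElem? hb'), h5.1, h5.2⟩
  have hbr : ∀ c ∈ allBranches (bs.map (Block.vertex f)), c.IsAdmissible f ε ∧ c.LeafRoot f := by
    intro c hc
    simp only [allBranches, List.mem_flatMap, List.mem_map] at hc
    obtain ⟨v, ⟨b, hb, rfl⟩, hc⟩ := hc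
    exact (hgood b hb).branches c hc
  refine ⟨⟨hε, ⟨?_, ?_, ?_⟩, ?_, fun c hc => (hbr c hc).1, ?_⟩, ?_, ?_, fun c hc => (hbr c hc).2⟩
  · obtain ⟨b, h1, h2⟩ := hhead
    exact ⟨b.vertex f, by rw [List.head?_map, h1]; rfl, h2⟩
  · obtain ⟨b, h1, h2⟩ := hlast
    exact ⟨b.vertex f, by rw [List.getLast?_map, h1]; rfl, h2⟩
  · intro i v w h
    obtain ⟨b, b', -, -, rfl, rfl, -, -, h1, h2⟩ := hN i v w h
    exact ⟨h1.rightSide.trans (h1.side.trans h1.leftSide.symm), h2⟩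
  · intro v hv
    obtain ⟨b, hb, rfl⟩ := List.mem_map.1 hv
    exact (hgood b hb).isAdmissible
  · have hm : ∀ i, ∃ m : ℝ → ℝ, ∀ b b', bs[i]? = some b → bs[i + 1]? = some b' →
        match (b.vertex f).kind.rightSide with
        | .right => IsRightSlope f ε (b.vertex f) (b'.vertex f) (b.slope / 2) (b'.slope / 2) m
        | .left => IsLeftSlope f ε (b.vertex f) (b'.vertex f) (b.slope / 2) (b'.slope / 2) m := by
      intro i
      by_cases h : ∃ v w, Neighbours (bs.map (Block.vertex f)) i v w
      · obtain ⟨v, w, h⟩ := h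
        obtain ⟨b, b', hb, hb', -, -, h1, h2, h3, -⟩ := hN i v w h
        obtain ⟨m, hm⟩ := h3.exists_slope hf hε hκ h1 h2
        refine ⟨m, fun c c' hc hc' => ?_⟩
        rw [hb] at hc
        rw [hb'] at hc'
        cases hc
        cases hc'
        exact hm
      · refine ⟨0, fun b b' hb hb' => absurd ⟨b.vertex f, b'.vertex f, ?_, ?_⟩ h⟩
        · rw [List.getElem?_map, hb]; rfl
        · rw [List.getElem?_map, hb']; rfl
    choose m hm using hm
    -- The value `0` beyond the end of the list is never used.
    refine ⟨fun i => (bs[i]?.map fun b => b.slope / 2).getD 0, m, ?_, ?_⟩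
    · intro i v hv
      rw [List.getElem?_map, Option.map_eq_some_iff] at hv
      obtain ⟨b, hb, rfl⟩ := hv
      have hbg := hgood b (List.mem_of_getElem? hb)
      have e1 : 2 * (b.slope / 2) = b.slope := by ring
      simp only [hb, Option.map_some, Option.getD_some, e1]
      refine ⟨hbg.isLinearity, fun s hs => ?_⟩
      rcases hbg.figure with h | h | h
      · simp [Block.vertex, h, kindOfShape_bot] at hs
      · simp [Block.vertex, h, kindOfShape_top] at hs
      · obtain ⟨h1, h2⟩ := h.ne_infinity
        have hs' : kindOfShape f b.l b.r b.arcs = .fifthType s := hs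
        rcases kindOfShape_cases f b.l b.r h1 h2 with ⟨h', -⟩ | ⟨s', -, hl, hr, x, hA, hx⟩ |
          ⟨h', -⟩ | ⟨s', h', -⟩ | ⟨h' | h', -⟩ | ⟨h', -⟩ | ⟨s', h', -⟩ | ⟨h', -⟩
        · simp [h'] at hs'
        · rw [(h.single (hl.trans hr.symm) x hA hx).2]
          simp [FreeVertex.leftEnd, Block.vertex, hA, leftEnd]
        all_goals simp [h'] at hs'
    · intro i v w h
      obtain ⟨b, b', hb, hb', rfl, rfl, -⟩ := hN i v w h
      simp only [hb, hb', Option.map_some, Option.getD_some]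
      exact hm i b b' hb hb'
  · intro i v w h
    obtain ⟨b, b', -, -, rfl, rfl, h1, h2, h3, h4⟩ := hN i v w h
    exact h3.force hf hε hκ h1 h2 h4
  · intro v hv
    change v.LeafRoot f
    obtain ⟨b, hb, rfl⟩ := List.mem_map.1 hv
    have hbg := hgood b hb
    simp only [FreeVertex.LeafRoot, Block.vertex]
    rcases hbg.figure with h | h | h
    · rw [h, kindOfShape_bot]; trivial
    · rw [h, kindOfShape_top]; trivial
    obtain ⟨h1, h2⟩ := h.ne_infinity
    rcases kindOfShape_cases f b.l b.r h1 h2 with ⟨h', -⟩ | ⟨s', h', hl, hr, x, hA, hx⟩ |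
      ⟨h', -⟩ | ⟨s', h', -⟩ | ⟨h' | h', hl, hr, x, y, hA, hx, hy⟩ | ⟨h', -⟩ | ⟨s', h', -⟩ | ⟨h', -⟩
    · rw [h']; trivial
    · rw [h']
      simpa [FreeVertex.leftEnd, hA, leftEnd] using (h.single (hl.trans hr.symm) x hA hx).1
    · rw [h']; trivial
    · rw [h']; trivial
    · rw [h']
      simp only
      obtain ⟨i, hi, hbi⟩ := List.getElem_of_mem hb
      have hne : leftEnd b.arcs ≠ ⊥ := by
        rw [hA]; exact hx.trans_ne (h.ordered.2.1 x (by simp [hA])).2.2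
      have hne' : rightEnd b.arcs ≠ ⊤ := by
        rw [hA]; exact hy.symm.trans_ne (h.ordered.2.1 y (by simp [hA])).2.1
      -- A long chord has finite ends, whereas the extreme blocks reach infinity. So it has
      -- neighbours on both sides, and their tangents are needed for the roots at its ends.
      have hi0 : i ≠ 0 := by
        rintro rfl
        obtain ⟨c, h3, h4⟩ := hhead
        rw [List.head?_eq_getElem?, List.getElem?_eq_getElem hi, hbi] at h3
        cases h3
        exact hne h4
      have hi1 : i + 1 < bs.length := by
        by_contra hcon
        obtain ⟨c, h3, h4⟩ := hlast
        have h5 : bs.length - 1 = i := by omega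
        rw [List.getLast?_eq_getElem?, h5, List.getElem?_eq_getElem hi, hbi] at h3
        cases h3
        exact hne' h4
      obtain ⟨j, rfl⟩ := Nat.exists_eq_succ_of_ne_zero hi0
      have h3 := List.isChain_iff_getElem.1 hchain j hi
      have h4 := List.isChain_iff_getElem.1 hchain _ hi1
      simp only [Nat.succ_eq_add_one] at hbi
      rw [hbi] at h3
      rw [hbi] at h4
      exact hbg.degenerateEndsAreRoots hf hε h3.1 h3.2 h4.1 h4.2 hl hr hA hx hy
    · rw [h']; trivial
    · rw [h']; exact h.solid
    · rw [h']; exact h.solid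
    · rw [h']; exact h.solid

end chain

/-! ### Convergence of lists and of chordal domains -/

theorem ListConverges.nil {α : Type} {R : (ℕ → α) → α → Prop} :
    ListConverges R (fun _ => []) [] :=
  ⟨0, Fin.elim0, Fin.elim0, fun _ => by simp, by simp, fun i => i.elim0⟩

theorem ListConverges.cons {α : Type} {R : (ℕ → α) → α → Prop} {x : ℕ → α} {y : α}
    {xs : ℕ → List α} {ys : List α} (h : R x y) (hs : ListConverges R xs ys) :
    ListConverges R (fun n => x n :: xs n) (y :: ys) := by
  obtain ⟨m, p, q, h1, rfl, h3⟩ := hs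
  refine ⟨m + 1, Fin.cons x p, Fin.cons y q, fun n => ?_, by simp [List.ofFn_succ], fun i => ?_⟩
  · simp [List.ofFn_succ, h1]
  · refine Fin.cases ?_ (fun i => ?_) i
    · simpa using h
    · simpa using h3 i

theorem ListConverges.const {α : Type} {R : (ℕ → α) → α → Prop} (l : List α)
    (h : ∀ x ∈ l, R (fun _ => x) x) : ListConverges R (fun _ => l) l := by
  induction l with
  | nil => exact .nil
  | cons x xs ih => exact .cons (h x (by simp)) (ih fun y hy => h y (by simp [hy]))

theorem ArcConverges.const (x : Arc) : ArcConverges (fun _ => x) x :=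
  ⟨tendsto_const_nhds, tendsto_const_nhds⟩

theorem ArcConverges.point {t : ℕ → ℝ} {t' : ℝ} (h : Tendsto t atTop (𝓝 t')) :
    ArcConverges (fun n => ⟨t n, t n⟩) ⟨t', t'⟩ :=
  have := (continuous_coe_real_ereal.tendsto t').comp h
  ⟨this, this⟩

/-- The limit of a constant family of chords is its closure, hence the closedness assumption. -/
theorem BranchConverges.const (b : Branch) (h : IsClosed b.chords) :
    BranchConverges (fun _ => b) b := by
  cases b with
  | mk C k as bs =>
    refine ⟨fun _ => C, k, as, bs, fun _ => rfl, ?_⟩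
    congr 1
    ext p
    have h1 := mem_closure_iff_seq_limit (s := C) (a := p)
    rw [IsClosed.closure_eq (show IsClosed C from h)] at h1
    exact h1

-- Closedness, nesting and completion of chordal domains

theorem IsChordFamily.isCompact {f a b : ℝ → ℝ} {l₀ l₁ : ℝ} (h : IsChordFamily f a b l₀ l₁) :
    IsCompact ((fun l => (a l, b l)) '' Icc l₀ l₁) :=
  isCompact_Icc.image_of_continuousOn (h.continuousOn_left.prodMk h.continuousOn_right)

theorem IsChordalDomain.isClosed {f : ℝ → ℝ} {C : Set (ℝ × ℝ)} {top bot : ℝ × ℝ}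
    (h : IsChordalDomain f C top bot) : IsClosed C := by
  obtain ⟨a, b, l₀, l₁, h1, -, -, -, rfl⟩ := isChordalDomain_iff.1 h
  exact h1.isCompact.isClosed

theorem Wired.isClosed {f : ℝ → ℝ} {A : List Arc} {B : List Branch} (h : Wired f A B) :
    ∀ b ∈ B, IsClosed b.chords := by
  intro b hb
  have h1 : List.Forall₂ (fun (b : Branch) g => IsChordalDomain f b.chords g (hull b.arcs))
      B (gaps A) := h.flip
  obtain ⟨i, hi, rfl⟩ := List.getElem_of_mem hb
  exact (h1.get hi (h1.length_eq ▸ hi)).isClosed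

/-- A chord of a chordal domain is determined by its length. -/
theorem IsChordFamily.mem_image {f a b : ℝ → ℝ} {l₀ l₁ : ℝ} (h : IsChordFamily f a b l₀ l₁)
    {p : ℝ × ℝ} (hp : p ∈ (fun l => (a l, b l)) '' Icc l₀ l₁) :
    p.2 - p.1 ∈ Icc l₀ l₁ ∧ a (p.2 - p.1) = p.1 ∧ b (p.2 - p.1) = p.2 := by
  obtain ⟨l, hl, rfl⟩ := hp
  simpa only [(h.closed l hl).1, and_true] using hl

/-- A chord carries its length, so nested sets of chords have parametrizations that agree on common
lengths. This turns inclusion in a flow into one common pair of functions. -/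
theorem IsChordFamily.eqOn {f a b a' b' : ℝ → ℝ} {l₀ l₁ l₀' l₁' : ℝ}
    (h : IsChordFamily f a b l₀ l₁) (h' : IsChordFamily f a' b' l₀' l₁')
    (hs : (fun l => (a l, b l)) '' Icc l₀ l₁ ⊆ (fun l => (a' l, b' l)) '' Icc l₀' l₁') {l : ℝ}
    (hl : l ∈ Icc l₀ l₁) : l ∈ Icc l₀' l₁' ∧ a' l = a l ∧ b' l = b l := by
  have := h'.mem_image (hs ⟨l, hl, rfl⟩)
  simpa only [(h.closed l hl).1] using this

theorem IsChordFamily.congr {f a b a' b' : ℝ → ℝ} {l₀ l₁ : ℝ}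
    (h : IsChordFamily f a b l₀ l₁) (ha : ∀ l ∈ Icc l₀ l₁, a' l = a l)
    (hb : ∀ l ∈ Icc l₀ l₁, b' l = b l) : IsChordFamily f a' b' l₀ l₁ where
  nonneg := h.nonneg
  continuousOn_left := h.continuousOn_left.congr ha
  continuousOn_right := h.continuousOn_right.congr hb
  closed l hl := by rw [ha l hl, hb l hl]; exact h.closed l hl
  interior l hl := by
    obtain ⟨⟨p, hp, hp'⟩, ⟨q, hq, hq'⟩, h3⟩ := h.interior l hl
    rw [ha l (Ioo_subset_Icc_self hl), hb l (Ioo_subset_Icc_self hl)]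
    have h4 : Icc l₀ l₁ ∈ 𝓝 l := Icc_mem_nhds hl.1 hl.2
    exact ⟨⟨p, hp, hp'.congr_of_eventuallyEq (eventually_of_mem h4 ha)⟩,
      ⟨q, hq, hq'.congr_of_eventuallyEq (eventually_of_mem h4 hb)⟩, h3⟩

/-- The conditions on a chord of a chordal domain. -/
def chordSet (f : ℝ → ℝ) : Set (ℝ × ℝ) :=
  {p | CupEquation f p.1 p.2 ∧ DL f p.1 p.2 ≤ 0 ∧ DR f p.1 p.2 ≤ 0}

theorem isClosed_chordSet {f : ℝ → ℝ} {κ₀ : ℝ} (hf : IsBoundary f κ₀) : IsClosed (chordSet f) := by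
  have h0 : Continuous f := continuous_iff_continuousAt.2 fun t => (hf.hasDerivAt t).continuousAt
  have h1 : Continuous (deriv f) :=
    continuous_iff_continuousAt.2 fun t => (hf.hasDerivAt_deriv t).continuousAt
  have h2 := hf.continuous_secondDeriv
  have h3 := hf.continuous_dslope
  refine IsClosed.and (isClosed_eq ?_ ?_) (IsClosed.and (isClosed_le ?_ continuous_const)
    (isClosed_le ?_ continuous_const))
  · fun_prop
  · fun_prop
  · exact (h2.comp continuous_fst).sub h3
  · exact (h2.comp continuous_snd).sub h3

theorem IsChordFamily.strictMonoOn {f a b : ℝ → ℝ} {κ₀ l₀ l₁ : ℝ} (hf : IsBoundary f κ₀)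
    (h : IsChordFamily f a b l₀ l₁) : StrictMonoOn b (Icc l₀ l₁) :=
  (h.chordCurve_right hf).strictMonoOn

theorem IsChordFamily.strictAntiOn {f a b : ℝ → ℝ} {κ₀ l₀ l₁ : ℝ} (hf : IsBoundary f κ₀)
    (h : IsChordFamily f a b l₀ l₁) : StrictAntiOn a (Icc l₀ l₁) := fun _ hx _ hy hxy =>
  neg_lt_neg_iff.1 ((h.chordCurve_left hf).strictMonoOn hx hy hxy)

/-- A growing chordal domain of bounded lengths can be completed by its upper chord. -/
theorem IsChordFamily.extend {f a b : ℝ → ℝ} {κ₀ l₀ L : ℝ} (hf : IsBoundary f κ₀) (hL : l₀ < L)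
    (h : ∀ l₁ ∈ Ioo l₀ L, IsChordFamily f a b l₀ l₁) :
    ∃ a' b', IsChordFamily f a' b' l₀ L ∧ (∀ l ≠ L, a' l = a l) ∧ ∀ l ≠ L, b' l = b l := by
  -- The midpoint between `l` and `L` is an admissible upper length strictly above `l`, so each `l <
  -- L` can be treated inside a genuine family.
  have hmem : ∀ l ∈ Ico l₀ L, (l + L) / 2 ∈ Ioo l₀ L ∧ l ∈ Ico l₀ ((l + L) / 2) := fun l hl =>
    ⟨⟨by linarith [hl.1, hl.2], by linarith [hl.2]⟩, hl.1, by linarith [hl.2]⟩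
  have hcl : ∀ l ∈ Ico l₀ L, b l - a l = l ∧ (a l, b l) ∈ chordSet f := fun l hl =>
    (h _ (hmem l hl).1).closed l (Ico_subset_Icc_self (hmem l hl).2)
  have hbmono : MonotoneOn b (Ico l₀ L) := fun x hx y hy hxy =>
    ((h _ (hmem y hy).1).strictMonoOn hf).monotoneOn
      ⟨hx.1, hxy.trans (hmem y hy).2.2.le⟩ (Ico_subset_Icc_self (hmem y hy).2) hxy
  have hamono : AntitoneOn a (Ico l₀ L) := fun x hx y hy hxy =>
    ((h _ (hmem y hy).1).strictAntiOn hf).antitoneOn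
      ⟨hx.1, hxy.trans (hmem y hy).2.2.le⟩ (Ico_subset_Icc_self (hmem y hy).2) hxy
  have hl₀ : l₀ ∈ Ico l₀ L := left_mem_Ico.2 hL
  have hmax : ∀ l ∈ Iio L, max l l₀ ∈ Ico l₀ L := fun l hl => ⟨le_max_right _ _, max_lt hl hL⟩
  -- The right ends increase, and `b l = a l + l ≤ a l₀ + L` bounds them, so the upper chord exists
  -- as a limit. The left ends then converge because `b l - a l = l`.
  obtain ⟨B, hB⟩ : ∃ B, Tendsto b (𝓝[<] L) (𝓝 B) := by
    have h1 : MonotoneOn (fun l => b (max l l₀)) (Iio L) := fun x hx y hy hxy =>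
      hbmono (hmax x hx) (hmax y hy) (max_le_max_right _ hxy)
    have h2 : BddAbove ((fun l => b (max l l₀)) '' Iio L) := by
      refine ⟨a l₀ + L, ?_⟩
      rintro _ ⟨l, hl, rfl⟩
      have h3 := (hcl _ (hmax l hl)).1
      have h4 := hamono hl₀ (hmax l hl) (hmax l hl).1
      have h5 := (hmax l hl).2
      simp only
      linarith
    refine ⟨_, (h1.tendsto_nhdsLT h2).congr' ?_⟩
    filter_upwards [Ioo_mem_nhdsLT hL] with l hl
    rw [max_eq_left hl.1.le]
  have hA : Tendsto a (𝓝[<] L) (𝓝 (B - L)) := by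
    have h1 : Tendsto (fun l => b l - l) (𝓝[<] L) (𝓝 (B - L)) :=
      hB.sub (tendsto_id.mono_left nhdsWithin_le_nhds)
    refine h1.congr' ?_
    filter_upwards [Ioo_mem_nhdsLT hL] with l hl
    linarith [(hcl l ⟨hl.1.le, hl.2⟩).1]
  have hcont : ∀ (c : ℝ → ℝ) (D : ℝ), Tendsto c (𝓝[<] L) (𝓝 D) →
      (∀ l₁ ∈ Ioo l₀ L, ContinuousOn c (Icc l₀ l₁)) →
      ContinuousOn (Function.update c L D) (Icc l₀ L) := by
    intro c D hD hc l hl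
    by_cases he : l = L
    · rw [he, continuousWithinAt_update_same]
      exact hD.mono_left (nhdsWithin_mono _ fun x hx => lt_of_le_of_ne hx.1.2 hx.2)
    · rw [continuousWithinAt_update_of_ne he]
      have hl' : l ∈ Ico l₀ L := ⟨hl.1, lt_of_le_of_ne hl.2 he⟩
      refine (hc _ (hmem l hl').1 l (Ico_subset_Icc_self (hmem l hl').2)).mono_of_mem_nhdsWithin ?_
      filter_upwards [self_mem_nhdsWithin,
        mem_nhdsWithin_of_mem_nhds (Iio_mem_nhds (hmem l hl').2.2)] with x hx hx'
      exact ⟨hx.1, hx'.le⟩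
  refine ⟨Function.update a L (B - L), Function.update b L B, ⟨(h _ (hmem l₀ hl₀).1).nonneg,
    hcont a _ hA fun l hl => (h l hl).continuousOn_left,
    hcont b _ hB fun l hl => (h l hl).continuousOn_right, ?_, ?_⟩,
    fun l hl => Function.update_of_ne hl _ _, fun l hl => Function.update_of_ne hl _ _⟩
  · intro l hl
    by_cases he : l = L
    · subst he
      simp only [Function.update_self]
      refine ⟨by ring, ?_⟩
      exact (isClosed_chordSet hf).mem_of_tendsto (hA.prodMk_nhds hB) (by
        filter_upwards [Ioo_mem_nhdsLT hL] with x hx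
        exact (hcl x ⟨hx.1.le, hx.2⟩).2)
    · rw [Function.update_of_ne he, Function.update_of_ne he]
      exact hcl l ⟨hl.1, lt_of_le_of_ne hl.2 he⟩
  · intro l hl
    obtain ⟨⟨p, hp, hp'⟩, ⟨q, hq, hq'⟩, h3⟩ := (h _ (hmem l ⟨hl.1.le, hl.2⟩).1).interior l
      ⟨hl.1, (hmem l ⟨hl.1.le, hl.2⟩).2.2⟩
    rw [Function.update_of_ne hl.2.ne, Function.update_of_ne hl.2.ne]
    have h4 : ∀ᶠ x in 𝓝 l, x ≠ L := eventually_ne_nhds hl.2.ne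
    exact ⟨⟨p, hp, hp'.congr_of_eventuallyEq (h4.mono fun x hx => Function.update_of_ne hx _ _)⟩,
      ⟨q, hq, hq'.congr_of_eventuallyEq (h4.mono fun x hx => Function.update_of_ne hx _ _)⟩, h3⟩

/-! ### Limits of ports -/

section port

variable {g : ℝ → ℝ} {κ₀ η : ℝ} {e : ℕ → ℝ}

/-- The two solutions are compared only from the later starting point `p'`, where the old one has
not exceeded the new initial slope. -/
theorem rightSlope_le_rightSlope (hg : Continuous g) {κ₁ κ₂ p p' σ σ' u : ℝ} (hκ : κ₂ ≤ κ₁)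
    (hp : p ≤ p') (hu : p' ≤ u) (hlt : ∀ t : ℝ, p < t → t < u → g t < rightSlope g κ₁ p σ t)
    (hσ : rightSlope g κ₁ p σ p' ≤ σ') : rightSlope g κ₁ p σ u ≤ rightSlope g κ₂ p' σ' u := by
  refine slope_comparison hκ hu (hasDerivAt_rightSlope_coe hg κ₁ p σ)
    (hasDerivAt_rightSlope_coe hg κ₂ p' σ') (fun t ht => (hlt t (hp.trans_lt ht.1) ht.2).le) ?_
  rwa [rightSlope_self]

theorem PortTendsto.const (hg : Continuous g) (he : ∀ n, 0 < e n ∧ e n ≤ η) (p σ : ℝ) :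
    PortTendsto g (fun n => (e n)⁻¹) η⁻¹ (fun _ => p) p (fun _ => σ) σ where
  tendsto := Or.inr ⟨EReal.coe_ne_bot p, EReal.coe_ne_top p, tendsto_const_nhds, tendsto_const_nhds⟩
  mono := Eventually.of_forall fun n u h₁ _ h₃ => by
    refine rightSlope_le_rightSlope hg (inv_anti₀ (he n).1 (he n).2) le_rfl
      (EReal.coe_lt_coe_iff.1 h₁).le (fun t ht => h₃ t (EReal.coe_lt_coe_iff.2 ht)) ?_
    rw [rightSlope_self]

theorem PortTendsto.bot (hg : Continuous g) (hb : ExpBounded g κ₀) (hκ : κ₀ < η⁻¹)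
    (he : ∀ n, 0 < e n ∧ e n ≤ η) (σ : ℕ → ℝ) (σ' : ℝ) :
    PortTendsto g (fun n => (e n)⁻¹) η⁻¹ (fun _ => ⊥) ⊥ σ σ' where
  tendsto := Or.inl ⟨fun _ => rfl, rfl⟩
  mono := Eventually.of_forall fun n u _ _ h₃ => by
    simp only [rightSlope, if_true] at h₃ ⊢
    exact slopeFromBot_comparison hb hg hκ (inv_anti₀ (he n).1 (he n).2) fun t ht =>
      (h₃ t (EReal.bot_lt_coe t) ht).le

/-- The end of the long chord advances to the right. Old tangents reach the limit end with a slope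
not above that of the limit chord, since `2 / (2ε) = 1/ε` is the coefficient of their equation;
afterwards the smaller parameter `1/η` only helps. -/
theorem PortTendsto.increasing (hg : Continuous g) {b A : ℝ → ℝ} {l₀ : ℝ}
    (h : IsChordCurve g b A l₀ (2 * η)) (hl : ∀ n, l₀ ≤ 2 * e n)
    (he : ∀ n, 0 < e n ∧ e n ≤ η) (hlim : Tendsto e atTop (𝓝 η)) :
    PortTendsto g (fun n => (e n)⁻¹) η⁻¹ (fun n => b (2 * e n)) (b (2 * η))
      (fun n => A (2 * e n)) (A (2 * η)) where
  tendsto := by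
    have h0 : ∀ n, 2 * e n ∈ Icc l₀ (2 * η) := fun n => ⟨hl n, by linarith [(he n).2]⟩
    have h1 : 2 * η ∈ Icc l₀ (2 * η) := right_mem_Icc.2 ((hl 0).trans (h0 0).2)
    have h2 : Tendsto (fun n => 2 * e n) atTop (𝓝[Icc l₀ (2 * η)] (2 * η)) :=
      tendsto_nhdsWithin_iff.2 ⟨hlim.const_mul 2, Eventually.of_forall h0⟩
    refine Or.inr ⟨EReal.coe_ne_bot _, EReal.coe_ne_top _, ?_, (h.2 _ h1).tendsto.comp h2⟩
    exact (continuous_coe_real_ereal.tendsto _).comp ((h.1 _ h1).tendsto.comp h2)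
  mono := Eventually.of_forall fun n u h₁ h₂ h₃ => by
    have hle : 2 * e n ≤ 2 * η := by linarith [(he n).2]
    have h4 : (2 : ℝ) / (2 * e n) = (e n)⁻¹ := by
      rw [div_mul_cancel_left₀ two_ne_zero]
    have hm := (h.mono (hl n) le_rfl)
    refine rightSlope_le_rightSlope hg (inv_anti₀ (he n).1 (he n).2)
      (hm.strictMonoOn.monotoneOn (left_mem_Icc.2 hle) (right_mem_Icc.2 hle) hle)
      (EReal.coe_lt_coe_iff.1 h₂).le (fun t ht => h₃ t (EReal.coe_lt_coe_iff.2 ht)) ?_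
    refine hm.le_of_increasing (by linarith [(he n).1]) hle (fun t => ?_)
      (rightSlope_self _ _ _ _).le
    rw [h4]
    exact hasDerivAt_rightSlope_coe hg _ _ _ t

/-- The end of the base retreats, so the limit solution starts earlier. It is followed along the
chord curve up to the old end, where it is at least the old slope because `1/η ≤ 1/ε ≤ 2/l`. The
formulas for `p` and `σ` are required only eventually, since the flow lies in one fixed domain only
after some parameter. -/
theorem PortTendsto.decreasing (hg : Continuous g) {b A : ℝ → ℝ} {l₀ l₁ l' : ℝ} {l : ℕ → ℝ}
    (h : IsChordCurve g b A l₀ l₁) (hl₀ : 0 ≤ l₀) (hl' : l₀ ≤ l') (hl : ∀ n, l' ≤ l n)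
    (hl₁ : ∀ᶠ n in atTop, l n ≤ l₁) (hle : ∀ n, l n ≤ 2 * e n) (hpos : ∀ n, 0 < l n)
    (he : ∀ n, 0 < e n ∧ e n ≤ η) (hlim : Tendsto l atTop (𝓝 l')) {p : ℕ → EReal} {σ : ℕ → ℝ}
    (hp : ∀ᶠ n in atTop, p n = b (l n) ∧ σ n = A (l n)) :
    PortTendsto g (fun n => (e n)⁻¹) η⁻¹ p (b l') σ (A l') where
  tendsto := by
    have h0 : ∀ᶠ n in atTop, l n ∈ Icc l₀ l₁ := hl₁.mono fun n hn => ⟨hl'.trans (hl n), hn⟩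
    obtain ⟨m, hm⟩ := h0.exists
    have h1 : l' ∈ Icc l₀ l₁ := ⟨hl', (hl m).trans hm.2⟩
    have h2 : Tendsto l atTop (𝓝[Icc l₀ l₁] l') := tendsto_nhdsWithin_iff.2 ⟨hlim, h0⟩
    refine Or.inr ⟨EReal.coe_ne_bot _, EReal.coe_ne_top _, ?_, ?_⟩
    · exact ((continuous_coe_real_ereal.tendsto _).comp ((h.1 _ h1).tendsto.comp h2)).congr'
        (hp.mono fun n hn => hn.1.symm)
    · exact ((h.2 _ h1).tendsto.comp h2).congr' (hp.mono fun n hn => hn.2.symm)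
  mono := by
    filter_upwards [hp, hl₁] with n hn hn' u h₁ h₂ h₃
    rw [hn.1, hn.2] at *
    have hk := inv_anti₀ (he n).1 (he n).2
    have hm := h.mono hl' hn'
    refine slope_comparison hk (EReal.coe_lt_coe_iff.1 h₁).le (hasDerivAt_rightSlope_coe hg _ _ _)
      (hasDerivAt_rightSlope_coe hg _ _ _)
      (fun t ht => (h₃ t (EReal.coe_lt_coe_iff.2 ht.1) ht.2).le) ?_
    rw [rightSlope_self]
    refine hm.le_of_decreasing (hl₀.trans hl') (hl n) (hasDerivAt_rightSlope_coe hg _ _ _) ?_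
      (rightSlope_self _ _ _ _).ge
    have h4 : (2 : ℝ) / (2 * e n) = (e n)⁻¹ := by
      rw [div_mul_cancel_left₀ two_ne_zero]
    exact hk.trans (h4 ▸ div_le_div_of_nonneg_left zero_le_two (hpos n) (hle n))

end port

/-! ### Figures and their limits -/

/-- The arcs of a vertex, the branches below it and its slope. -/
structure Figure where
  arcs : List Arc
  below : List Branch
  slope : ℝ

def Figure.block (F : Figure) (l r : Side) : Block := ⟨l, r, F.arcs, F.below, F.slope⟩

/-- The requirements on a single free vertex of a graph. -/
structure FreeVertex.IsStanding (f : ℝ → ℝ) (ε : ℝ) (v : FreeVertex) : Prop where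
  admissible : v.IsAdmissible f ε
  branches : ∀ c ∈ branchNodes v.below, c.IsAdmissible f ε ∧ c.LeafRoot f
  leafRoot : v.LeafRoot f
  linear : ∃ σ, IsLinearity f v.arcs σ

/-- The figure `F` is the limit at `η` of the vertex `v`; here `V` is the limit before the
reconstruction, which depends on the type of `v` only. -/
structure IsFigureLimit (f : ℝ → ℝ) (I : Set ℝ) (η : ℝ) (v : ℝ → FreeVertex) (F : Figure)
    (V : Kind → FreeVertex) : Prop where
  left_bot : ∀ ε ∈ I, leftEnd (v ε).arcs = ⊥ ↔ leftEnd F.arcs = ⊥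
  right_top : ∀ ε ∈ I, rightEnd (v ε).arcs = ⊤ ↔ rightEnd F.arcs = ⊤
  left_side : ∀ ε ∈ I, leftEnd F.arcs = ⊥ → F.arcs = [⟨⊥, ⊥⟩] ∨ (v ε).kind.leftSide = .left
  right_side : ∀ ε ∈ I, rightEnd F.arcs = ⊤ → F.arcs = [⟨⊤, ⊤⟩] ∨ (v ε).kind.rightSide = .right
  -- The families are left free because a figure may absorb an angle on either side. This can turn
  -- left tangents on the left into right ones, and right tangents on the right into left ones, but
  -- never the reverse. On a side where the figure is infinite there are no tangents, and the family
  -- is fixed by convention.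
  good : ∀ ε ∈ I, ∀ l r : Side, (l = .left → leftEnd F.arcs = ⊥ ∨ (v ε).kind.leftSide = .left) →
    (r = .right → rightEnd F.arcs = ⊤ ∨ (v ε).kind.rightSide = .right) → (leftEnd F.arcs = ⊥ → l = .left) →
    (rightEnd F.arcs = ⊤ → r = .right) → (F.block l r).IsGood f η
  reconstruct : ∀ ε ∈ I, collapseChord f (renameLongChord f (V (v ε).kind)) =
    (F.block (v ε).kind.leftSide (v ε).kind.rightSide).vertex f
  converges : ∀ (e : ℕ → ℝ) (K : Kind), (∀ n, e n ∈ I) → Tendsto e atTop (𝓝 η) →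
    (∀ n, (v (e n)).kind = K) → VertexConverges (fun n => v (e n)) (V K)
  right_port : ∀ e σ : ℕ → ℝ, (∀ n, e n ∈ I) → Tendsto e atTop (𝓝 η) →
    (∀ n, IsLinearity f (v (e n)).arcs (σ n)) → rightEnd F.arcs ≠ ⊤ →
    PortTendsto (deriv (deriv f)) (fun n => (e n)⁻¹) η⁻¹ (fun n => rightEnd (v (e n)).arcs)
      (rightEnd F.arcs) σ F.slope
  left_port : ∀ e σ : ℕ → ℝ, (∀ n, e n ∈ I) → Tendsto e atTop (𝓝 η) →
    (∀ n, IsLinearity f (v (e n)).arcs (σ n)) → leftEnd F.arcs ≠ ⊥ →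
    PortTendsto (fun t => deriv (deriv f) (-t)) (fun n => (e n)⁻¹) η⁻¹
      (fun n => -leftEnd (v (e n)).arcs) (-leftEnd F.arcs) σ F.slope

theorem Branch.IsAdmissible.mono {f : ℝ → ℝ} {ε η : ℝ} (h : ε ≤ η) {b : Branch}
    (hb : b.IsAdmissible f ε) : b.IsAdmissible f η := by
  obtain ⟨h1, h2, h3, h4, h5, h6⟩ := hb
  exact ⟨h1, h2, h3, h4, h5.trans_le (by linarith), h6⟩

theorem wired_nil {f : ℝ → ℝ} {x : Arc} {B : List Branch} (h : Wired f [x] B) : B = [] :=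
  List.forall₂_nil_left_iff.1 h

section infinity

theorem kindOfShape_negInfinity {f : ℝ → ℝ} {l r : Side} {A : List Arc} {s : Side}
    (h : kindOfShape f l r A = .negInfinity s) : A = [⟨⊥, ⊥⟩] := by
  by_contra h1
  by_cases h2 : A = [⟨⊤, ⊤⟩]
  · rw [h2, kindOfShape_top] at h; cases h
  · exact (kindOfShape_not_infinity f l r h1 h2).1 s h

theorem kindOfShape_posInfinity {f : ℝ → ℝ} {l r : Side} {A : List Arc} {s : Side}
    (h : kindOfShape f l r A = .posInfinity s) : A = [⟨⊤, ⊤⟩] := by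
  by_contra h1
  by_cases h2 : A = [⟨⊥, ⊥⟩]
  · rw [h2, kindOfShape_bot] at h; cases h
  · exact (kindOfShape_not_infinity f l r h2 h1).2 s h

theorem FreeVertex.IsAdmissible.arcs_negInfinity {f : ℝ → ℝ} {ε : ℝ} {v : FreeVertex}
    (h : v.IsAdmissible f ε) {s : Side} (hs : v.kind = .negInfinity s) :
    v.arcs = [⟨⊥, ⊥⟩] ∧ v.below = [] := by
  have h1 := kindOfShape_negInfinity (h.1.symm.trans hs)
  have h2 := h.2.1
  rw [h1] at h2
  exact ⟨h1, wired_nil h2⟩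

theorem FreeVertex.IsAdmissible.arcs_posInfinity {f : ℝ → ℝ} {ε : ℝ} {v : FreeVertex}
    (h : v.IsAdmissible f ε) {s : Side} (hs : v.kind = .posInfinity s) :
    v.arcs = [⟨⊤, ⊤⟩] ∧ v.below = [] := by
  have h1 := kindOfShape_posInfinity (h.1.symm.trans hs)
  have h2 := h.2.1
  rw [h1] at h2
  exact ⟨h1, wired_nil h2⟩

theorem Block.isGood_infinity (f : ℝ → ℝ) (ε : ℝ) (l r : Side) {x : Arc} (σ : ℝ)
    (hx : x = ⟨⊥, ⊥⟩ ∨ x = ⟨⊤, ⊤⟩) : (⟨l, r, [x], [], σ⟩ : Block).IsGood f ε where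
  figure := by
    rcases hx with rfl | rfl
    · exact Or.inl rfl
    · exact Or.inr (Or.inl rfl)
  wired := List.Forall₂.nil
  gaps g hg := by simp [BMOFoliation.gaps] at hg
  branches c hc := by simp [branchNodes] at hc

variable {f : ℝ → ℝ} {κ₀ η : ℝ} {I : Set ℝ} {v : ℝ → FreeVertex}

theorem isFigureLimit_negInfinity (hf : IsBoundary f κ₀) (hκ : κ₀ < η⁻¹)
    (hI : ∀ ε ∈ I, 0 < ε ∧ ε ≤ η) (hv : ∀ ε ∈ I, (v ε).IsStanding f ε)
    (h : ∀ ε ∈ I, ∃ s, (v ε).kind = .negInfinity s) :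
    IsFigureLimit f I η v ⟨[⟨⊥, ⊥⟩], [], 0⟩ (fun K => ⟨K, [⟨⊥, ⊥⟩], []⟩) := by
  have hA : ∀ ε ∈ I, (v ε).arcs = [⟨⊥, ⊥⟩] ∧ (v ε).below = [] := fun ε hε =>
    let ⟨_, hs⟩ := h ε hε
    (hv ε hε).admissible.arcs_negInfinity hs
  refine ⟨fun ε hε => by rw [(hA ε hε).1], fun ε hε => by rw [(hA ε hε).1],
    fun _ _ _ => Or.inl rfl, fun ε hε h1 => ?_, fun _ _ l r _ _ _ _ => Block.isGood_infinity f η l r 0 (Or.inl rfl),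
    fun ε hε => ?_, fun e K he _ hK => ?_, fun e σ he hlim hσ _ => ?_,
    fun _ _ _ _ _ h1 => absurd rfl h1⟩
  · exact absurd h1 (by simp [rightEnd])
  · obtain ⟨s, hs⟩ := h ε hε
    simp [hs, renameLongChord, collapseChord, Figure.block, Block.vertex, kindOfShape_bot,
      Kind.rightSide]
  · refine ⟨hK, ?_, ?_⟩
    · simp only [(hA _ (he _)).1]
      exact .const _ fun x _ => .const x
    · simp only [(hA _ (he _)).2]
      exact .nil
  · simp only [(hA _ (he _)).1]
    exact .bot hf.continuous_secondDeriv hf.growth hκ (fun n => hI _ (he n)) σ 0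

theorem isFigureLimit_posInfinity (hf : IsBoundary f κ₀) (hκ : κ₀ < η⁻¹)
    (hI : ∀ ε ∈ I, 0 < ε ∧ ε ≤ η) (hv : ∀ ε ∈ I, (v ε).IsStanding f ε)
    (h : ∀ ε ∈ I, ∃ s, (v ε).kind = .posInfinity s) :
    IsFigureLimit f I η v ⟨[⟨⊤, ⊤⟩], [], 0⟩ (fun K => ⟨K, [⟨⊤, ⊤⟩], []⟩) := by
  have hA : ∀ ε ∈ I, (v ε).arcs = [⟨⊤, ⊤⟩] ∧ (v ε).below = [] := fun ε hε =>
    let ⟨_, hs⟩ := h ε hε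
    (hv ε hε).admissible.arcs_posInfinity hs
  refine ⟨fun ε hε => by rw [(hA ε hε).1], fun ε hε => by rw [(hA ε hε).1],
    fun ε hε h1 => ?_, fun _ _ _ => Or.inl rfl, fun _ _ l r _ _ _ _ => Block.isGood_infinity f η l r 0 (Or.inr rfl),
    fun ε hε => ?_, fun e K he _ hK => ?_, fun _ _ _ _ _ h1 => absurd rfl h1,
    fun e σ he hlim hσ _ => ?_⟩
  · exact absurd h1 (by simp [leftEnd])
  · obtain ⟨s, hs⟩ := h ε hε
    simp [hs, renameLongChord, collapseChord, Figure.block, Block.vertex, kindOfShape_top,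
      Kind.leftSide]
  · refine ⟨hK, ?_, ?_⟩
    · simp only [(hA _ (he _)).1]
      exact .const _ fun x _ => .const x
    · simp only [(hA _ (he _)).2]
      exact .nil
  · simp only [(hA _ (he _)).1, leftEnd, EReal.neg_top]
    exact .bot (hf.continuous_secondDeriv.comp continuous_neg) hf.growth.neg hκ
      (fun n => hI _ (he n)) σ 0

end infinity

/-! ### Constant multicups -/

theorem exists_coe_mem {x : Arc} (h : x.l ≤ x.r ∧ x.l ≠ ⊤ ∧ x.r ≠ ⊥) : ∃ t : ℝ, t ∈ x.carrier := by
  rcases eq_or_ne x.l ⊥ with h1 | h1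
  · rcases eq_or_ne x.r ⊤ with h2 | h2
    · exact ⟨0, by simp [Arc.carrier, h1, h2]⟩
    · exact ⟨x.r.toReal, by simp [Arc.carrier, h1, EReal.coe_toReal h2 h.2.2]⟩
  · exact ⟨x.l.toReal, by simpa [Arc.carrier, EReal.coe_toReal h.2.1 h1] using h.1⟩

theorem ArcsOrdered.exists_ne {A : List Arc} (h : ArcsOrdered A) (hne : ∀ t : ℝ, A ≠ [⟨t, t⟩]) :
    ∃ x ∈ arcPoints A, ∃ y ∈ arcPoints A, x ≠ y := by
  obtain ⟨h1, h2, h3⟩ := h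
  rcases A with _ | ⟨x, _ | ⟨y, ys⟩⟩
  · exact absurd rfl h1
  · have hx := h2 x (by simp)
    have hlt : x.l < x.r := by
      refine lt_of_le_of_ne hx.1 fun he => hne x.l.toReal ?_
      have e1 := EReal.coe_toReal hx.2.1 (he ▸ hx.2.2)
      rw [← congrArg₂ Arc.mk e1.symm (he.symm.trans e1.symm)]
    obtain ⟨s, hs1, hs2⟩ := EReal.lt_iff_exists_real_btwn.1 hlt
    obtain ⟨t, ht1, ht2⟩ := EReal.lt_iff_exists_real_btwn.1 hs2
    exact ⟨s, ⟨x, by simp, hs1.le, hs2.le⟩, t, ⟨x, by simp, (hs1.trans ht1).le, ht2.le⟩,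
      (EReal.coe_lt_coe_iff.1 ht1).ne⟩
  · obtain ⟨s, hs⟩ := exists_coe_mem (h2 x (by simp))
    obtain ⟨t, ht⟩ := exists_coe_mem (h2 y (by simp))
    have hlt := (List.isChain_cons_cons.1 h3).1
    exact ⟨s, ⟨x, by simp, hs⟩, t, ⟨y, by simp, ht⟩,
      (EReal.coe_lt_coe_iff.1 ((hs.2.trans_lt hlt).trans_le ht.1)).ne⟩

theorem IsLinearity.slope_unique {f : ℝ → ℝ} {A : List Arc} {σ σ' : ℝ} (h : IsLinearity f A σ)
    (h' : IsLinearity f A σ') {x y : ℝ} (hx : x ∈ arcPoints A) (hy : y ∈ arcPoints A)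
    (hxy : x ≠ y) : σ = σ' := by
  have := (h x hx y hy).1.symm.trans (h' x hx y hy).1
  exact mul_right_cancel₀ (sub_ne_zero.2 hxy.symm) this

/-- Nothing moves, and two distinct points of the arcs determine the slope, so it does not depend on
`ε` either. The length condition survives as a weak inequality; equality makes the limit a full
multicup. -/
theorem isFigureLimit_multicup {f : ℝ → ℝ} {κ₀ η₁ η : ℝ} (hf : IsBoundary f κ₀) (h0 : 0 ≤ η₁)
    (h01 : η₁ < η) {v : ℝ → FreeVertex} (hv : ∀ ε ∈ Ioo η₁ η, (v ε).IsStanding f ε)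
    (h : IsConstantMulticup (Ioo η₁ η) v) : ∃ F V, IsFigureLimit f (Ioo η₁ η) η v F V := by
  obtain ⟨w, hw, hvw⟩ := h
  have hst : ∀ ε ∈ Ioo η₁ η, w.IsStanding f ε := fun ε hε => hvw ε hε ▸ hv ε hε
  obtain ⟨ε₀, hε₀⟩ : (Ioo η₁ η).Nonempty := nonempty_Ioo.2 h01
  have hw₀ := hst ε₀ hε₀
  obtain ⟨σ, hσ⟩ := hw₀.linear
  have hpos : ∀ ε ∈ Ioo η₁ η, 0 < ε := fun ε hε => h0.trans_lt hε.1
  have hlong : ∀ ε ∈ Ioo η₁ η, ArcsOrdered w.arcs ∧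
      leftEnd w.arcs + ((2 * ε : ℝ) : EReal) ≤ rightEnd w.arcs := by
    intro ε hε
    have := (hst ε hε).admissible.2.2.2
    rw [hw] at this
    exact this
  have hord := (hlong ε₀ hε₀).1
  have hsolid : SolidArcsAreRoots f w.arcs := by
    have := hw₀.leafRoot
    rw [FreeVertex.LeafRoot, hw] at this
    exact this
  have hshape : kindOfShape f .left .right w.arcs = .multicup := by
    have := hw₀.admissible.1
    rw [hw] at this
    exact this.symm
  have hnp : ∀ x, w.arcs = [x] → x.l ≠ x.r := by
    intro x hA hx
    have h1 := (hlong ε₀ hε₀).2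
    have h2 := hord.2.1 x (by simp [hA])
    rw [hA] at h1
    change x.l + _ ≤ x.r at h1
    rw [← hx, ← EReal.coe_toReal h2.2.1 (hx ▸ h2.2.2), ← EReal.coe_add, EReal.coe_le_coe_iff] at h1
    linarith [hpos ε₀ hε₀]
  obtain ⟨x, hx, y, hy, hxy⟩ := hord.exists_ne fun t ht => hnp _ ht rfl
  have hη : leftEnd w.arcs + ((2 * η : ℝ) : EReal) ≤ rightEnd w.arcs := by
    rcases eq_or_ne (leftEnd w.arcs) ⊥ with h1 | h1
    · rw [h1]; simp
    rcases eq_or_ne (rightEnd w.arcs) ⊤ with h2 | h2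
    · rw [h2]; exact le_top
    have e1 := EReal.coe_toReal hord.left_ne_top h1
    have e2 := EReal.coe_toReal h2 hord.right_ne_bot
    rw [← e1, ← e2, ← EReal.coe_add, EReal.coe_le_coe_iff]
    by_contra hcon
    push Not at hcon
    -- If the length were below `2η`, a parameter between half of the length and `η` would already
    -- violate the condition.
    obtain ⟨ε, hε1, hε2⟩ := exists_between
      (max_lt h01 (by linarith : ((rightEnd w.arcs).toReal - (leftEnd w.arcs).toReal) / 2 < η))
    have h3 := (hlong ε ⟨(le_max_left _ _).trans_lt hε1, hε2⟩).2
    rw [← e1, ← e2, ← EReal.coe_add, EReal.coe_le_coe_iff] at h3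
    linarith [(le_max_right _ _).trans_lt hε1]
  have hσ' : ∀ e σ' : ℕ → ℝ, (∀ n, e n ∈ Ioo η₁ η) → (∀ n, IsLinearity f (v (e n)).arcs (σ' n)) →
      σ' = fun _ => σ := fun e σ' he h => funext fun n =>
    IsLinearity.slope_unique (hvw _ (he n) ▸ h n) hσ hx hy hxy
  refine ⟨⟨w.arcs, w.below, σ⟩, fun K => ⟨K, w.arcs, w.below⟩,
    fun ε hε => by rw [hvw ε hε], fun ε hε => by rw [hvw ε hε],
    fun ε hε _ => Or.inr (by rw [hvw ε hε, hw]; rfl),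
    fun ε hε _ => Or.inr (by rw [hvw ε hε, hw]; rfl), ?_, ?_, ?_, ?_, ?_⟩
  · intro ε hε l r _ _ hl hr
    refine ⟨Or.inr (Or.inr ⟨hord, hσ, hsolid, hl, hr, fun _ _ => hη, ?_, ?_⟩),
      hw₀.admissible.2.1, fun g hg => (hw₀.admissible.2.2.1 g hg).trans (by linarith [hε₀.2]),
      fun c hc => ⟨(hw₀.branches c hc).1.mono hε₀.2.le, (hw₀.branches c hc).2⟩⟩
    · intro _ _ x y hA hx hy
      have hA' : w.arcs = [x, y] := hA
      rw [hA'] at hshape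
      simp only [kindOfShape, hx, hy, and_self, if_true] at hshape
      split_ifs at hshape
    · intro _ x hA hx
      exact absurd hx (hnp x hA)
  · intro ε hε
    rw [hvw ε hε, hw]
    have h1 : collapseChord f ⟨.multicup, w.arcs, w.below⟩ = ⟨.multicup, w.arcs, w.below⟩ := by
      unfold collapseChord
      split
      · simp
      · rfl
    simp only [renameLongChord, h1, Figure.block, Block.vertex, Kind.leftSide, Kind.rightSide,
      hshape]
  · intro e K he _ hK
    simp only [hvw _ (he _)] at hK ⊢
    exact ⟨hK, .const _ fun x _ => .const x,
      .const _ fun b hb => .const b (hw₀.admissible.2.1.isClosed b hb)⟩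
  · intro e σ' he _ hl hne
    simp only [hσ' e σ' he hl, hvw _ (he _)]
    change PortTendsto _ _ _ (fun _ => rightEnd w.arcs) (rightEnd w.arcs) _ σ
    rw [← EReal.coe_toReal hne hord.right_ne_bot]
    exact .const hf.continuous_secondDeriv (fun n => ⟨hpos _ (he n), (he n).2.le⟩) _ _
  · intro e σ' he _ hl hne
    simp only [hσ' e σ' he hl, hvw _ (he _)]
    change PortTendsto _ _ _ (fun _ => -leftEnd w.arcs) (-leftEnd w.arcs) _ σ
    rw [← EReal.coe_toReal hord.left_ne_top hne, ← EReal.coe_neg]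
    exact .const (hf.continuous_secondDeriv.comp continuous_neg)
      (fun n => ⟨hpos _ (he n), (he n).2.le⟩) _ _

/-! ### Figures over a single chordal domain -/

/-- The kinds of figures that sit on a single chord. -/
def Kind.IsChord (K : Kind) : Prop :=
  K = .firstType ∨ K = .birdie ∨ ∃ s, K = .trolleybus s

theorem exists_chord_points {f : ℝ → ℝ} {l r : Side} {A : List Arc}
    (hK : (kindOfShape f l r A).IsChord) (ho : ArcsOrdered A) :
    ∃ a b : ℝ, a < b ∧ A = [⟨a, a⟩, ⟨b, b⟩] := by
  have key : ∀ x y : Arc, A = [x, y] → x.l = x.r → y.l = y.r →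
      ∃ a b : ℝ, a < b ∧ A = [⟨a, a⟩, ⟨b, b⟩] := by
    rintro x y rfl hx hy
    have h1 := ho.2.1 x (by simp)
    have h2 := ho.2.1 y (by simp)
    have h3 := (List.isChain_cons_cons.1 ho.2.2).1
    have e1 := EReal.coe_toReal h1.2.1 (hx.trans_ne h1.2.2)
    have e2 := EReal.coe_toReal h2.2.1 (hy.trans_ne h2.2.2)
    refine ⟨x.l.toReal, y.l.toReal, ?_, ?_⟩
    · rw [← EReal.coe_lt_coe_iff, e1, e2, hx]; exact h3
    · rw [← congrArg₂ Arc.mk e1.symm (hx.symm.trans e1.symm),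
        ← congrArg₂ Arc.mk e2.symm (hy.symm.trans e2.symm)]
  by_cases h₁ : A = [⟨⊥, ⊥⟩]
  · rw [h₁, kindOfShape_bot] at hK; simp [Kind.IsChord] at hK
  by_cases h₂ : A = [⟨⊤, ⊤⟩]
  · rw [h₂, kindOfShape_top] at hK; simp [Kind.IsChord] at hK
  rcases kindOfShape_cases f l r h₁ h₂ with ⟨h, -⟩ | ⟨s, h, -⟩ | ⟨h, -, -, x, y, hA, hx, hy⟩ |
    ⟨s, h, -, -, x, y, hA, hx, hy⟩ | ⟨h, -, -, x, y, hA, hx, hy⟩ | ⟨h, -⟩ | ⟨s, h, -⟩ | ⟨h, -⟩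
  · rw [h] at hK; simp [Kind.IsChord] at hK
  · rw [h] at hK; simp [Kind.IsChord] at hK
  · exact key x y hA hx hy
  · exact key x y hA hx hy
  · exact key x y hA hx hy
  · rw [h] at hK; simp [Kind.IsChord] at hK
  · rw [h] at hK; simp [Kind.IsChord] at hK
  · rw [h] at hK; simp [Kind.IsChord] at hK

/-- The two arcs of a chord. -/
def chordArcs (a b : ℝ) : List Arc := [⟨a, a⟩, ⟨b, b⟩]

theorem exists_family_of_isChord {f : ℝ → ℝ} {ε : ℝ} {v : FreeVertex}
    (h : v.IsAdmissible f ε) (hK : v.kind.IsChord) {C : Set (ℝ × ℝ)} {k : FixedKind}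
    {arcs : List Arc} {below : List Branch} (hb : v.below = [.mk C k arcs below]) :
    ∃ a b : ℝ → ℝ, ∃ l : ℝ, (hull v.arcs).2 - (hull v.arcs).1 = l ∧
      IsChordFamily f a b ((hull arcs).2 - (hull arcs).1) l ∧ (hull arcs).2 - (hull arcs).1 < l ∧
      v.arcs = chordArcs (a l) (b l) ∧
      C = (fun l => (a l, b l)) '' Icc ((hull arcs).2 - (hull arcs).1) l ∧
      hull arcs = (a ((hull arcs).2 - (hull arcs).1), b ((hull arcs).2 - (hull arcs).1)) ∧
      l ≤ 2 * ε ∧ (v.kind = .firstType → l = 2 * ε) := by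
  obtain ⟨h1, h2, h3, h4⟩ := h
  have ho : ArcsOrdered v.arcs := by
    rcases hK with hK | hK | ⟨s, hK⟩ <;> rw [hK] at h4 <;> exact h4.1
  obtain ⟨x, y, hxy, hA⟩ := exists_chord_points (h1 ▸ hK) ho
  have hh : hull v.arcs = (x, y) := by simp [hA, hull, leftEnd, rightEnd]
  rw [hA, hb] at h2
  have hC := (List.forall₂_cons.1 h2).1
  obtain ⟨a, b, l₀, l₁, hf, hlt, htop, hbot, hC'⟩ := isChordalDomain_iff.1 hC
  simp only [EReal.toReal_coe, Prod.mk.injEq] at htop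
  have e0 : (hull arcs).2 - (hull arcs).1 = l₀ := by
    change hull arcs = _ at hbot
    rw [hbot]; exact (hf.closed l₀ (left_mem_Icc.2 hlt.le)).1
  have e1 : y - x = l₁ := by
    rw [htop.1, htop.2]; exact (hf.closed l₁ (right_mem_Icc.2 hlt.le)).1
  refine ⟨a, b, l₁, by rw [hh]; exact e1, e0 ▸ hf, e0 ▸ hlt, ?_, e0 ▸ hC', ?_, ?_, ?_⟩
  · rw [hA, htop.1, htop.2]; rfl
  · rw [e0]; exact hbot
  · have := h3 (x, y) (by simp [hA, gaps])
    rw [← e1]; exact this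
  · intro hK
    rw [hK] at h4
    have := h4.2.2.2
    rw [hh] at this
    rw [← e1]; exact this

theorem isLinearity_chordArcs {f : ℝ → ℝ} {a b : ℝ} (hab : a < b) (h : CupEquation f a b) :
    IsLinearity f (chordArcs a b) (dslope (deriv f) a b) := by
  have hd : deriv f b - deriv f a = dslope (deriv f) a b * (b - a) := by
    rw [dslope_of_ne _ hab.ne', slope_def_field, div_mul_cancel₀ _ (sub_ne_zero.2 hab.ne')]
  have hm : ∀ x ∈ arcPoints (chordArcs a b), x = a ∨ x = b := by
    rintro x ⟨z, hz, h1, h2⟩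
    simp only [chordArcs, List.mem_cons, List.not_mem_nil, or_false] at hz
    rcases hz with rfl | rfl
    · exact Or.inl (le_antisymm (EReal.coe_le_coe_iff.1 h2) (EReal.coe_le_coe_iff.1 h1))
    · exact Or.inr (le_antisymm (EReal.coe_le_coe_iff.1 h2) (EReal.coe_le_coe_iff.1 h1))
  intro x hx y hy
  rcases hm x hx with rfl | rfl <;> rcases hm y hy with rfl | rfl
  · simp [CupEquation]
  · exact ⟨hd, h⟩
  · exact ⟨by linarith, h.symm⟩
  · simp [CupEquation]

theorem mem_chordArcs (a b : ℝ) : a ∈ arcPoints (chordArcs a b) ∧ b ∈ arcPoints (chordArcs a b) :=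
  ⟨⟨⟨a, a⟩, by simp [chordArcs], le_rfl, le_rfl⟩, ⟨⟨b, b⟩, by simp [chordArcs], le_rfl, le_rfl⟩⟩

theorem IsLinearity.eq_dslope {f : ℝ → ℝ} {a b σ : ℝ} (hab : a < b)
    (h : IsLinearity f (chordArcs a b) σ) : σ = dslope (deriv f) a b :=
  (h.dslope_eq (mem_chordArcs a b).1 (mem_chordArcs a b).2 fun h => absurd h hab.ne).symm

theorem isFigure_chordArcs {f : ℝ → ℝ} {ε a b : ℝ} {l r : Side} (hab : a < b)
    (h : CupEquation f a b) (hl : l = .left → r = .right → b - a = 2 * ε) :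
    IsFigure f ε l r (chordArcs a b) (dslope (deriv f) a b) where
  ordered := ⟨by simp [chordArcs], fun x hx => by
      simp only [chordArcs, List.mem_cons, List.not_mem_nil, or_false] at hx
      rcases hx with rfl | rfl <;> simp, by simpa [chordArcs] using hab⟩
  linear := isLinearity_chordArcs hab h
  solid x hx hne := by
    simp only [chordArcs, List.mem_cons, List.not_mem_nil, or_false] at hx
    rcases hx with rfl | rfl <;> exact absurd rfl hne
  left_infinite h := absurd h (EReal.coe_ne_bot a)
  right_infinite h := absurd h (EReal.coe_ne_top b)
  long h₁ h₂ := by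
    change (a : EReal) + _ ≤ b
    rw [← EReal.coe_add, EReal.coe_le_coe_iff]
    linarith [hl h₁ h₂]
  long_chord h₁ h₂ x y hA _ _ := by
    simp only [chordArcs, List.cons.injEq, and_true] at hA
    rw [← hA.1, ← hA.2]
    exact hl h₁ h₂
  single _ x hA _ := by simp [chordArcs] at hA

theorem branchNodes_singleton (C : Set (ℝ × ℝ)) (k : FixedKind) (arcs : List Arc)
    (below : List Branch) :
    branchNodes [.mk C k arcs below] = .mk C k arcs below :: branchNodes below := by
  simp [branchNodes, Branch.nodes]

/-- The requirements on the lower vertex do not involve the chords above it, so the chordal domain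
can be exchanged for its limit. -/
theorem Branch.IsAdmissible.congr {f : ℝ → ℝ} {ε : ℝ} {C C' : Set (ℝ × ℝ)} {k : FixedKind}
    {arcs : List Arc} {below : List Branch}
    (h : (Branch.mk C k arcs below).IsAdmissible f ε ∧ (Branch.mk C k arcs below).LeafRoot f) :
    (Branch.mk C' k arcs below).IsAdmissible f ε ∧ (Branch.mk C' k arcs below).LeafRoot f := h

/-- A chord over a chordal domain is a good block. -/
theorem isGood_chord {f : ℝ → ℝ} {η l₀ l₁ : ℝ} {a b : ℝ → ℝ} {k : FixedKind} {arcs : List Arc}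
    {below : List Branch} {l r : Side} (h : IsChordFamily f a b l₀ l₁) (hlt : l₀ < l₁)
    (hl₁ : l₁ ≤ 2 * η) (hh : hull arcs = (a l₀, b l₀))
    (hbr : ∀ c ∈ branchNodes [.mk ((fun l => (a l, b l)) '' Icc l₀ l₁) k arcs below],
      c.IsAdmissible f η ∧ c.LeafRoot f) (hl : l = .left → r = .right → l₁ = 2 * η) :
    (⟨l, r, chordArcs (a l₁) (b l₁), [.mk ((fun l => (a l, b l)) '' Icc l₀ l₁) k arcs below],
      dslope (deriv f) (a l₁) (b l₁)⟩ : Block).IsGood f η := by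
  have h1 := h.closed l₁ (right_mem_Icc.2 hlt.le)
  have h2 : a l₁ < b l₁ := by linarith [h1.1, h.nonneg]
  refine ⟨Or.inr (Or.inr (isFigure_chordArcs h2 h1.2.1 fun h₁ h₂ => h1.1.trans (hl h₁ h₂))),
    ?_, ?_, hbr⟩
  · refine List.Forall₂.cons ?_ List.Forall₂.nil
    exact isChordalDomain_iff.2 ⟨a, b, l₀, l₁, h, hlt, by simp, hh, rfl⟩
  · intro g hg
    simp only [chordArcs, gaps, EReal.toReal_coe, List.mem_singleton] at hg
    rw [hg]
    exact h1.1.trans_le hl₁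

/-! ### Full flows -/

/-- The parametrizations of nested domains agree, so they define one family for all lengths below
`2η`; its upper chord is added by `IsChordFamily.extend`. -/
theorem exists_family_of_monotone {f : ℝ → ℝ} {κ₀ η₁ η l₀ : ℝ} (hf : IsBoundary f κ₀)
    (h01 : η₁ < η) {C : ℝ → Set (ℝ × ℝ)} (hC : MonotoneOn C (Ioo η₁ η))
    (h : ∀ ε ∈ Ioo η₁ η, ∃ a b, IsChordFamily f a b l₀ (2 * ε) ∧ l₀ < 2 * ε ∧
      C ε = (fun l => (a l, b l)) '' Icc l₀ (2 * ε)) :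
    ∃ a b, IsChordFamily f a b l₀ (2 * η) ∧ ∀ ε ∈ Ioo η₁ η, ∀ a' b',
      IsChordFamily f a' b' l₀ (2 * ε) → C ε = (fun l => (a' l, b' l)) '' Icc l₀ (2 * ε) →
      ∀ l ∈ Icc l₀ (2 * ε), a' l = a l ∧ b' l = b l := by
  choose! a b hfam hlt hCe using h
  have hagree : ∀ ε ∈ Ioo η₁ η, ∀ ε' ∈ Ioo η₁ η, ε ≤ ε' → ∀ l ∈ Icc l₀ (2 * ε),
      a ε' l = a ε l ∧ b ε' l = b ε l := by
    intro ε hε ε' hε' hle l hl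
    exact ((hfam ε hε).eqOn (hfam ε' hε') (hCe ε hε ▸ hCe ε' hε' ▸ hC hε hε' hle) hl).2
  -- A choice of a parameter in `(η₁, η)` whose domain contains the length `l`: the midpoint between
  -- `max (l/2) η₁` and `η`.
  set e : ℝ → ℝ := fun l => (max (l / 2) η₁ + η) / 2 with he
  have hemem : ∀ l < 2 * η, e l ∈ Ioo η₁ η ∧ l ≤ 2 * e l := by
    intro l hl
    have h1 := le_max_left (l / 2) η₁
    have h2 := le_max_right (l / 2) η₁
    have h3 : max (l / 2) η₁ < η := max_lt (by linarith) h01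
    simp only [he]
    exact ⟨⟨by linarith, by linarith⟩, by linarith⟩
  have hglob : ∀ ε ∈ Ioo η₁ η, ∀ l ∈ Icc l₀ (2 * ε),
      a (e l) l = a ε l ∧ b (e l) l = b ε l := by
    intro ε hε l hl
    obtain ⟨h1, h2⟩ := hemem l (by linarith [hl.2, hε.2])
    rcases le_total (e l) ε with hle | hle
    · have := hagree _ h1 _ hε hle l ⟨hl.1, h2⟩
      exact ⟨this.1.symm, this.2.symm⟩
    · exact hagree _ hε _ h1 hle l hl
  have hL : l₀ < 2 * η := by
    obtain ⟨ε, hε⟩ := nonempty_Ioo.2 h01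
    linarith [hlt ε hε, hε.2]
  obtain ⟨a', b', hfam', ha', hb'⟩ := IsChordFamily.extend (a := fun l => a (e l) l)
    (b := fun l => b (e l) l) hf hL fun l₁ hl₁ => by
      obtain ⟨h1, h2⟩ := hemem l₁ hl₁.2
      refine IsChordFamily.mono ?_ h2
      exact (hfam _ h1).congr (fun l hl => (hglob _ h1 l hl).1) fun l hl => (hglob _ h1 l hl).2
  refine ⟨a', b', hfam', fun ε hε a₂ b₂ h2 hC2 l hl => ?_⟩
  have h3 := ((hfam ε hε).eqOn h2 (hCe ε hε ▸ hC2.le) hl).2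
  have hne : l ≠ 2 * η := by linarith [hl.2, hε.2]
  rw [h3.1, h3.2, ha' l hne, hb' l hne, (hglob ε hε l hl).1, (hglob ε hε l hl).2]
  exact ⟨rfl, rfl⟩

theorem kindOfShape_chordArcs (f : ℝ → ℝ) (a b : ℝ) :
    kindOfShape f .right .left (chordArcs a b) = .birdie ∧
    (∀ s, kindOfShape f s s (chordArcs a b) = .trolleybus s) ∧
    kindOfShape f .left .right (chordArcs a b) =
      if DL f a b = 0 ∨ DR f a b = 0 then .thirdType else .firstType := by
  refine ⟨by simp [kindOfShape, chordArcs], fun s => ?_, ?_⟩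
  · cases s <;> simp [kindOfShape, chordArcs]
  · by_cases hD : DL f a b = 0 ∨ DR f a b = 0 <;> simp [kindOfShape, chordArcs, hD]

/-- The limit is the chord of length `2η` over the completed domain. Its differentials may vanish in
the limit, and the renaming of long chords matches exactly the case distinction in `kindOfShape`. -/
theorem isFigureLimit_fullFlow {f : ℝ → ℝ} {κ₀ η₁ η : ℝ} (hf : IsBoundary f κ₀) (h0 : 0 ≤ η₁)
    (h01 : η₁ < η) {v : ℝ → FreeVertex} (hv : ∀ ε ∈ Ioo η₁ η, (v ε).IsStanding f ε)
    (h : IsFullFlow (Ioo η₁ η) v) : ∃ F V, IsFigureLimit f (Ioo η₁ η) η v F V := by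
  obtain ⟨hK, C, ⟨k, arcs, below, hB⟩, hC⟩ := h
  have hpos : ∀ ε ∈ Ioo η₁ η, 0 < ε := fun ε hε => h0.trans_lt hε.1
  set l₀ := (hull arcs).2 - (hull arcs).1 with hl₀
  have hex : ∀ ε ∈ Ioo η₁ η, ∃ a b, IsChordFamily f a b l₀ (2 * ε) ∧ l₀ < 2 * ε ∧
      C ε = (fun l => (a l, b l)) '' Icc l₀ (2 * ε) ∧
      (v ε).arcs = chordArcs (a (2 * ε)) (b (2 * ε)) ∧ hull arcs = (a l₀, b l₀) := by
    intro ε hε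
    obtain ⟨a, b, l, -, h2, h3, h4, h5, h6, -, h8⟩ :=
      exists_family_of_isChord (hv ε hε).admissible (Or.inl (hK ε hε)) (hB ε hε)
    obtain rfl := h8 (hK ε hε)
    exact ⟨a, b, h2, h3, h5, h4, h6⟩
  obtain ⟨a, b, hfam, hagree⟩ := exists_family_of_monotone hf h01 hC fun ε hε =>
    let ⟨a, b, h1, h2, h3, _⟩ := hex ε hε
    ⟨a, b, h1, h2, h3⟩
  have hε : ∀ ε ∈ Ioo η₁ η, l₀ < 2 * ε ∧ C ε = (fun l => (a l, b l)) '' Icc l₀ (2 * ε) ∧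
      (v ε).arcs = chordArcs (a (2 * ε)) (b (2 * ε)) ∧ hull arcs = (a l₀, b l₀) := by
    intro ε hε
    obtain ⟨a', b', h1, h2, h3, h4, h5⟩ := hex ε hε
    have h6 := hagree ε hε a' b' h1 h3
    refine ⟨h2, ?_, ?_, ?_⟩
    · rw [h3]
      exact image_congr fun l hl => by rw [(h6 l hl).1, (h6 l hl).2]
    · rw [h4, (h6 _ (right_mem_Icc.2 h2.le)).1, (h6 _ (right_mem_Icc.2 h2.le)).2]
    · rw [h5, (h6 _ (left_mem_Icc.2 h2.le)).1, (h6 _ (left_mem_Icc.2 h2.le)).2]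
  obtain ⟨ε₀, hε₀⟩ : (Ioo η₁ η).Nonempty := nonempty_Ioo.2 h01
  have hlt : l₀ < 2 * η := by linarith [(hε ε₀ hε₀).1, hε₀.2]
  have hbr : ∀ c ∈ branchNodes [.mk ((fun l => (a l, b l)) '' Icc l₀ (2 * η)) k arcs below],
      c.IsAdmissible f η ∧ c.LeafRoot f := by
    have h1 := (hv ε₀ hε₀).branches
    rw [hB ε₀ hε₀] at h1
    rw [branchNodes_singleton] at h1 ⊢
    intro c hc
    rcases List.mem_cons.1 hc with rfl | hc
    · have h2 := (h1 _ List.mem_cons_self).imp_left (Branch.IsAdmissible.mono hε₀.2.le)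
      exact Branch.IsAdmissible.congr h2
    · exact (h1 c (by simp [hc])).imp_left (Branch.IsAdmissible.mono hε₀.2.le)
  have hη := hfam.closed (2 * η) (right_mem_Icc.2 hlt.le)
  have hsq : ∀ e : ℕ → ℝ, (∀ n, e n ∈ Ioo η₁ η) → ∀ n, 2 * e n ∈ Icc l₀ (2 * η) := fun e he n =>
    ⟨(hε _ (he n)).1.le, by linarith [(he n).2]⟩
  have hlims : ∀ e : ℕ → ℝ, (∀ n, e n ∈ Ioo η₁ η) → Tendsto e atTop (𝓝 η) → ∀ c : ℝ → ℝ,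
      ContinuousOn c (Icc l₀ (2 * η)) → ∀ l ∈ Icc l₀ (2 * η),
      Tendsto (fun n => c (min l (2 * e n))) atTop (𝓝 (c l)) := by
    intro e he hlim c hc l hl
    refine (hc l hl).tendsto.comp (tendsto_nhdsWithin_iff.2 ⟨?_, Eventually.of_forall fun n =>
      ⟨le_min hl.1 (hsq e he n).1, (min_le_left _ _).trans hl.2⟩⟩)
    have h1 : Tendsto (fun n => min l (2 * e n)) atTop (𝓝 (min l (2 * η))) :=
      tendsto_const_nhds.min (hlim.const_mul 2)
    rwa [min_eq_left hl.2] at h1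
  have hlims' : ∀ e : ℕ → ℝ, (∀ n, e n ∈ Ioo η₁ η) → Tendsto e atTop (𝓝 η) → ∀ c : ℝ → ℝ,
      ContinuousOn c (Icc l₀ (2 * η)) → Tendsto (fun n => c (2 * e n)) atTop (𝓝 (c (2 * η))) := by
    intro e he hlim c hc
    refine (hlims e he hlim c hc _ (right_mem_Icc.2 hlt.le)).congr fun n => ?_
    rw [min_eq_right (hsq e he n).2]
  have hσ' : ∀ e σ : ℕ → ℝ, (∀ n, e n ∈ Ioo η₁ η) → (∀ n, IsLinearity f (v (e n)).arcs (σ n)) →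
      σ = fun n => dslope (deriv f) (a (2 * e n)) (b (2 * e n)) := fun e σ he h => funext fun n => by
    have h1 := h n
    rw [(hε _ (he n)).2.2.1] at h1
    refine h1.eq_dslope ?_
    linarith [(hfam.closed _ (hsq e he n)).1, hpos _ (he n)]
  refine ⟨⟨chordArcs (a (2 * η)) (b (2 * η)),
    [.mk ((fun l => (a l, b l)) '' Icc l₀ (2 * η)) k arcs below],
    dslope (deriv f) (a (2 * η)) (b (2 * η))⟩, fun K => ⟨K, chordArcs (a (2 * η)) (b (2 * η)),
    [.mk ((fun l => (a l, b l)) '' Icc l₀ (2 * η)) k arcs below]⟩,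
    fun ε h1 => ?_, fun ε h1 => ?_, fun ε _ h2 => absurd h2 (EReal.coe_ne_bot _),
    fun ε _ h2 => absurd h2 (EReal.coe_ne_top _), fun ε h1 l r _ _ _ _ => ?_, fun ε h1 => ?_, ?_,
    fun e σ he hlim hσ _ => ?_, fun e σ he hlim hσ _ => ?_⟩
  · rw [(hε ε h1).2.2.1]
    exact iff_of_false (EReal.coe_ne_bot _) (EReal.coe_ne_bot _)
  · rw [(hε ε h1).2.2.1]
    exact iff_of_false (EReal.coe_ne_top _) (EReal.coe_ne_top _)
  · exact isGood_chord hfam hlt le_rfl (hε ε₀ hε₀).2.2.2 hbr fun _ _ => rfl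
  · rw [hK ε h1]
    simp only [Figure.block, Block.vertex, Kind.leftSide, Kind.rightSide,
      (kindOfShape_chordArcs f _ _).2.2, renameLongChord]
    have e1 : hull (chordArcs (a (2 * η)) (b (2 * η))) = (a (2 * η), b (2 * η)) := by
      simp [hull, chordArcs, leftEnd, rightEnd]
    rw [e1]
    split_ifs <;> simp [collapseChord]
  · intro e K he hlim hK'
    refine ⟨hK', ?_, ?_⟩
    · simp only [(hε _ (he _)).2.2.1]
      exact .cons (.point (hlims' e he hlim a hfam.continuousOn_left))
        (.cons (.point (hlims' e he hlim b hfam.continuousOn_right)) .nil)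
    · simp only [hB _ (he _)]
      refine .cons ⟨fun n => C (e n), k, arcs, below, fun _ => rfl, ?_⟩ .nil
      congr 1
      ext p
      constructor
      · rintro ⟨l, hl, rfl⟩
        -- A chord of length `l` is approximated by itself once it belongs to the domain, and by the
        -- upper chord before that; the upper chord of the limit is only reached in this second way.
        refine ⟨fun n => (a (min l (2 * e n)), b (min l (2 * e n))), fun n => ?_,
          (hlims e he hlim a hfam.continuousOn_left l hl).prodMk_nhds
            (hlims e he hlim b hfam.continuousOn_right l hl)⟩
        change _ ∈ C (e n)
        rw [(hε _ (he n)).2.1]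
        exact ⟨_, ⟨le_min hl.1 (hsq e he n).1, min_le_right _ _⟩, rfl⟩
      · rintro ⟨q, hq, hqp⟩
        refine hfam.isCompact.isClosed.mem_of_tendsto hqp (Eventually.of_forall fun n => ?_)
        have h1 : q n ∈ C (e n) := hq n
        rw [(hε _ (he n)).2.1] at h1
        exact image_mono (Icc_subset_Icc_right (hsq e he n).2) h1
  · rw [hσ' e σ he hσ]
    simp only [(hε _ (he _)).2.2.1]
    exact .increasing hf.continuous_secondDeriv (hfam.chordCurve_right hf)
      (fun n => (hsq e he n).1) (fun n => ⟨hpos _ (he n), (he n).2.le⟩) hlim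
  · rw [hσ' e σ he hσ]
    simp only [(hε _ (he _)).2.2.1]
    have := PortTendsto.increasing (hf.continuous_secondDeriv.comp continuous_neg)
      (hfam.chordCurve_left hf) (fun n => (hsq e he n).1)
      (fun n => ⟨hpos _ (he n), (he n).2.le⟩) hlim
    exact this

/-! ### Decreasing flows -/

theorem exists_mem_of_mem_gaps {A : List Arc} {g : ℝ × ℝ} (h : g ∈ gaps A) :
    ∃ x ∈ A, ∃ y ∈ A, g = (x.r.toReal, y.l.toReal) := by
  induction A with
  | nil => simp [gaps] at h
  | cons x xs ih =>
    cases xs with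
    | nil => simp [gaps] at h
    | cons y ys =>
      rw [gaps, List.mem_cons] at h
      rcases h with rfl | h
      · exact ⟨x, by simp, y, by simp, rfl⟩
      · obtain ⟨x', hx', y', hy', h'⟩ := ih h
        exact ⟨x', by simp [hx'], y', by simp [hy'], h'⟩

theorem ArcsOrdered.mem_left {A : List Arc} (h : ArcsOrdered A) {a : ℝ} (ha : leftEnd A = a) :
    a ∈ arcPoints A := by
  rcases A with _ | ⟨x, xs⟩
  · exact absurd rfl h.1
  have ha' : x.l = a := ha
  exact mem_arcPoints_head ha'.le (ha' ▸ (h.2.1 x (by simp)).1)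

theorem ArcsOrdered.mem_right {A : List Arc} (h : ArcsOrdered A) {b : ℝ} (hb : rightEnd A = b) :
    b ∈ arcPoints A := by
  rcases List.eq_nil_or_concat A with rfl | ⟨xs, x, rfl⟩
  · exact absurd rfl h.1
  rw [List.concat_eq_append] at *
  rw [rightEnd_append] at hb
  exact mem_arcPoints_last (hb ▸ (h.2.1 x (by simp)).1) hb.ge

theorem fixedKindOfShape_cases (A : List Arc) :
    fixedKindOfShape A = .closedMulticup ∨ ∀ x ∈ A, x.l = x.r := by
  rcases A with _ | ⟨x, _ | ⟨y, _ | ⟨z, A⟩⟩⟩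
  · simp
  · by_cases h : x.l = x.r <;> simp [fixedKindOfShape, h]
  · by_cases h : x.l = x.r ∧ y.l = y.r
    · exact Or.inr (by simpa using h)
    · exact Or.inl (by simp [fixedKindOfShape, h])
  · exact Or.inl (by simp [fixedKindOfShape])

theorem Branch.IsAdmissible.ends {f : ℝ → ℝ} {ε : ℝ} {c : Branch} (h : c.IsAdmissible f ε) :
    leftEnd c.arcs = ((hull c.arcs).1 : ℝ) ∧ rightEnd c.arcs = ((hull c.arcs).2 : ℝ) :=
  ⟨(EReal.coe_toReal h.2.1.left_ne_top h.2.2.1).symm,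
    (EReal.coe_toReal h.2.2.2.1 h.2.1.right_ne_bot).symm⟩

/-- A vertex subordinated to other vertices becomes a good block if the chordal domain above it
disappears. -/
theorem isGood_of_branch {f : ℝ → ℝ} {ε : ℝ} {c : Branch} {l r : Side}
    (hc : ∀ d ∈ c.nodes, d.IsAdmissible f ε ∧ d.LeafRoot f) (hlr : l = .left → r ≠ .right) :
    (⟨l, r, c.arcs, c.children, dslope (deriv f) (hull c.arcs).1 (hull c.arcs).2⟩ : Block).IsGood
      f ε := by
  have hnodes : c.nodes = c :: branchNodes c.children := by
    cases c; simp [Branch.nodes, Branch.children]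
  rw [hnodes] at hc
  obtain ⟨hadm, hleaf⟩ := hc c (by simp)
  obtain ⟨e1, e2⟩ := hadm.ends
  obtain ⟨h1, h2, h3, h4, h5, ⟨σ, h6⟩, h7⟩ := hadm
  refine ⟨Or.inr (Or.inr ⟨h2, ?_, ?_, fun h => absurd h h3, fun h => absurd h h4,
    fun hl hr => absurd hr (hlr hl), fun hl hr => absurd hr (hlr hl), ?_⟩), h7, ?_,
    fun d hd => hc d (by simp [hd])⟩
  -- For a single point any slope satisfies linearity; the average over the degenerate chord selects
  -- `f''`, the value that a vertex of the fifth type needs.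
  · by_cases he : (hull c.arcs).1 = (hull c.arcs).2
    · have h8 := h2.exists_of_eq e1.ge (e2.trans (congrArg _ he.symm)).le
      change IsLinearity f c.arcs _
      rw [h8]
      have h9 : ∀ x ∈ arcPoints [(⟨(hull c.arcs).1, (hull c.arcs).1⟩ : Arc)],
          x = (hull c.arcs).1 := by
        rintro x ⟨z, hz, hz1, hz2⟩
        rw [List.mem_singleton] at hz
        subst hz
        exact le_antisymm (EReal.coe_le_coe_iff.1 hz2) (EReal.coe_le_coe_iff.1 hz1)
      intro x hx y hy
      rw [h9 x hx, h9 y hy]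
      simp [CupEquation]
    · rwa [h6.dslope_eq (h2.mem_left e1) (h2.mem_right e2) fun h => absurd h he]
  · intro x hx hne
    rcases fixedKindOfShape_cases c.arcs with h | h
    · rw [Branch.LeafRoot, h1, h] at hleaf
      exact hleaf x hx hne
    · exact absurd (h x hx) hne
  · intro _ x hA hx
    have hA' : c.arcs = [x] := hA
    have h8 : c.kind = .secondType := by rw [h1, hA']; simp [fixedKindOfShape, hx]
    rw [Branch.LeafRoot, h8] at hleaf
    have h9 : hull c.arcs = (x.l.toReal, x.l.toReal) := by
      rw [hA']; simp [hull, leftEnd, rightEnd, hx]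
    simp only [h9] at hleaf ⊢
    exact ⟨hleaf, dslope_same _ _⟩
  · intro g hg
    obtain ⟨x, hx, y, hy, rfl⟩ := exists_mem_of_mem_gaps hg
    have h8 := isChain_arcs_le (fun z hz => (h2.2.1 z hz).1) h2.2.2
    have hx' := h2.2.1 x hx
    have hy' := h2.2.1 y hy
    have h9 : (hull c.arcs).1 ≤ x.r.toReal := EReal.toReal_le_toReal ((h8 x hx).1.trans hx'.1) h3
      (ne_top_of_le_ne_top h4 (h8 x hx).2)
    have h10 : y.l.toReal ≤ (hull c.arcs).2 := EReal.toReal_le_toReal (hy'.1.trans (h8 y hy).2)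
      (ne_bot_of_le_ne_bot h3 (h8 y hy).1) h4
    simp only
    linarith

/-- After some `ε₀` all domains lie in the one for `ε₀`, so a base is determined by its length,
which decreases to its infimum `L`. If `L` exceeds the length of the lower chord, the limit is the
chord of length `L`; otherwise the chordal domain has disappeared and the lower vertex takes over.
-/
theorem isFigureLimit_decreasingFlow {f : ℝ → ℝ} {κ₀ η₁ η : ℝ} (hf : IsBoundary f κ₀) (h0 : 0 ≤ η₁)
    (h01 : η₁ < η) {v : ℝ → FreeVertex} (hv : ∀ ε ∈ Ioo η₁ η, (v ε).IsStanding f ε)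
    (h : IsDecreasingFlow (Ioo η₁ η) v) : ∃ F V, IsFigureLimit f (Ioo η₁ η) η v F V := by
  obtain ⟨hK, ⟨C, ⟨k, arcs, below, hB⟩, hC⟩, -, hℓ⟩ := h
  have hpos : ∀ ε ∈ Ioo η₁ η, 0 < ε := fun ε hε => h0.trans_lt hε.1
  set l₀ := (hull arcs).2 - (hull arcs).1 with hl₀
  set ℓ : ℝ → ℝ := fun ε => (hull (v ε).arcs).2 - (hull (v ε).arcs).1 with hℓdef
  have hex : ∀ ε ∈ Ioo η₁ η, ∃ a b, IsChordFamily f a b l₀ (ℓ ε) ∧ l₀ < ℓ ε ∧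
      (v ε).arcs = chordArcs (a (ℓ ε)) (b (ℓ ε)) ∧
      C ε = (fun l => (a l, b l)) '' Icc l₀ (ℓ ε) ∧ hull arcs = (a l₀, b l₀) ∧ ℓ ε ≤ 2 * ε := by
    intro ε hε
    obtain ⟨a, b, l, h1, h2, h3, h4, h5, h6, h7, -⟩ := exists_family_of_isChord
      (hv ε hε).admissible (Or.inr (hK ε hε).symm) (hB ε hε)
    subst h1
    exact ⟨a, b, h2, h3, h4, h5, h6, h7⟩
  obtain ⟨ε₀, hε₀⟩ : (Ioo η₁ η).Nonempty := nonempty_Ioo.2 h01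
  obtain ⟨a, b, hfam, hlt₀, -, hC₀, hhull, -⟩ := hex ε₀ hε₀
  have hge : ∀ ε ∈ Ioo η₁ η, ε₀ ≤ ε → C ε = (fun l => (a l, b l)) '' Icc l₀ (ℓ ε) ∧
      (v ε).arcs = chordArcs (a (ℓ ε)) (b (ℓ ε)) := by
    intro ε hε hle
    obtain ⟨a', b', h1, h2, h3, h4, -⟩ := hex ε hε
    have h5 := fun l hl => (h1.eqOn hfam (h4 ▸ hC₀ ▸ hC hε₀ hε hle) (l := l) hl).2
    refine ⟨?_, ?_⟩
    · rw [h4]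
      exact image_congr fun l hl => by rw [(h5 l hl).1, (h5 l hl).2]
    · rw [h3, (h5 _ (right_mem_Icc.2 h2.le)).1, (h5 _ (right_mem_Icc.2 h2.le)).2]
  set L := sInf (ℓ '' Ioo η₁ η) with hL
  have hbdd : BddBelow (ℓ '' Ioo η₁ η) := by
    refine ⟨l₀, ?_⟩
    rintro _ ⟨ε, hε, rfl⟩
    obtain ⟨-, -, -, h2, -⟩ := hex ε hε
    exact h2.le
  have hLle : ∀ ε ∈ Ioo η₁ η, L ≤ ℓ ε := fun ε hε => csInf_le hbdd ⟨ε, hε, rfl⟩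
  have hl₀L : l₀ ≤ L := by
    refine le_csInf ((nonempty_Ioo.2 h01).image _) ?_
    rintro _ ⟨ε, hε, rfl⟩
    obtain ⟨-, -, -, h2, -⟩ := hex ε hε
    exact h2.le
  have hLη : L ≤ 2 * η := by
    obtain ⟨-, -, -, -, -, -, -, h2⟩ := hex ε₀ hε₀
    linarith [hLle ε₀ hε₀, hε₀.2]
  have hlim : ∀ e : ℕ → ℝ, (∀ n, e n ∈ Ioo η₁ η) → Tendsto e atTop (𝓝 η) →
      Tendsto (fun n => ℓ (e n)) atTop (𝓝 L) := fun e he hlim =>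
    (hℓ.tendsto_nhdsWithin_Ioo_left (nonempty_Ioo.2 h01) hbdd).comp
      (tendsto_nhdsWithin_iff.2 ⟨hlim, Eventually.of_forall fun n => (he n).2⟩)
  have hLmem : L ∈ Icc l₀ (ℓ ε₀) := ⟨hl₀L, hLle ε₀ hε₀⟩
  have hfamL := hfam.mono hLmem.2
  have hnodes : ∀ d ∈ (Branch.mk ((fun l => (a l, b l)) '' Icc l₀ L) k arcs below).nodes,
      d.IsAdmissible f η ∧ d.LeafRoot f := by
    have h1 := (hv ε₀ hε₀).branches
    rw [hB ε₀ hε₀, branchNodes_singleton] at h1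
    intro c hc
    rw [Branch.nodes] at hc
    rcases List.mem_cons.1 hc with rfl | hc
    · have h2 := (h1 _ List.mem_cons_self).imp_left (Branch.IsAdmissible.mono hε₀.2.le)
      exact Branch.IsAdmissible.congr h2
    · exact (h1 c (by simp [hc])).imp_left (Branch.IsAdmissible.mono hε₀.2.le)
  obtain ⟨e1, e2⟩ := (hnodes _ (by rw [Branch.nodes]; exact List.mem_cons_self)).1.ends
  simp only [Branch.arcs] at e1 e2
  obtain ⟨V, hV⟩ : ∃ V : Kind → FreeVertex, V = fun K => ⟨K, chordArcs (a L) (b L),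
    [.mk ((fun l => (a l, b l)) '' Icc l₀ L) k arcs below]⟩ := ⟨_, rfl⟩
  have hVren : ∀ K, K = .birdie ∨ (∃ s, K = .trolleybus s) → renameLongChord f (V K) = V K := by
    rintro K (rfl | ⟨s, rfl⟩) <;> simp [hV, renameLongChord]
  obtain ⟨F, hFl, hFr, hFs, hgood, hrec⟩ : ∃ F : Figure, leftEnd F.arcs = (a L : ℝ) ∧
      rightEnd F.arcs = (b L : ℝ) ∧ F.slope = dslope (deriv f) (a L) (b L) ∧
      (∀ l r : Side, (l = .left → r ≠ .right) → (F.block l r).IsGood f η) ∧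
      ∀ K, K = .birdie ∨ (∃ s, K = .trolleybus s) →
        collapseChord f (V K) = (F.block K.leftSide K.rightSide).vertex f := by
    -- In the first case the chordal domain collapses, and the figure is the lower vertex with its
    -- own arcs and branches; in the second case a shorter chordal domain remains.
    rcases hl₀L.eq_or_lt with he | hlt
    · refine ⟨⟨arcs, below, dslope (deriv f) (hull arcs).1 (hull arcs).2⟩, ?_, ?_, ?_, ?_, ?_⟩
      · rw [e1, hhull, he]
      · rw [e2, hhull, he]
      · rw [hhull, he]
      · exact fun l r hlr => isGood_of_branch hnodes hlr
      · intro K hK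
        rw [collapseChord, hV]
        simp only
        rw [if_pos]
        · rfl
        · refine ⟨?_, ?_, hK.symm⟩
          · rw [e1, hhull, he]; rfl
          · rw [e2, hhull, he]; rfl
    · refine ⟨⟨chordArcs (a L) (b L), [.mk ((fun l => (a l, b l)) '' Icc l₀ L) k arcs below],
        dslope (deriv f) (a L) (b L)⟩, rfl, rfl, rfl, ?_, ?_⟩
      · intro l r hlr
        refine isGood_chord hfamL hlt hLη hhull ?_ fun h1 h2 => absurd h2 (hlr h1)
        simpa [branchNodes] using hnodes
      · intro K hK
        rw [collapseChord, hV]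
        simp only
        rw [if_neg]
        · obtain ⟨k1, k2, -⟩ := kindOfShape_chordArcs f (a L) (b L)
          rcases hK with rfl | ⟨s, rfl⟩
          · simp only [Figure.block, Block.vertex, Kind.leftSide, Kind.rightSide, k1]
          · simp only [Figure.block, Block.vertex, Kind.leftSide, Kind.rightSide, k2]
        · rintro ⟨h1, -⟩
          have h2 : leftEnd arcs = (a L : ℝ) := h1
          rw [e1, hhull, EReal.coe_eq_coe_iff] at h2
          exact absurd h2 (hfamL.strictAntiOn hf (left_mem_Icc.2 hlt.le)
            (right_mem_Icc.2 hlt.le) hlt).ne'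
  have hev : ∀ e : ℕ → ℝ, (∀ n, e n ∈ Ioo η₁ η) → Tendsto e atTop (𝓝 η) → ∀ᶠ n in atTop,
      ε₀ ≤ e n := fun e _ hlim => hlim.eventually (eventually_ge_nhds hε₀.2)
  have hev1 : ∀ e : ℕ → ℝ, (∀ n, e n ∈ Ioo η₁ η) → Tendsto e atTop (𝓝 η) → ∀ᶠ n in atTop,
      ℓ (e n) ≤ ℓ ε₀ := fun e he hlim => (hev e he hlim).mono fun n hn => hℓ hε₀ (he n) hn
  have hp : ∀ e σ : ℕ → ℝ, (∀ n, e n ∈ Ioo η₁ η) → Tendsto e atTop (𝓝 η) →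
      (∀ n, IsLinearity f (v (e n)).arcs (σ n)) → ∀ᶠ n in atTop,
      (v (e n)).arcs = chordArcs (a (ℓ (e n))) (b (ℓ (e n))) ∧
        σ n = dslope (deriv f) (a (ℓ (e n))) (b (ℓ (e n))) := by
    intro e σ he hlim hσ
    filter_upwards [hev e he hlim, hev1 e he hlim] with n hn hn1
    have h1 := (hge _ (he n) hn).2
    refine ⟨h1, (h1 ▸ hσ n).eq_dslope ?_⟩
    obtain ⟨-, -, -, h2, -⟩ := hex _ (he n)
    linarith [(hfam.closed (ℓ (e n)) ⟨h2.le, hn1⟩).1, hfam.nonneg]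
  have hpos' : ∀ ε ∈ Ioo η₁ η, 0 < ℓ ε := fun ε hε => by
    obtain ⟨_, _, h1, h2, -⟩ := hex ε hε
    linarith [h1.nonneg]
  have hle2 : ∀ ε ∈ Ioo η₁ η, ℓ ε ≤ 2 * ε := fun ε hε => by
    obtain ⟨-, -, -, -, -, -, -, h1⟩ := hex ε hε
    exact h1
  have hreal : ∀ ε ∈ Ioo η₁ η, leftEnd (v ε).arcs ≠ ⊥ ∧ rightEnd (v ε).arcs ≠ ⊤ := fun ε hε => by
    obtain ⟨_, _, -, -, h1, -⟩ := hex ε hε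
    rw [h1]
    exact ⟨EReal.coe_ne_bot _, EReal.coe_ne_top _⟩
  refine ⟨F, V,
    fun ε hε => iff_of_false (hreal ε hε).1 (by rw [hFl]; exact EReal.coe_ne_bot _),
    fun ε hε => iff_of_false (hreal ε hε).2 (by rw [hFr]; exact EReal.coe_ne_top _), fun ε _ h1 => ?_, fun ε _ h1 => ?_,
    fun ε hε l r hl hr _ _ => hgood l r fun h1 h2 => ?_, fun ε hε => ?_, ?_, ?_, ?_⟩
  · rw [hFl] at h1; exact absurd h1 (EReal.coe_ne_bot _)
  · rw [hFr] at h1; exact absurd h1 (EReal.coe_ne_top _)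
  -- A trolleybus or a birdie never has left tangents on the left together with right tangents on
  -- the right, and absorbing angles cannot create this pair. So no length condition has to be
  -- verified.
  · have h3 := (hl h1).resolve_left (by rw [hFl]; exact EReal.coe_ne_bot _)
    have h4 := (hr h2).resolve_left (by rw [hFr]; exact EReal.coe_ne_top _)
    rcases hK ε hε with ⟨s, hs⟩ | hs <;> rw [hs] at h3 h4
    · exact Side.noConfusion (h3.symm.trans h4)
    · exact Side.noConfusion h3
  · rw [hVren _ (hK ε hε).symm, hrec _ (hK ε hε).symm]
  · intro e K he hlim' hKe
    rw [hV]
    refine ⟨hKe, ?_, ?_⟩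
    -- Convergence of lists demands two arcs for every `n`, but the formulas in terms of the fixed
    -- family hold only for `e n ≥ ε₀`. For the other `n` only the shape matters.
    · have hcc : ∀ n, ∃ x y, (v (e n)).arcs = chordArcs x y ∧
          (ε₀ ≤ e n → x = a (ℓ (e n)) ∧ y = b (ℓ (e n))) := by
        intro n
        obtain ⟨a', b', -, -, h1, -⟩ := hex _ (he n)
        by_cases hn : ε₀ ≤ e n
        · exact ⟨_, _, (hge _ (he n) hn).2, fun _ => ⟨rfl, rfl⟩⟩
        · exact ⟨_, _, h1, fun h => absurd h hn⟩
      choose x y hxy hxy' using hcc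
      have hc : ∀ c : ℝ → ℝ, ContinuousOn c (Icc l₀ (ℓ ε₀)) →
          Tendsto (fun n => c (ℓ (e n))) atTop (𝓝 (c L)) := fun c hc =>
        (hc L hLmem).tendsto.comp (tendsto_nhdsWithin_iff.2 ⟨hlim e he hlim',
          (hev1 e he hlim').mono fun n hn => ⟨hl₀L.trans (hLle _ (he n)), hn⟩⟩)
      simp only [hxy]
      refine .cons (.point ?_) (.cons (.point ?_) .nil)
      · exact (hc a hfam.continuousOn_left).congr'
          ((hev e he hlim').mono fun n hn => (hxy' n hn).1.symm)
      · exact (hc b hfam.continuousOn_right).congr'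
          ((hev e he hlim').mono fun n hn => (hxy' n hn).2.symm)
    · simp only [hB _ (he _)]
      refine .cons ⟨fun n => C (e n), k, arcs, below, fun _ => rfl, ?_⟩ .nil
      congr 1
      ext p
      constructor
      · rintro ⟨l, hl, rfl⟩
        refine ⟨fun n => (a l, b l), fun n => ?_, tendsto_const_nhds⟩
        change _ ∈ C (e n)
        rcases le_total ε₀ (e n) with hn | hn
        · rw [(hge _ (he n) hn).1]
          exact ⟨l, ⟨hl.1, hl.2.trans (hLle _ (he n))⟩, rfl⟩
        -- For parameters below `ε₀` the domain is larger still, so it also contains the chord.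
        · refine hC (he n) hε₀ hn ?_
          rw [hC₀]
          exact ⟨l, ⟨hl.1, hl.2.trans hLmem.2⟩, rfl⟩
      · rintro ⟨q, hq, hqp⟩
        have h1 : ∀ᶠ n in atTop, q n ∈ (fun l => (a l, b l)) '' Icc l₀ (ℓ ε₀) ∧
            (q n).2 - (q n).1 ≤ ℓ (e n) := by
          filter_upwards [hev e he hlim', hev1 e he hlim'] with n hn hn1
          have h2 : q n ∈ C (e n) := hq n
          rw [(hge _ (he n) hn).1] at h2
          refine ⟨image_mono (Icc_subset_Icc_right hn1) h2, ?_⟩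
          exact ((hfam.mono hn1).mem_image h2).1.2
        have h2 : p ∈ (fun l => (a l, b l)) '' Icc l₀ (ℓ ε₀) :=
          hfam.isCompact.isClosed.mem_of_tendsto hqp (h1.mono fun n hn => hn.1)
        obtain ⟨h3, h4, h5⟩ := hfam.mem_image h2
        have h6 : p.2 - p.1 ≤ L := le_of_tendsto_of_tendsto
          (((continuous_snd.sub continuous_fst).tendsto p).comp hqp) (hlim e he hlim')
          (h1.mono fun n hn => hn.2)
        exact ⟨p.2 - p.1, ⟨h3.1, h6⟩, Prod.ext h4 h5⟩
  · intro e σ he hlim' hσ _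
    rw [hFr, hFs]
    refine .decreasing hf.continuous_secondDeriv (hfam.chordCurve_right hf) hfam.nonneg hl₀L
      (fun n => hLle _ (he n)) (hev1 e he hlim') (fun n => hle2 _ (he n))
      (fun n => hpos' _ (he n)) (fun n => ⟨hpos _ (he n), (he n).2.le⟩) (hlim e he hlim')
      ((hp e σ he hlim' hσ).mono fun n hn => ⟨?_, hn.2⟩)
    rw [hn.1]; rfl
  · intro e σ he hlim' hσ _
    rw [hFl, hFs, ← EReal.coe_neg]
    refine .decreasing (hf.continuous_secondDeriv.comp continuous_neg) (hfam.chordCurve_left hf)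
      hfam.nonneg hl₀L (fun n => hLle _ (he n)) (hev1 e he hlim') (fun n => hle2 _ (he n))
      (fun n => hpos' _ (he n)) (fun n => ⟨hpos _ (he n), (he n).2.le⟩) (hlim e he hlim')
      ((hp e σ he hlim' hσ).mono fun n hn => ⟨?_, hn.2⟩)
    rw [hn.1]; rfl

/-! ### Edges and gaps -/

section gap

variable {g : ℝ → ℝ} {κ : ℝ} {p q c : EReal} {σ σ' τ : ℝ}

/-- A domain of right tangents counts as a gap whose angle sits at its far end, and one of left
tangents as a gap whose angle sits at its near end. So domains with and without an angle share one
uniqueness and one limit theorem. -/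
theorem RightEdge.gap (hlt : p < q) (h : RightEdge g κ p σ q σ') : Gap g κ p σ q σ' q where
  left_le := hlt.le
  le_right := le_rfl
  left_ne := hlt.ne_top
  right_ne := hlt.ne_bot
  lt_rightSlope := h.1
  lt_leftSlope u h₁ h₂ := absurd (h₁.trans h₂) (lt_irrefl _)
  balance t ht := by rw [h.2 t ht, ht, leftSlope_self]

theorem LeftEdge.gap (hlt : p < q) (h : LeftEdge g κ p σ q σ') : Gap g κ p σ q σ' p where
  left_le := le_rfl
  le_right := hlt.le
  left_ne := hlt.ne_top
  right_ne := hlt.ne_bot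
  lt_rightSlope u h₁ h₂ := absurd (h₁.trans h₂) (lt_irrefl _)
  lt_leftSlope := h.1
  balance t ht := by rw [h.2 t ht, ht, rightSlope_self]

theorem gap_of_angle (hlt : p < c) (hlt' : c < q) (h : RightEdge g κ p σ c τ)
    (h' : LeftEdge g κ c τ q σ') : Gap g κ p σ q σ' c where
  left_le := hlt.le
  le_right := hlt'.le
  left_ne := hlt.ne_top
  right_ne := hlt'.ne_bot
  lt_rightSlope := h.1
  lt_leftSlope := h'.1
  balance t ht := (h.2 t ht).trans (h'.2 t ht).symm

theorem Gap.rightEdge (h : Gap g κ p σ q σ' q) : RightEdge g κ p σ q σ' :=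
  ⟨h.lt_rightSlope, fun t ht => by rw [h.balance t ht, ht, leftSlope_self]⟩

theorem Gap.leftEdge (h : Gap g κ p σ q σ' p) : LeftEdge g κ p σ q σ' :=
  ⟨h.lt_leftSlope, fun t ht => by rw [← h.balance t ht, ht, rightSlope_self]⟩

theorem Gap.rightEdge_angle (h : Gap g κ p σ q σ' c) :
    RightEdge g κ p σ c (rightSlope g κ p σ c.toReal) :=
  ⟨h.lt_rightSlope, fun t ht => by rw [ht, EReal.toReal_coe]⟩

theorem Gap.leftEdge_angle (h : Gap g κ p σ q σ' c) :
    LeftEdge g κ c (rightSlope g κ p σ c.toReal) q σ' :=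
  ⟨h.lt_leftSlope, fun t ht => by rw [← h.balance t ht, ht, EReal.toReal_coe]⟩

end gap

/-! ### Graphs as woven from angles and other vertices -/

def angleVertex (c : EReal) : FreeVertex := ⟨.angle, [⟨c, c⟩], []⟩

open scoped Classical in
/-- The graph with the vertices `v 0, …, v k` and an angle at `c i` between the vertices number `i`
and `i + 1` if the adjacent tangents are right and left. -/
noncomputable def weave (k : ℕ) (v : ℕ → FreeVertex) (c : ℕ → EReal) (l r : ℕ → Side) :
    FoliationGraph :=
  match k with
  | 0 => [v 0]
  | k + 1 =>
    if r 0 = .right ∧ l 1 = .left then v 0 :: angleVertex (c 0) ::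
      weave k (fun i => v (i + 1)) (fun i => c (i + 1)) (fun i => l (i + 1)) (fun i => r (i + 1))
    else v 0 ::
      weave k (fun i => v (i + 1)) (fun i => c (i + 1)) (fun i => l (i + 1)) (fun i => r (i + 1))

theorem weave_congr {k : ℕ} {v v' : ℕ → FreeVertex} {c c' : ℕ → EReal} {l r l' r' : ℕ → Side}
    (hv : ∀ i ≤ k, v i = v' i) (hc : ∀ i < k, c i = c' i) (hl : ∀ i < k, l (i + 1) = l' (i + 1))
    (hr : ∀ i < k, r i = r' i) : weave k v c l r = weave k v' c' l' r' := by
  induction k generalizing v v' c c' l r l' r' with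
  | zero => simp [weave, hv]
  | succ k ih =>
    have h1 := ih (v := fun i => v (i + 1)) (v' := fun i => v' (i + 1)) (c := fun i => c (i + 1))
      (c' := fun i => c' (i + 1)) (l := fun i => l (i + 1)) (l' := fun i => l' (i + 1))
      (r := fun i => r (i + 1)) (r' := fun i => r' (i + 1)) (fun i hi => hv _ (by omega))
      (fun i hi => hc _ (by omega)) (fun i hi => hl _ (by omega)) (fun i hi => hr _ (by omega))
    have h2 := hl 0 (by omega)
    simp only [zero_add] at h2
    simp only [weave]
    rw [h1, hv 0 (by omega), hc 0 (by omega), hr 0 (by omega), h2]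

theorem weave_map {k : ℕ} {v : ℕ → FreeVertex} {c : ℕ → EReal} {l r : ℕ → Side}
    {φ : FreeVertex → FreeVertex} (hφ : ∀ c, φ (angleVertex c) = angleVertex c) :
    (weave k v c l r).map φ = weave k (fun i => φ (v i)) c l r := by
  induction k generalizing v c l r with
  | zero => simp [weave]
  | succ k ih =>
    simp only [weave]
    split_ifs <;> simp [ih, hφ]

theorem weave_converges {k : ℕ} {v : ℕ → ℕ → FreeVertex} {V : ℕ → FreeVertex}
    {c : ℕ → ℕ → EReal} {c' : ℕ → EReal} {l r : ℕ → Side}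
    (hv : ∀ i ≤ k, VertexConverges (fun n => v n i) (V i))
    (hc : ∀ i < k, Tendsto (fun n => c n i) atTop (𝓝 (c' i))) :
    GraphConverges (fun n => weave k (v n) (c n) l r) (weave k V c' l r) := by
  induction k generalizing v V c c' l r with
  | zero => exact .cons (hv 0 le_rfl) .nil
  | succ k ih =>
    have h1 := ih (v := fun n i => v n (i + 1)) (V := fun i => V (i + 1))
      (c := fun n i => c n (i + 1)) (c' := fun i => c' (i + 1)) (l := fun i => l (i + 1))
      (r := fun i => r (i + 1)) (fun i hi => hv _ (by omega)) (fun i hi => hc _ (by omega))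
    simp only [weave]
    split_ifs
    · refine .cons (hv 0 (by omega)) (.cons ⟨fun _ => rfl, .cons ?_ .nil, .nil⟩ h1)
      exact ⟨hc 0 (by omega), hc 0 (by omega)⟩
    · exact .cons (hv 0 (by omega)) h1

/-- The position of the angle between two neighbouring figures; if there is no angle, then it is
the end of the domain of right or left tangents. -/
def Junction (s s' : Side) (p q c : EReal) : Prop :=
  (s = .right ∧ s' = .left) ∨ (s = .right ∧ s' = .right ∧ c = q) ∨
    (s = .left ∧ s' = .left ∧ c = p)

/-- The conditions on the tangents between two neighbours. -/
def Adjacent (g : ℝ → ℝ) (κ : ℝ) (v : FreeVertex) (σ : ℝ) (w : FreeVertex) (σ' : ℝ) : Prop :=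
  v.kind.rightSide = w.kind.leftSide ∧ v.rightEnd < w.leftEnd ∧
    (v.kind.rightSide = .right → RightEdge g κ v.rightEnd σ w.leftEnd σ') ∧
    (v.kind.rightSide = .left → LeftEdge g κ v.rightEnd σ w.leftEnd σ')

/-- Two angles cannot be neighbours: after an angle the tangents are left, before it they are right.
Hence at most one angle separates consecutive other vertices. The slopes `β` are numbered along the
whole graph, `σ` along the vertices other than angles. -/
theorem exists_weave {g : ℝ → ℝ} {κ : ℝ} {P : FreeVertex → ℝ → Prop} (k : ℕ)
    (s : ℕ → FreeVertex) (Γ : FoliationGraph) (β : ℕ → ℝ)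
    (hfilter : Γ.filter (fun v => v.kind.notAngle) = List.ofFn fun i : Fin (k + 1) => s i)
    (hadj : ∀ i v w, Neighbours Γ i v w → Adjacent g κ v (β i) w (β (i + 1)))
    (hP : ∀ i v, Γ[i]? = some v → P v (β i))
    (hangle : ∀ v ∈ Γ, v.kind = .angle → ∃ c, v = angleVertex c)
    (hhead : ∀ v, Γ.head? = some v → v.kind ≠ .angle)
    (hlast : ∀ v, Γ.getLast? = some v → v.kind ≠ .angle) :
    ∃ (σ : ℕ → ℝ) (c : ℕ → EReal), σ 0 = β 0 ∧ Γ = weave k s c (fun i => (s i).kind.leftSide)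
        (fun i => (s i).kind.rightSide) ∧ (∀ i ≤ k, P (s i) (σ i)) ∧
      ∀ i < k, Junction (s i).kind.rightSide (s (i + 1)).kind.leftSide (s i).rightEnd
          (s (i + 1)).leftEnd (c i) ∧
        Gap g κ (s i).rightEnd (σ i) (s (i + 1)).leftEnd (σ (i + 1)) (c i) := by
  have hna : ∀ v : FreeVertex, v.kind ≠ .angle → v.kind.notAngle = true := by
    intro v hv
    cases hk : v.kind <;> simp_all [Kind.notAngle]
  induction k generalizing s Γ β with
  | zero =>
    cases Γ with
    | nil => simp at hfilter
    | cons v Γ =>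
      have hv := hna v (hhead v rfl)
      rw [List.filter_cons_of_pos (by exact hv)] at hfilter
      simp only [List.ofFn_succ, List.ofFn_zero, List.cons.injEq] at hfilter
      obtain ⟨hv0, hΓ⟩ := hfilter
      have hnil : Γ = [] := by
        by_contra hne
        have h1 : (v :: Γ).getLast? = some (Γ.getLast hne) := by
          rw [List.getLast?_cons, List.getLast?_eq_getLast_of_ne_nil hne]; rfl
        have h2 := hna _ (hlast _ h1)
        have h3 : Γ.getLast hne ∈ Γ.filter fun v => v.kind.notAngle :=
          List.mem_filter.2 ⟨List.getLast_mem hne, h2⟩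
        rw [hΓ] at h3
        simp at h3
      subst hnil
      have hv0' : v = s 0 := hv0
      refine ⟨β, fun _ => ⊥, rfl, by rw [hv0']; rfl, fun i hi => ?_, fun i hi => absurd hi (by omega)⟩
      obtain rfl : i = 0 := by omega
      exact hv0' ▸ hP 0 v rfl
  | succ k ih =>
    cases Γ with
    | nil => simp at hfilter
    | cons v Γ =>
      have hv := hna v (hhead v rfl)
      rw [List.filter_cons_of_pos (by exact hv), List.ofFn_succ, List.cons.injEq] at hfilter
      obtain ⟨hv0, hΓ⟩ := hfilter
      have hv0' : v = s 0 := hv0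
      simp only [Fin.val_succ] at hΓ
      cases Γ with
      | nil => simp at hΓ
      | cons w Γ =>
        have hlast' : ∀ x, (w :: Γ).getLast? = some x → x.kind ≠ .angle := fun x hx =>
          hlast x (by rw [List.getLast?_cons_cons]; exact hx)
        have hvw := hadj 0 v w ⟨rfl, rfl⟩
        by_cases hw : w.kind = .angle
        · obtain ⟨c₀, rfl⟩ := hangle w (by simp) hw
          cases Γ with
          | nil => exact absurd hw (hlast' _ rfl)
          | cons x Γ =>
            have hwx := hadj 1 _ x ⟨rfl, rfl⟩
            have hx : x.kind ≠ .angle := fun hx => by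
              have := hwx.1
              rw [hx] at this
              exact Side.noConfusion this
            rw [List.filter_cons_of_neg (by simp [angleVertex, Kind.notAngle])] at hΓ
            have hx1 : x = s 1 := by
              rw [List.filter_cons_of_pos (by exact hna x hx), List.ofFn_succ,
                List.cons.injEq] at hΓ
              exact hΓ.1
            obtain ⟨σ, c, h0, h1, h2, h3⟩ := ih (fun i => s (i + 1)) (x :: Γ) (fun i => β (i + 2)) hΓ
              (fun i v w h => hadj (i + 2) v w h) (fun i v h => hP (i + 2) v h)
              (fun v hv => hangle v (by simp [hv])) (fun y hy => by
                simp only [List.head?_cons, Option.some.injEq] at hy; exact hy ▸ hx)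
              (fun y hy => hlast' y (by rw [List.getLast?_cons_cons]; exact hy))
            have hR := hvw.1.trans (show (angleVertex c₀).kind.leftSide = .right from rfl)
            have hL : (s 1).kind.leftSide = .left := by
              rw [← hx1, ← hwx.1]; rfl
            have e1 := hvw.2.2.1 hR
            have e2 := hwx.2.2.2 rfl
            have hgap := gap_of_angle hvw.2.1 hwx.2.1 e1 e2
            refine ⟨fun i => i.casesOn (β 0) σ, fun i => i.casesOn c₀ c, rfl, ?_, ?_, ?_⟩
            · rw [weave, if_pos ⟨hv0' ▸ hR, hL⟩, h1, hv0']
              rfl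
            · rintro (_ | i) hi
              · exact hv0' ▸ hP 0 v rfl
              · exact h2 i (by omega)
            · rintro (_ | i) hi
              · refine ⟨Or.inl ⟨hv0' ▸ hR, hL⟩, ?_⟩
                simp only [zero_add]
                rw [h0, ← hv0', ← hx1]
                exact hgap
              · exact h3 i (by omega)
        · have hw1 : w = s 1 := by
            rw [List.filter_cons_of_pos (by exact hna w hw), List.ofFn_succ, List.cons.injEq] at hΓ
            exact hΓ.1
          obtain ⟨σ, c, h0, h1, h2, h3⟩ := ih (fun i => s (i + 1)) (w :: Γ) (fun i => β (i + 1)) hΓ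
            (fun i v w h => hadj (i + 1) v w h) (fun i v h => hP (i + 1) v h)
            (fun v hv => hangle v (by simp [hv])) (fun y hy => by
              simp only [List.head?_cons, Option.some.injEq] at hy; exact hy ▸ hw) hlast'
          have hside := hvw.1
          have key : ∃ c₀, Junction v.kind.rightSide w.kind.leftSide v.rightEnd w.leftEnd c₀ ∧
              Gap g κ v.rightEnd (β 0) w.leftEnd (β 1) c₀ := by
            rcases v.kind.rightSide.eq_or with hs | hs
            · exact ⟨_, Or.inr (Or.inr ⟨hs, hside ▸ hs, rfl⟩), (hvw.2.2.2 hs).gap hvw.2.1⟩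
            · exact ⟨_, Or.inr (Or.inl ⟨hs, hside ▸ hs, rfl⟩), (hvw.2.2.1 hs).gap hvw.2.1⟩
          obtain ⟨c₀, hj, hgap⟩ := key
          rw [hw1, hv0'] at hside hj hgap
          refine ⟨fun i => i.casesOn (β 0) σ, fun i => i.casesOn c₀ c, rfl, ?_, ?_, ?_⟩
          · rw [weave, if_neg, h1, hv0']
            rintro ⟨h4, h5⟩
            exact Side.noConfusion (h4.symm.trans (hside.trans h5))
          · rintro (_ | i) hi
            · exact hv0' ▸ hP 0 v rfl
            · exact h2 i (by omega)
          · rintro (_ | i) hi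
            · refine ⟨hj, ?_⟩
              simp only [zero_add]
              rw [h0]
              exact hgap
            · exact h3 i (by omega)

/-! ### The reconstruction of a woven graph -/

theorem glue_vertex {f : ℝ → ℝ} {b w : Block} (hb : b.arcs ≠ [⟨⊥, ⊥⟩]) (hw : w.arcs ≠ [⟨⊤, ⊤⟩]) :
    glue f (b.vertex f) (w.vertex f) = (b.glue w).vertex f := by
  simp only [glue, Block.vertex, Block.glue, kindOfShape_leftSide' f b.l b.r hb,
    kindOfShape_rightSide' f w.l w.r hw]

/-- An angle contributes no new arc; its only effect is to make the tangents on the left of the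
figure right. -/
theorem glue_angle_left {f : ℝ → ℝ} {s r : Side} {A : List Arc} {B : List Branch} {σ : ℝ}
    {c : EReal} (hA : A ≠ []) (hc : leftEnd A = c) :
    glue f (angleVertex c) ((⟨s, r, A, B, σ⟩ : Block).vertex f) =
      (⟨.right, r, A, B, σ⟩ : Block).vertex f := by
  have hj : joinArcs [⟨c, c⟩] A = A := by
    rcases A with _ | ⟨x, xs⟩
    · exact absurd rfl hA
    · rw [← hc]; rfl
  simp only [glue, Block.vertex, angleVertex, hj, List.nil_append, Kind.leftSide]
  by_cases hT : A = [⟨⊤, ⊤⟩]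
  · rw [hT, kindOfShape_top, kindOfShape_top]
  · rw [kindOfShape_rightSide' f s r hT]

theorem glue_angle_right {f : ℝ → ℝ} {l s : Side} {A : List Arc} {B : List Branch} {σ : ℝ}
    {c : EReal} (hA : A ≠ []) (hc : rightEnd A = c) :
    glue f ((⟨l, s, A, B, σ⟩ : Block).vertex f) (angleVertex c) =
      (⟨l, .left, A, B, σ⟩ : Block).vertex f := by
  have hj : joinArcs A [⟨c, c⟩] = A := by
    rcases List.eq_nil_or_concat A with rfl | ⟨xs, x, rfl⟩
    · exact absurd rfl hA
    · rw [List.concat_eq_append] at hc ⊢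
      rw [rightEnd_append] at hc
      rw [joinArcs_append, ← hc]
  simp only [glue, Block.vertex, angleVertex, hj, List.append_nil, Kind.rightSide]
  by_cases hT : A = [⟨⊥, ⊥⟩]
  · rw [hT, kindOfShape_bot, kindOfShape_bot]
  · rw [kindOfShape_leftSide' f l s hT]

def angleBlock (c : EReal) (σ : ℝ) : Block := ⟨.right, .left, [⟨c, c⟩], [], σ⟩

theorem angleBlock_vertex {f : ℝ → ℝ} {c : EReal} {σ : ℝ} (h₁ : c ≠ ⊥) (h₂ : c ≠ ⊤) :
    (angleBlock c σ).vertex f = angleVertex c := by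
  simp [angleBlock, Block.vertex, angleVertex, kindOfShape, h₁, h₂]

/-- Gluing of a figure with the first of the following blocks. -/
def Block.glueHead (b : Block) : List Block → List Block
  | [] => []
  | w :: ws => b.glue w :: ws

open scoped Classical in
/-- The blocks of the reconstruction of the graph woven from the figures `F 0, …, F k` and angles at
the points `c i`; here `l` is the family of tangents on the left. -/
noncomputable def assemble (g : ℝ → ℝ) (κ : ℝ) (k : ℕ) (F : ℕ → Figure) (c : ℕ → EReal)
    (l : Side) : List Block :=
  match k with
  | 0 => [(F 0).block l .right]
  | k + 1 =>
    if rightEnd (F 0).arcs = leftEnd (F 1).arcs then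
      -- The inner families on both sides of a glued point are dummies, as `Block.glue` forgets
      -- them.
      ((F 0).block l .right).glueHead
        (assemble g κ k (fun i => F (i + 1)) (fun i => c (i + 1)) .right)
    else if c 0 = leftEnd (F 1).arcs then
      (F 0).block l .right :: assemble g κ k (fun i => F (i + 1)) (fun i => c (i + 1)) .right
    else if c 0 = rightEnd (F 0).arcs then
      (F 0).block l .left :: assemble g κ k (fun i => F (i + 1)) (fun i => c (i + 1)) .left
    else (F 0).block l .right ::
      angleBlock (c 0) (rightSlope g κ (rightEnd (F 0).arcs) (F 0).slope (c 0).toReal) ::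
        assemble g κ k (fun i => F (i + 1)) (fun i => c (i + 1)) .left

/-- Only the left family of the first block depends on `l`, so the induction may change this family
without affecting the rest. -/
theorem assemble_head (g : ℝ → ℝ) (κ : ℝ) (k : ℕ) (F : ℕ → Figure) (c : ℕ → EReal)
    (hF : ∀ i ≤ k, (F i).arcs ≠ []) : ∃ r A B ws, A ≠ [] ∧ leftEnd A = leftEnd (F 0).arcs ∧
      ∀ l, assemble g κ k F c l = ⟨l, r, A, B, (F 0).slope⟩ :: ws := by
  induction k generalizing F c with
  | zero => exact ⟨_, _, _, _, hF 0 le_rfl, rfl, fun l => rfl⟩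
  | succ k ih =>
    obtain ⟨r, A, B, ws, h1, h2, h3⟩ := ih (fun i => F (i + 1)) (fun i => c (i + 1))
      fun i hi => hF _ (by omega)
    have h0 := hF 0 (by omega)
    simp only [assemble]
    split_ifs
    · refine ⟨r, joinArcs (F 0).arcs A, (F 0).below ++ B, ws, ?_, (ends_join h0 h1).1,
        fun l => by rw [h3]; rfl⟩
      intro he
      have h4 := ends_join h0 h1
      rcases hA : (F 0).arcs with _ | ⟨x, _ | ⟨y, ys⟩⟩
      · exact h0 hA
      · rw [hA] at he
        rcases A with _ | ⟨z, zs⟩ <;> simp [joinArcs] at he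
      · rw [hA] at he
        simp [joinArcs] at he
    all_goals exact ⟨_, _, _, _, h0, rfl, fun l => rfl⟩

/-- The families `l` and `r` inside the graph disappear from the answer: after the gluing, what
remains of a gap is dictated by the position of `c i` relative to its ends. This is why the limit
does not depend on types that fail to stabilize. -/
theorem collapse_weave {f g : ℝ → ℝ} {κ : ℝ} (k : ℕ) (v : ℕ → FreeVertex) (F : ℕ → Figure)
    (c : ℕ → EReal) (l r : ℕ → Side) (hF : ∀ i ≤ k, (F i).arcs ≠ [])
    (hv : ∀ i ≤ k, v i = ((F i).block (l i) (r i)).vertex f)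
    (hj : ∀ i < k, Junction (r i) (l (i + 1)) (rightEnd (F i).arcs) (leftEnd (F (i + 1)).arcs) (c i))
    (hc : ∀ i < k, rightEnd (F i).arcs ≤ c i ∧ c i ≤ leftEnd (F (i + 1)).arcs ∧
      rightEnd (F i).arcs ≠ ⊤ ∧ leftEnd (F (i + 1)).arcs ≠ ⊥)
    (hr : r k = .right) :
    collapseTangents f (weave k v c l r) = (assemble g κ k F c (l 0)).map (Block.vertex f) := by
  induction k generalizing v F c l r with
  | zero => simp [weave, collapseTangents, assemble, hv, hr]
  | succ k ih =>
    have ih' := ih (fun i => v (i + 1)) (fun i => F (i + 1)) (fun i => c (i + 1))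
      (fun i => l (i + 1)) (fun i => r (i + 1)) (fun i hi => hF _ (by omega))
      (fun i hi => hv _ (by omega)) (fun i hi => hj _ (by omega)) (fun i hi => hc _ (by omega)) hr
    obtain ⟨r', A, B, ws, hA, hA', hass⟩ := assemble_head g κ k (fun i => F (i + 1))
      (fun i => c (i + 1)) fun i hi => hF _ (by omega)
    have hF0 := hF 0 (by omega)
    have hv0 := hv 0 (by omega)
    obtain ⟨hc1, hc2, hc3, hc4⟩ := hc 0 (by omega)
    have hj0 := hj 0 (by omega)
    simp only [zero_add] at ih' hA' hass hc2 hc4 hj0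
    rw [hass, List.map_cons] at ih'
    set p := rightEnd (F 0).arcs with hp
    set q := leftEnd (F 1).arcs with hq
    have hglue : ∀ s s' s'', p = q → glue f (((F 0).block (l 0) s).vertex f)
        ((⟨s', r', A, B, (F 1).slope⟩ : Block).vertex f) =
        (((F 0).block (l 0) .right).glue ⟨s'', r', A, B, (F 1).slope⟩).vertex f := by
      intro s s' s'' hpq
      refine glue_vertex (fun he => hc4 ?_) (fun he => hc3 ?_)
      · have h1 : (F 0).arcs = [⟨⊥, ⊥⟩] := he
        rw [← hpq, hp, h1]; rfl
      · have h1 : A = [⟨⊤, ⊤⟩] := he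
        rw [hpq, ← hA', h1]; rfl
    have hl0 : (v 0).rightEnd = p := by rw [hv0]; rfl
    have hlw : ∀ s, ((⟨s, r', A, B, (F 1).slope⟩ : Block).vertex f).leftEnd = q := fun _ => hA'
    by_cases hang : r 0 = .right ∧ l 1 = .left
    · have e1 : collapseTangents f (angleVertex (c 0) :: weave k (fun i => v (i + 1))
          (fun i => c (i + 1)) (fun i => l (i + 1)) (fun i => r (i + 1))) =
          if c 0 = q then (⟨.right, r', A, B, (F 1).slope⟩ : Block).vertex f ::
            ws.map (Block.vertex f)
          else angleVertex (c 0) :: (⟨.left, r', A, B, (F 1).slope⟩ : Block).vertex f ::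
            ws.map (Block.vertex f) := by
        rw [collapseTangents, ih', hang.2]
        simp only [hlw]
        have h1 : (angleVertex (c 0)).rightEnd = c 0 := rfl
        rw [h1]
        split_ifs with h2
        · rw [glue_angle_left hA (hA'.trans h2.symm)]
        · rfl
      rw [weave, if_pos hang, collapseTangents, e1, assemble]
      simp only [hass, Block.glueHead, ← hp, ← hq]
      by_cases hcq : c 0 = q
      · simp only [if_pos hcq, hl0, hlw]
        by_cases hpq : p = q
        · rw [if_pos hpq, if_pos hpq, hv0, hglue _ _ .right hpq]
          simp
        · rw [if_neg hpq, if_neg hpq, hv0, hang.1]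
          simp
      · simp only [if_neg hcq, hl0]
        have hpq : p ≠ q := fun h => hcq (le_antisymm hc2 (h ▸ hc1))
        have h1 : (angleVertex (c 0)).leftEnd = c 0 := rfl
        rw [h1, if_neg hpq]
        by_cases hcp : c 0 = p
        · rw [if_pos hcp.symm, if_pos hcp, hv0]
          have h2 := glue_angle_right (f := f) (l := l 0) (s := r 0) (B := (F 0).below)
            (σ := (F 0).slope) hF0 hcp.symm
          rw [List.map_cons, List.map_cons]
          congr 1
        · rw [if_neg (Ne.symm hcp), if_neg hcp, hv0, hang.1, List.map_cons, List.map_cons,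
            List.map_cons, angleBlock_vertex]
          · rintro he
            exact hcp (le_antisymm (he ▸ bot_le) hc1)
          · rintro he
            exact hcq (le_antisymm hc2 (he ▸ le_top))
    · have hside : (r 0 = .right ∧ l 1 = .right ∧ c 0 = q) ∨ (r 0 = .left ∧ l 1 = .left ∧ c 0 = p) :=
        hj0.resolve_left hang
      rw [weave, if_neg hang, collapseTangents, ih', assemble]
      simp only [hass, Block.glueHead, hl0, hlw, ← hp, ← hq]
      by_cases hpq : p = q
      · rw [if_pos hpq, if_pos hpq, hv0, hglue _ _ .right hpq]
        simp
      · rw [if_neg hpq, if_neg hpq, hv0]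
        rcases hside with ⟨h1, h2, h3⟩ | ⟨h1, h2, h3⟩
        · rw [if_pos h3, h1, h2]; simp
        · rw [if_neg (fun h => hpq (h3.symm.trans h)), if_pos h3, h1, h2]; simp

theorem angleBlock_isGood (f : ℝ → ℝ) (ε : ℝ) {c : EReal} {σ : ℝ} (h₁ : c ≠ ⊥) (h₂ : c ≠ ⊤) :
    (angleBlock c σ).IsGood f ε where
  figure := by
    refine Or.inr (Or.inr ⟨⟨by simp [angleBlock], by simp [angleBlock, h₁, h₂],
      by simp [angleBlock]⟩, ?_, ?_, fun h => absurd h h₁, fun h => absurd h h₂,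
      fun h => Side.noConfusion h, fun h => Side.noConfusion h, fun h => Side.noConfusion h⟩)
    · have h : ∀ x ∈ arcPoints [(⟨c, c⟩ : Arc)], (x : EReal) = c := by
        rintro x ⟨y, hy, hx1, hx2⟩
        rw [List.mem_singleton] at hy
        subst hy
        exact le_antisymm hx2 hx1
      intro x hx y hy
      have hxy : x = y := EReal.coe_eq_coe_iff.1 ((h x hx).trans (h y hy).symm)
      subst hxy
      simp [CupEquation]
    · intro x hx hne
      rw [angleBlock, List.mem_singleton] at hx
      subst hx
      exact absurd rfl hne
  wired := List.Forall₂.nil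
  gaps g hg := by simp [angleBlock, BMOFoliation.gaps] at hg
  branches c hc := by simp [angleBlock, branchNodes] at hc

/-- Each gap leaves one of four configurations: glued figures, right tangents, left tangents, or an
angle with both. The junction conditions guarantee that a figure receives left tangents on its left
or right tangents on its right only if it had them before. -/
theorem assemble_good {f g : ℝ → ℝ} {ε κ : ℝ} (hε : 0 < ε) (k : ℕ) (F : ℕ → Figure)
    (c : ℕ → EReal) (l r : ℕ → Side) (hF : ∀ i ≤ k, (F i).arcs ≠ [])
    (hgood : ∀ i ≤ k, ∀ l' r', (l' = .left → l i = .left) → (r' = .right → r i = .right) →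
      (leftEnd (F i).arcs = ⊥ → l' = .left) → (rightEnd (F i).arcs = ⊤ → r' = .right) →
      ((F i).block l' r').IsGood f ε)
    (hj : ∀ i < k, Junction (r i) (l (i + 1)) (rightEnd (F i).arcs) (leftEnd (F (i + 1)).arcs) (c i))
    (hgap : ∀ i < k, Gap g κ (rightEnd (F i).arcs) (F i).slope (leftEnd (F (i + 1)).arcs)
      (F (i + 1)).slope (c i))
    (hr : r k = .right) (htop : rightEnd (F k).arcs = ⊤) {l' : Side}
    (hl : l' = .left → l 0 = .left) (hbot : leftEnd (F 0).arcs = ⊥ → l' = .left) :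
    (∀ b ∈ assemble g κ k F c l', b.IsGood f ε) ∧
    ((assemble g κ k F c l').IsChain fun b w =>
      b.Linked g κ w ∧ rightEnd b.arcs < leftEnd w.arcs) ∧
    ∃ b, (assemble g κ k F c l').getLast? = some b ∧ rightEnd b.arcs = ⊤ := by
  induction k generalizing F c l r l' with
  | zero =>
    refine ⟨?_, by simp [assemble], _, rfl, htop⟩
    intro b hb
    rw [assemble, List.mem_singleton] at hb
    subst hb
    exact hgood 0 le_rfl _ _ hl (fun _ => hr) hbot fun _ => rfl
  | succ k ih =>
    have ih' := fun l' => ih (l' := l') (fun i => F (i + 1)) (fun i => c (i + 1))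
      (fun i => l (i + 1)) (fun i => r (i + 1)) (fun i hi => hF _ (by omega))
      (fun i hi => hgood _ (by omega)) (fun i hi => hj _ (by omega)) (fun i hi => hgap _ (by omega))
      hr htop
    obtain ⟨r', A, B, ws, hA, hA', hass⟩ := assemble_head g κ k (fun i => F (i + 1))
      (fun i => c (i + 1)) fun i hi => hF _ (by omega)
    have hF0 := hF 0 (by omega)
    have hgap0 := hgap 0 (by omega)
    have hj0 := hj 0 (by omega)
    have hgood0 := fun s (hs : s = .right → r 0 = .right) => hgood 0 (by omega) l' s hl hs hbot
      fun h => absurd h hgap0.left_ne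
    simp only [zero_add] at hA' hass hgap0 hj0 ih'
    have hne : leftEnd (F 1).arcs ≠ ⊥ := hgap0.right_ne
    have hlast : ∀ (b : Block) s, (b :: assemble g κ k (fun i => F (i + 1)) (fun i => c (i + 1))
        s).getLast? = (assemble g κ k (fun i => F (i + 1)) (fun i => c (i + 1)) s).getLast? := by
      intro b s
      rw [hass, List.getLast?_cons_cons]
    rw [assemble]
    split_ifs with h1 h2 h3
    -- Since the inner family is forgotten by gluing, it may be replaced by the family that the
    -- first figure really has on its right; with it both parts are known to be good.
    · set s := r 0 with hs
      have hs' : s = .left → l 1 = .left := fun h => by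
        rcases hj0 with ⟨h4, -⟩ | ⟨h4, -⟩ | ⟨-, h5, -⟩
        · exact Side.noConfusion (h4.symm.trans h)
        · exact Side.noConfusion (h4.symm.trans h)
        · exact h5
      obtain ⟨i1, i2, b, i3, i4⟩ := ih' s hs' fun h => absurd h hne
      rw [hass] at i1 i2 i3 ⊢
      have hlink : ((F 0).block l' s).Linked g κ ⟨s, r', A, B, (F 1).slope⟩ := by
        obtain ⟨t, ht⟩ : ∃ t : ℝ, rightEnd (F 0).arcs = t :=
          ⟨_, (EReal.coe_toReal hgap0.left_ne (h1 ▸ hne)).symm⟩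
        have hA'' : leftEnd A = t := hA'.trans (h1.symm.trans ht)
        have hct : c 0 = t := le_antisymm (hgap0.le_right.trans (h1.symm.trans ht).le)
          (ht ▸ hgap0.left_le)
        have hσ : (F 0).slope = (F 1).slope := by
          have := hgap0.balance t hct
          rwa [← h1, ht, rightSlope_self, leftSlope_self] at this
        have hcon : ∀ u : ℝ, rightEnd (F 0).arcs < u → ¬ (u : EReal) < leftEnd A :=
          fun u h4 h5 => lt_irrefl _ (h4.trans (h5.trans_eq (hA''.trans ht.symm)))
        refine ⟨rfl, hgap0.left_ne, hA'.trans_ne hne,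
          fun _ => ⟨fun u h4 h5 => absurd h5 (hcon u h4), fun u hu => ?_⟩,
          fun _ => ⟨fun u h4 h5 => absurd h5 (hcon u h4), fun u hu => ?_⟩⟩
        · obtain rfl : t = u := EReal.coe_eq_coe_iff.1 (hA''.symm.trans hu)
          rw [← hσ]
          change rightSlope g κ (rightEnd (F 0).arcs) (F 0).slope t = _
          rw [ht, rightSlope_self]
        · obtain rfl : t = u := EReal.coe_eq_coe_iff.1 (ht.symm.trans hu)
          change leftSlope g κ (leftEnd A) _ t = (F 0).slope
          rw [hA'', leftSlope_self, hσ]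
      have he : rightEnd (F 0).arcs = leftEnd A := h1.trans hA'.symm
      obtain ⟨g1, g2, g3, -⟩ := (hgood0 s fun h => h).glue hε (i1 _ (by simp)) hlink he
      obtain ⟨t, -, -, hσ⟩ := hlink.slope_eq he
      have hb : ((F 0).block l' .right).glue ⟨.right, r', A, B, (F 1).slope⟩ =
          ((F 0).block l' s).glue ⟨s, r', A, B, (F 1).slope⟩ := rfl
      simp only [Block.glueHead, hb]
      refine ⟨?_, ?_, ?_⟩
      · intro d hd
        rcases List.mem_cons.1 hd with rfl | hd
        · exact g1
        · exact i1 d (by simp [hd])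
      · cases ws with
        | nil => simp
        | cons w' ws =>
          rw [List.isChain_cons_cons] at i2 ⊢
          refine ⟨⟨i2.1.1.congr rfl g3 hσ rfl rfl rfl, ?_⟩, i2.2⟩
          rw [g3]; exact i2.1.2
      · cases ws with
        | nil =>
          rw [List.getLast?_singleton, Option.some.injEq] at i3
          exact ⟨_, List.getLast?_singleton, g3.trans (i3 ▸ i4)⟩
        | cons w' ws => exact ⟨b, by rw [List.getLast?_cons_cons] at i3 ⊢; exact i3, i4⟩
    · have hlt : rightEnd (F 0).arcs < leftEnd (F 1).arcs :=
        lt_of_le_of_ne (hgap0.left_le.trans hgap0.le_right) h1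
      have hr0 : r 0 = .right := by
        rcases hj0 with ⟨h4, -⟩ | ⟨h4, -⟩ | ⟨-, -, h5⟩
        · exact h4
        · exact h4
        · exact absurd (h5.symm.trans h2) h1
      obtain ⟨i1, i2, i3⟩ := ih' .right (fun h => Side.noConfusion h) fun h => absurd h hne
      rw [hlast]
      refine ⟨?_, ?_, i3⟩
      · intro d hd
        rcases List.mem_cons.1 hd with rfl | hd
        · exact hgood0 _ fun _ => hr0
        · exact i1 d hd
      · rw [hass] at i2 ⊢
        rw [List.isChain_cons_cons]
        have hedge := Gap.rightEdge (h2 ▸ hgap0)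
        refine ⟨⟨⟨rfl, hgap0.left_ne, hA'.trans_ne hne, fun _ => ?_,
          fun h => Side.noConfusion h⟩, ?_⟩, i2⟩
        · simp only [hA']; exact hedge
        · exact hlt.trans_eq hA'.symm
    · have hlt : rightEnd (F 0).arcs < leftEnd (F 1).arcs :=
        lt_of_le_of_ne (hgap0.left_le.trans hgap0.le_right) h1
      have hl1 : l 1 = .left := by
        rcases hj0 with ⟨-, h4⟩ | ⟨-, -, h5⟩ | ⟨-, h4, -⟩
        · exact h4
        · exact absurd h5 h2
        · exact h4
      obtain ⟨i1, i2, i3⟩ := ih' .left (fun _ => hl1) fun _ => rfl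
      rw [hlast]
      refine ⟨?_, ?_, i3⟩
      · intro d hd
        rcases List.mem_cons.1 hd with rfl | hd
        · exact hgood0 _ fun h => Side.noConfusion h
        · exact i1 d hd
      · rw [hass] at i2 ⊢
        rw [List.isChain_cons_cons]
        have hedge := Gap.leftEdge (h3 ▸ hgap0)
        refine ⟨⟨⟨rfl, hgap0.left_ne, hA'.trans_ne hne, fun h => Side.noConfusion h,
          fun _ => ?_⟩, ?_⟩, i2⟩
        · simp only [hA']; exact hedge
        · exact hlt.trans_eq hA'.symm
    · have hlt1 : rightEnd (F 0).arcs < c 0 := lt_of_le_of_ne hgap0.left_le (Ne.symm h3)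
      have hlt2 : c 0 < leftEnd (F 1).arcs := lt_of_le_of_ne hgap0.le_right h2
      obtain ⟨hr0, hl1⟩ : r 0 = .right ∧ l 1 = .left := by
        rcases hj0 with h4 | ⟨-, -, h5⟩ | ⟨-, -, h5⟩
        · exact h4
        · exact absurd h5 h2
        · exact absurd h5 h3
      obtain ⟨i1, i2, i3⟩ := ih' .left (fun _ => hl1) fun _ => rfl
      rw [List.getLast?_cons_cons, hlast]
      refine ⟨?_, ?_, i3⟩
      · intro d hd
        rcases List.mem_cons.1 hd with rfl | hd
        · exact hgood0 _ fun _ => hr0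
        rcases List.mem_cons.1 hd with rfl | hd
        · exact angleBlock_isGood f ε hlt1.ne_bot hlt2.ne_top
        · exact i1 d hd
      · rw [hass] at i2 ⊢
        rw [List.isChain_cons_cons, List.isChain_cons_cons]
        refine ⟨⟨⟨rfl, hgap0.left_ne, hlt1.ne_bot, fun _ => hgap0.rightEdge_angle,
          fun h => Side.noConfusion h⟩, hlt1⟩, ⟨⟨rfl, hlt2.ne_top,
          hA'.trans_ne hne, fun h => Side.noConfusion h, fun _ => ?_⟩,
          hlt2.trans_eq hA'.symm⟩, i2⟩
        simp only [hA']; exact hgap0.leftEdge_angle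

/-! ### Uniqueness of limits -/

theorem ListConverges.unique {α : Type} {R : (ℕ → α) → α → Prop} {x : ℕ → List α} {y y' : List α}
    (hR : ∀ p q q', R p q → R p q' → q = q') (h : ListConverges R x y) (h' : ListConverges R x y') :
    y = y' := by
  obtain ⟨m, p, q, h1, rfl, h3⟩ := h
  obtain ⟨m', p', q', h1', rfl, h3'⟩ := h'
  obtain rfl : m = m' := by
    have := congrArg List.length ((h1 0).symm.trans (h1' 0))
    simpa using this
  have hp : p = p' := by
    funext i n
    exact congrFun (List.ofFn_injective ((h1 n).symm.trans (h1' n))) i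
  subst hp
  exact congrArg List.ofFn (funext fun i => hR _ _ _ (h3 i) (h3' i))

theorem ArcConverges.unique {x : ℕ → Arc} {y y' : Arc} (h : ArcConverges x y)
    (h' : ArcConverges x y') : y = y' := by
  cases y
  cases y'
  exact congrArg₂ Arc.mk (tendsto_nhds_unique h.1 h'.1) (tendsto_nhds_unique h.2 h'.2)

theorem BranchConverges.unique {x : ℕ → Branch} {y y' : Branch} (h : BranchConverges x y)
    (h' : BranchConverges x y') : y = y' := by
  obtain ⟨C, k, arcs, below, h1, rfl⟩ := h
  obtain ⟨C', k', arcs', below', h1', rfl⟩ := h'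
  have h2 := fun n => (h1 n).symm.trans (h1' n)
  simp only [Branch.mk.injEq] at h2
  obtain rfl : C = C' := funext fun n => (h2 n).1
  obtain ⟨-, rfl, rfl, rfl⟩ := h2 0
  rfl

theorem VertexConverges.unique {x : ℕ → FreeVertex} {y y' : FreeVertex} (h : VertexConverges x y)
    (h' : VertexConverges x y') : y = y' := by
  cases y
  cases y'
  obtain ⟨h1, h2, h3⟩ := h
  obtain ⟨h1', h2', h3'⟩ := h'
  simp only [FreeVertex.mk.injEq]
  exact ⟨(h1 0).symm.trans (h1' 0),
    ListConverges.unique (R := ArcConverges) (fun _ _ _ h h' => h.unique h') h2 h2',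
    ListConverges.unique (R := BranchConverges) (fun _ _ _ h h' => h.unique h') h3 h3'⟩

theorem GraphConverges.unique {x : ℕ → FoliationGraph} {y y' : FoliationGraph}
    (h : GraphConverges x y) (h' : GraphConverges x y') : y = y' :=
  ListConverges.unique (R := VertexConverges)
    (fun _ _ _ h h' => h.unique h') h h'

/-! ### Vertices of admissible graphs -/

section graph

variable {f : ℝ → ℝ} {κ₀ ε : ℝ}

theorem FreeVertex.IsAdmissible.cases {v : FreeVertex} (h : v.IsAdmissible f ε) :
    (∃ s, v.kind = .negInfinity s) ∨ (∃ s, v.kind = .posInfinity s) ∨ ArcsOrdered v.arcs := by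
  have h4 := h.2.2.2
  cases hk : v.kind with
  | negInfinity s => exact Or.inl ⟨s, rfl⟩
  | posInfinity s => exact Or.inr (Or.inl ⟨s, rfl⟩)
  | multitrolleybus s => rw [hk] at h4; cases s <;> exact Or.inr (Or.inr h4.1)
  | _ => rw [hk] at h4; exact Or.inr (Or.inr h4.1)

theorem FreeVertex.IsAdmissible.rightEnd_eq_bot {v : FreeVertex} (h : v.IsAdmissible f ε) :
    v.rightEnd = ⊥ ↔ ∃ s, v.kind = .negInfinity s := by
  constructor
  · intro h1
    rcases h.cases with h2 | ⟨s, h2⟩ | h2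
    · exact h2
    · rw [FreeVertex.rightEnd, (h.arcs_posInfinity h2).1] at h1
      exact absurd h1 (by simp [BMOFoliation.rightEnd])
    · exact absurd h1 h2.right_ne_bot
  · rintro ⟨s, hs⟩
    rw [FreeVertex.rightEnd, (h.arcs_negInfinity hs).1]; rfl

theorem FreeVertex.IsAdmissible.leftEnd_eq_top {v : FreeVertex} (h : v.IsAdmissible f ε) :
    v.leftEnd = ⊤ ↔ ∃ s, v.kind = .posInfinity s := by
  constructor
  · intro h1
    rcases h.cases with ⟨s, h2⟩ | h2 | h2
    · rw [FreeVertex.leftEnd, (h.arcs_negInfinity h2).1] at h1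
      exact absurd h1 (by simp [BMOFoliation.leftEnd])
    · exact h2
    · exact absurd h1 h2.left_ne_top
  · rintro ⟨s, hs⟩
    rw [FreeVertex.leftEnd, (h.arcs_posInfinity hs).1]; rfl

theorem FreeVertex.IsAdmissible.eq_angleVertex {v : FreeVertex} (h : v.IsAdmissible f ε)
    (hv : v.kind = .angle) : ∃ c, v = angleVertex c := by
  obtain ⟨K, A, B⟩ := v
  obtain ⟨h1, h2, -⟩ := h
  simp only at hv h1 h2
  subst hv
  obtain ⟨x, hA, hx⟩ : ∃ x, A = [x] ∧ x.l = x.r := by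
    by_cases h₁ : A = [⟨⊥, ⊥⟩]
    · exact ⟨_, h₁, rfl⟩
    by_cases h₂ : A = [⟨⊤, ⊤⟩]
    · exact ⟨_, h₂, rfl⟩
    rcases kindOfShape_cases f (Kind.leftSide .angle) (Kind.rightSide .angle) h₁ h₂ with
      ⟨-, -, -, h⟩ | ⟨s, h, -⟩ | ⟨h, -⟩ | ⟨s, h, -⟩ | ⟨h | h, -⟩ | ⟨h, -⟩ | ⟨s, h, -⟩ | ⟨h, -⟩
    · exact h
    all_goals rw [h] at h1; exact absurd h1 (by simp)
  subst hA
  rw [wired_nil h2]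
  refine ⟨x.l, ?_⟩
  cases x
  simp only at hx
  subst hx
  rfl

theorem FreeVertex.IsAdmissible.ends_angle {v : FreeVertex} (h : v.IsAdmissible f ε)
    (hv : v.kind = .angle) : v.leftEnd ≠ ⊥ ∧ v.rightEnd ≠ ⊤ := by
  have := h.2.2.2
  rw [hv] at this
  exact this.2

theorem IsAdmissible.adjacent {Γ : FoliationGraph} (hf : IsBoundary f κ₀) (hκ : κ₀ < ε⁻¹)
    (h : IsAdmissible f ε Γ) {i : ℕ} {v w : FreeVertex} (hn : Neighbours Γ i v w) {β β' : ℝ}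
    {m : ℝ → ℝ}
    (hm : match v.kind.rightSide with
      | .right => IsRightSlope f ε v w β β' m
      | .left => IsLeftSlope f ε v w β β' m) :
    Adjacent (deriv (deriv f)) ε⁻¹ v (2 * β) w (2 * β') := by
  obtain ⟨hε, hpath, hadm, -⟩ := h
  obtain ⟨h1, h2⟩ := hpath.2.2 i v w hn
  have hv := hadm v (List.mem_of_getElem? hn.1)
  have hw := hadm w (List.mem_of_getElem? hn.2)
  refine ⟨h1, h2, fun hs => ?_, fun hs => ?_⟩
  · rw [hs] at hm
    exact hm.rightEdge hf hε hκ hv.rightEnd_eq_bot h2.ne_top fun h3 s h4 =>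
      h3 (hw.leftEnd_eq_top.2 ⟨s, h4⟩)
  · rw [hs] at hm
    exact hm.leftEdge hf hε hκ hw.leftEnd_eq_top h2.ne_bot fun h3 s h4 =>
      h3 (hv.rightEnd_eq_bot.2 ⟨s, h4⟩)

theorem IsAdmissible.exists_weave {Γ : FoliationGraph} (hf : IsBoundary f κ₀) (hκ : κ₀ < ε⁻¹)
    (h : IsAdmissible f ε Γ) {k : ℕ} {s : ℕ → FreeVertex}
    (hfilter : Γ.filter (fun v => v.kind.notAngle) = List.ofFn fun i : Fin (k + 1) => s i) :
    ∃ (σ : ℕ → ℝ) (c : ℕ → EReal), Γ = weave k s c (fun i => (s i).kind.leftSide)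
        (fun i => (s i).kind.rightSide) ∧ (∀ i ≤ k, IsLinearity f (s i).arcs (σ i)) ∧
      ∀ i < k, Junction (s i).kind.rightSide (s (i + 1)).kind.leftSide (s i).rightEnd
          (s (i + 1)).leftEnd (c i) ∧
        Gap (deriv (deriv f)) ε⁻¹ (s i).rightEnd (σ i) (s (i + 1)).leftEnd (σ (i + 1)) (c i) := by
  obtain ⟨-, ⟨⟨v₀, hv₀, hv₀'⟩, ⟨v₁, hv₁, hv₁'⟩, -⟩, hadm, -, β, m, hβ, hm⟩ := id h
  obtain ⟨σ, c, -, h1⟩ := BMOFoliation.exists_weave (g := deriv (deriv f)) (κ := ε⁻¹)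
    (P := fun v σ => IsLinearity f v.arcs σ) k s Γ (fun i => 2 * β i) hfilter
    (fun i v w hn => h.adjacent hf hκ hn (hm i v w hn)) (fun i v hv => (hβ i v hv).1)
    (fun v hv => (hadm v hv).eq_angleVertex)
    (fun v hv hK => by
      obtain rfl : v₀ = v := Option.some.inj (hv₀.symm.trans hv)
      exact ((hadm _ (List.mem_of_mem_head? hv)).ends_angle hK).1 hv₀')
    (fun v hv hK => by
      obtain rfl : v₁ = v := Option.some.inj (hv₁.symm.trans hv)
      exact ((hadm _ (List.mem_of_mem_getLast? hv)).ends_angle hK).2 hv₁')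
  exact ⟨σ, c, h1⟩

theorem IsAdmissible.isStanding {Γ : FoliationGraph} (h : IsAdmissible f ε Γ) (h' : LeafRoot f Γ)
    {v : FreeVertex} (hv : v ∈ Γ) : v.IsStanding f ε := by
  obtain ⟨-, -, h1, h2, β, -, h3, -⟩ := h
  have hb : ∀ c ∈ branchNodes v.below, c ∈ allBranches Γ := fun c hc =>
    List.mem_flatMap.2 ⟨v, hv, hc⟩
  refine ⟨h1 v hv, fun c hc => ⟨h2 c (hb c hc), h'.2 c (hb c hc)⟩, h'.1 v hv, ?_⟩
  obtain ⟨i, hi⟩ := List.mem_iff_getElem?.1 hv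
  exact ⟨_, (h3 i v hi).1⟩

theorem weave_head (k : ℕ) (v : ℕ → FreeVertex) (c : ℕ → EReal) (l r : ℕ → Side) :
    (weave k v c l r).head? = some (v 0) := by
  cases k with
  | zero => rfl
  | succ k => rw [weave]; split_ifs <;> rfl

theorem weave_getLast (k : ℕ) (v : ℕ → FreeVertex) (c : ℕ → EReal) (l r : ℕ → Side) :
    (weave k v c l r).getLast? = some (v k) := by
  induction k generalizing v c l r with
  | zero => rfl
  | succ k ih =>
    have h := ih (fun i => v (i + 1)) (fun i => c (i + 1)) (fun i => l (i + 1)) (fun i => r (i + 1))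
    have h' : ∀ x (xs : List FreeVertex), xs.getLast? = some (v (k + 1)) →
        (x :: xs).getLast? = some (v (k + 1)) := by
      rintro x (_ | ⟨y, ys⟩) hx
      · simp at hx
      · rwa [List.getLast?_cons_cons]
    rw [weave]
    split_ifs
    · exact h' _ _ (h' _ _ h)
    · exact h' _ _ h

end graph

/-! ### Woven flows -/

/-- A flow of graphs that are woven from moving figures, which have limits, and angles. -/
structure IsWovenFlow (f : ℝ → ℝ) (I : Set ℝ) (η : ℝ) (k : ℕ) (s : ℕ → ℝ → FreeVertex)
    (F : ℕ → Figure) (V : ℕ → Kind → FreeVertex) (σ : ℝ → ℕ → ℝ) (c : ℝ → ℕ → EReal)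
    (Γ : ℝ → FoliationGraph) : Prop where
  limit : ∀ i ≤ k, IsFigureLimit f I η (s i) (F i) (V i)
  graph : ∀ ε ∈ I, Γ ε = weave k (fun i => s i ε) (c ε) (fun i => (s i ε).kind.leftSide)
    fun i => (s i ε).kind.rightSide
  linear : ∀ ε ∈ I, ∀ i ≤ k, IsLinearity f (s i ε).arcs (σ ε i)
  junction : ∀ ε ∈ I, ∀ i < k, Junction (s i ε).kind.rightSide (s (i + 1) ε).kind.leftSide
    (s i ε).rightEnd (s (i + 1) ε).leftEnd (c ε i)
  gap : ∀ ε ∈ I, ∀ i < k, Gap (deriv (deriv f)) ε⁻¹ (s i ε).rightEnd (σ ε i) (s (i + 1) ε).leftEnd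
    (σ ε (i + 1)) (c ε i)
  left_bot : ∀ ε ∈ I, leftEnd (s 0 ε).arcs = ⊥
  right_top : ∀ ε ∈ I, rightEnd (s k ε).arcs = ⊤

/-- Finiteness of the set of types yields subsequences along which the combinatorial structure is
constant. -/
theorem finite_kind : Finite Kind := by
  refine Set.finite_univ_iff.1 ((Set.toFinite ({.angle, .trolleybus .left, .trolleybus .right,
    .birdie, .multicup, .multitrolleybus .left, .multitrolleybus .right, .multibirdie, .firstType,
    .thirdType, .negInfinity .left, .negInfinity .right, .posInfinity .left, .posInfinity .right,
    .fifthType .left, .fifthType .right} : Set Kind)).subset fun K _ => ?_)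
  rcases K with _ | (_ | _) | _ | _ | (_ | _) | _ | _ | _ | (_ | _) | (_ | _) | (_ | _) <;> simp

theorem exists_subseq_const {α : Type} [Finite α] (x : ℕ → α) :
    ∃ (φ : ℕ → ℕ) (a : α), StrictMono φ ∧ ∀ n, x (φ n) = a := by
  obtain ⟨a, ha⟩ := Finite.exists_infinite_fiber x
  obtain ⟨φ, h1, h2⟩ := extraction_of_frequently_atTop
    (Nat.frequently_atTop_iff_infinite.2 (Set.infinite_coe_iff.1 ha))
  exact ⟨φ, a, h1, h2⟩

theorem IsFigureLimit.arcs_ne_nil {f : ℝ → ℝ} {I : Set ℝ} {η : ℝ} {v : ℝ → FreeVertex} {F : Figure}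
    {V : Kind → FreeVertex} (h : IsFigureLimit f I η v F V) {ε : ℝ} (hε : ε ∈ I) : F.arcs ≠ [] := by
  -- The families are chosen so that the inner ones occur exactly at infinite ends, which meets all
  -- the conditions under which the figure is known to be good.
  have hside : ∀ (P : Prop) (s s' : Side), s ≠ s' → ∃ l : Side, (l = s → P) ∧ (P → l = s) :=
    fun P s s' hs => by
      by_cases hP : P
      · exact ⟨s, fun _ => hP, fun _ => rfl⟩
      · exact ⟨s', fun h => absurd h.symm hs, fun h => absurd h hP⟩
  obtain ⟨l, hl, hl'⟩ := hside (leftEnd F.arcs = ⊥) .left .right (by simp)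
  obtain ⟨r, hr, hr'⟩ := hside (rightEnd F.arcs = ⊤) .right .left (by simp)
  rcases (h.good ε hε l r (fun h => Or.inl (hl h)) (fun h => Or.inl (hr h)) hl' hr').figure with
    h | h | h
  · exact fun he => by
      have h1 : F.arcs = [⟨⊥, ⊥⟩] := h
      simp [h1] at he
  · exact fun he => by
      have h1 : F.arcs = [⟨⊤, ⊤⟩] := h
      simp [h1] at he
  · exact h.ordered.1

section woven

variable {f : ℝ → ℝ} {κ₀ : ℝ} {I : Set ℝ} {η : ℝ} {k : ℕ} {s : ℕ → ℝ → FreeVertex}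
  {F : ℕ → Figure} {V : ℕ → Kind → FreeVertex} {σ : ℝ → ℕ → ℝ} {c : ℝ → ℕ → EReal}
  {Γ : ℝ → FoliationGraph}

theorem IsWovenFlow.ports (h : IsWovenFlow f I η k s F V σ c Γ) {e : ℕ → ℝ} (he : ∀ n, e n ∈ I)
    (hlim : Tendsto e atTop (𝓝 η)) {i : ℕ} (hi : i < k) :
    PortTendsto (deriv (deriv f)) (fun n => (e n)⁻¹) η⁻¹ (fun n => rightEnd (s i (e n)).arcs)
      (rightEnd (F i).arcs) (fun n => σ (e n) i) (F i).slope ∧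
    PortTendsto (fun t => deriv (deriv f) (-t)) (fun n => (e n)⁻¹) η⁻¹
      (fun n => -leftEnd (s (i + 1) (e n)).arcs) (-leftEnd (F (i + 1)).arcs)
      (fun n => σ (e n) (i + 1)) (F (i + 1)).slope := by
  have hg := h.gap _ (he 0) i hi
  exact ⟨(h.limit i hi.le).right_port e _ he hlim (fun n => h.linear _ (he n) i hi.le)
      (mt ((h.limit i hi.le).right_top _ (he 0)).2 hg.left_ne),
    (h.limit (i + 1) hi).left_port e _ he hlim (fun n => h.linear _ (he n) (i + 1) hi)
      (mt ((h.limit (i + 1) hi).left_bot _ (he 0)).2 hg.right_ne)⟩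

theorem IsWovenFlow.gap_limit (hf : IsBoundary f κ₀) (hη : 0 < η) (hκ : κ₀ < η⁻¹)
    (h : IsWovenFlow f I η k s F V σ c Γ) {e : ℕ → ℝ} (he : ∀ n, e n ∈ I)
    (hlim : Tendsto e atTop (𝓝 η)) {i : ℕ} (hi : i < k) {c' : EReal}
    (hc : Tendsto (fun n => c (e n) i) atTop (𝓝 c')) :
    Gap (deriv (deriv f)) η⁻¹ (rightEnd (F i).arcs) (F i).slope (leftEnd (F (i + 1)).arcs)
      (F (i + 1)).slope c' :=
  Gap.limit hf.continuous_secondDeriv hf.growth hκ (hlim.inv₀ hη.ne') (h.ports he hlim hi).1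
    (h.ports he hlim hi).2 hc fun n => h.gap _ (he n) i hi

/-- By compactness of the extended line every sequence of angles has limit points. Each of them is
an angle between the same limit figures, so all of them coincide, for all sequences of parameters.
-/
theorem IsWovenFlow.exists_tendsto (hf : IsBoundary f κ₀) (hη : 0 < η) (hκ₀ : 0 ≤ κ₀)
    (hκ : κ₀ < η⁻¹) (h : IsWovenFlow f I η k s F V σ c Γ) {e : ℕ → ℝ} (he : ∀ n, e n ∈ I)
    (hlim : Tendsto e atTop (𝓝 η)) : ∃ c' : ℕ → EReal, ∀ e : ℕ → ℝ, (∀ n, e n ∈ I) →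
      Tendsto e atTop (𝓝 η) → ∀ i < k, Tendsto (fun n => c (e n) i) atTop (𝓝 (c' i)) := by
  have hex : ∀ i, ∃ c', i < k → Gap (deriv (deriv f)) η⁻¹ (rightEnd (F i).arcs) (F i).slope
      (leftEnd (F (i + 1)).arcs) (F (i + 1)).slope c' := by
    intro i
    obtain ⟨c', φ, hφ, hc⟩ := CompactSpace.tendsto_subseq fun n => c (e n) i
    exact ⟨c', fun hi => h.gap_limit hf hη hκ (fun n => he (φ n)) (hlim.comp hφ.tendsto_atTop) hi hc⟩
  choose c' hc' using hex
  refine ⟨c', fun e he hlim i hi => tendsto_of_subseq_tendsto fun ns hns => ?_⟩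
  obtain ⟨c'', φ, hφ, hc⟩ := CompactSpace.tendsto_subseq fun n => c (e (ns n)) i
  have h1 := h.gap_limit hf hη hκ (fun n => he (ns (φ n)))
    (hlim.comp (hns.comp hφ.tendsto_atTop)) hi hc
  obtain rfl := Gap.unique hf.continuous_secondDeriv hf.growth hκ₀ hκ h1 (hc' i hi)
  exact ⟨φ, hc⟩

theorem IsWovenFlow.junction_limit (h : IsWovenFlow f I η k s F V σ c Γ) {e : ℕ → ℝ}
    (he : ∀ n, e n ∈ I) (hlim : Tendsto e atTop (𝓝 η)) {i : ℕ} (hi : i < k) {c' : EReal}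
    (hc : Tendsto (fun n => c (e n) i) atTop (𝓝 c')) {K K' : Kind}
    (hK : ∀ n, (s i (e n)).kind = K) (hK' : ∀ n, (s (i + 1) (e n)).kind = K') :
    Junction K.rightSide K'.leftSide (rightEnd (F i).arcs) (leftEnd (F (i + 1)).arcs) c' := by
  obtain ⟨hp, hq⟩ := h.ports he hlim hi
  have hj := fun n => h.junction _ (he n) i hi
  simp only [hK, hK'] at hj
  have hq' : Tendsto (fun n => leftEnd (s (i + 1) (e n)).arcs) atTop
      (𝓝 (leftEnd (F (i + 1)).arcs)) := by
    have := (continuous_neg.tendsto _).comp hq.tendsto_end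
    simpa [Function.comp_def] using this
  rcases K.rightSide.eq_or with h1 | h1 <;> rcases K'.leftSide.eq_or with h2 | h2 <;>
    simp only [h1, h2, Junction, reduceCtorEq, false_and, and_false, true_and, false_or, or_false,
      and_self, or_self, forall_const] at hj ⊢
  · exact tendsto_nhds_unique hc (hp.tendsto_end.congr fun n => (hj n).symm)
  · exact tendsto_nhds_unique hc (hq'.congr fun n => (hj n).symm)

end woven

/-! ### The modified limit of a woven flow -/

section woven

variable {f : ℝ → ℝ} {κ₀ : ℝ} {I : Set ℝ} {η : ℝ} {k : ℕ} {s : ℕ → ℝ → FreeVertex}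
  {F : ℕ → Figure} {V : ℕ → Kind → FreeVertex} {σ : ℝ → ℕ → ℝ} {c : ℝ → ℕ → EReal}
  {Γ : ℝ → FoliationGraph}

/-- The limit of the graphs whose figures have the types `K i`. -/
noncomputable def limitGraph (k : ℕ) (V : ℕ → Kind → FreeVertex) (c : ℕ → EReal)
    (K : ℕ → Kind) : FoliationGraph :=
  weave k (fun i => V i (K i)) c (fun i => (K i).leftSide) fun i => (K i).rightSide

theorem IsWovenFlow.converges (h : IsWovenFlow f I η k s F V σ c Γ) {e : ℕ → ℝ}
    (he : ∀ n, e n ∈ I) (hlim : Tendsto e atTop (𝓝 η)) {c' : ℕ → EReal}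
    (hc : ∀ i < k, Tendsto (fun n => c (e n) i) atTop (𝓝 (c' i))) {K : ℕ → Kind}
    (hK : ∀ n, ∀ i ≤ k, (s i (e n)).kind = K i) :
    GraphConverges (fun n => Γ (e n)) (limitGraph k V c' K) := by
  have h1 : (fun n => Γ (e n)) = fun n => weave k (fun i => s i (e n)) (c (e n))
      (fun i => (K i).leftSide) fun i => (K i).rightSide := by
    funext n
    rw [h.graph _ (he n)]
    exact weave_congr (fun _ _ => rfl) (fun _ _ => rfl)
      (fun i hi => by rw [hK n (i + 1) (by omega)]) fun i hi => by rw [hK n i (by omega)]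
  rw [h1]
  exact weave_converges (fun i hi => (h.limit i hi).converges e _ he hlim fun n => hK n i hi) hc

/-- The types `K` occur only on the left of the equality. Different subsequences may converge to
different graphs, but their reconstructions agree. -/
theorem IsWovenFlow.reconstruct_limitGraph (hf : IsBoundary f κ₀) (hη : 0 < η) (hκ : κ₀ < η⁻¹)
    (h : IsWovenFlow f I η k s F V σ c Γ) {e : ℕ → ℝ}
    (he : ∀ n, e n ∈ I) (hlim : Tendsto e atTop (𝓝 η)) {c' : ℕ → EReal}
    (hc : ∀ i < k, Tendsto (fun n => c (e n) i) atTop (𝓝 (c' i))) {K : ℕ → Kind}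
    (hK : ∀ n, ∀ i ≤ k, (s i (e n)).kind = K i) :
    reconstruct f (limitGraph k V c' K) =
      (assemble (deriv (deriv f)) η⁻¹ k F c' .left).map (Block.vertex f) ∧
    (∀ b ∈ assemble (deriv (deriv f)) η⁻¹ k F c' .left, b.IsGood f η) ∧
    ((assemble (deriv (deriv f)) η⁻¹ k F c' .left).IsChain fun b w =>
      b.Linked (deriv (deriv f)) η⁻¹ w ∧ rightEnd b.arcs < leftEnd w.arcs) ∧
    (∃ b, (assemble (deriv (deriv f)) η⁻¹ k F c' .left).head? = some b ∧ leftEnd b.arcs = ⊥) ∧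
    ∃ b, (assemble (deriv (deriv f)) η⁻¹ k F c' .left).getLast? = some b ∧ rightEnd b.arcs = ⊤ := by
  classical
  have hbot : leftEnd (F 0).arcs = ⊥ :=
    ((h.limit 0 (Nat.zero_le k)).left_bot _ (he 0)).1 (h.left_bot _ (he 0))
  have htop : rightEnd (F k).arcs = ⊤ :=
    ((h.limit k le_rfl).right_top _ (he 0)).1 (h.right_top _ (he 0))
  have hF : ∀ i ≤ k, (F i).arcs ≠ [] := fun i hi => (h.limit i hi).arcs_ne_nil (he 0)
  have hgap := fun i hi => h.gap_limit hf hη hκ he hlim hi (hc i hi)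
  -- The outermost sides have no tangents, so their families are set by convention. This leaves the
  -- types unchanged: a point at infinity ignores its outer family, and an infinite arc already has
  -- the conventional one.
  obtain ⟨l, hl⟩ : ∃ l : ℕ → Side, l = fun i => if i = 0 then .left else (K i).leftSide := ⟨_, rfl⟩
  obtain ⟨r, hr⟩ : ∃ r : ℕ → Side, r = fun i => if i = k then .right else (K i).rightSide :=
    ⟨_, rfl⟩
  have hl0 : l 0 = .left := by simp [hl]
  have hrk : r k = .right := by simp [hr]
  have hl' : ∀ i, i ≠ 0 → l i = (K i).leftSide := fun i hi => by simp [hl, hi]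
  have hr' : ∀ i, i ≠ k → r i = (K i).rightSide := fun i hi => by simp [hr, hi]
  have hj : ∀ i < k, Junction (r i) (l (i + 1)) (rightEnd (F i).arcs) (leftEnd (F (i + 1)).arcs)
      (c' i) := fun i hi => by
    rw [hr' i hi.ne, hl' (i + 1) (by omega)]
    exact h.junction_limit he hlim hi (hc i hi) (fun n => hK n i hi.le) fun n => hK n (i + 1) hi
  have hgood : ∀ i ≤ k, ∀ l' r', (l' = .left → l i = .left) → (r' = .right → r i = .right) →
      (leftEnd (F i).arcs = ⊥ → l' = .left) → (rightEnd (F i).arcs = ⊤ → r' = .right) →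
      ((F i).block l' r').IsGood f η := by
    intro i hi l' r' h1 h2 h3 h4
    refine (h.limit i hi).good _ (he 0) l' r' (fun h5 => ?_) (fun h5 => ?_) h3 h4
    · rcases eq_or_ne i 0 with rfl | hi0
      · exact Or.inl hbot
      · rw [hK 0 i hi, ← hl' i hi0]
        exact Or.inr (h1 h5)
    · rcases eq_or_ne i k with rfl | hik
      · exact Or.inl htop
      · rw [hK 0 i hi, ← hr' i hik]
        exact Or.inr (h2 h5)
  have hv : ∀ i ≤ k, collapseChord f (renameLongChord f (V i (K i))) =
      ((F i).block (l i) (r i)).vertex f := by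
    intro i hi
    rw [← hK 0 i hi, (h.limit i hi).reconstruct _ (he 0), hK 0 i hi]
    have h1 : (F i).arcs = [⟨⊥, ⊥⟩] ∨ (K i).leftSide = l i := by
      rcases eq_or_ne i 0 with rfl | hi0
      · rw [hl0, ← hK 0 0 hi]
        exact (h.limit 0 hi).left_side _ (he 0) hbot
      · exact Or.inr (hl' i hi0).symm
    have h2 : (F i).arcs = [⟨⊤, ⊤⟩] ∨ (K i).rightSide = r i := by
      rcases eq_or_ne i k with rfl | hik
      · rw [hrk, ← hK 0 i hi]
        exact (h.limit i hi).right_side _ (he 0) htop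
      · exact Or.inr (hr' i hik).symm
    have h3 : (F i).arcs = [⟨⊥, ⊥⟩] → (K i).rightSide = r i := fun h3 =>
      h2.resolve_left fun h4 => by simp [h3] at h4
    have h4 : (F i).arcs = [⟨⊤, ⊤⟩] → (K i).leftSide = l i := fun h4 =>
      h1.resolve_left fun h3 => by simp [h3] at h4
    simp only [Figure.block, Block.vertex]
    by_cases h5 : (F i).arcs = [⟨⊥, ⊥⟩]
    · rw [h5, kindOfShape_bot, kindOfShape_bot, h3 h5]
    · by_cases h6 : (F i).arcs = [⟨⊤, ⊤⟩]
      · rw [h6, kindOfShape_top, kindOfShape_top, h4 h6]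
      · rw [h1.resolve_left h5, h2.resolve_left h6]
  refine ⟨?_, ?_⟩
  · rw [reconstruct, List.map_map, limitGraph, weave_map (fun c => by
      simp [angleVertex, renameLongChord, collapseChord])]
    rw [← hl0, ← collapse_weave (g := deriv (deriv f)) (κ := η⁻¹) k
      (fun i => collapseChord f (renameLongChord f (V i (K i)))) F c' l r hF hv hj
      (fun i hi => ⟨(hgap i hi).left_le, (hgap i hi).le_right, (hgap i hi).left_ne,
        (hgap i hi).right_ne⟩) hrk]
    congr 1
    exact weave_congr (fun _ _ => rfl) (fun _ _ => rfl) (fun i _ => (hl' _ (by omega)).symm)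
      fun i hi => (hr' i hi.ne).symm
  · obtain ⟨g1, g2, g3⟩ := assemble_good (l' := .left) hη k F c' l r hF hgood hj hgap hrk htop
      (fun _ => hl0) fun _ => rfl
    refine ⟨g1, g2, ?_, g3⟩
    obtain ⟨r', A, B, ws, -, h2, h3⟩ := assemble_head (deriv (deriv f)) η⁻¹ k F c' hF
    exact ⟨_, by rw [h3]; rfl, h2.trans hbot⟩

theorem exists_subseq_kinds (s : ℕ → ℝ → FreeVertex) (k : ℕ) (e : ℕ → ℝ) :
    ∃ (φ : ℕ → ℕ) (K : ℕ → Kind), StrictMono φ ∧ ∀ n, ∀ i ≤ k, (s i (e (φ n))).kind = K i := by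
  have := finite_kind
  obtain ⟨φ, K, h1, h2⟩ := exists_subseq_const fun n => fun i : Fin (k + 1) => (s i (e n)).kind
  refine ⟨φ, fun i => if h : i < k + 1 then K ⟨i, h⟩ else .angle, h1, fun n i hi => ?_⟩
  simp only [Nat.lt_succ_of_le hi, dite_true, ← h2 n]

theorem IsWovenFlow.exists_modifiedLimit {η₁ : ℝ} (hf : IsBoundary f κ₀) (h0 : 0 ≤ η₁)
    (h01 : η₁ < η) (hκ₀ : 0 ≤ κ₀) (hκ : κ₀ < η⁻¹)
    (h : IsWovenFlow f (Ioo η₁ η) η k s F V σ c Γ) :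
    ∃ G : FoliationGraph, IsModifiedLimit f η₁ η Γ G ∧
      (∀ G' : FoliationGraph, IsModifiedLimit f η₁ η Γ G' → G' = G) ∧
      IsAdmissible f η G ∧ NonDegeneracyForce f η G ∧ LeafRoot f G := by
  have hη : 0 < η := h0.trans_lt h01
  obtain ⟨e₁, -, he₁, hlim₁⟩ := exists_seq_strictMono_tendsto' h01
  obtain ⟨c', hc'⟩ := h.exists_tendsto hf hη hκ₀ hκ he₁ hlim₁
  obtain ⟨φ₀, K₀, hφ₀, hK₀⟩ := exists_subseq_kinds s k e₁
  have he₀ : ∀ n, e₁ (φ₀ n) ∈ Ioo η₁ η := fun n => he₁ _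
  have hlim₀ := hlim₁.comp hφ₀.tendsto_atTop
  have hrec := h.reconstruct_limitGraph hf hη hκ he₀ hlim₀ (hc' _ he₀ hlim₀) hK₀
  refine ⟨_, ?_, ?_, blocks_good hf hη hκ hrec.2.1 hrec.2.2.1 hrec.2.2.2.1 hrec.2.2.2.2⟩
  · intro e he hlim
    obtain ⟨φ, K, hφ, hK⟩ := exists_subseq_kinds s k e
    have he' : ∀ n, e (φ n) ∈ Ioo η₁ η := fun n => he _
    have hlim' := hlim.comp hφ.tendsto_atTop
    exact ⟨φ, hφ, _, h.converges he' hlim' (hc' _ he' hlim') hK,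
      (h.reconstruct_limitGraph hf hη hκ he' hlim' (hc' _ he' hlim') hK).1⟩
  · intro G' hG'
    -- A competing modified limit is tested on a sequence whose types are already constant; a
    -- further subsequence keeps these types, and limits of graphs are unique.
    obtain ⟨ψ, hψ, L, hL, rfl⟩ := hG' _ he₀ hlim₀
    have he' : ∀ n, e₁ (φ₀ (ψ n)) ∈ Ioo η₁ η := fun n => he₀ _
    have hlim' := hlim₀.comp hψ.tendsto_atTop
    rw [hL.unique (h.converges he' hlim' (hc' _ he' hlim') fun n => hK₀ (ψ n)), hrec.1]

end woven

/-- A smooth flow is woven from figures that have limits and from angles. -/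
theorem IsSmoothFlow.exists_wovenFlow {f : ℝ → ℝ} {κ₀ η₁ η : ℝ} (hf : IsBoundary f κ₀)
    (h0 : 0 ≤ η₁) (h01 : η₁ < η) (hκ : κ₀ < η⁻¹) {Γ : ℝ → FoliationGraph}
    (h : IsSmoothFlow f η₁ η Γ) : ∃ k s F V σ c, IsWovenFlow f (Ioo η₁ η) η k s F V σ c Γ := by
  obtain ⟨hgr, n, S, hS, hkind⟩ := h
  have hI : ∀ ε ∈ Ioo η₁ η, 0 < ε ∧ ε ≤ η := fun ε hε => ⟨h0.trans_lt hε.1, hε.2.le⟩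
  obtain ⟨ε₀, hε₀⟩ : (Ioo η₁ η).Nonempty := nonempty_Ioo.2 h01
  -- There is at least one vertex other than an angle, because the first vertex reaches minus
  -- infinity and angles are finite.
  obtain ⟨k, rfl⟩ : ∃ k, n = k + 1 := by
    refine Nat.exists_eq_succ_of_ne_zero ?_
    rintro rfl
    obtain ⟨-, ⟨⟨v, hv, hv'⟩, -⟩, hadm, -⟩ := (hgr ε₀ hε₀).1
    have hmem := List.mem_of_mem_head? hv
    have h1 := hS ε₀ hε₀
    rw [List.ofFn_zero, List.filter_eq_nil_iff] at h1
    have h2 := h1 v hmem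
    have h3 : v.kind = .angle := by
      cases hk : v.kind <;> simp_all [Kind.notAngle]
    exact ((hadm v hmem).ends_angle h3).1 hv'
  obtain ⟨s, hs⟩ : ∃ s : ℕ → ℝ → FreeVertex, ∀ i : Fin (k + 1), s i = S i :=
    ⟨fun i => if h : i < k + 1 then S ⟨i, h⟩ else S 0, fun i => dif_pos i.2⟩
  have hfilter : ∀ ε ∈ Ioo η₁ η, (Γ ε).filter (fun v => v.kind.notAngle) =
      List.ofFn fun i : Fin (k + 1) => s i ε := fun ε hε => by
    rw [hS ε hε]; simp only [hs]
  have hst : ∀ i ≤ k, ∀ ε ∈ Ioo η₁ η, (s i ε).IsStanding f ε := by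
    intro i hi ε hε
    refine (hgr ε hε).1.isStanding (hgr ε hε).2.2.2
      (List.mem_of_mem_filter (p := fun v => v.kind.notAngle) ?_)
    rw [hfilter ε hε, List.mem_ofFn]
    exact ⟨⟨i, Nat.lt_succ_of_le hi⟩, rfl⟩
  have hlim : ∀ i, ∃ F V, i ≤ k → IsFigureLimit f (Ioo η₁ η) η (s i) F V := by
    intro i
    by_cases hi : i ≤ k
    · have key : ∃ F V, IsFigureLimit f (Ioo η₁ η) η (s i) F V := by
        have h1 := hkind ⟨i, Nat.lt_succ_of_le hi⟩
        rw [← hs] at h1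
        rcases h1 with h1 | (h1 | h1) | h1 | h1
        · exact isFigureLimit_multicup hf h0 h01 (hst i hi) h1
        · exact ⟨_, _, isFigureLimit_negInfinity hf hκ hI (hst i hi) h1⟩
        · exact ⟨_, _, isFigureLimit_posInfinity hf hκ hI (hst i hi) h1⟩
        · exact isFigureLimit_fullFlow hf h0 h01 (hst i hi) h1
        · exact isFigureLimit_decreasingFlow hf h0 h01 (hst i hi) h1
      obtain ⟨F, V, h1⟩ := key
      exact ⟨F, V, fun _ => h1⟩
    · exact ⟨⟨[], [], 0⟩, fun _ => angleVertex ⊥, fun h1 => absurd h1 hi⟩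
  choose F V hFV using hlim
  have hw : ∀ ε, ∃ (σ : ℕ → ℝ) (c : ℕ → EReal), ε ∈ Ioo η₁ η →
      Γ ε = weave k (fun i => s i ε) c (fun i => (s i ε).kind.leftSide)
        (fun i => (s i ε).kind.rightSide) ∧ (∀ i ≤ k, IsLinearity f (s i ε).arcs (σ i)) ∧
      ∀ i < k, Junction (s i ε).kind.rightSide (s (i + 1) ε).kind.leftSide (s i ε).rightEnd
          (s (i + 1) ε).leftEnd (c i) ∧
        Gap (deriv (deriv f)) ε⁻¹ (s i ε).rightEnd (σ i) (s (i + 1) ε).leftEnd (σ (i + 1)) (c i) := by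
    intro ε
    by_cases hε : ε ∈ Ioo η₁ η
    · obtain ⟨σ, c, h1⟩ := (hgr ε hε).1.exists_weave hf (s := fun i => s i ε)
        (hκ.trans (inv_strictAnti₀ (hI ε hε).1 hε.2)) (hfilter ε hε)
      exact ⟨σ, c, fun _ => h1⟩
    · exact ⟨fun _ => 0, fun _ => ⊥, fun h1 => absurd h1 hε⟩
  choose σ c hσc using hw
  refine ⟨k, s, F, V, σ, c, hFV, fun ε hε => (hσc ε hε).1, fun ε hε => (hσc ε hε).2.1,
    fun ε hε i hi => ((hσc ε hε).2.2 i hi).1, fun ε hε i hi => ((hσc ε hε).2.2 i hi).2,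
    fun ε hε => ?_, fun ε hε => ?_⟩
  · obtain ⟨-, ⟨⟨v, hv, hv'⟩, -⟩, -⟩ := (hgr ε hε).1
    rw [(hσc ε hε).1, weave_head, Option.some.injEq] at hv
    rw [hv]
    exact hv'
  · obtain ⟨-, ⟨-, ⟨v, hv, hv'⟩, -⟩, -⟩ := (hgr ε hε).1
    rw [(hσc ε hε).1, weave_getLast, Option.some.injEq] at hv
    rw [hv]
    exact hv'

end BMOFoliation

-- The theorem on modified limits

open BMOFoliation
theorem mainTheorem8 (f : ℝ → ℝ) (εInf : ℝ) (hreg : RegularityCondition f)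
    (hsum : SummabilityCondition f εInf) (η₁ η₂ : ℝ) (h₀ : 0 ≤ η₁) (h₁ : η₁ < η₂) (h₂ : η₂ < εInf)
    (Γ : ℝ → FoliationGraph) (hΓ : IsSmoothFlow f η₁ η₂ Γ) :
    ∃ G : FoliationGraph, IsModifiedLimit f η₁ η₂ Γ G ∧
      (∀ G' : FoliationGraph, IsModifiedLimit f η₁ η₂ Γ G' → G' = G) ∧
      IsAdmissible f η₂ G ∧ NonDegeneracyForce f η₂ G ∧ LeafRoot f G := by
  have hη : 0 < η₂ := h₀.trans_lt h₁
  have hpos : 0 < εInf := hη.trans h₂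
  have hκ : εInf⁻¹ < η₂⁻¹ := inv_strictAnti₀ hη h₂
  have hf := hreg.isBoundary hpos hsum
  obtain ⟨k, s, F, V, σ, c, hw⟩ := hΓ.exists_wovenFlow hf h₀ h₁ hκ
  exact hw.exists_modifiedLimit hf h₀ h₁ (inv_pos.2 hpos).le hκ
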